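/- All manifolds are real 6-dimensional smooth, respectively complex 3-dimensional. **Definitions.** An *elliptic CR-manifold* is a smooth 6-manifold $M$ with a smooth rank-4 distribution $D\subset TM$ and a smooth field of endomorphisms $J$ of $D$, $J^2=-\mathrm{id}$, whose Levi form $\mathcal L_x:D_x\times D_x\to T_xM/D_x$ (bracket of sections modulo $D$) satisfies $\mathcal L(JX,JY)=\mathcal L(X,Y)$ and is such that each non-zero real linear combination of its two scalar components is non-degenerate. It is considered together with its canonical splitting into an ordered pair $D=D^+\oplus D^-$ of smooth $J$-invariant rank-2 distributions, the null spaces of two mutually conjugate complex linear combinations of the components of $\mathcal L$ (the vectors $X\in D_x$ such that $X-iJX$ is annihilated by the combination). Its canonical almost complex structure is the one on $TM$ for which $X-iJX$, $Y+iJY$ and $[X-iJX,\,Y+iJY]$ are of type $(1,0)$ for all local sections $X$ of $D^+$, $Y$ of $D^-$. It is *torsion-free* if $M$ is locally CR-embeddable in some $\mathbb C^N$, $D^+$ and $D^-$ are integrable, and the canonical almost complex structure is integrable. A *split CR-isomorphism* is a CR-diffeomorphism taking $D^\pm$ to $D^\pm$. A *non-involutive triple* $(N,L_1,L_2)$ is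 a complex 3-fold $N$ with two holomorphic direction fields $L_1,L_2$ which at every point span a plane, such that $[Z_1,Z_2]\notin L_1\oplus L_2$ at every point for local holomorphic generators $Z_j$ of $L_j$. Its associated CR-manifold $\mathcal C(N,L_1,L_2)$ is the underlying real manifold of $N$ with $D=L_1\oplus L_2$, $J=i$ on $L_1=D^+$ and $J=-i$ on $L_2=D^-$. Isomorphisms of triples are biholomorphic maps that take $L_1$ to $L_1$ and $L_2$ to $L_2$. A *complex second order ODE* is an equation $y''=B(x,y,y')$ with $B$ holomorphic on an open set $U\subset\mathbb C^3$ (coordinates $x,y,p$). Its associated triple is $(U,\ \langle\partial_p\rangle,\ \langle\partial_x+p\,\partial_y+B\,\partial_p\rangle)$. Two ODE are point equivalent near 1-jets $q\in U$, $q'\in U'$ if there is a biholomorphic map between open sets of the $(x,y)$-plane that takes the point and direction of $q$ to those of $q'$ and graphs of solutions of the first ODE with 1-jets near $q$ to graphs of solutions of the second. **Proposition.** There is a 1-1 correspondence between torsion-free elliptic CR-manifolds of CR-dimension and codimension two, non-involutive triples and (locally) complex second order ODE. Precisely: 1. For each non-involutive triple, $\mathcal C(N,L_1,L_2)$ is a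 torsion-free elliptic CR-manifold. 2. Each torsion-free elliptic CR-manifold is (globally) split CR-isomorphic to $\mathcal C(N,L_1,L_2)$ for some non-involutive triple. 3. A homeomorphism between open subsets of $N$ and $N'$ is a split CR-isomorphism for the associated CR-structures if and only if it is an isomorphism of the triples. If its domain is connected, it is a CR-diffeomorphism (without regard to the order of the splitting) if and only if it is either an isomorphism of the triples or an antiholomorphic diffeomorphism that takes $L_1$ to $L_2'$ and $L_2$ to $L_1'$. 4. The triple associated with an ODE is non-involutive, and each non-involutive triple is, near each of its points, isomorphic to the triple associated with an ODE. 5. Two ODE are point equivalent near the 1-jets $q$, $q'$ if and only if their associated triples are locally isomorphic by a map that takes $q$ to $q'$. 6. Near each 1-jet in $U$ the ODE has a general solution, i.e. a holomorphic family $\phi(t,c_1,c_2)$, $(t,c_1,c_2)\in\Omega\subset\mathbb C^3$ open, of solutions such that $(t,c_1,c_2)\mapsto(t,\phi,\partial_t\phi)$ is an injective local biholomorphism of $\Omega$ into $U$ with the 1-jet in its image. For each general solution $\phi$, the map $(t,\phi,\partial_t\phi)\mapsto(z_1,w_1,z_2,w_2)=(c_1,c_2,\bar t,\bar\phi)$ is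 a CR-embedding into $\mathbb C^4$ of the corresponding open part of the CR-manifold of the ODE, with image $$\{(z_1,w_1,z_2,w_2)\in\mathbb C^4 : (\bar z_2,z_1,w_1)\in\Omega,\ \bar w_2=\phi(\bar z_2,z_1,w_1)\}.$$ -/

import Mathlib

open Set Filter Topology
open scoped Manifold ContDiff

universe u v

noncomputable section

/-- `ℂ³`. It is the model space of complex 3-folds and, regarded as a real vector space of
dimension 6, the model space of smooth real 6-manifolds. -/
abbrev C3 : Type := Fin 3 → ℂ

/-- A holomorphic atlas modelled on `ℂ³` is in particular a smooth real atlas. -/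
theorem isManifold_real_of_complex (M : Type u) [TopologicalSpace M] [ChartedSpace C3 M]
    [IsManifold 𝓘(ℂ, C3) ∞ M] : IsManifold 𝓘(ℝ, C3) ∞ M := by
  apply isManifold_of_contDiffOn
  intro e e' he he'
  have h := (contDiffGroupoid ∞ 𝓘(ℂ, C3)).compatible he he'
  rw [contDiffGroupoid, mem_groupoid_of_pregroupoid] at h
  have h1 : ContDiffOn ℂ ∞
      (𝓘(ℂ, C3) ∘ (e.symm ≫ₕ e') ∘ 𝓘(ℂ, C3).symm)
      (𝓘(ℂ, C3).symm ⁻¹' (e.symm ≫ₕ e').source ∩ range 𝓘(ℂ, C3)) := h.1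
  exact h1.restrict_scalars ℝ

/-! ## Distributions, sections and brackets on a smooth 6-manifold -/

section RealManifold

variable {M : Type u} [TopologicalSpace M] [ChartedSpace C3 M] [IsManifold 𝓘(ℝ, C3) ∞ M]

/-- The vector field `X` is smooth on the set `V`. -/
def SmoothFieldOn (X : (x : M) → TangentSpace 𝓘(ℝ, C3) x) (V : Set M) : Prop :=
  ContMDiffOn 𝓘(ℝ, C3) 𝓘(ℝ, C3).tangent ∞
    (fun x => (⟨x, X x⟩ : TangentBundle 𝓘(ℝ, C3) M)) V

/-- `D` is a smooth distribution of rank `r` on `M`: near each point it has a smooth frame. -/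
def IsSmoothDistribution (r : ℕ) (D : (x : M) → Submodule ℝ (TangentSpace 𝓘(ℝ, C3) x)) : Prop :=
  ∀ x : M, ∃ V : Set M, IsOpen V ∧ x ∈ V ∧
    ∃ X : Fin r → (y : M) → TangentSpace 𝓘(ℝ, C3) y,
      (∀ i, SmoothFieldOn (X i) V) ∧
      ∀ y ∈ V, LinearIndependent ℝ (fun i => X i y) ∧
        D y = Submodule.span ℝ (range fun i => X i y)

/-- `X` is a smooth section of the distribution `D` over `V`. -/
def IsSectionOn (D : (x : M) → Submodule ℝ (TangentSpace 𝓘(ℝ, C3) x))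
    (X : (x : M) → TangentSpace 𝓘(ℝ, C3) x) (V : Set M) : Prop :=
  SmoothFieldOn X V ∧ ∀ y ∈ V, X y ∈ D y

/-- `D` is involutive: the bracket of two local sections of `D` is a section of `D`. -/
def IsInvolutive (D : (x : M) → Submodule ℝ (TangentSpace 𝓘(ℝ, C3) x)) : Prop :=
  ∀ (V : Set M) (X Y : (x : M) → TangentSpace 𝓘(ℝ, C3) x), IsOpen V →
    IsSectionOn D X V → IsSectionOn D Y V →
    ∀ x ∈ V, VectorField.mlieBracket 𝓘(ℝ, C3) X Y x ∈ D x

/-- `w ∈ T_x M` represents the value `𝓛_x(u, v) ∈ T_x M / D_x` of the Levi form of `D`: it is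
the bracket at `x` of two local sections of `D` that extend `u` and `v`. -/
def LeviValue (D : (x : M) → Submodule ℝ (TangentSpace 𝓘(ℝ, C3) x)) (x : M)
    (u v w : TangentSpace 𝓘(ℝ, C3) x) : Prop :=
  ∃ (V : Set M) (X Y : (x : M) → TangentSpace 𝓘(ℝ, C3) x), IsOpen V ∧ x ∈ V ∧
    IsSectionOn D X V ∧ IsSectionOn D Y V ∧ X x = u ∧ Y x = v ∧
    VectorField.mlieBracket 𝓘(ℝ, C3) X Y x = w

/-- The differential of a map from `M` to a complex vector space, as a real-linear map. -/
def realDiff {W : Type v} [NormedAddCommGroup W] [NormedSpace ℝ W] (F : M → W) (x : M) :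
    TangentSpace 𝓘(ℝ, C3) x →L[ℝ] W :=
  mfderiv 𝓘(ℝ, C3) 𝓘(ℝ, W) F x

/-- An almost complex structure `I` is integrable: it is induced by complex local coordinates. -/
def IsIntegrableACS
    (I : (x : M) → TangentSpace 𝓘(ℝ, C3) x →ₗ[ℝ] TangentSpace 𝓘(ℝ, C3) x) : Prop :=
  ∀ x : M, ∃ ψ ∈ IsManifold.maximalAtlas 𝓘(ℝ, C3) ∞ M, x ∈ ψ.source ∧
    ∀ y ∈ ψ.source, ∀ u : TangentSpace 𝓘(ℝ, C3) y,
      realDiff ψ y (I y u) = Complex.I • realDiff ψ y u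

end RealManifold

/-! ## Elliptic CR-manifolds of CR-dimension two and codimension two -/

/-- The data of a 6-manifold with a distribution `D`, endomorphisms `J` of `D` and an ordered pair
`D⁺`, `D⁻` of subdistributions. Only the restriction of `J x` to `D x` is meaningful. The
conditions are in `IsAlmostCR`, `IsElliptic` and `IsTorsionFreeElliptic` below. -/
structure CRManifold : Type (u + 1) where
  carrier : Type u
  [top : TopologicalSpace carrier]
  [charted : ChartedSpace C3 carrier]
  [mfd : IsManifold 𝓘(ℝ, C3) ∞ carrier]
  D : (x : carrier) → Submodule ℝ (TangentSpace 𝓘(ℝ, C3) x)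
  J : (x : carrier) → TangentSpace 𝓘(ℝ, C3) x → TangentSpace 𝓘(ℝ, C3) x
  Dp : (x : carrier) → Submodule ℝ (TangentSpace 𝓘(ℝ, C3) x)
  Dm : (x : carrier) → Submodule ℝ (TangentSpace 𝓘(ℝ, C3) x)

namespace CRManifold

attribute [instance] CRManifold.top CRManifold.charted CRManifold.mfd

variable (C : CRManifold.{u})

/-- `D` has rank four and `J` is a smooth field of endomorphisms of `D` with `J² = -id`. -/
structure IsAlmostCR : Prop where
  dist : IsSmoothDistribution 4 C.D
  J_mem : ∀ x, ∀ a ∈ C.D x, C.J x a ∈ C.D x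
  J_add : ∀ x, ∀ a ∈ C.D x, ∀ b ∈ C.D x, C.J x (a + b) = C.J x a + C.J x b
  J_smul : ∀ x (r : ℝ), ∀ a ∈ C.D x, C.J x (r • a) = r • C.J x a
  J_sq : ∀ x, ∀ a ∈ C.D x, C.J x (C.J x a) = -a
  J_smooth : ∀ (V : Set C.carrier) (X : (x : C.carrier) → TangentSpace 𝓘(ℝ, C3) x),
    IsOpen V → IsSectionOn C.D X V → SmoothFieldOn (fun x => C.J x (X x)) V

/-- The `J`-null space in `D_x` of the complex combination `ℓ ∘ 𝓛_x` of the components of the Levi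
form: the vectors `a ∈ D_x` with `ℓ (𝓛_x (a - i J a, b)) = 0` for all `b ∈ D_x`, where `𝓛_x` is
extended complex bilinearly. -/
def IsNullVector (x : C.carrier) (ℓ : TangentSpace 𝓘(ℝ, C3) x →ₗ[ℝ] ℂ)
    (a : TangentSpace 𝓘(ℝ, C3) x) : Prop :=
  a ∈ C.D x ∧ ∀ b ∈ C.D x, ∀ w w' : TangentSpace 𝓘(ℝ, C3) x,
    LeviValue C.D x a b w → LeviValue C.D x (C.J x a) b w' → ℓ w - Complex.I * ℓ w' = 0

/-- A partially integrable elliptic CR-manifold of CR-dimension two and codimension two with its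
canonical splitting `D = D⁺ ⊕ D⁻`. -/
structure IsElliptic : Prop extends C.IsAlmostCR where
  /-- `𝓛(JX, JY) = 𝓛(X, Y)` -/
  partiallyIntegrable : ∀ x, ∀ a ∈ C.D x, ∀ b ∈ C.D x, ∀ w w' : TangentSpace 𝓘(ℝ, C3) x,
    LeviValue C.D x a b w → LeviValue C.D x (C.J x a) (C.J x b) w' → w' - w ∈ C.D x
  /-- Every nonzero real linear combination of the scalar components of `𝓛_x` (a nonzero covector
  `ℓ` on `T_x M / D_x` applied to `𝓛_x`) is non-degenerate on `D_x`. -/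
  elliptic : ∀ x (ℓ : TangentSpace 𝓘(ℝ, C3) x →ₗ[ℝ] ℝ), ℓ ≠ 0 → (∀ a ∈ C.D x, ℓ a = 0) →
    ∀ a ∈ C.D x, (∀ b ∈ C.D x, ∀ w, LeviValue C.D x a b w → ℓ w = 0) → a = 0
  rank_Dp : IsSmoothDistribution 2 C.Dp
  rank_Dm : IsSmoothDistribution 2 C.Dm
  splitting : ∀ x, Disjoint (C.Dp x) (C.Dm x) ∧ C.Dp x ⊔ C.Dm x = C.D x
  /-- `D⁺_x` and `D⁻_x` are the null spaces of two mutually conjugate complex linear combinations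
  of the scalar components of `𝓛_x`. -/
  null : ∀ x, ∃ ℓ : TangentSpace 𝓘(ℝ, C3) x →ₗ[ℝ] ℂ, ℓ ≠ 0 ∧ (∀ a ∈ C.D x, ℓ a = 0) ∧
    (∀ a, a ∈ C.Dp x ↔ C.IsNullVector x ℓ a) ∧
    (∀ a, a ∈ C.Dm x ↔ C.IsNullVector x (Complex.conjAe.toLinearMap ∘ₗ ℓ) a)

/-- `I` is the canonical almost complex structure on `M`: for local sections `X` of `D⁺` and `Y` of
`D⁻`, the complex vectors `X - iJX`, `Y + iJY` and `[X - iJX, Y + iJY]` are of type `(1,0)` for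
`I`. (A complex vector `a + i b` with `a`, `b` real is of type `(1,0)` if `I a = -b`.) -/
structure IsCanonicalACS
    (I : (x : C.carrier) → TangentSpace 𝓘(ℝ, C3) x →ₗ[ℝ] TangentSpace 𝓘(ℝ, C3) x) : Prop where
  sq : ∀ x a, I x (I x a) = -a
  on_Dp : ∀ x, ∀ a ∈ C.Dp x, I x a = C.J x a
  on_Dm : ∀ x, ∀ a ∈ C.Dm x, I x a = -C.J x a
  bracket : ∀ (V : Set C.carrier) (X Y : (x : C.carrier) → TangentSpace 𝓘(ℝ, C3) x), IsOpen V →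
    IsSectionOn C.Dp X V → IsSectionOn C.Dm Y V → ∀ x ∈ V,
    I x (VectorField.mlieBracket 𝓘(ℝ, C3) X Y x +
        VectorField.mlieBracket 𝓘(ℝ, C3) (fun y => C.J y (X y)) (fun y => C.J y (Y y)) x) =
      -(VectorField.mlieBracket 𝓘(ℝ, C3) X (fun y => C.J y (Y y)) x -
        VectorField.mlieBracket 𝓘(ℝ, C3) (fun y => C.J y (X y)) Y x)

/-- The restriction of `F` to the open set `V` is a CR-embedding into `ℂᴺ`: a smooth embedding such
that `dF` takes `D_x` onto the maximal complex subspace of the tangent space of the image, and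
`J` to multiplication by `i`. -/
structure IsCREmbeddingOn {N : ℕ} (F : C.carrier → (Fin N → ℂ)) (V : Set C.carrier) : Prop where
  isOpen : IsOpen V
  smooth : ContMDiffOn 𝓘(ℝ, C3) 𝓘(ℝ, Fin N → ℂ) ∞ F V
  embedding : IsEmbedding (fun x : V => F x)
  immersion : ∀ x ∈ V, Function.Injective (realDiff F x)
  maximal : ∀ x ∈ V, ∀ a, a ∈ C.D x ↔ ∃ b, realDiff F x b = Complex.I • realDiff F x a
  map_J : ∀ x ∈ V, ∀ a ∈ C.D x, realDiff F x (C.J x a) = Complex.I • realDiff F x a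

/-- A torsion-free elliptic CR-manifold: it is (locally) embeddable, `D⁺` and `D⁻` are integrable,
and the canonical almost complex structure is integrable. -/
structure IsTorsionFreeElliptic : Prop extends C.IsElliptic where
  embeddable : ∀ x, ∃ (N : ℕ) (F : C.carrier → (Fin N → ℂ)) (V : Set C.carrier),
    x ∈ V ∧ C.IsCREmbeddingOn F V
  involutive_Dp : IsInvolutive C.Dp
  involutive_Dm : IsInvolutive C.Dm
  integrable : ∃ I, C.IsCanonicalACS I ∧ IsIntegrableACS I

variable {C} in
/-- `f` is a CR-diffeomorphism from the open set `f.source` to the open set `f.target`. -/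
structure IsCRIso {C' : CRManifold.{v}} (f : OpenPartialHomeomorph C.carrier C'.carrier) :
    Prop where
  smooth : ContMDiffOn 𝓘(ℝ, C3) 𝓘(ℝ, C3) ∞ f f.source
  smooth_symm : ContMDiffOn 𝓘(ℝ, C3) 𝓘(ℝ, C3) ∞ f.symm f.target
  map_D : ∀ x ∈ f.source,
    (C.D x).map (mfderiv 𝓘(ℝ, C3) 𝓘(ℝ, C3) f x).toLinearMap = C'.D (f x)
  map_J : ∀ x ∈ f.source, ∀ a ∈ C.D x,
    mfderiv 𝓘(ℝ, C3) 𝓘(ℝ, C3) f x (C.J x a) = C'.J (f x) (mfderiv 𝓘(ℝ, C3) 𝓘(ℝ, C3) f x a)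

variable {C} in
/-- `f` is a CR-diffeomorphism which takes `D⁺` to `D⁺` and `D⁻` to `D⁻`. -/
structure IsSplitCRIso {C' : CRManifold.{v}} (f : OpenPartialHomeomorph C.carrier C'.carrier) :
    Prop extends IsCRIso f where
  map_Dp : ∀ x ∈ f.source,
    (C.Dp x).map (mfderiv 𝓘(ℝ, C3) 𝓘(ℝ, C3) f x).toLinearMap = C'.Dp (f x)
  map_Dm : ∀ x ∈ f.source,
    (C.Dm x).map (mfderiv 𝓘(ℝ, C3) 𝓘(ℝ, C3) f x).toLinearMap = C'.Dm (f x)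

end CRManifold

/-! ## Complex 3-folds with two direction fields -/

/-- A complex 3-fold (a smooth manifold over `ℂ`: complex differentiability of all orders is
holomorphy) with two fields `L₁`, `L₂` of complex subspaces of its tangent spaces. The
conditions are in `IsPathGeometry` below. -/
structure Threefold : Type (u + 1) where
  carrier : Type u
  [top : TopologicalSpace carrier]
  [charted : ChartedSpace C3 carrier]
  [mfd : IsManifold 𝓘(ℂ, C3) ∞ carrier]
  L₁ : (x : carrier) → Submodule ℂ (TangentSpace 𝓘(ℂ, C3) x)
  L₂ : (x : carrier) → Submodule ℂ (TangentSpace 𝓘(ℂ, C3) x)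

section ComplexManifold

variable {M : Type u} [TopologicalSpace M] [ChartedSpace C3 M] [IsManifold 𝓘(ℂ, C3) ∞ M]

/-- The vector field `Z` is holomorphic and generates the direction field `L` on `V`. -/
structure IsHolomorphicGenerator (L : (x : M) → Submodule ℂ (TangentSpace 𝓘(ℂ, C3) x))
    (Z : (x : M) → TangentSpace 𝓘(ℂ, C3) x) (V : Set M) : Prop where
  holomorphic : ContMDiffOn 𝓘(ℂ, C3) 𝓘(ℂ, C3).tangent ∞
    (fun x => (⟨x, Z x⟩ : TangentBundle 𝓘(ℂ, C3) M)) V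
  ne_zero : ∀ x ∈ V, Z x ≠ 0
  span : ∀ x ∈ V, L x = Submodule.span ℂ {Z x}

/-- `L` is a holomorphic direction field: locally generated by a nonvanishing holomorphic vector
field. -/
def IsHolomorphicDirectionField (L : (x : M) → Submodule ℂ (TangentSpace 𝓘(ℂ, C3) x)) : Prop :=
  ∀ x : M, ∃ (V : Set M) (Z : (x : M) → TangentSpace 𝓘(ℂ, C3) x),
    IsOpen V ∧ x ∈ V ∧ IsHolomorphicGenerator L Z V

end ComplexManifold

namespace Threefold

attribute [instance] Threefold.top Threefold.charted Threefold.mfd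

/-- `L₁` and `L₂` are holomorphic direction fields which at every point span a plane, and the
distribution of these planes is nowhere involutive. -/
structure IsPathGeometry (P : Threefold.{u}) : Prop where
  direction₁ : IsHolomorphicDirectionField P.L₁
  direction₂ : IsHolomorphicDirectionField P.L₂
  independent : ∀ x, Disjoint (P.L₁ x) (P.L₂ x)
  nonInvolutive : ∀ (V : Set P.carrier) (Z₁ Z₂ : (x : P.carrier) → TangentSpace 𝓘(ℂ, C3) x),
    IsOpen V → IsHolomorphicGenerator P.L₁ Z₁ V → IsHolomorphicGenerator P.L₂ Z₂ V →
    ∀ x ∈ V, VectorField.mlieBracket 𝓘(ℂ, C3) Z₁ Z₂ x ∉ P.L₁ x ⊔ P.L₂ x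

/-- `f` is a biholomorphic map from `f.source` to `f.target` which takes `L₁` to `L₁` and `L₂`
to `L₂`. -/
structure IsIso {P : Threefold.{u}} {P' : Threefold.{v}}
    (f : OpenPartialHomeomorph P.carrier P'.carrier) : Prop where
  holomorphic : ContMDiffOn 𝓘(ℂ, C3) 𝓘(ℂ, C3) ∞ f f.source
  holomorphic_symm : ContMDiffOn 𝓘(ℂ, C3) 𝓘(ℂ, C3) ∞ f.symm f.target
  map_L₁ : ∀ x ∈ f.source,
    (P.L₁ x).map (mfderiv 𝓘(ℂ, C3) 𝓘(ℂ, C3) f x).toLinearMap = P'.L₁ (f x)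
  map_L₂ : ∀ x ∈ f.source,
    (P.L₂ x).map (mfderiv 𝓘(ℂ, C3) 𝓘(ℂ, C3) f x).toLinearMap = P'.L₂ (f x)

/-- The linear map with value `i a` on `a ∈ A` and `-i b` on `b ∈ B`, for two subspaces `A`, `B`
with `A ∩ B = 0`; it is only meaningful on `A + B`. -/
def twist (A B : Submodule ℂ C3) (c : C3) : C3 :=
  open Classical in
  if h : ∃ a ∈ A, c - a ∈ B then Complex.I • h.choose - Complex.I • (c - h.choose) else 0

/-- A complex subspace of `ℂ³`, regarded as a real subspace. -/
def underlyingReal (A : Submodule ℂ C3) : Submodule ℝ C3 := A.restrictScalars ℝ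

/-- The CR-manifold associated with a complex 3-fold with two direction fields, on the same
underlying smooth manifold: `D = L₁ ⊕ L₂`, `J = i` on `L₁ = D⁺` and `J = -i` on `L₂ = D⁻`. -/
def toCR (P : Threefold.{u}) : CRManifold.{u} where
  carrier := P.carrier
  mfd := isManifold_real_of_complex P.carrier
  D := fun x => underlyingReal (P.L₁ x ⊔ P.L₂ x)
  J := fun x => twist (P.L₁ x) (P.L₂ x)
  Dp := fun x => underlyingReal (P.L₁ x)
  Dm := fun x => underlyingReal (P.L₂ x)

/-- The real differential of `f` at `x`, in terms of the underlying complex vector spaces of the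
tangent spaces. -/
def diffR {P : Threefold.{u}} {P' : Threefold.{v}}
    (f : OpenPartialHomeomorph P.carrier P'.carrier) (x : P.carrier) : C3 →L[ℝ] C3 :=
  mfderiv 𝓘(ℝ, C3) 𝓘(ℝ, C3) f x

/-- `f` is an antiholomorphic diffeomorphism from `f.source` to `f.target` which takes `L₁` to
`L₂` and `L₂` to `L₁`. -/
structure IsAntiIso {P : Threefold.{u}} {P' : Threefold.{v}}
    (f : OpenPartialHomeomorph P.carrier P'.carrier) : Prop where
  smooth : ContMDiffOn 𝓘(ℝ, C3) 𝓘(ℝ, C3) ∞ f f.source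
  smooth_symm : ContMDiffOn 𝓘(ℝ, C3) 𝓘(ℝ, C3) ∞ f.symm f.target
  antiholomorphic : ∀ x ∈ f.source, ∀ a : C3, diffR f x (Complex.I • a) = -(Complex.I • diffR f x a)
  map_L₁ : ∀ x ∈ f.source,
    (underlyingReal (P.L₁ x)).map (diffR f x).toLinearMap = underlyingReal (P'.L₂ (f x))
  map_L₂ : ∀ x ∈ f.source,
    (underlyingReal (P.L₂ x)).map (diffR f x).toLinearMap = underlyingReal (P'.L₁ (f x))

end Threefold

/-! ## Complex second order ODE -/

/-- A complex second order ODE `y'' = B(x, y, y')` with `B` holomorphic on an open set of `ℂ³` with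
coordinates `(x, y, p)`. Values of `B` outside `dom` are irrelevant. -/
structure ComplexODE where
  dom : TopologicalSpace.Opens C3
  B : C3 → ℂ
  holomorphic : ContDiffOn ℂ ∞ B dom

namespace ComplexODE

/-- `y` is a (holomorphic) solution on the open set `S`. -/
structure IsSolutionOn (o : ComplexODE) (y : ℂ → ℂ) (S : Set ℂ) : Prop where
  isOpen : IsOpen S
  holomorphic : DifferentiableOn ℂ y S
  mem : ∀ x ∈ S, ![x, y x, deriv y x] ∈ o.dom
  eq : ∀ x ∈ S, deriv (deriv y) x = o.B ![x, y x, deriv y x]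

/-- The open set `dom` with the two directions `∂_p` and `∂_x + p ∂_y + B ∂_p`. -/
def toThreefold (o : ComplexODE) : Threefold.{0} where
  carrier := o.dom
  charted := @TopologicalSpace.Opens.instChartedSpace C3 C3 _ _ (chartedSpaceSelf C3) o.dom
  L₁ := fun _ => show Submodule ℂ C3 from Submodule.span ℂ {![0, 0, 1]}
  L₂ := fun q => show Submodule ℂ C3 from
    Submodule.span ℂ {![1, (q : C3) 2, o.B q]}

/-- The biholomorphic map `ψ` between open sets of the `(x, y)`-plane takes the ODE `o` near the
1-jet `q = (x₀, y₀, p₀)` to the ODE `o'` near the 1-jet `q'`: it maps the point and the direction of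
`q` to those of `q'`, and it maps the graphs of solutions of `o` with 1-jets near `q` to graphs
of solutions of `o'`. -/
structure IsPointTransformation (o o' : ComplexODE) (q q' : C3)
    (ψ : OpenPartialHomeomorph (ℂ × ℂ) (ℂ × ℂ)) : Prop where
  holomorphic : ContDiffOn ℂ ∞ ψ ψ.source
  holomorphic_symm : ContDiffOn ℂ ∞ ψ.symm ψ.target
  mem : (q 0, q 1) ∈ ψ.source
  map_point : ψ (q 0, q 1) = (q' 0, q' 1)
  map_direction : ∃ c : ℂ, c ≠ 0 ∧ fderiv ℂ ψ (q 0, q 1) (1, q 2) = c • ((1, q' 2) : ℂ × ℂ)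
  map_solutions : ∃ W ∈ 𝓝 q, ∀ (y : ℂ → ℂ) (S : Set ℂ), o.IsSolutionOn y S →
    ∀ x ∈ S, (x, y x) ∈ ψ.source → ![x, y x, deriv y x] ∈ W →
      ∃ (y' : ℂ → ℂ) (S' : Set ℂ), o'.IsSolutionOn y' S' ∧
        ∀ᶠ t in 𝓝 x, (ψ (t, y t)).1 ∈ S' ∧ (ψ (t, y t)).2 = y' (ψ (t, y t)).1

/-- The partial derivative of `φ` in the `i`-th variable. -/
def pd (i : Fin 3) (φ : C3 → ℂ) (c : C3) : ℂ := fderiv ℂ φ c (Pi.single i 1)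

/-- For `φ = φ(t, c₁, c₂)`, the map `(t, c₁, c₂) ↦ (t, φ, ∂φ/∂t)`. -/
def jet (φ : C3 → ℂ) (c : C3) : C3 := ![c 0, φ c, pd 0 φ c]

/-- `φ(t, c₁, c₂)` is a general solution of the ODE on the open set `Ω`: a holomorphic family of
solutions depending on two parameters such that `(t, c₁, c₂) ↦ (t, φ, ∂φ/∂t)` is an injective local
biholomorphism from `Ω` into the domain of the ODE. -/
structure IsGeneralSolution (o : ComplexODE) (φ : C3 → ℂ) (Ω : Set C3) : Prop where
  isOpen : IsOpen Ω
  holomorphic : ContDiffOn ℂ ∞ φ Ω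
  mem : ∀ c ∈ Ω, jet φ c ∈ o.dom
  eq : ∀ c ∈ Ω, pd 0 (pd 0 φ) c = o.B (jet φ c)
  injOn : InjOn (jet φ) Ω
  nondegenerate : ∀ c ∈ Ω, Function.Bijective (fderiv ℂ (jet φ) c)

end ComplexODE

end

/-! In holomorphic coordinates let `Z₁`, `Z₂` generate `L₁`, `L₂` and put `T = [Z₁, Z₂]`.
Non-involutivity says that `Z₁`, `Z₂`, `T` form a frame, and `D = L₁ ⊕ L₂` is the kernel of the
complex-valued form `det3 Z₁ Z₂ ·`. For real smooth sections of `D` with values `a₁ Z₁ + a₂ Z₂` and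
`b₁ Z₁ + b₂ Z₂`, this form takes the value `(a₁ b₂ - a₂ b₁) det3 Z₁ Z₂ T` on their bracket
(`det3_bracket`). As `J` multiplies the two coefficients by `i` and `-i`, the invariance of the Levi
form, ellipticity and the identification of its null spaces with `L₁` and `L₂` are algebra with 2 ×
2 determinants. The canonical almost complex structure is that of the 3-fold itself, and first
integrals of `L₂` together with the conjugates of first integrals of `L₁` give the local embedding
in `ℂ⁴`.

Conversely, take coordinates in which the canonical almost complex structure is multiplication by
`i`. Then `D⁺` and `D⁻` become complex line fields; normalize generators `X`, `Y` to have one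
component equal to 1. Involutivity of `D⁺` and `D⁻` and the local embedding force the
`(0,1)`-derivatives of `X` and `Y` along `X` and `Y` to vanish. A map annihilated by two
`(0,1)`-fields is annihilated by their bracket (`dbar_bracket`), and ellipticity makes this bracket
the missing third direction; hence `X` and `Y` are holomorphic. The transition maps of these
coordinates commute with `i`, so the coordinates form a holomorphic atlas and the identity map is
the required CR-isomorphism.

The same bracket argument shows that a diffeomorphism whose differential is complex linear on `L₁`
and `L₂` is holomorphic. If the order of the splitting is not prescribed, consider a holomorphic
generator `Z` of a direction field: `[Z, JZ] = 0`, so its image `r Z₁' + s Z₂'` satisfies `r s = 0`.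
Thus each direction field goes into one of the two; by connectedness the choice is constant, and the
exchanging maps are antiholomorphic.

For the normal form of a triple, two first integrals `x`, `y` of `L₁` and the slope `p` of `L₂` in
the `(x, y)`-plane are coordinates; non-involutivity is what makes `p` vary along `L₁`. Solutions of
an ODE lift to integral curves of the total derivative. A point transformation therefore prolongs to
an isomorphism of triples by its action on slopes, and an isomorphism of triples descends to the
plane because it preserves the `p`-lines.

All integration rests on `exists_holomorphic_flow`, obtained from the inverse function theorem in a
Banach space of continuous curves. It yields flow boxes, first integrals and general solutions. -/

noncomputable section


/-! ### Linear algebra of `ℂ³` -/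

/-- The determinant of three vectors of `ℂ³`. -/
def det3 (u v w : C3) : ℂ :=
  u 0 * (v 1 * w 2 - v 2 * w 1) - u 1 * (v 0 * w 2 - v 2 * w 0) + u 2 * (v 0 * w 1 - v 1 * w 0)

theorem det3_cramer (a b c w : C3) :
    det3 a b c • w = det3 w b c • a + det3 a w c • b + det3 a b w • c := by
  ext i
  fin_cases i <;> simp [det3] <;> ring

theorem exists_eq_of_det3_ne_zero {a b c : C3} (h : det3 a b c ≠ 0) (w : C3) :
    ∃ r s t : ℂ, w = r • a + s • b + t • c := by
  refine ⟨det3 w b c / det3 a b c, det3 a w c / det3 a b c, det3 a b w / det3 a b c, ?_⟩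
  have := det3_cramer a b c w
  calc w = (det3 a b c)⁻¹ • (det3 a b c • w) := by rw [smul_smul, inv_mul_cancel₀ h, one_smul]
    _ = _ := by
      rw [this]
      simp only [smul_add, smul_smul, div_eq_inv_mul]

theorem det3_comb₃ (a b : C3) (r s : ℂ) : det3 a b (r • a + s • b) = 0 := by
  simp [det3]; ring

theorem det3_add_smul (a b c : C3) (r s t : ℂ) :
    det3 a b (r • a + s • b + t • c) = t * det3 a b c := by
  simp [det3]; ring

/-- Membership in the plane spanned by `a`, `b` becomes one scalar equation. Sections of `D` are
handled through this equation because it can be differentiated. -/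
theorem det3_eq_zero_iff {a b c : C3} (h : det3 a b c ≠ 0) (w : C3) :
    det3 a b w = 0 ↔ ∃ r s : ℂ, w = r • a + s • b := by
  constructor
  · intro hw
    obtain ⟨r, s, t, rfl⟩ := exists_eq_of_det3_ne_zero h w
    rw [det3_add_smul] at hw
    have ht : t = 0 := by simpa [h] using hw
    exact ⟨r, s, by simp [ht]⟩
  · rintro ⟨r, s, rfl⟩
    exact det3_comb₃ a b r s

theorem det3_comb_unique {a b c : C3} (h : det3 a b c ≠ 0) {r s r' s' : ℂ}
    (hw : r • a + s • b = r' • a + s' • b) : r = r' ∧ s = s' := by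
  have h1 : det3 (r • a + s • b) b c = det3 (r' • a + s' • b) b c := by rw [hw]
  have h2 : det3 a (r • a + s • b) c = det3 a (r' • a + s' • b) c := by rw [hw]
  have e1 : ∀ r s : ℂ, det3 (r • a + s • b) b c = r * det3 a b c := by
    intro r s; simp [det3]; ring
  have e2 : ∀ r s : ℂ, det3 a (r • a + s • b) c = s * det3 a b c := by
    intro r s; simp [det3]; ring
  rw [e1, e1] at h1
  rw [e2, e2] at h2
  exact ⟨mul_right_cancel₀ h h1, mul_right_cancel₀ h h2⟩

/-- The coordinate vectors `c` give the 2 × 2 minors of `a`, `w`. As equations the minors can be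
differentiated, and their nonvanishing is an open condition. -/
theorem det3_line_iff {a : C3} (ha : a ≠ 0) (w : C3) :
    (∀ c, det3 a w c = 0) ↔ ∃ r : ℂ, w = r • a := by
  constructor
  · intro h
    have h0 := h (Pi.single 0 1)
    have h1 := h (Pi.single 1 1)
    have h2 := h (Pi.single 2 1)
    simp [det3] at h0 h1 h2
    obtain ⟨i, hi⟩ := Function.ne_iff.1 ha
    have hi' : a i ≠ 0 := hi
    refine ⟨w i / a i, ?_⟩
    ext j
    simp only [Pi.smul_apply, smul_eq_mul]
    field_simp
    fin_cases i <;> fin_cases j <;> simp <;> grind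
  · rintro ⟨r, rfl⟩ c
    simp [det3]; ring

theorem det3_ne_zero_iff {a b c : C3} :
    det3 a b c ≠ 0 ↔ ∀ r s t : ℂ, r • a + s • b + t • c = 0 → r = 0 ∧ s = 0 ∧ t = 0 := by
  constructor
  · intro h r s t hrst
    have e1 : det3 (r • a + s • b + t • c) b c = r * det3 a b c := by simp [det3]; ring
    have e2 : det3 a (r • a + s • b + t • c) c = s * det3 a b c := by simp [det3]; ring
    have e3 := det3_add_smul a b c r s t
    rw [hrst] at e1 e2 e3
    simp only [det3, Pi.zero_apply, zero_mul, mul_zero, sub_zero, add_zero] at e1 e2 e3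
    exact ⟨(mul_eq_zero.1 e1.symm).resolve_right h, (mul_eq_zero.1 e2.symm).resolve_right h,
      (mul_eq_zero.1 e3.symm).resolve_right h⟩
  · intro hli h
    have hdet : (Matrix.of ![a, b, c]).det = 0 := by
      rw [Matrix.det_fin_three]
      simp [det3] at h ⊢
      linear_combination h
    obtain ⟨v, hv, hv0⟩ := Matrix.exists_vecMul_eq_zero_iff.2 hdet
    have hsum : v 0 • a + v 1 • b + v 2 • c = 0 := by
      ext j
      have := congrFun hv0 j
      simp [Matrix.vecMul, dotProduct, Fin.sum_univ_three] at this
      simpa using this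
    obtain ⟨h0, h1, h2⟩ := hli _ _ _ hsum
    apply hv
    ext i
    fin_cases i <;> simp [h0, h1, h2]

theorem det3_map_ne_zero {a b c : C3} (h : det3 a b c ≠ 0) {T : C3 →L[ℂ] C3}
    (hT : Function.Injective T) : det3 (T a) (T b) (T c) ≠ 0 := by
  rw [det3_ne_zero_iff] at h ⊢
  intro r s t hrst
  apply h
  apply hT
  simpa using hrst

theorem det3_ne_zero_of_notMem {a b c : C3} (ha : a ≠ 0) (hb : b ≠ 0)
    (hd : Disjoint (Submodule.span ℂ {a}) (Submodule.span ℂ {b}))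
    (hc : c ∉ Submodule.span ℂ {a} ⊔ Submodule.span ℂ {b}) : det3 a b c ≠ 0 := by
  rw [det3_ne_zero_iff]
  intro r s t hsum
  have hab : ∀ r : ℂ, r • a ∈ Submodule.span ℂ {a} := fun r =>
    Submodule.smul_mem _ _ (Submodule.mem_span_singleton_self a)
  have hbb : ∀ r : ℂ, r • b ∈ Submodule.span ℂ {b} := fun r =>
    Submodule.smul_mem _ _ (Submodule.mem_span_singleton_self b)
  by_cases h2 : t = 0
  · rw [h2, zero_smul, add_zero] at hsum
    have e : r • a = (-s) • b := by rw [neg_smul]; exact eq_neg_of_add_eq_zero_left hsum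
    have hz := Submodule.disjoint_def.1 hd _ (hab r) (e ▸ hbb _)
    rw [hz, zero_add] at hsum
    exact ⟨by simpa [ha] using hz, by simpa [hb] using hsum, h2⟩
  · refine absurd ?_ hc
    have e : t • c = (-r) • a + (-s) • b := by
      simp only [neg_smul]
      rw [← sub_eq_zero, ← hsum]; abel
    have : c = t⁻¹ • ((-r) • a + (-s) • b) := by
      rw [← e, smul_smul, inv_mul_cancel₀ h2, one_smul]
    rw [this]
    exact Submodule.smul_mem _ _ (Submodule.add_mem_sup (hab _) (hbb _))

theorem ne_zero_of_det3_left {a b c : C3} (h : det3 a b c ≠ 0) : a ≠ 0 := by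
  rintro rfl; simp [det3] at h

theorem ne_zero_of_det3_mid {a b c : C3} (h : det3 a b c ≠ 0) : b ≠ 0 := by
  rintro rfl; simp [det3] at h

/-! ### The Cauchy-Riemann operator on `ℂ³` -/

/-- Write `c = x + y i` and use real linearity. The hypothesis concerns one vector only, since
fields are at first known to be holomorphic only along certain directions. -/
theorem map_smul_of_map_I_smul {E F : Type*} [AddCommGroup E] [Module ℂ E] [AddCommGroup F]
    [Module ℂ F] (T : E →ₗ[ℝ] F) {a : E} (h : T (Complex.I • a) = Complex.I • T a) (c : ℂ) :
    T (c • a) = c • T a := by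
  conv_lhs => rw [← Complex.re_add_im c]
  conv_rhs => rw [← Complex.re_add_im c]
  rw [add_smul, map_add, mul_smul, Complex.coe_smul, Complex.coe_smul, map_smul, map_smul,
    h, add_smul, mul_smul, Complex.coe_smul, Complex.coe_smul]


/-- Twice the `(0,1)`-part of the real differential of `f`, as a function of a real tangent
vector. -/
def dbar {F : Type*} [NormedAddCommGroup F] [NormedSpace ℂ F] (f : C3 → F) (z a : C3) : F :=
  fderiv ℝ f z a + Complex.I • fderiv ℝ f z (Complex.I • a)

section dbar
variable {F : Type*} [NormedAddCommGroup F] [NormedSpace ℂ F]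

theorem dbar_eq_zero_iff (f : C3 → F) (z a : C3) :
    dbar f z a = 0 ↔ fderiv ℝ f z (Complex.I • a) = Complex.I • fderiv ℝ f z a := by
  unfold dbar
  constructor
  · intro h
    have h2 := congrArg (fun x => Complex.I • x) h
    simp only [smul_add, smul_smul, Complex.I_mul_I, smul_zero] at h2
    rw [neg_one_smul] at h2
    exact (eq_of_sub_eq_zero (by rw [sub_eq_add_neg]; exact h2)).symm
  · intro h
    rw [h, smul_smul, Complex.I_mul_I, neg_one_smul, add_neg_cancel]

theorem dbar_add (f : C3 → F) (z a b : C3) : dbar f z (a + b) = dbar f z a + dbar f z b := by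
  simp only [dbar, smul_add, map_add]; abel

theorem dbar_I_smul (f : C3 → F) (z a : C3) :
    dbar f z (Complex.I • a) = -(Complex.I • dbar f z a) := by
  simp only [dbar, smul_add, smul_smul, Complex.I_mul_I, neg_one_smul, map_neg, smul_neg]
  abel

/-- Conjugate linearity in the direction is what allows the vanishing of `dbar` to be tested on a
complex frame. -/
theorem dbar_smul (f : C3 → F) (z : C3) (c : ℂ) (a : C3) :
    dbar f z (c • a) = (starRingEnd ℂ c) • dbar f z a := by
  have hr : ∀ (r : ℝ) (b : C3), dbar f z ((r : ℂ) • b) = (r : ℂ) • dbar f z b := by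
    intro r b
    have e : ((r : ℂ) • b) = r • b := by ext i; simp
    rw [e]
    have e2 : Complex.I • r • b = r • (Complex.I • b) := smul_comm _ _ _
    simp only [dbar, e2, map_smul]
    rw [smul_comm Complex.I r, ← smul_add]
    exact (Complex.coe_smul _ _).symm
  conv_lhs => rw [← Complex.re_add_im c]
  rw [add_smul, dbar_add, hr, mul_smul, hr, dbar_I_smul, smul_neg, ← sub_eq_add_neg,
    ← mul_smul, ← sub_smul]
  congr 1
  apply Complex.ext <;> simp

/-- The `(0,1)`-vector fields annihilating a function are closed under brackets. -/
theorem dbar_bracket {f : C3 → F} {A B : C3 → C3} {z : C3} (hf : ContDiffAt ℝ 2 f z)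
    (hA : DifferentiableAt ℝ A z) (hB : DifferentiableAt ℝ B z)
    (hfA : ∀ᶠ y in 𝓝 z, dbar f y (A y) = 0) (hfB : ∀ᶠ y in 𝓝 z, dbar f y (B y) = 0) :
    dbar f z (VectorField.lieBracket ℝ A B z -
      VectorField.lieBracket ℝ (fun y => Complex.I • A y) (fun y => Complex.I • B y) z) = 0 := by
  have hf' : DifferentiableAt ℝ (fderiv ℝ f) z :=
    (hf.fderiv_right (m := 1) (by norm_num)).differentiableAt (by norm_num)
  have hsymm : IsSymmSndFDerivAt ℝ f z := hf.isSymmSndFDerivAt (by simp)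
  -- Differentiate the identity `dbar f y (A y) = 0` at `z` in the direction `v`.
  have key : ∀ {A : C3 → C3}, DifferentiableAt ℝ A z → (∀ᶠ y in 𝓝 z, dbar f y (A y) = 0) →
      ∀ v, fderiv ℝ (fderiv ℝ f) z v (A z) + fderiv ℝ f z (fderiv ℝ A z v) +
        Complex.I • (fderiv ℝ (fderiv ℝ f) z v (Complex.I • A z) +
          fderiv ℝ f z (Complex.I • fderiv ℝ A z v)) = 0 := by
    intro A hA hfA v
    have h0 : HasFDerivAt (fun y => dbar f y (A y)) (0 : C3 →L[ℝ] F) z :=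
      (hasFDerivAt_const (0 : F) z).congr_of_eventuallyEq hfA
    have hIA : HasFDerivAt (fun y => Complex.I • A y) (Complex.I • fderiv ℝ A z) z :=
      hA.hasFDerivAt.const_smul Complex.I
    have h1 : HasFDerivAt (fun y => dbar f y (A y)) _ z :=
      (hf'.hasFDerivAt.clm_apply hA.hasFDerivAt).add
        ((hf'.hasFDerivAt.clm_apply hIA).const_smul Complex.I)
    have h2 := DFunLike.congr_fun (h1.unique h0) v
    simp at h2
    rw [← h2]
    simp only [smul_add]
    abel
  -- Derivative of the identity for `B` along `A + i(iA)`, minus that of the identity for `A` along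
  -- `B + i(iB)`: the second derivatives of `f` cancel by symmetry and the bracket terms remain.
  have h1 := key hB hfB (A z)
  have h2 := key hB hfB (Complex.I • A z)
  have h3 := key hA hfA (B z)
  have h4 := key hA hfA (Complex.I • B z)
  have hIA : fderiv ℝ (fun y => Complex.I • A y) z = Complex.I • fderiv ℝ A z :=
    fderiv_fun_const_smul hA _
  have hIB : fderiv ℝ (fun y => Complex.I • B y) z = Complex.I • fderiv ℝ B z :=
    fderiv_fun_const_smul hB _
  have e1 := hsymm (A z) (B z)
  have e2 := hsymm (A z) (Complex.I • B z)
  have e3 := hsymm (Complex.I • A z) (B z)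
  have e4 := hsymm (Complex.I • A z) (Complex.I • B z)
  simp only [VectorField.lieBracket, hIA, hIB, dbar, map_sub, smul_sub, smul_add,
    smul_smul, Complex.I_mul_I, neg_one_smul, map_neg, _root_.smul_apply, smul_neg] at *
  have h2' := congrArg (fun x => Complex.I • x) h2
  have h4' := congrArg (fun x => Complex.I • x) h4
  simp only [smul_add, smul_smul, Complex.I_mul_I, neg_one_smul, smul_zero] at h2' h4'
  rw [e1, e2] at h1
  rw [e3, e4] at h2'
  have h5 := congrArg₂ (· - ·) (congrArg₂ (· + ·) h1 h2') (congrArg₂ (· + ·) h3 h4')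
  simp only [add_zero, sub_zero] at h5
  rw [← h5]
  abel

end dbar

/-- A real smooth map with complex linear differentials is holomorphic. -/
theorem contDiffOn_complex_of_real {E F : Type*} [NormedAddCommGroup E] [NormedSpace ℂ E]
    [FiniteDimensional ℂ E] [NormedAddCommGroup F] [NormedSpace ℂ F] {f : E → F} {U : Set E}
    (hU : IsOpen U) (hf : ContDiffOn ℝ ∞ f U)
    (hc : ∀ z ∈ U, ∀ a, fderiv ℝ f z (Complex.I • a) = Complex.I • fderiv ℝ f z a) :
    ContDiffOn ℂ ∞ f U := by
  -- The real derivative commutes with `i`, hence is complex linear and is the complex derivative.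
  have hd : ∀ {f : E → F}, ContDiffOn ℝ ∞ f U →
      (∀ z ∈ U, ∀ a, fderiv ℝ f z (Complex.I • a) = Complex.I • fderiv ℝ f z a) →
      ∀ z ∈ U, DifferentiableAt ℂ f z := by
    intro f hf hc z hz
    have h1 : HasFDerivAt f (fderiv ℝ f z) z :=
      ((hf.contDiffAt (hU.mem_nhds hz)).differentiableAt (by simp)).hasFDerivAt
    have hlin : ∀ (c : ℂ) (a : E), fderiv ℝ f z (c • a) = c • fderiv ℝ f z a :=
      fun c a => map_smul_of_map_I_smul (fderiv ℝ f z).toLinearMap (hc z hz a) c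
    let L : E →L[ℂ] F :=
      { toFun := fderiv ℝ f z
        map_add' := map_add _
        map_smul' := hlin
        cont := (fderiv ℝ f z).continuous }
    have h2 := hasFDerivAt_iff_isLittleO_nhds_zero.1 h1
    have : HasFDerivAt f L z := hasFDerivAt_iff_isLittleO_nhds_zero.2 h2
    exact this.differentiableAt
  -- Induction on the order for all `f` at once: the directional derivatives of `f` satisfy the same
  -- hypotheses.
  refine contDiffOn_infty.2 fun n => ?_
  induction n generalizing f with
  | zero => exact contDiffOn_zero.2 hf.continuousOn
  | succ n ih =>
    have hdf := hd hf hc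
    have hfe : ∀ z ∈ U, ∀ y, fderiv ℂ f z y = fderiv ℝ f z y := by
      intro z hz y
      rw [((hdf z hz).hasFDerivAt.restrictScalars ℝ).fderiv]; rfl
    have : ((n + 1 : ℕ) : WithTop ℕ∞) = (n : WithTop ℕ∞) + 1 := by norm_cast
    rw [this, contDiffOn_succ_iff_fderiv_of_isOpen hU]
    refine ⟨fun z hz => (hdf z hz).differentiableWithinAt, by simp, ?_⟩
    rw [contDiffOn_clm_apply]
    intro y
    have hre : ContDiffOn ℝ ∞ (fun z => fderiv ℝ f z y) U :=
      (hf.fderiv_of_isOpen hU (by simp)).clm_apply contDiffOn_const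
    have heq : EqOn (fun z => fderiv ℂ f z y) (fun z => fderiv ℝ f z y) U :=
      fun z hz => hfe z hz y
    refine ContDiffOn.congr ?_ heq
    -- The Cauchy-Riemann equation for `z ↦ f'(z) y`: exchange the two directions by symmetry of the
    -- second derivative, then differentiate the equation for `f`.
    refine ih hre ?_
    intro z hz a
    have hfz := hf.contDiffAt (hU.mem_nhds hz)
    have hf' : DifferentiableAt ℝ (fderiv ℝ f) z :=
      (hfz.fderiv_right (m := 1) (by rw [one_add_one_eq_two]; exact ENat.LEInfty.out)).differentiableAt (by norm_num)
    have hsymm : IsSymmSndFDerivAt ℝ f z := hfz.isSymmSndFDerivAt (by simpa using ENat.LEInfty.out)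
    have hcomp : ∀ y v, fderiv ℝ (fun z => fderiv ℝ f z y) z v = fderiv ℝ (fderiv ℝ f) z v y := by
      intro y v
      rw [fderiv_clm_apply hf' (differentiableAt_const _)]
      simp
    have hI : fderiv ℝ (fun z => fderiv ℝ f z (Complex.I • a)) z =
        fderiv ℝ (fun z => Complex.I • fderiv ℝ f z a) z := by
      apply Filter.EventuallyEq.fderiv_eq
      filter_upwards [hU.mem_nhds hz] with w hw using hc w hw a
    have hI2 : fderiv ℝ (fun z => Complex.I • fderiv ℝ f z a) z =
        Complex.I • fderiv ℝ (fun z => fderiv ℝ f z a) z :=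
      fderiv_fun_const_smul (hf'.clm_apply (differentiableAt_const _)) _
    rw [hcomp, hcomp, hsymm, ← hcomp, hI, hI2, _root_.smul_apply, hcomp, hsymm]

/-! ### Brackets of sections of plane and line fields -/

theorem fderiv_det3_apply {A B C : C3 → C3} {z : C3} (hA : DifferentiableAt ℝ A z)
    (hB : DifferentiableAt ℝ B z) (hC : DifferentiableAt ℝ C z) (v : C3) :
    fderiv ℝ (fun y => det3 (A y) (B y) (C y)) z v = det3 (fderiv ℝ A z v) (B z) (C z) +
      det3 (A z) (fderiv ℝ B z v) (C z) + det3 (A z) (B z) (fderiv ℝ C z v) := by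
  have hA' := hasFDerivAt_pi'.1 hA.hasFDerivAt
  have hB' := hasFDerivAt_pi'.1 hB.hasFDerivAt
  have hC' := hasFDerivAt_pi'.1 hC.hasFDerivAt
  have h := (((hA' 0).mul (((hB' 1).mul (hC' 2)).sub ((hB' 2).mul (hC' 1)))).sub
    ((hA' 1).mul (((hB' 0).mul (hC' 2)).sub ((hB' 2).mul (hC' 0))))).add
    ((hA' 2).mul (((hB' 0).mul (hC' 1)).sub ((hB' 1).mul (hC' 0))))
  rw [show fderiv ℝ (fun y => det3 (A y) (B y) (C y)) z = _ from HasFDerivAt.fderiv h]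
  simp [det3]
  ring

/-- The Levi form of the plane field spanned by `X` and `Y`. -/
theorem det3_bracket {X Y A B : C3 → C3} {z : C3} (hX : DifferentiableAt ℝ X z)
    (hY : DifferentiableAt ℝ Y z) (hA : DifferentiableAt ℝ A z) (hB : DifferentiableAt ℝ B z)
    (hXX : dbar X z (X z) = 0) (hXY : dbar X z (Y z) = 0) (hYX : dbar Y z (X z) = 0)
    (hYY : dbar Y z (Y z) = 0) (hAD : ∀ᶠ y in 𝓝 z, det3 (X y) (Y y) (A y) = 0)
    (hBD : ∀ᶠ y in 𝓝 z, det3 (X y) (Y y) (B y) = 0) {a₁ a₂ b₁ b₂ : ℂ}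
    (ha : A z = a₁ • X z + a₂ • Y z) (hb : B z = b₁ • X z + b₂ • Y z) :
    det3 (X z) (Y z) (VectorField.lieBracket ℝ A B z) =
      (a₁ * b₂ - a₂ * b₁) * det3 (X z) (Y z) (VectorField.lieBracket ℝ X Y z) := by
  have lin : ∀ {X : C3 → C3} {v : C3}, dbar X z v = 0 → ∀ c : ℂ,
      fderiv ℝ X z (c • v) = c • fderiv ℝ X z v := fun h c =>
    map_smul_of_map_I_smul (fderiv ℝ _ z).toLinearMap ((dbar_eq_zero_iff _ _ _).1 h) c
  -- Differentiate the equation `det3 X Y A = 0` of the plane field in the direction `v`.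
  have key : ∀ {A : C3 → C3}, DifferentiableAt ℝ A z →
      (∀ᶠ y in 𝓝 z, det3 (X y) (Y y) (A y) = 0) → ∀ v,
      det3 (fderiv ℝ X z v) (Y z) (A z) + det3 (X z) (fderiv ℝ Y z v) (A z) +
        det3 (X z) (Y z) (fderiv ℝ A z v) = 0 := by
    intro A hA h v
    rw [← fderiv_det3_apply hX hY hA]
    have : (fun y => det3 (X y) (Y y) (A y)) =ᶠ[𝓝 z] fun _ => (0 : ℂ) := h
    rw [this.fderiv_eq]; simp
  have h1 := key hA hAD (B z)
  have h2 := key hB hBD (A z)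
  rw [hb] at h1
  rw [ha] at h2
  -- The four vanishing `dbar` values allow the coefficients to be pulled out of the derivatives of
  -- `X` and `Y`; what is left over is a multiple of the bracket of `X` and `Y`.
  rw [ha, map_add, map_add, lin hXX, lin hXY, lin hYX, lin hYY] at h1
  rw [hb, map_add, map_add, lin hXX, lin hXY, lin hYX, lin hYY] at h2
  simp only [VectorField.lieBracket]
  rw [ha, hb]
  simp only [map_add] at h1 h2 ⊢
  generalize fderiv ℝ A z (b₁ • X z) = p₁ at *
  generalize fderiv ℝ A z (b₂ • Y z) = p₂ at *
  generalize fderiv ℝ B z (a₁ • X z) = q₁ at *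
  generalize fderiv ℝ B z (a₂ • Y z) = q₂ at *
  generalize fderiv ℝ X z (X z) = r₁ at *
  generalize fderiv ℝ X z (Y z) = r₂ at *
  generalize fderiv ℝ Y z (X z) = s₁ at *
  generalize fderiv ℝ Y z (Y z) = s₂ at *
  generalize X z = x at *
  generalize Y z = y at *
  simp only [det3, Pi.add_apply, Pi.sub_apply, Pi.smul_apply, smul_eq_mul] at h1 h2 ⊢
  linear_combination h2 - h1

/-- Brackets of sections of the complex line field spanned by `Z`. -/
theorem det3_bracket_line {Z A B : C3 → C3} {z : C3} (hZ : DifferentiableAt ℝ Z z)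
    (hA : DifferentiableAt ℝ A z) (hB : DifferentiableAt ℝ B z) (hZZ : dbar Z z (Z z) = 0)
    (hAZ : ∀ᶠ y in 𝓝 z, ∃ r : ℂ, A y = r • Z y) (hBZ : ∀ᶠ y in 𝓝 z, ∃ r : ℂ, B y = r • Z y)
    (w : C3) : det3 (Z z) (VectorField.lieBracket ℝ A B z) w = 0 := by
  have lin : ∀ c : ℂ, fderiv ℝ Z z (c • Z z) = c • fderiv ℝ Z z (Z z) :=
    map_smul_of_map_I_smul (fderiv ℝ Z z).toLinearMap ((dbar_eq_zero_iff _ _ _).1 hZZ)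
  have key : ∀ {A : C3 → C3}, DifferentiableAt ℝ A z →
      (∀ᶠ y in 𝓝 z, ∃ r : ℂ, A y = r • Z y) → ∀ v,
      det3 (fderiv ℝ Z z v) (A z) w + det3 (Z z) (fderiv ℝ A z v) w = 0 := by
    intro A hA h v
    have := fderiv_det3_apply hZ hA (differentiableAt_const w) v
    have h0 : (fun y => det3 (Z y) (A y) w) =ᶠ[𝓝 z] fun _ => (0 : ℂ) := by
      filter_upwards [h] with y hy
      obtain ⟨r, hr⟩ := hy
      rw [hr]; simp [det3]; ring
    rw [h0.fderiv_eq] at this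
    simp at this
    rw [this]
    simp [det3]
  obtain ⟨a, ha⟩ := hAZ.self_of_nhds
  obtain ⟨b, hb⟩ := hBZ.self_of_nhds
  have h1 := key hA hAZ (B z)
  have h2 := key hB hBZ (A z)
  rw [hb] at h1
  rw [ha] at h2
  rw [ha, lin] at h1
  rw [hb, lin] at h2
  simp only [VectorField.lieBracket]
  rw [ha, hb]
  generalize fderiv ℝ A z (b • Z z) = p at *
  generalize fderiv ℝ B z (a • Z z) = q at *
  simp only [det3, Pi.sub_apply, Pi.smul_apply, smul_eq_mul] at h1 h2 ⊢
  linear_combination h2 - h1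

/-! ### Inverse functions -/

/-- The inverse function theorem for smooth maps, with an inverse that is smooth on an open set. -/
theorem exists_openPartialHomeomorph_of_contDiffOn {𝕜 E F : Type*} [RCLike 𝕜]
    [NormedAddCommGroup E] [NormedSpace 𝕜 E] [CompleteSpace E] [NormedAddCommGroup F]
    [NormedSpace 𝕜 F] {f : E → F} {U : Set E} (hU : IsOpen U) (hf : ContDiffOn 𝕜 ∞ f U) {a : E}
    (ha : a ∈ U) {f' : E ≃L[𝕜] F} (hf' : fderiv 𝕜 f a = f') :
    ∃ φ : OpenPartialHomeomorph E F, (φ : E → F) = f ∧ a ∈ φ.source ∧ φ.source ⊆ U ∧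
      ContDiffOn 𝕜 ∞ φ.symm φ.target ∧
      ∀ x ∈ φ.source, ∃ T : E ≃L[𝕜] F, HasFDerivAt f (T : E →L[𝕜] F) x := by
  have hfa := hf.contDiffAt (hU.mem_nhds ha)
  have hd : ∀ x ∈ U, HasFDerivAt f (fderiv 𝕜 f x) x := fun x hx =>
    ((hf.contDiffAt (hU.mem_nhds hx)).differentiableAt (by simp)).hasFDerivAt
  have hda : HasFDerivAt f (f' : E →L[𝕜] F) a := hf' ▸ hd a ha
  let φ₀ := hfa.toOpenPartialHomeomorph f hda (by simp)
  have ha₀ : a ∈ φ₀.source := hfa.mem_toOpenPartialHomeomorph_source hda (by simp)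
  have hc : ContinuousOn (fderiv 𝕜 f) U := hf.continuousOn_fderiv_of_isOpen hU (by simp)
  -- Restriction to the open set where the derivative is invertible makes the inverse smooth on its
  -- whole domain, not only at the image of `a`.
  let V : Set E := U ∩ fderiv 𝕜 f ⁻¹' range ((↑) : (E ≃L[𝕜] F) → (E →L[𝕜] F))
  have hV : IsOpen V := hc.isOpen_inter_preimage hU ContinuousLinearEquiv.isOpen
  refine ⟨φ₀.restrOpen V hV, rfl, ⟨ha₀, ha, f', hf'.symm⟩, fun x hx => hx.2.1, ?_, ?_⟩
  · intro y hy
    have hy' := (φ₀.restrOpen V hV).map_target hy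
    obtain ⟨T, hT⟩ := hy'.2.2
    refine ContDiffAt.contDiffWithinAt ?_
    refine OpenPartialHomeomorph.contDiffAt_symm (f₀' := T) _ hy ?_ ?_
    · rw [hT]
      exact hd _ hy'.2.1
    · exact hf.contDiffAt (hU.mem_nhds hy'.2.1)
  · rintro x ⟨-, hx, T, hT⟩
    exact ⟨T, hT ▸ hd x hx⟩

/-! ### Superposition operators -/

section Superposition

variable {K : Type*} [TopologicalSpace K] [CompactSpace K] {E F : Type v}
  [NormedAddCommGroup E] [NormedSpace ℂ E] [NormedAddCommGroup F] [NormedSpace ℂ F]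

open Classical in
/-- The superposition operator `γ ↦ f ∘ γ`, with value `0` where the composition is not
continuous. -/
def superposition (f : E → F) (γ : C(K, E)) : C(K, F) :=
  if h : Continuous (f ∘ γ) then ⟨f ∘ γ, h⟩ else 0

omit [CompactSpace K] [NormedSpace ℂ E] [NormedSpace ℂ F] in
theorem superposition_apply {f : E → F} {U : Set E} (hf : ContinuousOn f U) {γ : C(K, E)}
    (hγ : ∀ s, γ s ∈ U) (s : K) : superposition f γ s = f (γ s) := by
  have h : Continuous (f ∘ γ) := hf.comp_continuous γ.continuous hγ
  simp [superposition, h]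

variable (K E F) in
/-- A continuous family of operators acts on continuous functions. -/
def familyApply : C(K, E →L[ℂ] F) →L[ℂ] C(K, E) →L[ℂ] C(K, F) :=
  LinearMap.mkContinuous₂
    (LinearMap.mk₂ ℂ (fun (A : C(K, E →L[ℂ] F)) (h : C(K, E)) =>
        (⟨fun s => A s (h s), A.continuous.clm_apply h.continuous⟩ : C(K, F)))
      (fun _ _ _ => by ext; simp) (fun _ _ _ => by ext; simp)
      (fun _ _ _ => by ext; simp) (fun _ _ _ => by ext; simp)) 1
    (fun A h => by
      refine (ContinuousMap.norm_le _ (by positivity)).2 fun s => ?_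
      rw [one_mul]
      exact ((A s).le_opNorm _).trans (mul_le_mul (A.norm_coe_le_norm s) (h.norm_coe_le_norm s)
        (norm_nonneg _) (norm_nonneg A)))

theorem familyApply_apply (A : C(K, E →L[ℂ] F)) (h : C(K, E)) (s : K) :
    familyApply K E F A h s = A s (h s) := rfl

omit [NormedSpace ℂ E] in
theorem isOpen_maps_into {U : Set E} (hU : IsOpen U) : IsOpen {γ : C(K, E) | ∀ s, γ s ∈ U} := by
  have := ContinuousMap.isOpen_setOfPred_mapsTo (X := K) isCompact_univ hU
  simpa [MapsTo] using this

/-- The derivative acts pointwise, `h ↦ f'(γ s) (h s)`. The remainder is small uniformly in `s`: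
`f'` is uniformly continuous near the compact image of `γ`, and the mean value inequality applies on
balls around the points `γ s` of a common radius. -/
theorem hasFDerivAt_superposition {f : E → F} {U : Set E} (hU : IsOpen U)
    (hf : ContDiffOn ℂ 1 f U) {γ : C(K, E)} (hγ : ∀ s, γ s ∈ U) :
    HasFDerivAt (superposition (K := K) f)
      (familyApply K E F (superposition (fderiv ℂ f) γ)) γ := by
  have hc : ContinuousOn (fderiv ℂ f) U := hf.continuousOn_fderiv_of_isOpen hU le_rfl
  rw [hasFDerivAt_iff_isLittleO, Asymptotics.isLittleO_iff]
  intro c hcpos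
  have hK : IsCompact (range γ) := isCompact_range γ.continuous
  have hu := hK.uniformContinuousAt_of_continuousAt (fderiv ℂ f)
    (by rintro _ ⟨s, rfl⟩; exact hc.continuousAt (hU.mem_nhds (hγ s)))
    (Metric.dist_mem_uniformity hcpos)
  obtain ⟨δ, hδ, hδ'⟩ := Metric.mem_uniformity_dist.1 hu
  obtain ⟨ε, hε, hεU⟩ := hK.exists_thickening_subset_open hU (by rintro _ ⟨s, rfl⟩; exact hγ s)
  filter_upwards [Metric.ball_mem_nhds γ (lt_min hδ hε)] with η hη
  have hηs : ∀ s, η s ∈ Metric.ball (γ s) (min δ ε) := fun s =>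
    lt_of_le_of_lt (ContinuousMap.dist_apply_le_dist s) hη
  have hball : ∀ s, Metric.ball (γ s) (min δ ε) ⊆ U := fun s x hx => hεU
    (Metric.mem_thickening_iff.2 ⟨γ s, mem_range_self s, lt_of_lt_of_le hx (min_le_right _ _)⟩)
  refine (ContinuousMap.norm_le _ (by positivity)).2 fun s => ?_
  have h1 : (superposition f η - superposition f γ -
      familyApply K E F (superposition (fderiv ℂ f) γ) (η - γ)) s =
      f (η s) - f (γ s) - fderiv ℂ f (γ s) (η s - γ s) := by
    simp only [ContinuousMap.sub_apply, familyApply_apply]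
    rw [superposition_apply hf.continuousOn (fun s => hball s (hηs s)),
      superposition_apply hf.continuousOn hγ, superposition_apply hc hγ]
  rw [h1]
  refine (Convex.norm_image_sub_le_of_norm_fderiv_le' (𝕜 := ℂ) (C := c)
    (s := Metric.ball (γ s) (min δ ε)) ?_ ?_ (convex_ball _ _) (Metric.mem_ball_self
      (lt_min hδ hε)) (hηs s)).trans ?_
  · intro x hx
    exact (hf.contDiffAt (hU.mem_nhds (hball s hx))).differentiableAt (by simp)
  · intro x hx
    have := hδ' (a := γ s) (b := x)
      (by rw [dist_comm]; exact lt_of_lt_of_le hx (min_le_left _ _)) (mem_range_self s)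
    rw [← dist_eq_norm, dist_comm]
    exact le_of_lt this
  · gcongr
    exact (η - γ).norm_coe_le_norm s

/-- Induction on the order: the derivative is a bounded linear map applied to the superposition
operator of `fderiv ℂ f`. The target changes from `F` to `E →L[ℂ] F`, which is why both spaces live
in one universe. -/
theorem contDiffOn_superposition {f : E → F} {U : Set E} (hU : IsOpen U)
    (hf : ContDiffOn ℂ ∞ f U) :
    ContDiffOn ℂ ∞ (superposition (K := K) f) {γ : C(K, E) | ∀ s, γ s ∈ U} := by
  have hO := isOpen_maps_into (K := K) hU
  refine contDiffOn_infty.2 fun n => ?_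
  induction n generalizing F with
  | zero =>
    refine contDiffOn_zero.2 fun γ hγ => ?_
    exact (hasFDerivAt_superposition hU (hf.of_le ENat.LEInfty.out)
      hγ).continuousAt.continuousWithinAt
  | succ n ih =>
    have : ((n + 1 : ℕ) : WithTop ℕ∞) = (n : WithTop ℕ∞) + 1 := by norm_cast
    rw [this, contDiffOn_succ_iff_hasFDerivWithinAt_of_uniqueDiffOn hO.uniqueDiffOn]
    refine ⟨by simp, fun γ => familyApply K E F (superposition (fderiv ℂ f) γ), ?_, fun γ hγ =>
      (hasFDerivAt_superposition hU (hf.of_le ENat.LEInfty.out) hγ).hasFDerivWithinAt⟩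
    exact (familyApply K E F).contDiff.comp_contDiffOn
      (ih (hf.fderiv_of_isOpen hU (by simp)))

end Superposition

/-! ### Holomorphic flows -/

section Flow

variable {E : Type v} [NormedAddCommGroup E] [NormedSpace ℂ E] [CompleteSpace E]

variable (E) in
/-- The primitive vanishing at `0`, as an operator on the continuous functions on `[0, 1]`. -/
def primitiveCLM : C(unitInterval, E) →L[ℂ] C(unitInterval, E) :=
  LinearMap.mkContinuous
    { toFun := fun g => ⟨fun s => ∫ r in (0 : ℝ)..s, g (projIcc 0 1 zero_le_one r),
        (intervalIntegral.continuous_primitive (fun a b =>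
          (g.continuous.comp continuous_projIcc).intervalIntegrable a b) 0).comp
          continuous_subtype_val⟩
      map_add' := fun g h => by
        ext s
        exact intervalIntegral.integral_add
          ((g.continuous.comp continuous_projIcc).intervalIntegrable _ _)
          ((h.continuous.comp continuous_projIcc).intervalIntegrable _ _)
      map_smul' := fun c g => by
        ext s
        exact intervalIntegral.integral_smul c _ } 1
    (fun g => by
      refine (ContinuousMap.norm_le _ (by positivity)).2 fun s => ?_
      refine (intervalIntegral.norm_integral_le_of_norm_le_const
        (C := ‖g‖) fun r _ => g.norm_coe_le_norm _).trans ?_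
      rw [sub_zero, abs_of_nonneg s.2.1, one_mul]
      exact mul_le_of_le_one_right (norm_nonneg _) s.2.2)

omit [CompleteSpace E] in
theorem primitiveCLM_apply (g : C(unitInterval, E)) (s : unitInterval) :
    primitiveCLM E g s = ∫ r in (0 : ℝ)..s, g (projIcc 0 1 zero_le_one r) := rfl

omit [CompleteSpace E] in
-- Substitution in the integral. It shows that the solution curve for time `t`, restricted to `[0,
-- s]` and rescaled to `[0, 1]`, is the solution curve for time `s t`.
theorem primitiveCLM_comp_mul (g : C(unitInterval, E)) (s r : unitInterval) :
    primitiveCLM E g (s * r) =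
      ((s : ℝ) : ℂ) • primitiveCLM E (g.comp ⟨fun r => s * r, by fun_prop⟩) r := by
  rw [primitiveCLM_apply, primitiveCLM_apply, Complex.coe_smul]
  have h : ∫ x in (0 : ℝ)..r, (g.comp ⟨fun r => s * r, by fun_prop⟩)
      (projIcc 0 1 zero_le_one x) =
      ∫ x in (0 : ℝ)..r, g (projIcc 0 1 zero_le_one ((s : ℝ) * x)) := by
    refine intervalIntegral.integral_congr fun x hx => ?_
    rw [uIcc_of_le r.2.1] at hx
    have hx1 : x ∈ Icc (0 : ℝ) 1 := ⟨hx.1, hx.2.trans r.2.2⟩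
    simp only [ContinuousMap.comp_apply, ContinuousMap.coe_mk]
    congr 1
    rw [projIcc_of_mem zero_le_one hx1,
      projIcc_of_mem zero_le_one (unitInterval.mul_mem s.2 hx1)]
    rfl
  rw [h, intervalIntegral.smul_integral_comp_mul_left (fun x => g (projIcc 0 1 zero_le_one x)),
    mul_zero]
  rfl

theorem primitiveCLM_hasDerivWithinAt (g : C(unitInterval, E)) :
    HasDerivWithinAt (fun s : ℝ => ∫ r in (0 : ℝ)..s, g (projIcc 0 1 zero_le_one r)) (g 1)
      (Icc 0 1) 1 := by
  have hc : Continuous fun r => g (projIcc 0 1 zero_le_one r) :=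
    g.continuous.comp continuous_projIcc
  have := intervalIntegral.integral_hasDerivAt_right (hc.intervalIntegrable 0 1)
    hc.aestronglyMeasurable.stronglyMeasurableAtFilter hc.continuousAt
  rw [projIcc_right] at this
  exact this.hasDerivWithinAt

/-- The local flow of a holomorphic vector field is holomorphic. -/
theorem exists_holomorphic_flow {w : E → E} {U : Set E} (hU : IsOpen U)
    (hw : ContDiffOn ℂ ∞ w U) {x₀ : E} (hx₀ : x₀ ∈ U) :
    ∃ (W : Set (ℂ × E)) (Φ : ℂ × E → E), IsOpen W ∧ (0, x₀) ∈ W ∧ ContDiffOn ℂ ∞ Φ W ∧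
      (∀ x, (0, x) ∈ W → Φ (0, x) = x) ∧
      ∀ p ∈ W, Φ p ∈ U ∧ HasDerivAt (fun t => Φ (t, p.2)) (w (Φ p)) p.1 := by
  let P := C(unitInterval, E)
  let cst : E →L[ℂ] P := ContinuousLinearMap.const ℂ unitInterval
  let O : Set P := {γ | ∀ s, γ s ∈ U}
  have hO : IsOpen O := isOpen_maps_into hU
  -- The second component vanishes iff `γ = x + t ∫ w(γ)`, that is, iff `γ s` is the flow of `x` at
  -- time `s t`. The parameters `(t, x)` are carried along so that the inverse function theorem
  -- applies.
  let G : (ℂ × E) × P → (ℂ × E) × P := fun p =>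
    (p.1, p.2 - cst p.1.2 - p.1.1 • primitiveCLM E (superposition w p.2))
  have hN : ContDiffOn ℂ ∞ (fun p : (ℂ × E) × P => primitiveCLM E (superposition w p.2))
      (univ ×ˢ O) :=
    (primitiveCLM E).contDiff.comp_contDiffOn
      ((contDiffOn_superposition hU hw).comp contDiff_snd.contDiffOn fun p hp => hp.2)
  have hG : ContDiffOn ℂ ∞ G (univ ×ˢ O) := by
    refine contDiff_fst.contDiffOn.prodMk (ContDiffOn.sub (ContDiff.contDiffOn ?_) ?_)
    · fun_prop
    · exact (contDiff_fst.comp contDiff_fst).contDiffOn.smul hN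
  have hUO : IsOpen ((univ : Set (ℂ × E)) ×ˢ O) := isOpen_univ.prod hO
  let γ₀ : P := cst x₀
  let a : (ℂ × E) × P := ((0, x₀), γ₀)
  have ha : a ∈ (univ : Set (ℂ × E)) ×ˢ O := ⟨mem_univ _, fun s => hx₀⟩
  -- At `t = 0` the nonlinear term does not contribute in the direction of `γ`, so the derivative of
  -- `G` is triangular with identities on the diagonal.
  let S : ℂ × E →L[ℂ] P := -(cst ∘L ContinuousLinearMap.snd ℂ ℂ E) -
    (ContinuousLinearMap.fst ℂ ℂ E).smulRight (primitiveCLM E (superposition w γ₀))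
  let T : ((ℂ × E) × P) ≃L[ℂ] ((ℂ × E) × P) :=
    (ContinuousLinearEquiv.refl ℂ (ℂ × E)).skewProd (ContinuousLinearEquiv.refl ℂ P) S
  have hGa : fderiv ℂ G a = T := by
    have h1 : HasFDerivAt (fun p : (ℂ × E) × P => p.1.1)
        (ContinuousLinearMap.fst ℂ ℂ E ∘L ContinuousLinearMap.fst ℂ (ℂ × E) P) a :=
      (ContinuousLinearMap.fst ℂ ℂ E ∘L ContinuousLinearMap.fst ℂ (ℂ × E) P).hasFDerivAt
    have h2 := ((hN.contDiffAt (hUO.mem_nhds ha)).differentiableAt (by simp)).hasFDerivAt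
    have h3 : HasFDerivAt (fun p : (ℂ × E) × P => p.2 - cst p.1.2)
        (ContinuousLinearMap.snd ℂ (ℂ × E) P - cst ∘L (ContinuousLinearMap.snd ℂ ℂ E ∘L
          ContinuousLinearMap.fst ℂ (ℂ × E) P)) a :=
      (ContinuousLinearMap.snd ℂ (ℂ × E) P - cst ∘L (ContinuousLinearMap.snd ℂ ℂ E ∘L
          ContinuousLinearMap.fst ℂ (ℂ × E) P)).hasFDerivAt
    have h4 := (hasFDerivAt_fst (𝕜 := ℂ) (p := a)).prodMk (h3.sub (h1.smul h2))
    rw [show fderiv ℂ G a = _ from HasFDerivAt.fderiv h4]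
    refine ContinuousLinearMap.ext fun p => ?_
    simp [T, S, a]
    abel
  obtain ⟨φ, hφ, haφ, hφU, hφs, -⟩ := exists_openPartialHomeomorph_of_contDiffOn hUO hG ha hGa
  have hGa' : G a = ((0, x₀), 0) := by
    simp [G, a, γ₀]
  obtain ⟨δ, hδ, hball⟩ := Metric.isOpen_iff.1 φ.open_source a haφ
  let ι : ℂ × E → (ℂ × E) × P := fun p => (p, 0)
  let γ : ℂ × E → P := fun p => (φ.symm (ι p)).2
  have hι : Continuous ι := by fun_prop
  let W₁ : Set (ℂ × E) := ι ⁻¹' φ.target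
  have hW₁ : IsOpen W₁ := φ.open_target.preimage hι
  have hγ : ContDiffOn ℂ ∞ γ W₁ :=
    contDiff_snd.comp_contDiffOn (hφs.comp (contDiff_id.prodMk contDiff_const).contDiffOn
      fun p hp => hp)
  let W : Set (ℂ × E) := (W₁ ∩ γ ⁻¹' Metric.ball γ₀ δ) ∩ Metric.ball (0, x₀) δ
  have hW : IsOpen W :=
    (hγ.continuousOn.isOpen_inter_preimage hW₁ Metric.isOpen_ball).inter Metric.isOpen_ball
  have hι0 : φ a = ι (0, x₀) := by rw [hφ, hGa']
  have hγ0 : γ (0, x₀) = γ₀ := by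
    simp only [γ]
    rw [← hι0, φ.left_inv haφ]
  have hsol : ∀ p ∈ W₁, (∀ s, γ p s ∈ U) ∧
      γ p = cst p.2 + p.1 • primitiveCLM E (superposition w (γ p)) := by
    intro p hp
    have h1 : G (φ.symm (ι p)) = ι p := by rw [← hφ]; exact φ.right_inv hp
    have h2 : (φ.symm (ι p)).1 = p := congrArg Prod.fst h1
    have h3 := congrArg Prod.snd h1
    simp only [G, h2, ι] at h3
    refine ⟨(hφU (φ.map_target hp)).2, ?_⟩
    rw [sub_sub, sub_eq_zero] at h3
    exact h3
  -- The rescaled curve solves the integral equation for time `s t` and stays in the ball on which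
  -- `G` is injective, so it is the curve provided by the inverse function.
  have hscale : ∀ p ∈ W, ∀ s : unitInterval, γ (((s : ℝ) : ℂ) * p.1, p.2) 1 = γ p s := by
    intro p hp s
    obtain ⟨hU', heq⟩ := hsol p hp.1.1
    let σ : C(unitInterval, unitInterval) := ⟨fun r => s * r, by fun_prop⟩
    let η : P := (γ p).comp σ
    have hη : ((((s : ℝ) : ℂ) * p.1, p.2), η) ∈ φ.source := by
      apply hball
      have hp2 := hp.2
      rw [Metric.mem_ball, Prod.dist_eq, max_lt_iff] at hp2 ⊢
      simp only [dist_zero_right] at hp2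
      constructor
      · rw [Prod.dist_eq, max_lt_iff]
        refine ⟨?_, hp2.2⟩
        simp only [a, dist_zero_right, norm_mul, Complex.norm_real, Real.norm_eq_abs]
        refine lt_of_le_of_lt (mul_le_of_le_one_left (norm_nonneg _) ?_) hp2.1
        rw [abs_of_nonneg s.2.1]; exact s.2.2
      · refine lt_of_le_of_lt ?_ hp.1.2
        refine (ContinuousMap.dist_le dist_nonneg).2 fun r => ?_
        exact ContinuousMap.dist_apply_le_dist (f := γ p) (g := γ₀) (s * r)
    have hGη : G ((((s : ℝ) : ℂ) * p.1, p.2), η) = ι (((s : ℝ) : ℂ) * p.1, p.2) := by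
      refine Prod.ext rfl ?_
      simp only [G, ι]
      rw [sub_sub, sub_eq_zero]
      ext r
      have h1 : η r = p.2 + p.1 • primitiveCLM E (superposition w (γ p)) (s * r) :=
        DFunLike.congr_fun heq (s * r)
      have h2 : (superposition w (γ p)).comp σ = superposition w η := by
        ext r
        rw [superposition_apply hw.continuousOn (fun r => hU' (s * r))]
        exact superposition_apply hw.continuousOn hU' _
      rw [h1, primitiveCLM_comp_mul, h2, smul_smul, mul_comm p.1]
      rfl
    have h4 : φ.symm (ι (((s : ℝ) : ℂ) * p.1, p.2)) = ((((s : ℝ) : ℂ) * p.1, p.2), η) := by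
      rw [← hGη, ← hφ, φ.left_inv hη]
    simp only [γ]
    rw [h4]
    change γ p (s * 1) = _
    rw [mul_one]
  let Φ : ℂ × E → E := fun p => γ p 1
  have hΦ : ContDiffOn ℂ ∞ Φ W :=
    (ContinuousMap.evalCLM ℂ (1 : unitInterval) : P →L[ℂ] E).contDiff.comp_contDiffOn
      (hγ.mono fun p hp => hp.1.1)
  have hd : ∀ p ∈ W, HasDerivAt (fun t => Φ (t, p.2)) (fderiv ℂ Φ p (1, 0)) p.1 := by
    intro p hp
    have h1 := ((hΦ.contDiffAt (hW.mem_nhds hp)).differentiableAt (by simp)).hasFDerivAt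
    have h2 : HasDerivAt (fun t : ℂ => (t, p.2)) ((1 : ℂ), (0 : E)) p.1 :=
      (hasDerivAt_id p.1).prodMk (hasDerivAt_const _ _)
    exact h1.comp_hasDerivAt p.1 h2
  have hΦU : ∀ p ∈ W, Φ p ∈ U := fun p hp => (hsol p hp.1.1).1 1
  -- Both sides are the one-sided derivative at `s = 1` of `Φ (s t, x)`, by the chain rule and by
  -- the integral equation. Only `s ≤ 1` is available, because curves can only be shortened.
  have hmul : ∀ p ∈ W, p.1 • fderiv ℂ Φ p (1, 0) = p.1 • w (Φ p) := by
    intro p hp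
    obtain ⟨hU', heq⟩ := hsol p hp.1.1
    have h1 : HasDerivWithinAt (fun s : ℝ => Φ ((s : ℂ) * p.1, p.2))
        (p.1 • fderiv ℂ Φ p (1, 0)) (Icc 0 1) 1 := by
      have hs : HasDerivAt (fun s : ℝ => (s : ℂ) * p.1) p.1 1 := by
        simpa using (Complex.ofRealCLM.hasDerivAt (x := (1 : ℝ))).mul_const p.1
      have := hd p hp
      rw [show p.1 = ((1 : ℝ) : ℂ) * p.1 by simp] at this
      simpa [Function.comp_def] using
        (HasDerivAt.scomp (1 : ℝ) this hs).hasDerivWithinAt (s := Icc 0 1)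
    have h2 : HasDerivWithinAt (fun s : ℝ => Φ ((s : ℂ) * p.1, p.2))
        (p.1 • w (Φ p)) (Icc 0 1) 1 := by
      have h3 := ((primitiveCLM_hasDerivWithinAt (superposition w (γ p))).const_smul
        p.1).const_add p.2
      rw [superposition_apply hw.continuousOn hU'] at h3
      have h5 : ∀ s ∈ Icc (0 : ℝ) 1, Φ ((s : ℂ) * p.1, p.2) = p.2 + p.1 • ∫ r in (0 : ℝ)..s,
          superposition w (γ p) (projIcc 0 1 zero_le_one r) := by
        intro s hs
        have := hscale p hp ⟨s, hs⟩
        simp only [Φ]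
        rw [this]
        exact DFunLike.congr_fun heq ⟨s, hs⟩
      exact h3.congr h5 (h5 1 ⟨zero_le_one, le_rfl⟩)
    exact (uniqueDiffOn_Icc zero_lt_one 1 ⟨zero_le_one, le_rfl⟩).eq_deriv _ h1 h2
  -- Divide by the time; at time zero pass to the limit by continuity.
  have heq : ∀ p ∈ W, fderiv ℂ Φ p (1, 0) = w (Φ p) := by
    intro p hp
    by_cases hp0 : p.1 = 0
    · have hcont : ∀ f : ℂ × E → E, ContinuousOn f W →
          Tendsto (fun t => f (t, p.2)) (𝓝[≠] p.1) (𝓝 (f p)) := by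
        intro f hf
        have h1 : ContinuousAt f (p.1, p.2) := hf.continuousAt (hW.mem_nhds hp)
        have h2 : ContinuousAt (fun t : ℂ => (t, p.2)) p.1 := by fun_prop
        exact (ContinuousAt.comp (f := fun t : ℂ => (t, p.2)) h1 h2).tendsto.mono_left
          nhdsWithin_le_nhds
      refine tendsto_nhds_unique_of_eventuallyEq (hcont (fun p => fderiv ℂ Φ p (1, 0)) ?_)
        (hcont (fun p => w (Φ p)) ?_) ?_
      · exact (hΦ.continuousOn_fderiv_of_isOpen hW (by simp)).clm_apply continuousOn_const
      · exact hw.continuousOn.comp hΦ.continuousOn hΦU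
      · have h3 : ∀ᶠ t in 𝓝 p.1, (t, p.2) ∈ W :=
          (Continuous.prodMk_left p.2).continuousAt.preimage_mem_nhds (hW.mem_nhds hp)
        filter_upwards [nhdsWithin_le_nhds h3, self_mem_nhdsWithin] with t ht ht0
        rw [hp0] at ht0
        exact smul_right_injective E (show t ≠ 0 from ht0) (hmul (t, p.2) ht)
    · exact smul_right_injective E hp0 (hmul p hp)
  refine ⟨W, Φ, hW, ⟨⟨?_, ?_⟩, Metric.mem_ball_self hδ⟩, hΦ, ?_, fun p hp => ⟨hΦU p hp, ?_⟩⟩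
  · change ι (0, x₀) ∈ φ.target
    rw [← hι0]
    exact φ.map_source haφ
  · change γ (0, x₀) ∈ Metric.ball γ₀ δ
    rw [hγ0]
    exact Metric.mem_ball_self hδ
  · intro x hx
    have := DFunLike.congr_fun (hsol _ hx.1.1).2 1
    simp only [Φ]
    rw [this]
    simp [cst]
    rfl
  · rw [← heq p hp]
    exact hd p hp

end Flow

/-! ### Flow boxes and first integrals -/

/-- An injective endomorphism of `ℂ³` as a continuous linear equivalence. -/
theorem exists_equiv_of_injective {E : Type*} [NormedAddCommGroup E] [NormedSpace ℂ E]
    [FiniteDimensional ℂ E] {T : E →L[ℂ] E} (hT : Function.Injective T) :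
    ∃ S : E ≃L[ℂ] E, (S : E →L[ℂ] E) = T :=
  ⟨(LinearEquiv.ofInjectiveEndo T.toLinearMap hT).toContinuousLinearEquiv, by ext; rfl⟩

/-- A holomorphic vector field is straightened by holomorphic coordinates, which are the identity
on a coordinate plane. -/
theorem exists_flow_box {Z : C3 → C3} {U : Set C3} (hU : IsOpen U) (hZ : ContDiffOn ℂ ∞ Z U)
    {x₀ : C3} (hx₀ : x₀ ∈ U) {k : Fin 3} (hk : Z x₀ k ≠ 0) :
    ∃ (Ψ : OpenPartialHomeomorph C3 C3) (ε : ℝ), 0 < ε ∧ Ψ.source = Metric.ball x₀ ε ∧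
      Ψ.target ⊆ U ∧ ContDiffOn ℂ ∞ Ψ Ψ.source ∧ ContDiffOn ℂ ∞ Ψ.symm Ψ.target ∧
      (∀ c ∈ Ψ.source, c k = x₀ k → Ψ c = c) ∧
      ∀ c ∈ Ψ.source, ∃ T : C3 ≃L[ℂ] C3, HasFDerivAt Ψ (T : C3 →L[ℂ] C3) c ∧
        T (Pi.single k 1) = Z (Ψ c) := by
  obtain ⟨W, Φ, hW, h0W, hΦ, hΦ0, hΦW⟩ := exists_holomorphic_flow hU hZ hx₀
  let π : C3 →L[ℂ] C3 := ContinuousLinearMap.id ℂ C3 -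
    (ContinuousLinearMap.proj k : C3 →L[ℂ] ℂ).smulRight (Pi.single k 1)
  have hπ : ∀ c i, π c i = if i = k then 0 else c i := by
    intro c i
    by_cases h : i = k
    · subst h; simp [π]
    · simp [π, h]
  -- A point is sent to a time, its `k`-th coordinate relative to `x₀`, and an initial point on the
  -- slice through `x₀`.
  let j : C3 → ℂ × C3 := fun c => (c k - x₀ k, π c + x₀ k • Pi.single k 1)
  have hj : ContDiff ℂ ∞ j := by
    refine ContDiff.prodMk ?_ (π.contDiff.add contDiff_const)
    exact ((ContinuousLinearMap.proj k : C3 →L[ℂ] ℂ).contDiff).sub contDiff_const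
  have hj' : ∀ c, HasFDerivAt j ((ContinuousLinearMap.proj k : C3 →L[ℂ] ℂ).prod π) c := fun c =>
    (((ContinuousLinearMap.proj k : C3 →L[ℂ] ℂ).hasFDerivAt).sub_const _).prodMk
      (π.hasFDerivAt.add_const _)
  have hjk : ∀ c : C3, c k = x₀ k → j c = (0, c) := by
    intro c hc
    refine Prod.ext (by simp [j, hc]) ?_
    ext i
    by_cases h : i = k
    · subst h; simp [j, hπ, hc]
    · simp [j, hπ, h]
  let Ψ₀ : C3 → C3 := fun c => Φ (j c)
  let V : Set C3 := j ⁻¹' W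
  have hV : IsOpen V := hW.preimage hj.continuous
  have hx₀V : x₀ ∈ V := by
    change j x₀ ∈ W
    rw [hjk x₀ rfl]; exact h0W
  have hΨ₀ : ContDiffOn ℂ ∞ Ψ₀ V := hΦ.comp hj.contDiffOn fun c hc => hc
  have hdΦ : ∀ p ∈ W, HasFDerivAt Φ (fderiv ℂ Φ p) p := fun p hp =>
    ((hΦ.contDiffAt (hW.mem_nhds hp)).differentiableAt (by simp)).hasFDerivAt
  have hΦt : ∀ p ∈ W, fderiv ℂ Φ p (1, 0) = Z (Φ p) := by
    intro p hp
    have h2 : HasDerivAt (fun t : ℂ => (t, p.2)) ((1 : ℂ), (0 : C3)) p.1 :=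
      (hasDerivAt_id p.1).prodMk (hasDerivAt_const _ _)
    exact ((hdΦ p hp).comp_hasDerivAt p.1 h2).unique (hΦW p hp).2
  have hd : ∀ c ∈ V, HasFDerivAt Ψ₀
      (fderiv ℂ Φ (j c) ∘L (ContinuousLinearMap.proj k : C3 →L[ℂ] ℂ).prod π) c :=
    fun c hc => (hdΦ (j c) hc).comp c (hj' c)
  have hπk : π (Pi.single k 1) = 0 := by
    ext i
    by_cases h : i = k
    · subst h; simp [hπ]
    · simp [hπ, h]
  have hk' : ∀ c ∈ V, fderiv ℂ Ψ₀ c (Pi.single k 1) = Z (Ψ₀ c) := by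
    intro c hc
    rw [(hd c hc).fderiv]
    simp only [ContinuousLinearMap.comp_apply, ContinuousLinearMap.prod_apply, hπk]
    simpa using hΦt (j c) hc
  have hsl : ∀ c ∈ V, c k = x₀ k → Ψ₀ c = c := by
    intro c hc hck
    have hc' : j c ∈ W := hc
    rw [hjk c hck] at hc'
    simp only [Ψ₀]
    rw [hjk c hck, hΦ0 c hc']
  have hπd : ∀ a, fderiv ℂ Ψ₀ x₀ (π a) = π a := by
    intro a
    have hline : HasDerivAt (fun t : ℂ => x₀ + t • π a) (π a) 0 := by
      simpa using ((hasDerivAt_id (0 : ℂ)).smul_const (π a)).const_add x₀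
    have h1 : HasDerivAt (fun t : ℂ => Ψ₀ (x₀ + t • π a)) (fderiv ℂ Ψ₀ x₀ (π a)) 0 := by
      have : HasFDerivAt Ψ₀ (fderiv ℂ Ψ₀ x₀) (x₀ + (0 : ℂ) • π a) := by
        simpa using (hd x₀ hx₀V).differentiableAt.hasFDerivAt
      exact this.comp_hasDerivAt 0 hline
    refine h1.unique (hline.congr_of_eventuallyEq ?_)
    have hc : ContinuousAt (fun t : ℂ => x₀ + t • π a) 0 := hline.continuousAt
    filter_upwards [hc.preimage_mem_nhds (hV.mem_nhds (by simpa using hx₀V))] with t ht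
    exact hsl _ ht (by simp [hπ])
  -- The differential at `x₀` is the identity along the slice and takes the `k`-th coordinate vector
  -- to `Z x₀`, which is transversal to the slice.
  have hinj : Function.Injective (fderiv ℂ Ψ₀ x₀) := by
    rw [injective_iff_map_eq_zero]
    intro a ha
    have hdec : a = a k • Pi.single k 1 + π a := by simp [π]
    have hx : Ψ₀ x₀ = x₀ := hsl x₀ hx₀V rfl
    rw [hdec, map_add, map_smul, hk' x₀ hx₀V, hπd, hx] at ha
    have h1 := congrFun ha k
    simp [hπ, hk] at h1
    rw [h1, zero_smul, zero_add] at ha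
    rw [hdec, h1, ha]; simp
  obtain ⟨S, hS⟩ := exists_equiv_of_injective hinj
  obtain ⟨φ, hφ, hxφ, hφV, hφs, hφT⟩ :=
    exists_openPartialHomeomorph_of_contDiffOn hV hΨ₀ hx₀V hS.symm
  have hO : IsOpen (φ.source ∩ Ψ₀ ⁻¹' U) :=
    (hΨ₀.mono hφV).continuousOn.isOpen_inter_preimage φ.open_source hU
  obtain ⟨ε, hε, hball⟩ := Metric.isOpen_iff.1 hO x₀
    ⟨hxφ, by change Ψ₀ x₀ ∈ U; rw [hsl x₀ hx₀V rfl]; exact hx₀⟩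
  -- The norm is the sup norm, so the source is a polydisc and its coordinate lines are discs. This
  -- is needed to integrate along them.
  have hsrc : (φ.restrOpen (Metric.ball x₀ ε) Metric.isOpen_ball).source = Metric.ball x₀ ε := by
    rw [φ.restrOpen_source]
    exact inter_eq_right.2 fun c hc => (hball hc).1
  have hcoe : ((φ.restrOpen (Metric.ball x₀ ε) Metric.isOpen_ball : OpenPartialHomeomorph C3 C3) :
      C3 → C3) = Ψ₀ := hφ
  have hBV : ∀ c ∈ Metric.ball x₀ ε, c ∈ V := fun c hc => hφV (hball hc).1
  refine ⟨φ.restrOpen (Metric.ball x₀ ε) Metric.isOpen_ball, ε, hε, hsrc, ?_, ?_, ?_, ?_, ?_⟩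
  · intro y hy
    have h1 := (φ.restrOpen (Metric.ball x₀ ε) Metric.isOpen_ball).map_target hy
    rw [hsrc] at h1
    have h2 := (hball h1).2
    rw [mem_preimage, ← hcoe, OpenPartialHomeomorph.right_inv _ hy] at h2
    exact h2
  · rw [hsrc, hcoe]
    exact hΨ₀.mono hBV
  · exact hφs.mono fun y hy => hy.1
  · rw [hsrc, hcoe]
    exact fun c hc => hsl c (hBV c hc)
  · rw [hsrc, hcoe]
    intro c hc
    obtain ⟨T, hT⟩ := hφT c (hball hc).1
    refine ⟨T, hT, ?_⟩
    rw [← hk' c (hBV c hc), hT.fderiv]; rfl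

/-- A nonvanishing holomorphic vector field on `ℂ³` has locally two independent holomorphic first
integrals. -/
theorem exists_first_integrals {Z : C3 → C3} {U : Set C3} (hU : IsOpen U)
    (hZ : ContDiffOn ℂ ∞ Z U) {x₀ : C3} (hx₀ : x₀ ∈ U) (h0 : Z x₀ ≠ 0) :
    ∃ (V : Set C3) (h : C3 → Fin 2 → ℂ), IsOpen V ∧ x₀ ∈ V ∧ V ⊆ U ∧ ContDiffOn ℂ ∞ h V ∧
      ∀ y ∈ V, ∀ a, fderiv ℂ h y a = 0 ↔ ∃ r : ℂ, a = r • Z y := by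
  obtain ⟨k, hk⟩ := Function.ne_iff.1 h0
  obtain ⟨Ψ, ε, hε, hsrc, htgt, hΨ, hΨs, hsl, hT⟩ := exists_flow_box hU hZ hx₀ hk
  have hx : x₀ ∈ Ψ.source := by rw [hsrc]; exact Metric.mem_ball_self hε
  -- The first integrals are the two flow-box coordinates other than the time.
  let p : C3 →L[ℂ] (Fin 2 → ℂ) := ContinuousLinearMap.pi fun i =>
    ContinuousLinearMap.proj (k.succAbove i)
  have hp : ∀ a, p a = 0 ↔ ∃ r : ℂ, a = r • Pi.single k 1 := by
    intro a
    constructor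
    · intro ha
      refine ⟨a k, ?_⟩
      ext i
      rcases Fin.eq_self_or_eq_succAbove k i with rfl | ⟨m, rfl⟩
      · simp
      · have := congrFun ha m
        simp only [p, ContinuousLinearMap.coe_pi', ContinuousLinearMap.proj_apply,
          Pi.zero_apply] at this
        simp [this]
    · rintro ⟨r, rfl⟩
      ext i
      simp [p]
  refine ⟨Ψ.target, fun y => p (Ψ.symm y), Ψ.open_target, ?_, htgt,
    p.contDiff.comp_contDiffOn hΨs, ?_⟩
  · rw [← hsl x₀ hx rfl]
    exact Ψ.map_source hx
  · intro y hy a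
    obtain ⟨T, hT1, hT2⟩ := hT _ (Ψ.map_target hy)
    rw [Ψ.right_inv hy] at hT2
    have h1 : HasFDerivAt (fun y => p (Ψ.symm y)) (p ∘L (T.symm : C3 →L[ℂ] C3)) y :=
      p.hasFDerivAt.comp y (Ψ.hasFDerivAt_symm hy hT1)
    rw [h1.fderiv]
    simp only [ContinuousLinearMap.comp_apply, hp]
    refine exists_congr fun r => ?_
    rw [← hT2, ← map_smul]
    exact T.symm_apply_eq

/-! ### Push-forward of vector fields -/

section PushForward

variable {𝕜 : Type*} [RCLike 𝕜] [NormedSpace 𝕜 C3] {M : Type*} [TopologicalSpace M] [ChartedSpace C3 M]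
  {M' : Type*} [TopologicalSpace M'] [ChartedSpace C3 M']

variable (𝕜) in
/-- `f` is a smooth diffeomorphism from `f.source` to `f.target`. -/
structure IsDiffeoOn (f : OpenPartialHomeomorph M M') : Prop where
  smooth : ContMDiffOn 𝓘(𝕜, C3) 𝓘(𝕜, C3) ∞ f f.source
  smooth_symm : ContMDiffOn 𝓘(𝕜, C3) 𝓘(𝕜, C3) ∞ f.symm f.target

theorem IsDiffeoOn.symm {f : OpenPartialHomeomorph M M'} (hf : IsDiffeoOn 𝕜 f) :
    IsDiffeoOn 𝕜 f.symm := ⟨hf.smooth_symm, hf.smooth⟩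

theorem IsDiffeoOn.trans {M'' : Type*} [TopologicalSpace M''] [ChartedSpace C3 M'']
    {f : OpenPartialHomeomorph M M'} {g : OpenPartialHomeomorph M' M''}
    (hf : IsDiffeoOn 𝕜 f) (hg : IsDiffeoOn 𝕜 g) : IsDiffeoOn 𝕜 (f.trans g) := by
  constructor
  · rw [f.coe_trans, f.trans_source]
    exact hg.smooth.comp (hf.smooth.mono inter_subset_left) fun x hx => hx.2
  · rw [f.coe_trans_symm, f.trans_target]
    exact hf.smooth_symm.comp (hg.smooth_symm.mono inter_subset_left) fun x hx => hx.2

theorem IsDiffeoOn.mdifferentiable {f : OpenPartialHomeomorph M M'} (hf : IsDiffeoOn 𝕜 f) :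
    f.MDifferentiable 𝓘(𝕜, C3) 𝓘(𝕜, C3) :=
  ⟨hf.smooth.mdifferentiableOn (by simp), hf.smooth_symm.mdifferentiableOn (by simp)⟩

theorem isDiffeoOn_of_mem_maximalAtlas {e : OpenPartialHomeomorph M C3}
    (he : e ∈ IsManifold.maximalAtlas 𝓘(𝕜, C3) ∞ M) : IsDiffeoOn 𝕜 e :=
  ⟨contMDiffOn_of_mem_maximalAtlas he, contMDiffOn_symm_of_mem_maximalAtlas he⟩

variable (𝕜) in
/-- The differential of `f` at `x`, as a map between the model vector spaces. -/
def tmap (f : M → M') (x : M) : C3 →L[𝕜] C3 :=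
  (mfderiv 𝓘(𝕜, C3) 𝓘(𝕜, C3) f x : TangentSpace 𝓘(𝕜, C3) x →L[𝕜] TangentSpace 𝓘(𝕜, C3) (f x))

theorem IsDiffeoOn.tmap_symm_tmap {f : OpenPartialHomeomorph M M'} (hf : IsDiffeoOn 𝕜 f) {x : M}
    (hx : x ∈ f.source) (a : C3) : tmap 𝕜 f.symm (f x) (tmap 𝕜 f x a) = a :=
  DFunLike.congr_fun (hf.mdifferentiable.symm_comp_deriv hx) a

theorem IsDiffeoOn.tmap_tmap_symm {f : OpenPartialHomeomorph M M'} (hf : IsDiffeoOn 𝕜 f) {y : M'}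
    (hy : y ∈ f.target) (a : C3) : tmap 𝕜 f (f.symm y) (tmap 𝕜 f.symm y a) = a :=
  DFunLike.congr_fun (hf.mdifferentiable.comp_symm_deriv hy) a

theorem IsDiffeoOn.tmap_tmap_symm' {f : OpenPartialHomeomorph M M'} (hf : IsDiffeoOn 𝕜 f) {x : M}
    (hx : x ∈ f.source) (a : C3) : tmap 𝕜 f x (tmap 𝕜 f.symm (f x) a) = a := by
  have := hf.tmap_tmap_symm (f.map_source hx) a
  rwa [f.left_inv hx] at this

theorem IsDiffeoOn.injective {f : OpenPartialHomeomorph M M'} (hf : IsDiffeoOn 𝕜 f) {x : M}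
    (hx : x ∈ f.source) : Function.Injective (tmap 𝕜 f x) :=
  Function.LeftInverse.injective (hf.tmap_symm_tmap hx)

theorem IsDiffeoOn.tmap_comp {M'' : Type*} [TopologicalSpace M''] [ChartedSpace C3 M'']
    {f : OpenPartialHomeomorph M M'} {g : OpenPartialHomeomorph M' M''}
    (hf : IsDiffeoOn 𝕜 f) (hg : IsDiffeoOn 𝕜 g) {x : M} (hx : x ∈ f.source)
    (hfx : f x ∈ g.source) (a : C3) :
    tmap 𝕜 (f.trans g) x a = tmap 𝕜 g (f x) (tmap 𝕜 f x a) :=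
  DFunLike.congr_fun (mfderiv_comp (I' := 𝓘(𝕜, C3)) x (hg.mdifferentiable.mdifferentiableAt hfx)
    (hf.mdifferentiable.mdifferentiableAt hx)) a

variable (𝕜) in
/-- The push-forward of a vector field by `f`. -/
def push (f : OpenPartialHomeomorph M M') (X : M → C3) (y : M') : C3 :=
  tmap 𝕜 f (f.symm y) (X (f.symm y))

theorem push_apply (f : OpenPartialHomeomorph M M') (X : M → C3) {x : M} (hx : x ∈ f.source) :
    push 𝕜 f X (f x) = tmap 𝕜 f x (X x) := by
  rw [push, f.left_inv hx]

theorem IsDiffeoOn.push_symm_push {f : OpenPartialHomeomorph M M'} (hf : IsDiffeoOn 𝕜 f)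
    (X : M → C3) {x : M} (hx : x ∈ f.source) : push 𝕜 f.symm (push 𝕜 f X) x = X x := by
  have h1 : push 𝕜 f.symm (push 𝕜 f X) x = tmap 𝕜 f.symm (f x) (push 𝕜 f X (f x)) := rfl
  rw [h1, push_apply f X hx, hf.tmap_symm_tmap hx]

variable (𝕜) in
/-- The bracket of vector fields given by their values in the model space. -/
def bra (X Y : M → C3) (x : M) : C3 :=
  (VectorField.mlieBracket 𝓘(𝕜, C3) (M := M) X Y x : TangentSpace 𝓘(𝕜, C3) x)

theorem IsDiffeoOn.isInvertible {f : OpenPartialHomeomorph M M'} (hf : IsDiffeoOn 𝕜 f) {x : M}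
    (hx : x ∈ f.source) : (mfderiv 𝓘(𝕜, C3) 𝓘(𝕜, C3) f x).IsInvertible :=
  ⟨hf.mdifferentiable.mfderiv hx, rfl⟩

theorem IsDiffeoOn.mpullback_symm {f : OpenPartialHomeomorph M M'} (hf : IsDiffeoOn 𝕜 f)
    (X : M → C3) {y : M'} (hy : y ∈ f.target) :
    (VectorField.mpullback 𝓘(𝕜, C3) 𝓘(𝕜, C3) f.symm X y : C3) = push 𝕜 f X y := by
  have hinv := hf.symm.isInvertible hy
  apply hf.symm.injective hy
  have h2 : tmap 𝕜 f.symm y (push 𝕜 f X y) = X (f.symm y) := by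
    have := hf.tmap_symm_tmap (f.map_target hy) (X (f.symm y))
    rwa [f.right_inv hy] at this
  rw [h2]
  exact hinv.self_apply_inverse _

variable [IsManifold 𝓘(𝕜, C3) ∞ M] [IsManifold 𝓘(𝕜, C3) ∞ M']

variable (𝕜) in
/-- A vector field, given by its values in the model space, is smooth on `V`. -/
def SmoothFld (X : M → C3) (V : Set M) : Prop :=
  ContMDiffOn 𝓘(𝕜, C3) 𝓘(𝕜, C3).tangent ∞
    (fun x => (⟨x, X x⟩ : TangentBundle 𝓘(𝕜, C3) M)) V

theorem IsDiffeoOn.push_smooth {f : OpenPartialHomeomorph M M'} (hf : IsDiffeoOn 𝕜 f) {X : M → C3}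
    {V : Set M} (hV : IsOpen V) (hX : SmoothFld 𝕜 X V) :
    SmoothFld 𝕜 (push 𝕜 f X) (f.target ∩ f.symm ⁻¹' V) := by
  have h1 : IsManifold 𝓘(𝕜, C3) 1 M := .of_le (n := ∞) (by simp)
  have h2 : IsManifold 𝓘(𝕜, C3) 1 M' := .of_le (n := ∞) (by simp)
  intro y hy
  refine ContMDiffAt.contMDiffWithinAt ?_
  have hX' := hX.contMDiffAt (hV.mem_nhds hy.2)
  have := ContMDiffAt.mpullback_vectorField_preimage (m := ∞) (n := ∞) (f := f.symm) (x₀ := y)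
    hX' (hf.smooth_symm.contMDiffAt (f.open_target.mem_nhds hy.1)) (hf.symm.isInvertible hy.1)
    (by simp)
  refine this.congr_of_eventuallyEq ?_
  filter_upwards [f.open_target.mem_nhds hy.1] with z hz
  exact congrArg (fun v : C3 => (⟨z, v⟩ : TangentBundle 𝓘(𝕜, C3) M')) (hf.mpullback_symm X hz).symm

/-- Naturality of the bracket: push-forward by `f` agrees near `f x` with pullback by `f.symm`, and
pullback commutes with brackets. -/
theorem IsDiffeoOn.tmap_bra {f : OpenPartialHomeomorph M M'} (hf : IsDiffeoOn 𝕜 f) {X Y : M → C3}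
    {V : Set M} (hV : IsOpen V) (hX : SmoothFld 𝕜 X V) (hY : SmoothFld 𝕜 Y V) {x : M}
    (hx : x ∈ f.source) (hxV : x ∈ V) :
    tmap 𝕜 f x (bra 𝕜 X Y x) = bra 𝕜 (push 𝕜 f X) (push 𝕜 f Y) (f x) := by
  have h1 : IsManifold 𝓘(𝕜, C3) (minSmoothness 𝕜 2) M := by
    rw [minSmoothness_of_isRCLikeNormedField]
    exact .of_le (n := ∞) ENat.LEInfty.out
  have h2 : IsManifold 𝓘(𝕜, C3) (minSmoothness 𝕜 2) M' := by
    rw [minSmoothness_of_isRCLikeNormedField]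
    exact .of_le (n := ∞) ENat.LEInfty.out
  have hfx := f.map_source hx
  have hmd : ∀ {X : M → C3}, SmoothFld 𝕜 X V → MDifferentiableAt 𝓘(𝕜, C3) 𝓘(𝕜, C3).tangent
      (fun x => (⟨x, X x⟩ : TangentBundle 𝓘(𝕜, C3) M)) (f.symm (f x)) := by
    intro X hX
    rw [f.left_inv hx]
    exact (hX.contMDiffAt (hV.mem_nhds hxV)).mdifferentiableAt (by simp)
  have := VectorField.mpullback_mlieBracket (hmd hX) (hmd hY) (n := ∞)
    (hf.smooth_symm.contMDiffAt (f.open_target.mem_nhds hfx))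
    (by rw [minSmoothness_of_isRCLikeNormedField]; exact ENat.LEInfty.out)
  have h3 := hf.mpullback_symm (fun z => bra 𝕜 X Y z) hfx
  rw [push_apply f _ hx] at h3
  rw [← h3]
  refine Eq.trans this ?_
  have hev : ∀ X : M → C3, VectorField.mpullback 𝓘(𝕜, C3) 𝓘(𝕜, C3) f.symm X =ᶠ[𝓝 (f x)]
      push 𝕜 f X := fun X => by
    filter_upwards [f.open_target.mem_nhds hfx] with z hz using hf.mpullback_symm X hz
  exact (hev X).mlieBracket_vectorField_eq (hev Y)

omit [IsManifold 𝓘(𝕜, C3) ∞ M] in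
theorem bra_congr {X Y X' Y' : M → C3} {x : M} (hX : X =ᶠ[𝓝 x] X') (hY : Y =ᶠ[𝓝 x] Y') :
    bra 𝕜 X Y x = bra 𝕜 X' Y' x :=
  Filter.EventuallyEq.mlieBracket_vectorField_eq hX hY

theorem bra_eq_lieBracket (X Y : C3 → C3) (z : C3) :
    bra 𝕜 X Y z = VectorField.lieBracket 𝕜 X Y z := by
  have := VectorField.mlieBracketWithin_eq_lieBracketWithin (𝕜 := 𝕜) (V := X) (W := Y) (s := univ)
  have h2 := congrFun this z
  rw [VectorField.lieBracketWithin_univ] at h2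
  exact h2

theorem smoothFld_iff_contDiffOn {X : C3 → C3} {V : Set C3} :
    SmoothFld 𝕜 X V ↔ ContDiffOn 𝕜 ∞ X V :=
  contMDiffOn_vectorSpace_iff_contDiffOn

theorem tmap_eq_fderiv (f : C3 → C3) (z : C3) : tmap 𝕜 f z = fderiv 𝕜 f z := by
  rw [tmap, mfderiv_eq_fderiv]

end PushForward

/-! ### Real and complex smoothness -/

section RealComplex

variable {M : Type*} [TopologicalSpace M] [ChartedSpace C3 M]
  {M' : Type*} [TopologicalSpace M'] [ChartedSpace C3 M']

theorem contMDiffOn_real_of_complex {f : M → M'} {s : Set M}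
    (hf : ContMDiffOn 𝓘(ℂ, C3) 𝓘(ℂ, C3) ∞ f s) : ContMDiffOn 𝓘(ℝ, C3) 𝓘(ℝ, C3) ∞ f s := by
  intro x hx
  obtain ⟨h1, h2⟩ := contMDiffWithinAt_iff.1 (hf x hx)
  exact contMDiffWithinAt_iff.2 ⟨h1, h2.restrict_scalars ℝ⟩

theorem IsDiffeoOn.restrictScalars {f : OpenPartialHomeomorph M M'} (hf : IsDiffeoOn ℂ f) :
    IsDiffeoOn ℝ f :=
  ⟨contMDiffOn_real_of_complex hf.smooth, contMDiffOn_real_of_complex hf.smooth_symm⟩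

/-- Both structures use the same charts, so the complex derivative in charts, with scalars
restricted, is the real one. -/
theorem tmap_real_eq_complex {f : M → M'} {x : M}
    (hf : MDifferentiableAt 𝓘(ℂ, C3) 𝓘(ℂ, C3) f x) (a : C3) : tmap ℝ f x a = tmap ℂ f x a := by
  obtain ⟨h1, h2⟩ := hf.hasMFDerivAt
  have h3 : HasFDerivWithinAt (writtenInExtChartAt 𝓘(ℂ, C3) 𝓘(ℂ, C3) x f)
    (tmap ℂ f x) (range 𝓘(ℂ, C3)) (extChartAt 𝓘(ℂ, C3) x x) := h2
  have h4 : HasMFDerivAt 𝓘(ℝ, C3) 𝓘(ℝ, C3) f x ((tmap ℂ f x).restrictScalars ℝ) :=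
    ⟨h1, h3.restrictScalars ℝ⟩
  exact DFunLike.congr_fun h4.mfderiv a

theorem IsDiffeoOn.tmap_real {f : OpenPartialHomeomorph M M'} (hf : IsDiffeoOn ℂ f) {x : M}
    (hx : x ∈ f.source) (a : C3) : tmap ℝ f x a = tmap ℂ f x a :=
  tmap_real_eq_complex (hf.mdifferentiable.mdifferentiableAt hx) a

theorem IsDiffeoOn.tmap_real_smul {f : OpenPartialHomeomorph M M'} (hf : IsDiffeoOn ℂ f) {x : M}
    (hx : x ∈ f.source) (c : ℂ) (a : C3) : tmap ℝ f x (c • a) = c • tmap ℝ f x a := by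
  rw [hf.tmap_real hx, hf.tmap_real hx, map_smul]

theorem isDiffeoOn_chart [IsManifold 𝓘(ℂ, C3) ∞ M] (x : M) :
    IsDiffeoOn ℂ (chartAt C3 x : OpenPartialHomeomorph M C3) :=
  isDiffeoOn_of_mem_maximalAtlas (IsManifold.chart_mem_maximalAtlas x)

theorem contDiffOn_of_isDiffeoOn {𝕜 : Type*} [RCLike 𝕜] [NormedSpace 𝕜 C3]
    {f : OpenPartialHomeomorph C3 C3} (hf : IsDiffeoOn 𝕜 f) : ContDiffOn 𝕜 ∞ f f.source :=
  contMDiffOn_iff_contDiffOn.1 hf.smooth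

/-- In holomorphic charts the differential still commutes with `i`, so the statement reduces to
`contDiffOn_complex_of_real` for the coordinate expression `g`. -/
theorem contMDiffOn_complex_of_real [IsManifold 𝓘(ℂ, C3) ∞ M] [IsManifold 𝓘(ℂ, C3) ∞ M']
    {f : OpenPartialHomeomorph M M'} (hf : IsDiffeoOn ℝ f)
    (hc : ∀ x ∈ f.source, ∀ a, tmap ℝ f x (Complex.I • a) = Complex.I • tmap ℝ f x a) :
    ContMDiffOn 𝓘(ℂ, C3) 𝓘(ℂ, C3) ∞ f f.source := by
  intro x hx
  let e : OpenPartialHomeomorph M C3 := chartAt C3 x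
  let e' : OpenPartialHomeomorph M' C3 := chartAt C3 (f x)
  have he : IsDiffeoOn ℂ e := isDiffeoOn_chart x
  have he' : IsDiffeoOn ℂ e' := isDiffeoOn_chart (f x)
  let g : OpenPartialHomeomorph C3 C3 := e.symm.trans (f.trans e')
  have hfe' := hf.trans he'.restrictScalars
  have hg : IsDiffeoOn ℝ g := he.restrictScalars.symm.trans hfe'
  have hgc : ContDiffOn ℂ ∞ g g.source := by
    refine contDiffOn_complex_of_real g.open_source (contDiffOn_of_isDiffeoOn hg) ?_
    intro z hz a
    have hz1 : z ∈ e.symm.source := by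
      have := hz; simp only [g, e.symm.trans_source] at this; exact this.1
    have hz2 : e.symm z ∈ (f.trans e').source := by
      have := hz; simp only [g, e.symm.trans_source] at this; exact this.2
    have hz3 : e.symm z ∈ f.source ∧ f (e.symm z) ∈ e'.source := by
      simpa using hz2
    rw [← tmap_eq_fderiv]
    simp only [g]
    rw [he.restrictScalars.symm.tmap_comp hfe' hz1 hz2,
      he.restrictScalars.symm.tmap_comp hfe' hz1 hz2,
      hf.tmap_comp he'.restrictScalars hz3.1 hz3.2, hf.tmap_comp he'.restrictScalars hz3.1 hz3.2,
      he.symm.tmap_real_smul hz1, hc _ hz3.1, he'.tmap_real_smul hz3.2]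
  have hxe : x ∈ e.source := mem_chart_source C3 x
  have hxe' : f x ∈ e'.source := mem_chart_source C3 (f x)
  have hxg : e x ∈ g.source := by
    simp only [g, e.symm.trans_source, f.trans_source]
    refine ⟨e.map_source hxe, ?_⟩
    simp [e.left_inv hxe, hx, hxe']
  refine ContMDiffAt.contMDiffWithinAt ?_
  have h1 : ContMDiffAt 𝓘(ℂ, C3) 𝓘(ℂ, C3) ∞ e x :=
    he.smooth.contMDiffAt (e.open_source.mem_nhds hxe)
  have h2 : ContMDiffAt 𝓘(ℂ, C3) 𝓘(ℂ, C3) ∞ g (e x) :=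
    (hgc.contDiffAt (g.open_source.mem_nhds hxg)).contMDiffAt
  have hgx : g (e x) ∈ e'.target := by
    simp only [g, OpenPartialHomeomorph.coe_trans, Function.comp_apply, e.left_inv hxe]
    exact e'.map_source hxe'
  have h3 : ContMDiffAt 𝓘(ℂ, C3) 𝓘(ℂ, C3) ∞ e'.symm (g (e x)) :=
    he'.smooth_symm.contMDiffAt (e'.open_target.mem_nhds hgx)
  refine ((h3.comp (e x) h2).comp x h1).congr_of_eventuallyEq ?_
  have hO : IsOpen (f.source ∩ f ⁻¹' e'.source) := f.isOpen_inter_preimage e'.open_source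
  filter_upwards [e.open_source.mem_nhds hxe, hO.mem_nhds ⟨hx, hxe'⟩] with y hy hy'
  simp only [g, Function.comp_apply, OpenPartialHomeomorph.coe_trans, e.left_inv hy,
    e'.left_inv hy'.2]

/-- A real diffeomorphism with complex linear differentials is biholomorphic. -/
theorem IsDiffeoOn.complex_of_real [IsManifold 𝓘(ℂ, C3) ∞ M] [IsManifold 𝓘(ℂ, C3) ∞ M']
    {f : OpenPartialHomeomorph M M'} (hf : IsDiffeoOn ℝ f)
    (hc : ∀ x ∈ f.source, ∀ a, tmap ℝ f x (Complex.I • a) = Complex.I • tmap ℝ f x a) :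
    IsDiffeoOn ℂ f := by
  refine ⟨contMDiffOn_complex_of_real hf hc, contMDiffOn_complex_of_real hf.symm ?_⟩
  intro y hy a
  have hx := f.map_target hy
  apply hf.injective hx
  rw [hc _ hx, hf.tmap_tmap_symm hy, hf.tmap_tmap_symm hy]

end RealComplex

theorem lieBracket_real_eq_complex {X Y : C3 → C3} {z : C3} (hX : DifferentiableAt ℂ X z)
    (hY : DifferentiableAt ℂ Y z) :
    VectorField.lieBracket ℝ X Y z = VectorField.lieBracket ℂ X Y z := by
  simp only [VectorField.lieBracket, hX.fderiv_restrictScalars ℝ, hY.fderiv_restrictScalars ℝ]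
  rfl

theorem dbar_eq_zero_of_differentiableAt {X : C3 → C3} {z : C3} (hX : DifferentiableAt ℂ X z)
    (a : C3) : dbar X z a = 0 := by
  rw [dbar_eq_zero_iff, hX.fderiv_restrictScalars ℝ]
  exact map_smul (fderiv ℂ X z) _ _

/-! ### Frames of complex 3-folds with two direction fields -/

theorem IsDiffeoOn.mem_span_singleton_iff {M M' : Type*} [TopologicalSpace M] [ChartedSpace C3 M]
    [TopologicalSpace M'] [ChartedSpace C3 M'] {f : OpenPartialHomeomorph M M'}
    (hf : IsDiffeoOn ℂ f) {y : M} (hy : y ∈ f.source) (a w : C3) :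
    a ∈ Submodule.span ℂ {w} ↔ ∃ c : ℂ, tmap ℂ f y a = c • tmap ℂ f y w := by
  rw [Submodule.mem_span_singleton]
  refine exists_congr fun c => ?_
  rw [← map_smul, (hf.injective hy).eq_iff, eq_comm]

namespace Threefold

/-- In the coordinates `e`, over the open set `U`, the direction fields `L₁` and `L₂` are generated
by the holomorphic vector fields `Z₁` and `Z₂`, which with their bracket form a frame. -/
structure IsFrame (P : Threefold.{u}) (e : OpenPartialHomeomorph P.carrier C3) (U : Set C3)
    (Z₁ Z₂ : C3 → C3) : Prop where
  diffeo : IsDiffeoOn ℂ e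
  isOpen : IsOpen U
  subset : U ⊆ e.target
  hol₁ : ContDiffOn ℂ ∞ Z₁ U
  hol₂ : ContDiffOn ℂ ∞ Z₂ U
  mem₁ : ∀ y ∈ e.source, e y ∈ U → ∀ a : TangentSpace 𝓘(ℂ, C3) y,
    a ∈ P.L₁ y ↔ ∃ c : ℂ, tmap ℂ e y a = c • Z₁ (e y)
  mem₂ : ∀ y ∈ e.source, e y ∈ U → ∀ a : TangentSpace 𝓘(ℂ, C3) y,
    a ∈ P.L₂ y ↔ ∃ c : ℂ, tmap ℂ e y a = c • Z₂ (e y)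
  indep : ∀ z ∈ U, det3 (Z₁ z) (Z₂ z) (VectorField.lieBracket ℂ Z₁ Z₂ z) ≠ 0

variable {P : Threefold.{u}}

namespace IsFrame

variable {e : OpenPartialHomeomorph P.carrier C3} {U : Set C3} {Z₁ Z₂ : C3 → C3}

theorem differentiableAt₁ (h : P.IsFrame e U Z₁ Z₂) {z : C3} (hz : z ∈ U) :
    DifferentiableAt ℂ Z₁ z :=
  (h.hol₁.contDiffAt (h.isOpen.mem_nhds hz)).differentiableAt (by simp)

theorem differentiableAt₂ (h : P.IsFrame e U Z₁ Z₂) {z : C3} (hz : z ∈ U) :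
    DifferentiableAt ℂ Z₂ z :=
  (h.hol₂.contDiffAt (h.isOpen.mem_nhds hz)).differentiableAt (by simp)

theorem mem_sup (h : P.IsFrame e U Z₁ Z₂) {y : P.carrier} (hy : y ∈ e.source) (hyU : e y ∈ U)
    (a : TangentSpace 𝓘(ℂ, C3) y) :
    a ∈ P.L₁ y ⊔ P.L₂ y ↔ ∃ r s : ℂ, tmap ℂ e y a = r • Z₁ (e y) + s • Z₂ (e y) := by
  rw [Submodule.mem_sup]
  constructor
  · rintro ⟨b, hb, c, hc, rfl⟩
    obtain ⟨r, hr⟩ := (h.mem₁ y hy hyU b).1 hb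
    obtain ⟨s, hs⟩ := (h.mem₂ y hy hyU c).1 hc
    exact ⟨r, s, by rw [← hr, ← hs]; exact map_add (tmap ℂ e y) b c⟩
  · rintro ⟨r, s, hrs⟩
    refine ⟨tmap ℂ e.symm (e y) (r • Z₁ (e y)), (h.mem₁ y hy hyU _).2 ⟨r, ?_⟩,
      tmap ℂ e.symm (e y) (s • Z₂ (e y)), (h.mem₂ y hy hyU _).2 ⟨s, ?_⟩, ?_⟩
    · exact h.diffeo.tmap_tmap_symm' hy _
    · exact h.diffeo.tmap_tmap_symm' hy _
    · apply h.diffeo.injective hy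
      rw [hrs]
      refine (map_add (tmap ℂ e y) _ _).trans ?_
      rw [h.diffeo.tmap_tmap_symm' hy, h.diffeo.tmap_tmap_symm' hy]

end IsFrame

/-- Push local generators into the chart. Non-involutivity makes the bracket independent of them at
each point, and naturality of the bracket together with injectivity of the differential carries this
over. -/
theorem IsPathGeometry.exists_frame (hP : P.IsPathGeometry) (x : P.carrier) :
    ∃ (U : Set C3) (Z₁ Z₂ : C3 → C3), P.IsFrame (chartAt C3 x) U Z₁ Z₂ ∧ chartAt C3 x x ∈ U := by
  obtain ⟨V₁, W₁, hV₁, hx₁, h₁⟩ := hP.direction₁ x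
  obtain ⟨V₂, W₂, hV₂, hx₂, h₂⟩ := hP.direction₂ x
  let e : OpenPartialHomeomorph P.carrier C3 := chartAt C3 x
  have he : IsDiffeoOn ℂ e := isDiffeoOn_chart x
  have hV : IsOpen (V₁ ∩ V₂) := hV₁.inter hV₂
  have hs₁ : SmoothFld ℂ W₁ (V₁ ∩ V₂) := h₁.holomorphic.mono inter_subset_left
  have hs₂ : SmoothFld ℂ W₂ (V₁ ∩ V₂) := h₂.holomorphic.mono inter_subset_right
  have hxe : x ∈ e.source := mem_chart_source C3 x
  have hxi : e.symm (e x) = x := e.left_inv hxe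
  refine ⟨e.target ∩ e.symm ⁻¹' (V₁ ∩ V₂), push ℂ e W₁, push ℂ e W₂,
    ⟨he, e.isOpen_inter_preimage_symm hV, inter_subset_left,
    smoothFld_iff_contDiffOn.1 (he.push_smooth hV hs₁),
    smoothFld_iff_contDiffOn.1 (he.push_smooth hV hs₂), ?_, ?_, ?_⟩,
    e.map_source hxe, show e.symm (e x) ∈ V₁ ∩ V₂ by rw [hxi]; exact ⟨hx₁, hx₂⟩⟩
  · intro y hy hyU a
    have hyV : y ∈ V₁ ∩ V₂ := by
      have h3 : e.symm (e y) ∈ V₁ ∩ V₂ := hyU.2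
      rwa [e.left_inv hy] at h3
    rw [push_apply e W₁ hy, h₁.span y hyV.1]
    exact he.mem_span_singleton_iff hy a (W₁ y)
  · intro y hy hyU a
    have hyV : y ∈ V₁ ∩ V₂ := by
      have h3 : e.symm (e y) ∈ V₁ ∩ V₂ := hyU.2
      rwa [e.left_inv hy] at h3
    rw [push_apply e W₂ hy, h₂.span y hyV.2]
    exact he.mem_span_singleton_iff hy a (W₂ y)
  · rintro z ⟨hz, hzV⟩
    have hy : e.symm z ∈ e.source := e.map_target hz
    have hni := hP.nonInvolutive (V₁ ∩ V₂) W₁ W₂ hV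
      ⟨hs₁, fun y hy => h₁.ne_zero y hy.1, fun y hy => h₁.span y hy.1⟩
      ⟨hs₂, fun y hy => h₂.ne_zero y hy.2, fun y hy => h₂.span y hy.2⟩ _ hzV
    have hdis := hP.independent (e.symm z)
    rw [h₁.span _ hzV.1, h₂.span _ hzV.2] at hni hdis
    have hdet := det3_ne_zero_of_notMem (h₁.ne_zero _ hzV.1) (h₂.ne_zero _ hzV.2) hdis hni
    have := det3_map_ne_zero hdet (he.injective hy)
    rw [← bra_eq_lieBracket]
    have hb := he.tmap_bra hV hs₁ hs₂ hy hzV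
    rw [e.right_inv hz] at hb
    rw [← hb]
    exact this

/-- A frame gives non-involutivity for one pair of generators only. For others `W₁ = c₁ Z₁`, `W₂ =
c₂ Z₂`, and by `det3_bracket` the component of their bracket transversal to the plane is multiplied
by `c₁ c₂ ≠ 0`. -/
theorem isPathGeometry_of_frames
    (h : ∀ x, ∃ (e : OpenPartialHomeomorph P.carrier C3) (U : Set C3) (Z₁ Z₂ : C3 → C3),
      P.IsFrame e U Z₁ Z₂ ∧ x ∈ e.source ∧ e x ∈ U) : P.IsPathGeometry := by
  refine ⟨fun x => ?_, fun x => ?_, fun x => ?_, ?_⟩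
  · obtain ⟨e, U, Z₁, Z₂, he, hx, hxU⟩ := h x
    refine ⟨e.source ∩ e ⁻¹' U, push ℂ e.symm Z₁, e.isOpen_inter_preimage he.isOpen, ⟨hx, hxU⟩,
      ⟨he.diffeo.symm.push_smooth he.isOpen (smoothFld_iff_contDiffOn.2 he.hol₁), ?_, ?_⟩⟩
    · intro y hy h0
      apply ne_zero_of_det3_left (he.indep _ hy.2)
      have h1 : tmap ℂ e y (push ℂ e.symm Z₁ y) = Z₁ (e y) := he.diffeo.tmap_tmap_symm' hy.1 _
      rw [← h1, show push ℂ e.symm Z₁ y = 0 from h0, map_zero]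
    · intro y hy
      ext a
      rw [he.mem₁ y hy.1 hy.2]
      have h1 : tmap ℂ e y (push ℂ e.symm Z₁ y) = Z₁ (e y) := he.diffeo.tmap_tmap_symm' hy.1 _
      rw [← h1]
      exact (he.diffeo.mem_span_singleton_iff hy.1 a (push ℂ e.symm Z₁ y)).symm
  · obtain ⟨e, U, Z₁, Z₂, he, hx, hxU⟩ := h x
    refine ⟨e.source ∩ e ⁻¹' U, push ℂ e.symm Z₂, e.isOpen_inter_preimage he.isOpen, ⟨hx, hxU⟩,
      ⟨he.diffeo.symm.push_smooth he.isOpen (smoothFld_iff_contDiffOn.2 he.hol₂), ?_, ?_⟩⟩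
    · intro y hy h0
      apply ne_zero_of_det3_mid (he.indep _ hy.2)
      have h1 : tmap ℂ e y (push ℂ e.symm Z₂ y) = Z₂ (e y) := he.diffeo.tmap_tmap_symm' hy.1 _
      rw [← h1, show push ℂ e.symm Z₂ y = 0 from h0, map_zero]
    · intro y hy
      ext a
      rw [he.mem₂ y hy.1 hy.2]
      have h1 : tmap ℂ e y (push ℂ e.symm Z₂ y) = Z₂ (e y) := he.diffeo.tmap_tmap_symm' hy.1 _
      rw [← h1]
      exact (he.diffeo.mem_span_singleton_iff hy.1 a (push ℂ e.symm Z₂ y)).symm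
  · obtain ⟨e, U, Z₁, Z₂, he, hx, hxU⟩ := h x
    rw [Submodule.disjoint_def]
    intro a ha₁ ha₂
    obtain ⟨r, hr⟩ := (he.mem₁ x hx hxU a).1 ha₁
    obtain ⟨s, hs⟩ := (he.mem₂ x hx hxU a).1 ha₂
    have h1 : r • Z₁ (e x) + (0 : ℂ) • Z₂ (e x) = (0 : ℂ) • Z₁ (e x) + s • Z₂ (e x) := by
      rw [zero_smul, zero_smul, add_zero, zero_add, ← hr, ← hs]
    have h2 := (det3_comb_unique (he.indep _ hxU) h1).1
    apply he.diffeo.injective hx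
    rw [hr, h2, zero_smul]
    exact (map_zero _).symm
  · intro V W₁ W₂ hV h₁ h₂ x hxV hmem
    obtain ⟨e, U, Z₁, Z₂, he, hx, hxU⟩ := h x
    have hs₁ : SmoothFld ℂ W₁ V := h₁.holomorphic
    have hs₂ : SmoothFld ℂ W₂ V := h₂.holomorphic
    obtain ⟨r, s, hrs⟩ := (he.mem_sup hx hxU _).1 hmem
    have hb := he.diffeo.tmap_bra hV hs₁ hs₂ hx hxV
    rw [bra_eq_lieBracket] at hb
    have hO : IsOpen (e.target ∩ e.symm ⁻¹' V) := e.isOpen_inter_preimage_symm hV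
    have hxO : e x ∈ e.target ∩ e.symm ⁻¹' V := ⟨e.map_source hx, by simpa [e.left_inv hx]⟩
    have hd₁ : DifferentiableAt ℂ (push ℂ e W₁) (e x) :=
      ((smoothFld_iff_contDiffOn.1 (he.diffeo.push_smooth hV hs₁)).contDiffAt
        (hO.mem_nhds hxO)).differentiableAt (by simp)
    have hd₂ : DifferentiableAt ℂ (push ℂ e W₂) (e x) :=
      ((smoothFld_iff_contDiffOn.1 (he.diffeo.push_smooth hV hs₂)).contDiffAt
        (hO.mem_nhds hxO)).differentiableAt (by simp)
    have hp₁ : ∀ z ∈ U ∩ (e.target ∩ e.symm ⁻¹' V), ∃ c : ℂ, push ℂ e W₁ z = c • Z₁ z := by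
      intro z hz
      have hy := e.map_target hz.2.1
      have hm : W₁ (e.symm z) ∈ P.L₁ (e.symm z) := by
        rw [h₁.span _ hz.2.2]
        exact Submodule.mem_span_singleton_self _
      have := (he.mem₁ _ hy (by rw [e.right_inv hz.2.1]; exact hz.1) _).1 hm
      rwa [e.right_inv hz.2.1] at this
    have hp₂ : ∀ z ∈ U ∩ (e.target ∩ e.symm ⁻¹' V), ∃ c : ℂ, push ℂ e W₂ z = c • Z₂ z := by
      intro z hz
      have hy := e.map_target hz.2.1
      have hm : W₂ (e.symm z) ∈ P.L₂ (e.symm z) := by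
        rw [h₂.span _ hz.2.2]
        exact Submodule.mem_span_singleton_self _
      have := (he.mem₂ _ hy (by rw [e.right_inv hz.2.1]; exact hz.1) _).1 hm
      rwa [e.right_inv hz.2.1] at this
    have hN : U ∩ (e.target ∩ e.symm ⁻¹' V) ∈ 𝓝 (e x) :=
      (he.isOpen.inter hO).mem_nhds ⟨hxU, hxO⟩
    obtain ⟨c₁, hc₁⟩ := hp₁ (e x) ⟨hxU, hxO⟩
    obtain ⟨c₂, hc₂⟩ := hp₂ (e x) ⟨hxU, hxO⟩
    have hz₁ := he.differentiableAt₁ hxU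
    have hz₂ := he.differentiableAt₂ hxU
    -- Real brackets are used, so the coefficients need only be known pointwise; all the fields are
    -- holomorphic, so real and complex brackets agree.
    have hdet := det3_bracket (hz₁.restrictScalars ℝ) (hz₂.restrictScalars ℝ)
      (hd₁.restrictScalars ℝ) (hd₂.restrictScalars ℝ)
      (dbar_eq_zero_of_differentiableAt hz₁ _) (dbar_eq_zero_of_differentiableAt hz₁ _)
      (dbar_eq_zero_of_differentiableAt hz₂ _) (dbar_eq_zero_of_differentiableAt hz₂ _)
      (by
        filter_upwards [hN] with z hz
        obtain ⟨c, hc⟩ := hp₁ z hz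
        rw [hc]; simp [det3]; ring)
      (by
        filter_upwards [hN] with z hz
        obtain ⟨c, hc⟩ := hp₂ z hz
        rw [hc]; simp [det3]; ring)
      (a₁ := c₁) (a₂ := 0) (b₁ := 0) (b₂ := c₂) (by simp [hc₁]) (by simp [hc₂])
    rw [lieBracket_real_eq_complex hd₁ hd₂, lieBracket_real_eq_complex hz₁ hz₂, ← hb] at hdet
    rw [show tmap ℂ e x (bra ℂ W₁ W₂ x) = _ from hrs, det3_comb₃] at hdet
    have hne : ∀ {W : P.carrier → C3} {Z : C3 → C3} {c : ℂ}, W x ≠ 0 →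
        push ℂ e W (e x) = c • Z (e x) → c ≠ 0 := by
      rintro W Z c hW hc rfl
      rw [push_apply e W hx, zero_smul] at hc
      exact hW (he.diffeo.injective hx (hc.trans (map_zero _).symm))
    have hc₁0 : c₁ ≠ 0 := hne (W := W₁) (h₁.ne_zero x hxV) hc₁
    have hc₂0 : c₂ ≠ 0 := hne (W := W₂) (h₂.ne_zero x hxV) hc₂
    have := he.indep _ hxU
    simp [hc₁0, hc₂0, this] at hdet

end Threefold

/-! ### Isomorphisms -/

/-- Both terms of the bracket equal `c` times the derivative of `Z` along itself. For `c = ± i` this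
is `[Z, JZ] = 0`, the identity by which CR-maps recognize the direction fields. -/
theorem lieBracket_const_smul_self {Z : C3 → C3} {z : C3} (hZ : DifferentiableAt ℂ Z z) (c : ℂ) :
    VectorField.lieBracket ℝ Z (fun y => c • Z y) z = 0 := by
  have hI : fderiv ℝ (fun y => c • Z y) z = c • fderiv ℝ Z z :=
    fderiv_fun_const_smul (hZ.restrictScalars ℝ) _
  simp only [VectorField.lieBracket, hI, hZ.fderiv_restrictScalars ℝ]
  simp

/-- The derivatives of holomorphic fields are complex linear, so multiplying both fields by `i`
changes the sign of the bracket. -/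
theorem lieBracket_sub_lieBracket_I {Z W : C3 → C3} {z : C3} (hZ : DifferentiableAt ℂ Z z)
    (hW : DifferentiableAt ℂ W z) :
    VectorField.lieBracket ℝ Z W z -
      VectorField.lieBracket ℝ (fun y => Complex.I • Z y) (fun y => Complex.I • W y) z =
    (2 : ℂ) • VectorField.lieBracket ℂ Z W z := by
  have hIZ : fderiv ℝ (fun y => Complex.I • Z y) z = Complex.I • fderiv ℝ Z z :=
    fderiv_fun_const_smul (hZ.restrictScalars ℝ) _
  have hIW : fderiv ℝ (fun y => Complex.I • W y) z = Complex.I • fderiv ℝ W z :=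
    fderiv_fun_const_smul (hW.restrictScalars ℝ) _
  simp only [VectorField.lieBracket, hIZ, hIW, hZ.fderiv_restrictScalars ℝ,
    hW.fderiv_restrictScalars ℝ]
  simp [smul_smul]
  rw [two_smul]
  abel

/-- A function annihilated by the Cauchy-Riemann operator on a frame is annihilated by it. -/
theorem dbar_eq_zero_of_frame {f : C3 → C3} {X Y : C3 → C3} {z T : C3}
    (hX : dbar f z (X z) = 0) (hY : dbar f z (Y z) = 0) (hT : dbar f z T = 0)
    (hdet : det3 (X z) (Y z) T ≠ 0) (a : C3) : dbar f z a = 0 := by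
  obtain ⟨r, s, t, rfl⟩ := exists_eq_of_det3_ne_zero hdet a
  simp [dbar_add, dbar_smul, hX, hY, hT]

namespace Threefold

variable {P : Threefold.{u}} {P' : Threefold.{v}}

/-- Disjointness makes the decomposition unique, so the chosen summand in `twist` is the given one.
-/
theorem twist_add {A B : Submodule ℂ C3} (hd : Disjoint A B) {a b : C3} (ha : a ∈ A)
    (hb : b ∈ B) : twist A B (a + b) = Complex.I • a - Complex.I • b := by
  have h : ∃ c ∈ A, a + b - c ∈ B := ⟨a, ha, by simpa using hb⟩
  have hc := h.choose_spec
  have h0 : a - h.choose = 0 := by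
    refine Submodule.disjoint_def.1 hd _ (A.sub_mem ha hc.1) ?_
    have := B.sub_mem hc.2 hb
    have e : a + b - h.choose - b = a - h.choose := by abel
    rwa [e] at this
  have h1 : h.choose = a := (sub_eq_zero.1 h0).symm
  simp only [twist, h, dif_pos]
  rw [h1]
  congr 2
  abel

theorem twist_left {A B : Submodule ℂ C3} (hd : Disjoint A B) {a : C3} (ha : a ∈ A) :
    twist A B a = Complex.I • a := by
  simpa using twist_add hd ha B.zero_mem

theorem twist_right {A B : Submodule ℂ C3} (hd : Disjoint A B) {b : C3} (hb : b ∈ B) :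
    twist A B b = -(Complex.I • b) := by
  simpa using twist_add hd A.zero_mem hb

/-- The first direction field, with values in the model space. -/
def l₁ (P : Threefold.{u}) (x : P.carrier) : Submodule ℂ C3 := P.L₁ x

/-- The second direction field, with values in the model space. -/
def l₂ (P : Threefold.{u}) (x : P.carrier) : Submodule ℂ C3 := P.L₂ x

theorem IsPathGeometry.disjoint (hP : P.IsPathGeometry) (x : P.carrier) :
    Disjoint (P.l₁ x) (P.l₂ x) := hP.independent x

/-- If `κ ∘ df` is complex linear on the direction fields, then it is complex linear. -/
theorem IsFrame.tmap_I_smul {e : OpenPartialHomeomorph P.carrier C3} {U : Set C3}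
    {Z₁ Z₂ : C3 → C3} (h : P.IsFrame e U Z₁ Z₂) {f : OpenPartialHomeomorph P.carrier P'.carrier}
    (hf : IsDiffeoOn ℝ f) {κ : C3 →L[ℝ] C3} {σ : ℝ} (hσ : σ * σ = 1)
    (hκ : ∀ v, κ (Complex.I • v) = σ • Complex.I • κ v) (hκi : Function.Injective κ)
    (h₁ : ∀ y ∈ f.source, ∀ a : C3, a ∈ P.l₁ y →
      tmap ℝ f y (Complex.I • a) = σ • Complex.I • tmap ℝ f y a)
    (h₂ : ∀ y ∈ f.source, ∀ a : C3, a ∈ P.l₂ y →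
      tmap ℝ f y (Complex.I • a) = σ • Complex.I • tmap ℝ f y a)
    {x : P.carrier} (hx : x ∈ f.source) (hxe : x ∈ e.source) (hxU : e x ∈ U) (a : C3) :
    tmap ℝ f x (Complex.I • a) = σ • Complex.I • tmap ℝ f x a := by
  let e' : OpenPartialHomeomorph P'.carrier C3 := chartAt C3 (f x)
  have he' : IsDiffeoOn ℂ e' := isDiffeoOn_chart (f x)
  have he := h.diffeo
  have hfe' := hf.trans he'.restrictScalars
  let g : OpenPartialHomeomorph C3 C3 := e.symm.trans (f.trans e')
  have hg : IsDiffeoOn ℝ g := he.restrictScalars.symm.trans hfe'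
  have hgs := contDiffOn_of_isDiffeoOn hg
  have hsrc : ∀ z ∈ g.source, z ∈ e.target ∧ e.symm z ∈ f.source ∧ f (e.symm z) ∈ e'.source := by
    intro z hz
    simpa [g, OpenPartialHomeomorph.trans_source] using hz
  have hxi : e.symm (e x) = x := e.left_inv hxe
  have hxg : e x ∈ g.source := by
    have h1 : f x ∈ e'.source := mem_chart_source C3 (f x)
    have h2 := e.map_source hxe
    simp only [g, OpenPartialHomeomorph.trans_source, OpenPartialHomeomorph.symm_source,
      mem_inter_iff, mem_preimage]
    rw [hxi]
    exact ⟨h2, hx, h1⟩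
  have hdg : ∀ z ∈ g.source, ∀ a, fderiv ℝ g z a =
      tmap ℝ e' (f (e.symm z)) (tmap ℝ f (e.symm z) (tmap ℝ e.symm z a)) := by
    intro z hz a
    obtain ⟨hz1, hz2, hz3⟩ := hsrc z hz
    rw [← tmap_eq_fderiv]
    have hz4 : e.symm z ∈ (f.trans e').source := by
      rw [f.trans_source]; exact ⟨hz2, hz3⟩
    simp only [g]
    rw [he.restrictScalars.symm.tmap_comp hfe' hz1 hz4,
      hf.tmap_comp he'.restrictScalars hz2 hz3]
  -- With `κ` the identity and `σ = 1` this treats holomorphic maps, with `κ` the conjugation and `σ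
  -- = -1` antiholomorphic ones. In both cases the claim is that `dbar F` vanishes.
  let F : C3 → C3 := fun z => κ (g z)
  have hF : ContDiffOn ℝ ∞ F g.source := κ.contDiff.comp_contDiffOn hgs
  have hdF : ∀ z ∈ g.source, ∀ a, fderiv ℝ F z a = κ (fderiv ℝ g z a) := by
    intro z hz a
    have h1 := ((hgs.contDiffAt (g.open_source.mem_nhds hz)).differentiableAt
      (by simp)).hasFDerivAt
    rw [show fderiv ℝ F z = _ from (κ.hasFDerivAt.comp z h1).fderiv]
    rfl
  have hdbar : ∀ z ∈ g.source, ∀ a : C3,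
      tmap ℝ f (e.symm z) (Complex.I • tmap ℝ e.symm z a) =
        σ • Complex.I • tmap ℝ f (e.symm z) (tmap ℝ e.symm z a) ↔ dbar F z a = 0 := by
    intro z hz a
    obtain ⟨hz1, hz2, hz3⟩ := hsrc z hz
    rw [dbar_eq_zero_iff, hdF z hz, hdF z hz, hdg z hz, hdg z hz, he.symm.tmap_real_smul hz1]
    constructor
    · intro hh
      rw [hh, map_smul, map_smul, he'.tmap_real_smul hz3, hκ, smul_smul, hσ, one_smul]
    · intro hh
      apply he'.restrictScalars.injective hz3
      apply hκi
      rw [hh, map_smul, map_smul, he'.tmap_real_smul hz3, hκ, smul_smul, hσ, one_smul]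
  have hN : U ∩ g.source ∈ 𝓝 (e x) := (h.isOpen.inter g.open_source).mem_nhds ⟨hxU, hxg⟩
  have hZ₁ : ∀ z ∈ U ∩ g.source, dbar F z (Z₁ z) = 0 := by
    intro z hz
    obtain ⟨hz1, hz2, hz3⟩ := hsrc z hz.2
    refine (hdbar z hz.2 _).1 (h₁ _ hz2 _ ?_)
    have hr := e.right_inv hz1
    refine (h.mem₁ (e.symm z) (e.map_target hz1) (by rw [hr]; exact hz.1) _).2 ⟨1, ?_⟩
    rw [hr, one_smul, he.symm.tmap_real hz1]
    exact he.tmap_tmap_symm hz1 _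
  have hZ₂ : ∀ z ∈ U ∩ g.source, dbar F z (Z₂ z) = 0 := by
    intro z hz
    obtain ⟨hz1, hz2, hz3⟩ := hsrc z hz.2
    refine (hdbar z hz.2 _).1 (h₂ _ hz2 _ ?_)
    have hr := e.right_inv hz1
    refine (h.mem₂ (e.symm z) (e.map_target hz1) (by rw [hr]; exact hz.1) _).2 ⟨1, ?_⟩
    rw [hr, one_smul, he.symm.tmap_real hz1]
    exact he.tmap_tmap_symm hz1 _
  have hd₁ := h.differentiableAt₁ hxU
  have hd₂ := h.differentiableAt₂ hxU
  -- `F` is annihilated by the `(0,1)`-fields of `Z₁` and `Z₂` near the point, hence by their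
  -- bracket, which gives the direction `2 [Z₁, Z₂]` missing in the frame.
  have hT := dbar_bracket ((hF.contDiffAt (g.open_source.mem_nhds hxg)).of_le ENat.LEInfty.out)
    (hd₁.restrictScalars ℝ) (hd₂.restrictScalars ℝ)
    (by filter_upwards [hN] with z hz using hZ₁ z hz)
    (by filter_upwards [hN] with z hz using hZ₂ z hz)
  rw [lieBracket_sub_lieBracket_I hd₁ hd₂, dbar_smul] at hT
  have hT' : dbar F (e x) (VectorField.lieBracket ℂ Z₁ Z₂ (e x)) = 0 := by simpa using hT
  have hall := dbar_eq_zero_of_frame (hZ₁ _ ⟨hxU, hxg⟩) (hZ₂ _ ⟨hxU, hxg⟩) hT' (h.indep _ hxU)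
  have := (hdbar (e x) hxg (tmap ℝ e x a)).2 (hall _)
  rwa [hxi, he.restrictScalars.tmap_symm_tmap hxe] at this

/-- `T` takes the complex subspace `A` onto `B`. -/
def MapsOnto (T : C3 →L[ℝ] C3) (A B : Submodule ℂ C3) : Prop :=
  ∀ b : C3, b ∈ B ↔ ∃ a ∈ A, T a = b

theorem MapsOnto.mem {T : C3 →L[ℝ] C3} {A B : Submodule ℂ C3} (h : MapsOnto T A B) {a : C3}
    (ha : a ∈ A) : T a ∈ B := (h _).2 ⟨a, ha, rfl⟩

theorem MapsOnto.sup {T : C3 →L[ℝ] C3} {A B A' B' : Submodule ℂ C3} (h : MapsOnto T A A')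
    (h' : MapsOnto T B B') : MapsOnto T (A ⊔ B) (A' ⊔ B') := by
  intro b
  simp only [Submodule.mem_sup]
  constructor
  · rintro ⟨c, hc, d, hd, rfl⟩
    obtain ⟨a, ha, rfl⟩ := (h c).1 hc
    obtain ⟨b, hb, rfl⟩ := (h' d).1 hd
    exact ⟨a + b, ⟨a, ha, b, hb, rfl⟩, map_add _ _ _⟩
  · rintro ⟨_, ⟨a, ha, b, hb, rfl⟩, rfl⟩
    exact ⟨T a, h.mem ha, T b, h'.mem hb, (map_add _ _ _).symm⟩

theorem mapsOnto_iff_map_eq {T : C3 →L[ℝ] C3} {A B : Submodule ℂ C3} :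
    MapsOnto T A B ↔ (underlyingReal A).map T.toLinearMap = underlyingReal B := by
  rw [Submodule.ext_iff]
  exact forall_congr' fun b => Iff.comm

theorem mapsOnto_iff_map_eq_complex {T : C3 →L[ℝ] C3} {S : C3 →L[ℂ] C3} (hTS : ∀ a, T a = S a)
    {A B : Submodule ℂ C3} : MapsOnto T A B ↔ A.map S.toLinearMap = B := by
  rw [Submodule.ext_iff]
  refine forall_congr' fun b => ?_
  simp only [hTS]
  exact Iff.comm

/-- The conditions on a CR-isomorphism between the manifolds associated with complex 3-folds. -/
theorem isCRIso_toCR_iff {f : OpenPartialHomeomorph P.carrier P'.carrier} :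
    CRManifold.IsCRIso (C := P.toCR) (C' := P'.toCR) f ↔ IsDiffeoOn ℝ f ∧
      (∀ x ∈ f.source, MapsOnto (tmap ℝ f x) (P.l₁ x ⊔ P.l₂ x) (P'.l₁ (f x) ⊔ P'.l₂ (f x))) ∧
      ∀ x ∈ f.source, ∀ a : C3, a ∈ P.l₁ x ⊔ P.l₂ x →
        tmap ℝ f x (twist (P.l₁ x) (P.l₂ x) a) =
          twist (P'.l₁ (f x)) (P'.l₂ (f x)) (tmap ℝ f x a) :=
  ⟨fun h => ⟨⟨h.smooth, h.smooth_symm⟩, fun x hx => mapsOnto_iff_map_eq.2 (h.map_D x hx),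
    h.map_J⟩, fun h => ⟨h.1.smooth, h.1.smooth_symm,
    fun x hx => mapsOnto_iff_map_eq.1 (h.2.1 x hx), h.2.2⟩⟩

theorem isSplitCRIso_toCR_iff {f : OpenPartialHomeomorph P.carrier P'.carrier} :
    CRManifold.IsSplitCRIso (C := P.toCR) (C' := P'.toCR) f ↔
      CRManifold.IsCRIso (C := P.toCR) (C' := P'.toCR) f ∧
      (∀ x ∈ f.source, MapsOnto (tmap ℝ f x) (P.l₁ x) (P'.l₁ (f x))) ∧
      ∀ x ∈ f.source, MapsOnto (tmap ℝ f x) (P.l₂ x) (P'.l₂ (f x)) :=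
  ⟨fun h => ⟨h.toIsCRIso, fun x hx => mapsOnto_iff_map_eq.2 (h.map_Dp x hx),
    fun x hx => mapsOnto_iff_map_eq.2 (h.map_Dm x hx)⟩,
    fun h => ⟨h.1, fun x hx => mapsOnto_iff_map_eq.1 (h.2.1 x hx),
    fun x hx => mapsOnto_iff_map_eq.1 (h.2.2 x hx)⟩⟩

theorem isIso_iff {f : OpenPartialHomeomorph P.carrier P'.carrier} :
    IsIso f ↔ IsDiffeoOn ℂ f ∧
      (∀ x ∈ f.source, MapsOnto (tmap ℝ f x) (P.l₁ x) (P'.l₁ (f x))) ∧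
      ∀ x ∈ f.source, MapsOnto (tmap ℝ f x) (P.l₂ x) (P'.l₂ (f x)) := by
  constructor
  · intro h
    have hf : IsDiffeoOn ℂ f := ⟨h.holomorphic, h.holomorphic_symm⟩
    exact ⟨hf, fun x hx => (mapsOnto_iff_map_eq_complex (hf.tmap_real hx)).2 (h.map_L₁ x hx),
      fun x hx => (mapsOnto_iff_map_eq_complex (hf.tmap_real hx)).2 (h.map_L₂ x hx)⟩
  · rintro ⟨hf, h₁, h₂⟩
    exact ⟨hf.smooth, hf.smooth_symm,
      fun x hx => (mapsOnto_iff_map_eq_complex (hf.tmap_real hx)).1 (h₁ x hx),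
      fun x hx => (mapsOnto_iff_map_eq_complex (hf.tmap_real hx)).1 (h₂ x hx)⟩

theorem isAntiIso_iff {f : OpenPartialHomeomorph P.carrier P'.carrier} :
    IsAntiIso f ↔ IsDiffeoOn ℝ f ∧
      (∀ x ∈ f.source, ∀ a, tmap ℝ f x (Complex.I • a) = -(Complex.I • tmap ℝ f x a)) ∧
      (∀ x ∈ f.source, MapsOnto (tmap ℝ f x) (P.l₁ x) (P'.l₂ (f x))) ∧
      ∀ x ∈ f.source, MapsOnto (tmap ℝ f x) (P.l₂ x) (P'.l₁ (f x)) :=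
  ⟨fun h => ⟨⟨h.smooth, h.smooth_symm⟩, h.antiholomorphic,
    fun x hx => mapsOnto_iff_map_eq.2 (h.map_L₁ x hx),
    fun x hx => mapsOnto_iff_map_eq.2 (h.map_L₂ x hx)⟩,
    fun h => ⟨h.1.smooth, h.1.smooth_symm, h.2.1,
    fun x hx => mapsOnto_iff_map_eq.1 (h.2.2.1 x hx),
    fun x hx => mapsOnto_iff_map_eq.1 (h.2.2.2 x hx)⟩⟩

/-- `J` is `i` on the first and `-i` on the second direction field on both sides. So a split CR-map
is complex linear on each of them, and `IsFrame.tmap_I_smul` extends this to the whole tangent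
space. -/
theorem isSplitCRIso_iff_isIso (hP : P.IsPathGeometry) (hP' : P'.IsPathGeometry)
    (f : OpenPartialHomeomorph P.carrier P'.carrier) :
    CRManifold.IsSplitCRIso (C := P.toCR) (C' := P'.toCR) f ↔ IsIso f := by
  rw [isSplitCRIso_toCR_iff, isCRIso_toCR_iff, isIso_iff]
  constructor
  · rintro ⟨⟨hf, -, hJ⟩, h₁, h₂⟩
    refine ⟨hf.complex_of_real fun x hx a => ?_, h₁, h₂⟩
    obtain ⟨U, Z₁, Z₂, hfr, hxU⟩ := hP.exists_frame x
    have := hfr.tmap_I_smul hf (κ := ContinuousLinearMap.id ℝ C3) (σ := 1) (by norm_num)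
      (by simp) Function.injective_id ?_ ?_ hx (mem_chart_source C3 x) hxU a
    · simpa using this
    · intro y hy a ha
      have := hJ y hy a (Submodule.mem_sup_left ha)
      rw [one_smul]
      rwa [twist_left (hP.disjoint y) ha, twist_left (hP'.disjoint (f y))
        ((h₁ y hy).mem ha)] at this
    · intro y hy a ha
      have := hJ y hy a (Submodule.mem_sup_right ha)
      rw [one_smul]
      rw [twist_right (hP.disjoint y) ha, twist_right (hP'.disjoint (f y))
        ((h₂ y hy).mem ha), map_neg] at this
      exact neg_injective this
  · rintro ⟨hf, h₁, h₂⟩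
    refine ⟨⟨hf.restrictScalars, fun x hx => (h₁ x hx).sup (h₂ x hx), fun x hx a ha => ?_⟩,
      h₁, h₂⟩
    obtain ⟨b, hb, c, hc, rfl⟩ := Submodule.mem_sup.1 ha
    rw [twist_add (hP.disjoint x) hb hc, map_add, twist_add (hP'.disjoint (f x))
      ((h₁ x hx).mem hb) ((h₂ x hx).mem hc), map_sub, hf.tmap_real_smul hx,
      hf.tmap_real_smul hx]

/-- A CR-isomorphism takes a vector in one of the direction fields to a vector in one of them. -/
theorem mem_or_mem_of_isCRIso (hP' : P'.IsPathGeometry)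
    {e : OpenPartialHomeomorph P.carrier C3} {U : Set C3}
    {f : OpenPartialHomeomorph P.carrier P'.carrier} (he : IsDiffeoOn ℂ e)
    (hU : IsOpen U) (hf : IsDiffeoOn ℝ f)
    (hD : ∀ x ∈ f.source,
      MapsOnto (tmap ℝ f x) (P.l₁ x ⊔ P.l₂ x) (P'.l₁ (f x) ⊔ P'.l₂ (f x)))
    (hJ : ∀ x ∈ f.source, ∀ a : C3, a ∈ P.l₁ x ⊔ P.l₂ x →
        tmap ℝ f x (twist (P.l₁ x) (P.l₂ x) a) =
          twist (P'.l₁ (f x)) (P'.l₂ (f x)) (tmap ℝ f x a))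
    {Z : C3 → C3} (hZ : ContDiffOn ℂ ∞ Z U) {σ : ℝ}
    (hZD : ∀ y ∈ e.source, e y ∈ U → tmap ℂ e.symm (e y) (Z (e y)) ∈
      P.l₁ y ⊔ P.l₂ y)
    (hZJ : ∀ y ∈ e.source, e y ∈ U → twist (P.l₁ y) (P.l₂ y) (tmap ℂ e.symm (e y) (Z (e y))) =
      σ • Complex.I • tmap ℂ e.symm (e y) (Z (e y)))
    {x : P.carrier} (hx : x ∈ f.source) (hxe : x ∈ e.source) (hxU : e x ∈ U) :
    tmap ℝ f x (tmap ℂ e.symm (e x) (Z (e x))) ∈ P'.l₁ (f x) ∨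
    tmap ℝ f x (tmap ℂ e.symm (e x) (Z (e x))) ∈ P'.l₂ (f x) := by
  obtain ⟨U', Z₁', Z₂', hfr, hxU'⟩ := hP'.exists_frame (f x)
  set e' : OpenPartialHomeomorph P'.carrier C3 := chartAt C3 (f x) with he'def
  have he' : IsDiffeoOn ℂ e' := hfr.diffeo
  have hfe' := hf.trans he'.restrictScalars
  let g : OpenPartialHomeomorph C3 C3 := e.symm.trans (f.trans e')
  have hg : IsDiffeoOn ℝ g := he.restrictScalars.symm.trans hfe'
  have hsrc : ∀ z ∈ g.source, z ∈ e.target ∧ e.symm z ∈ f.source ∧ f (e.symm z) ∈ e'.source := by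
    intro z hz
    simpa [g, OpenPartialHomeomorph.trans_source] using hz
  have hxi : e.symm (e x) = x := e.left_inv hxe
  have hxe' : f x ∈ e'.source := mem_chart_source C3 (f x)
  have hxg : e x ∈ g.source := by
    have h2 := e.map_source hxe
    simp only [g, OpenPartialHomeomorph.trans_source, OpenPartialHomeomorph.symm_source,
      mem_inter_iff, mem_preimage]
    rw [hxi]
    exact ⟨h2, hx, hxe'⟩
  have hgx : g (e x) = e' (f x) := by
    simp only [g, OpenPartialHomeomorph.coe_trans, Function.comp_apply, hxi]
  have htg : ∀ z ∈ g.source, ∀ a, tmap ℝ g z a =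
      tmap ℝ e' (f (e.symm z)) (tmap ℝ f (e.symm z) (tmap ℂ e.symm z a)) := by
    intro z hz a
    obtain ⟨hz1, hz2, hz3⟩ := hsrc z hz
    have hz4 : e.symm z ∈ (f.trans e').source := by
      rw [f.trans_source]; exact ⟨hz2, hz3⟩
    simp only [g]
    rw [he.restrictScalars.symm.tmap_comp hfe' hz1 hz4,
      hf.tmap_comp he'.restrictScalars hz2 hz3, he.symm.tmap_real hz1]
  -- This field is `JZ` in coordinates, by the hypothesis on `σ`.
  let W : C3 → C3 := fun z => σ • Complex.I • Z z
  have hZr : ContDiffOn ℝ ∞ Z U := hZ.restrict_scalars ℝ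
  have hWr : ContDiffOn ℝ ∞ W U := (hZr.const_smul Complex.I).const_smul σ
  let A := push ℝ g Z
  let B := push ℝ g W
  have hO : IsOpen (g.target ∩ g.symm ⁻¹' U) := g.isOpen_inter_preimage_symm hU
  have hA := smoothFld_iff_contDiffOn.1 (hg.push_smooth hU (smoothFld_iff_contDiffOn.2 hZr))
  have hB := smoothFld_iff_contDiffOn.1 (hg.push_smooth hU (smoothFld_iff_contDiffOn.2 hWr))
  have hbr := hg.tmap_bra hU (smoothFld_iff_contDiffOn.2 hZr) (smoothFld_iff_contDiffOn.2 hWr)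
    hxg hxU
  have hdZ : DifferentiableAt ℂ Z (e x) :=
    (hZ.contDiffAt (hU.mem_nhds hxU)).differentiableAt (by simp)
  have hW0 : VectorField.lieBracket ℝ Z W (e x) = 0 := by
    have := lieBracket_const_smul_self hdZ ((σ : ℂ) * Complex.I)
    rw [← this]
    congr 1
    ext y i
    simp [W, mul_assoc]
  rw [bra_eq_lieBracket, bra_eq_lieBracket, hW0, map_zero] at hbr
  -- The image `A` of `Z` is a section of the target plane field, with coefficients `r`, `s`; the
  -- image `B` of `JZ` is `J A`, with coefficients `i r`, `-i s`.
  have hcomb : ∀ w ∈ g.target ∩ g.symm ⁻¹' U, w ∈ U' →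
      ∃ r s : ℂ, A w = r • Z₁' w + s • Z₂' w ∧
        B w = (Complex.I * r) • Z₁' w + (-(Complex.I * s)) • Z₂' w := by
    rintro w ⟨hw1, hw2⟩ hw3
    have hz := g.map_target hw1
    obtain ⟨hz1, hz2, hz3⟩ := hsrc _ hz
    have hy := e.map_target hz1
    have hr := e.right_inv hz1
    have hwe : e' (f (e.symm (g.symm w))) = w := g.right_inv hw1
    have hyU : e (e.symm (g.symm w)) ∈ U := by rw [hr]; exact hw2
    have hD0 := hZD _ hy hyU
    have hJ0 := hZJ _ hy hyU
    rw [hr] at hD0 hJ0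
    set y := e.symm (g.symm w)
    set v : C3 := tmap ℂ e.symm (g.symm w) (Z (g.symm w))
    have hD1 := (hD y hz2).mem hD0
    have hJ1 := hJ y hz2 v hD0
    obtain ⟨b, hb, c, hc, hbc⟩ := Submodule.mem_sup.1 hD1
    rw [hJ0, ← hbc, twist_add (hP'.disjoint (f y)) hb hc] at hJ1
    obtain ⟨r, hr'⟩ := (hfr.mem₁ (f y) hz3 (by rw [hwe]; exact hw3) b).1 hb
    obtain ⟨s, hs'⟩ := (hfr.mem₂ (f y) hz3 (by rw [hwe]; exact hw3) c).1 hc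
    rw [hwe] at hr' hs'
    have hAw : A w = tmap ℝ e' (f y) (tmap ℝ f y v) := htg _ hz _
    have hBw : B w = tmap ℝ e' (f y) (tmap ℝ f y (σ • Complex.I • v)) := by
      have h1 : B w = tmap ℝ e' (f y) (tmap ℝ f y (tmap ℂ e.symm (g.symm w) (W (g.symm w)))) :=
        htg _ hz _
      rw [h1]
      congr 2
      simp only [W, v]
      rw [← Complex.coe_smul, map_smul, map_smul, Complex.coe_smul]
    refine ⟨r, s, ?_, ?_⟩
    · rw [hAw, ← hbc, map_add, he'.tmap_real hz3, he'.tmap_real hz3, ← hr', ← hs']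
    · rw [hBw, hJ1, map_sub, he'.tmap_real_smul hz3, he'.tmap_real_smul hz3, he'.tmap_real hz3,
        he'.tmap_real hz3]
      rw [mul_smul, neg_smul, mul_smul, ← hr', ← hs', sub_eq_add_neg]
  have hxO : e' (f x) ∈ g.target ∩ g.symm ⁻¹' U := by
    rw [← hgx]
    refine ⟨g.map_source hxg, ?_⟩
    rw [mem_preimage, g.left_inv hxg]; exact hxU
  obtain ⟨r, s, hA0, hB0⟩ := hcomb _ hxO hxU'
  have hN : (g.target ∩ g.symm ⁻¹' U) ∩ U' ∈ 𝓝 (e' (f x)) :=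
    (hO.inter hfr.isOpen).mem_nhds ⟨hxO, hxU'⟩
  have hz₁ := hfr.differentiableAt₁ hxU'
  have hz₂ := hfr.differentiableAt₂ hxU'
  have hdet := det3_bracket (hz₁.restrictScalars ℝ) (hz₂.restrictScalars ℝ)
    ((hA.contDiffAt (hO.mem_nhds hxO)).differentiableAt (by simp))
    ((hB.contDiffAt (hO.mem_nhds hxO)).differentiableAt (by simp))
    (dbar_eq_zero_of_differentiableAt hz₁ _) (dbar_eq_zero_of_differentiableAt hz₁ _)
    (dbar_eq_zero_of_differentiableAt hz₂ _) (dbar_eq_zero_of_differentiableAt hz₂ _)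
    (by
      filter_upwards [hN] with w hw
      obtain ⟨r, s, hr, -⟩ := hcomb w hw.1 hw.2
      rw [show push ℝ g Z w = _ from hr]; exact det3_comb₃ _ _ _ _)
    (by
      filter_upwards [hN] with w hw
      obtain ⟨r, s, -, hs⟩ := hcomb w hw.1 hw.2
      rw [show push ℝ g W w = _ from hs]; exact det3_comb₃ _ _ _ _) hA0 hB0
  rw [hgx] at hbr
  rw [← hbr, lieBracket_real_eq_complex hz₁ hz₂] at hdet
  have h0 := hfr.indep _ hxU'
  -- The Levi coefficient of `A` and `B` is `-2 i r s`, and it vanishes because `[Z, JZ] = 0`.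
  have hrs : r = 0 ∨ s = 0 := by
    have h1 : r * -(Complex.I * s) - s * (Complex.I * r) = 0 := by
      have : det3 (Z₁' (e' (f x))) (Z₂' (e' (f x))) 0 = 0 := by simp [det3]
      rw [this] at hdet
      exact (mul_eq_zero.1 hdet.symm).resolve_right h0
    have h2 : -(2 * Complex.I) * (r * s) = 0 := by linear_combination h1
    simpa using h2
  have hAx : A (e' (f x)) = tmap ℂ e' (f x) (tmap ℝ f x (tmap ℂ e.symm (e x) (Z (e x)))) := by
    rw [← hgx, show A (g (e x)) = _ from push_apply g Z hxg, htg _ hxg, hxi,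
      he'.tmap_real hxe']
  rw [hAx] at hA0
  rcases hrs with rfl | rfl
  · right
    exact (hfr.mem₂ (f x) hxe' hxU' _).2 ⟨s, by rw [hA0, zero_smul, zero_add]⟩
  · left
    exact (hfr.mem₁ (f x) hxe' hxU' _).2 ⟨r, by rw [hA0, zero_smul, add_zero]⟩

end Threefold

/-! ### CR-maps without regard to the order of the splitting -/

namespace Threefold

variable {P : Threefold.{u}} {P' : Threefold.{v}}

/-- The set where `df` takes a vector field out of a direction field is open. -/
theorem eventually_notMem_direction {e : OpenPartialHomeomorph P.carrier C3}
    {e' : OpenPartialHomeomorph P'.carrier C3} (he : IsDiffeoOn ℂ e) (he' : IsDiffeoOn ℂ e')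
    {f : OpenPartialHomeomorph P.carrier P'.carrier} (hf : IsDiffeoOn ℝ f) {U U' : Set C3}
    (hU : IsOpen U) (hU' : IsOpen U') {Z W : C3 → C3} (hZ : ContDiffOn ℂ ∞ Z U)
    (hW : ContDiffOn ℂ ∞ W U') {L : P'.carrier → Submodule ℂ C3}
    (hL : ∀ y ∈ e'.source, e' y ∈ U' → ∀ a, a ∈ L y ↔ ∃ c : ℂ, tmap ℂ e' y a = c • W (e' y))
    {x : P.carrier} (hx : x ∈ f.source) (hxe : x ∈ e.source) (hxU : e x ∈ U)
    (hxe' : f x ∈ e'.source) (hxU' : e' (f x) ∈ U') (hW0 : W (e' (f x)) ≠ 0)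
    (h : tmap ℝ f x (tmap ℂ e.symm (e x) (Z (e x))) ∉ L (f x)) :
    ∀ᶠ y in 𝓝 x, tmap ℝ f y (tmap ℂ e.symm (e y) (Z (e y))) ∉ L (f y) := by
  have hfe' := hf.trans he'.restrictScalars
  let g : OpenPartialHomeomorph C3 C3 := e.symm.trans (f.trans e')
  have hg : IsDiffeoOn ℝ g := he.restrictScalars.symm.trans hfe'
  have hgs := contDiffOn_of_isDiffeoOn hg
  have hsrc : ∀ z ∈ g.source, z ∈ e.target ∧ e.symm z ∈ f.source ∧ f (e.symm z) ∈ e'.source := by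
    intro z hz
    simpa [g, OpenPartialHomeomorph.trans_source] using hz
  have hxi : e.symm (e x) = x := e.left_inv hxe
  have hxg : e x ∈ g.source := by
    have h2 := e.map_source hxe
    simp only [g, OpenPartialHomeomorph.trans_source, OpenPartialHomeomorph.symm_source,
      mem_inter_iff, mem_preimage]
    rw [hxi]
    exact ⟨h2, hx, hxe'⟩
  have hgx : g (e x) = e' (f x) := by
    simp only [g, OpenPartialHomeomorph.coe_trans, Function.comp_apply, hxi]
  have hdg : ∀ z ∈ g.source, ∀ a, fderiv ℝ g z a =
      tmap ℂ e' (f (e.symm z)) (tmap ℝ f (e.symm z) (tmap ℂ e.symm z a)) := by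
    intro z hz a
    obtain ⟨hz1, hz2, hz3⟩ := hsrc z hz
    rw [← tmap_eq_fderiv]
    have hz4 : e.symm z ∈ (f.trans e').source := by
      rw [f.trans_source]; exact ⟨hz2, hz3⟩
    simp only [g]
    rw [he.restrictScalars.symm.tmap_comp hfe' hz1 hz4,
      hf.tmap_comp he'.restrictScalars hz2 hz3, he.symm.tmap_real hz1, he'.tmap_real hz3]
  have hmem : ∀ z ∈ g.source, g z ∈ U' →
      (tmap ℝ f (e.symm z) (tmap ℂ e.symm z (Z z)) ∈ L (f (e.symm z)) ↔
        ∃ c : ℂ, fderiv ℝ g z (Z z) = c • W (g z)) := fun z hz hzU => by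
    rw [hdg z hz]
    exact hL _ (hsrc z hz).2.2 hzU _
  have hW0' : W (g (e x)) ≠ 0 := by rwa [hgx]
  -- Lying outside a line means that some 2 × 2 minor is nonzero, and the minors depend continuously
  -- on the point.
  have h' : ¬ ∀ c, det3 (W (g (e x))) (fderiv ℝ g (e x) (Z (e x))) c = 0 := by
    rw [det3_line_iff hW0', ← hmem _ hxg (by rwa [hgx]), hxi]
    exact h
  push Not at h'
  obtain ⟨c, hc⟩ := h'
  have hgc : ContDiffAt ℝ ∞ g (e x) := hgs.contDiffAt (g.open_source.mem_nhds hxg)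
  have hc₁ : ContinuousAt (fun z => fderiv ℝ g z (Z z)) (e x) :=
    (hgc.fderiv_right (m := 0) (by simp)).continuousAt.clm_apply
      (hZ.contDiffAt (hU.mem_nhds hxU)).continuousAt
  have hc₂ : ContinuousAt (fun z => W (g z)) (e x) := by
    refine ContinuousAt.comp (f := g) (g := W) ?_ hgc.continuousAt
    rw [hgx]
    exact (hW.contDiffAt (hU'.mem_nhds hxU')).continuousAt
  have hc₃ : ContinuousAt (fun z => det3 (W (g z)) (fderiv ℝ g z (Z z)) c) (e x) := by
    have h1 := fun i => (continuous_apply i).continuousAt.comp hc₁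
    have h2 := fun i => (continuous_apply i).continuousAt.comp hc₂
    simp only [det3]
    have k := fun i j => ((h2 i).mul (h1 j))
    have := (((h2 0).mul (((h1 1).mul_const (c 2)).sub ((h1 2).mul_const (c 1)))).sub
      ((h2 1).mul (((h1 0).mul_const (c 2)).sub ((h1 2).mul_const (c 0))))).add
      ((h2 2).mul (((h1 0).mul_const (c 1)).sub ((h1 1).mul_const (c 0))))
    exact this
  have hev : ∀ᶠ z in 𝓝 (e x), tmap ℝ f (e.symm z) (tmap ℂ e.symm z (Z z)) ∉ L (f (e.symm z)) := by
    filter_upwards [hc₃.eventually_ne hc, g.open_source.mem_nhds hxg,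
      hgc.continuousAt.preimage_mem_nhds (hU'.mem_nhds (by rwa [hgx]))] with z hz hzg hzU hmz
    obtain ⟨r, hr⟩ := (hmem z hzg hzU).1 hmz
    apply hz
    rw [hr]
    simp [det3]
    ring
  filter_upwards [(e.continuousAt hxe).eventually hev, e.open_source.mem_nhds hxe] with y hy hye
  rwa [e.left_inv hye] at hy

/-- A linear image of a subspace contained in the union of two subspaces lies in one of them. -/
theorem forall_mem_or_forall_mem {T : C3 →L[ℝ] C3} {A B B' : Submodule ℂ C3}
    (h : ∀ a ∈ A, T a ∈ B ∨ T a ∈ B') : (∀ a ∈ A, T a ∈ B) ∨ ∀ a ∈ A, T a ∈ B' := by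
  by_contra! hcon
  obtain ⟨⟨a, ha, haB⟩, b, hb, hbB⟩ := hcon
  have ha' := (h a ha).resolve_left haB
  have hb' := (h b hb).resolve_right hbB
  rcases h (a + b) (A.add_mem ha hb) with h1 | h1 <;> rw [map_add] at h1
  · exact haB ((B.add_mem_iff_left hb').1 h1)
  · exact hbB ((B'.add_mem_iff_right ha').1 h1)

/-- A preimage in `A ⊔ B` of a vector of `A'` has a `B`-part with image in `A' ⊓ B' = ⊥`. -/
theorem MapsOnto.of_sup {T : C3 →L[ℝ] C3} {A B A' B' : Submodule ℂ C3}
    (h : MapsOnto T (A ⊔ B) (A' ⊔ B')) (hd : Disjoint A' B') (hA : ∀ a ∈ A, T a ∈ A')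
    (hB : ∀ b ∈ B, T b ∈ B') : MapsOnto T A A' := by
  intro c
  refine ⟨fun hc => ?_, fun ⟨a, ha, hac⟩ => hac ▸ hA a ha⟩
  obtain ⟨_, hab, rfl⟩ := (h c).1 (Submodule.mem_sup_left hc)
  obtain ⟨a, ha, b, hb, rfl⟩ := Submodule.mem_sup.1 hab
  refine ⟨a, ha, ?_⟩
  rw [map_add, A'.add_mem_iff_right (hA a ha)] at hc
  rw [map_add, Submodule.disjoint_def.1 hd _ hc (hB b hb), add_zero]

theorem MapsOnto.absurd_of_le {T : C3 →L[ℝ] C3} {A B A' B' : Submodule ℂ C3}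
    (h : MapsOnto T (A ⊔ B) (A' ⊔ B')) (hd : Disjoint A' B') (hA : ∀ a ∈ A, T a ∈ A')
    (hB : ∀ b ∈ B, T b ∈ A') : B' = ⊥ := by
  rw [Submodule.eq_bot_iff]
  intro c hc
  obtain ⟨_, hab, rfl⟩ := (h c).1 (Submodule.mem_sup_right hc)
  obtain ⟨a, ha, b, hb, rfl⟩ := Submodule.mem_sup.1 hab
  refine Submodule.disjoint_def.1 hd _ ?_ hc
  rw [map_add]
  exact A'.add_mem (hA a ha) (hB b hb)

theorem IsFrame.tmap_symm_mem₁ {e : OpenPartialHomeomorph P.carrier C3} {U : Set C3}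
    {Z₁ Z₂ : C3 → C3} (h : P.IsFrame e U Z₁ Z₂) {y : P.carrier} (hy : y ∈ e.source)
    (hyU : e y ∈ U) : tmap ℂ e.symm (e y) (Z₁ (e y)) ∈ P.l₁ y :=
  (h.mem₁ y hy hyU _).2 ⟨1, by rw [h.diffeo.tmap_tmap_symm' hy, one_smul]⟩

theorem IsFrame.tmap_symm_mem₂ {e : OpenPartialHomeomorph P.carrier C3} {U : Set C3}
    {Z₁ Z₂ : C3 → C3} (h : P.IsFrame e U Z₁ Z₂) {y : P.carrier} (hy : y ∈ e.source)
    (hyU : e y ∈ U) : tmap ℂ e.symm (e y) (Z₂ (e y)) ∈ P.l₂ y :=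
  (h.mem₂ y hy hyU _).2 ⟨1, by rw [h.diffeo.tmap_tmap_symm' hy, one_smul]⟩

theorem IsFrame.tmap_symm_ne_zero₁ {e : OpenPartialHomeomorph P.carrier C3} {U : Set C3}
    {Z₁ Z₂ : C3 → C3} (h : P.IsFrame e U Z₁ Z₂) {y : P.carrier} (hy : y ∈ e.source)
    (hyU : e y ∈ U) : tmap ℂ e.symm (e y) (Z₁ (e y)) ≠ 0 := fun h0 =>
  ne_zero_of_det3_left (h.indep _ hyU)
    (by rw [← h.diffeo.tmap_tmap_symm' hy (Z₁ (e y)), h0, map_zero])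

theorem IsFrame.tmap_symm_ne_zero₂ {e : OpenPartialHomeomorph P.carrier C3} {U : Set C3}
    {Z₁ Z₂ : C3 → C3} (h : P.IsFrame e U Z₁ Z₂) {y : P.carrier} (hy : y ∈ e.source)
    (hyU : e y ∈ U) : tmap ℂ e.symm (e y) (Z₂ (e y)) ≠ 0 := fun h0 =>
  ne_zero_of_det3_mid (h.indep _ hyU)
    (by rw [← h.diffeo.tmap_tmap_symm' hy (Z₂ (e y)), h0, map_zero])

theorem IsPathGeometry.l₁_ne_bot (hP : P.IsPathGeometry) (x : P.carrier) : P.l₁ x ≠ ⊥ := by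
  obtain ⟨U, Z₁, Z₂, h, hxU⟩ := hP.exists_frame x
  exact (Submodule.ne_bot_iff _).2 ⟨_, h.tmap_symm_mem₁ (mem_chart_source C3 x) hxU,
    h.tmap_symm_ne_zero₁ (mem_chart_source C3 x) hxU⟩

theorem IsPathGeometry.l₂_ne_bot (hP : P.IsPathGeometry) (x : P.carrier) : P.l₂ x ≠ ⊥ := by
  obtain ⟨U, Z₁, Z₂, h, hxU⟩ := hP.exists_frame x
  exact (Submodule.ne_bot_iff _).2 ⟨_, h.tmap_symm_mem₂ (mem_chart_source C3 x) hxU,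
    h.tmap_symm_ne_zero₂ (mem_chart_source C3 x) hxU⟩

/-- At each point a CR-isomorphism preserves or exchanges the two direction fields. -/
theorem mapsOnto_or_mapsOnto_swap (hP : P.IsPathGeometry) (hP' : P'.IsPathGeometry)
    {f : OpenPartialHomeomorph P.carrier P'.carrier}
    (hf : CRManifold.IsCRIso (C := P.toCR) (C' := P'.toCR) f) {x : P.carrier} (hx : x ∈ f.source) :
    (MapsOnto (tmap ℝ f x) (P.l₁ x) (P'.l₁ (f x)) ∧
      MapsOnto (tmap ℝ f x) (P.l₂ x) (P'.l₂ (f x))) ∨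
    (MapsOnto (tmap ℝ f x) (P.l₁ x) (P'.l₂ (f x)) ∧
      MapsOnto (tmap ℝ f x) (P.l₂ x) (P'.l₁ (f x))) := by
  obtain ⟨hdf, hD, hJ⟩ := isCRIso_toCR_iff.1 hf
  obtain ⟨U, Z₁, Z₂, h, hxU⟩ := hP.exists_frame x
  set e : OpenPartialHomeomorph P.carrier C3 := chartAt C3 x with he
  have hxe : x ∈ e.source := mem_chart_source C3 x
  have h₁ : ∀ a ∈ P.l₁ x, tmap ℝ f x a ∈ P'.l₁ (f x) ∨ tmap ℝ f x a ∈ P'.l₂ (f x) := by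
    intro a ha
    obtain ⟨c, hc⟩ := (h.mem₁ x hxe hxU a).1 ha
    have hm : ∀ y ∈ e.source, e y ∈ U → tmap ℂ e.symm (e y) (c • Z₁ (e y)) ∈ P.l₁ y := by
      intro y hy hyU
      rw [map_smul]
      exact (P.l₁ y).smul_mem c (h.tmap_symm_mem₁ hy hyU)
    -- A constant multiple of the generator extends the given vector to a holomorphic section of the
    -- same direction field.
    have := mem_or_mem_of_isCRIso hP' h.diffeo h.isOpen hdf hD hJ (Z := fun z => c • Z₁ z)
      (h.hol₁.const_smul c) (σ := 1) (fun y hy hyU => Submodule.mem_sup_left (hm y hy hyU))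
      (fun y hy hyU => by rw [one_smul]; exact twist_left (hP.disjoint y) (hm y hy hyU))
      hx hxe hxU
    rwa [show tmap ℂ e.symm (e x) (c • Z₁ (e x)) = a by
      rw [← hc, h.diffeo.tmap_symm_tmap hxe]] at this
  have h₂ : ∀ a ∈ P.l₂ x, tmap ℝ f x a ∈ P'.l₁ (f x) ∨ tmap ℝ f x a ∈ P'.l₂ (f x) := by
    intro a ha
    obtain ⟨c, hc⟩ := (h.mem₂ x hxe hxU a).1 ha
    have hm : ∀ y ∈ e.source, e y ∈ U → tmap ℂ e.symm (e y) (c • Z₂ (e y)) ∈ P.l₂ y := by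
      intro y hy hyU
      rw [map_smul]
      exact (P.l₂ y).smul_mem c (h.tmap_symm_mem₂ hy hyU)
    have := mem_or_mem_of_isCRIso hP' h.diffeo h.isOpen hdf hD hJ (Z := fun z => c • Z₂ z)
      (h.hol₂.const_smul c) (σ := -1) (fun y hy hyU => Submodule.mem_sup_right (hm y hy hyU))
      (fun y hy hyU => by
        rw [neg_smul, one_smul]; exact twist_right (hP.disjoint y) (hm y hy hyU))
      hx hxe hxU
    rwa [show tmap ℂ e.symm (e x) (c • Z₂ (e x)) = a by
      rw [← hc, h.diffeo.tmap_symm_tmap hxe]] at this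
  have hd := hP'.disjoint (f x)
  have hD' := hD x hx
  have hsw : MapsOnto (tmap ℝ f x) (P.l₂ x ⊔ P.l₁ x) (P'.l₁ (f x) ⊔ P'.l₂ (f x)) := by
    rwa [sup_comm (P.l₂ x)]
  -- If both direction fields went into the same one, the plane would not be mapped onto the plane.
  -- The other two cases are preservation and exchange.
  rcases forall_mem_or_forall_mem h₁ with k₁ | k₁ <;>
    rcases forall_mem_or_forall_mem h₂ with k₂ | k₂
  · exact absurd (hD'.absurd_of_le hd k₁ k₂) (hP'.l₂_ne_bot _)
  · refine .inl ⟨hD'.of_sup hd k₁ k₂, MapsOnto.of_sup ?_ hd.symm k₂ k₁⟩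
    rwa [sup_comm (P'.l₂ (f x)), sup_comm (P.l₂ x)]
  · refine .inr ⟨MapsOnto.of_sup ?_ hd.symm k₁ k₂, hsw.of_sup hd k₂ k₁⟩
    rwa [sup_comm (P'.l₂ (f x))]
  · refine absurd (MapsOnto.absurd_of_le (A := P.l₁ x) (B := P.l₂ x) ?_ hd.symm k₁ k₂)
      (hP'.l₁_ne_bot _)
    rwa [sup_comm (P'.l₂ (f x))]

/-- The points where the direction fields are preserved and those where they are exchanged form two
disjoint open sets covering the source. If they are exchanged, `J = i` corresponds to `J = -i`, so
the differential is conjugate linear on both direction fields and hence everywhere. -/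
theorem isCRIso_iff_isIso_or_isAntiIso (hP : P.IsPathGeometry) (hP' : P'.IsPathGeometry)
    (f : OpenPartialHomeomorph P.carrier P'.carrier) (hconn : IsPreconnected f.source) :
    CRManifold.IsCRIso (C := P.toCR) (C' := P'.toCR) f ↔ IsIso f ∨ IsAntiIso f := by
  constructor
  · intro h
    have hpt := fun x (hx : x ∈ f.source) => mapsOnto_or_mapsOnto_swap hP hP' h hx
    obtain ⟨hdf, hD, hJ⟩ := isCRIso_toCR_iff.1 h
    let S : Set P.carrier := {x | x ∈ f.source ∧ MapsOnto (tmap ℝ f x) (P.l₁ x) (P'.l₁ (f x)) ∧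
      MapsOnto (tmap ℝ f x) (P.l₂ x) (P'.l₂ (f x))}
    let S' : Set P.carrier := {x | x ∈ f.source ∧ MapsOnto (tmap ℝ f x) (P.l₁ x) (P'.l₂ (f x)) ∧
      MapsOnto (tmap ℝ f x) (P.l₂ x) (P'.l₁ (f x))}
    have hdisj : Disjoint S S' := by
      rw [Set.disjoint_left]
      rintro x ⟨hx, h1, -⟩ ⟨-, h2, -⟩
      apply hP.l₁_ne_bot x
      rw [Submodule.eq_bot_iff]
      intro a ha
      apply hdf.injective hx
      rw [map_zero]
      exact Submodule.disjoint_def.1 (hP'.disjoint (f x)) _ (h1.mem ha) (h2.mem ha)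
    have hS : IsOpen S := by
      rw [isOpen_iff_mem_nhds]
      rintro x ⟨hx, h1, h2⟩
      obtain ⟨U, Z₁, Z₂, hfr, hxU⟩ := hP.exists_frame x
      obtain ⟨U', Z₁', Z₂', hfr', hxU'⟩ := hP'.exists_frame (f x)
      have hxe := mem_chart_source C3 x
      have hxe' := mem_chart_source C3 (f x)
      -- Openness: preserving `L₁` at `x` means that its generator is not taken into the second
      -- direction field, which persists nearby and excludes the exchange.
      have hn : tmap ℝ f x _ ∉ P'.l₂ (f x) := fun hn => hfr.tmap_symm_ne_zero₁ hxe hxU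
        (hdf.injective hx (by
          rw [map_zero]
          exact Submodule.disjoint_def.1 (hP'.disjoint (f x)) _
            (h1.mem (hfr.tmap_symm_mem₁ hxe hxU)) hn))
      filter_upwards [eventually_notMem_direction hfr.diffeo hfr'.diffeo hdf hfr.isOpen
        hfr'.isOpen hfr.hol₁ hfr'.hol₂ (L := P'.l₂) hfr'.mem₂ hx hxe hxU hxe' hxU'
        (ne_zero_of_det3_mid (hfr'.indep _ hxU')) hn, f.open_source.mem_nhds hx,
        (chartAt C3 x).open_source.mem_nhds hxe,
        ((chartAt C3 x).continuousAt hxe).preimage_mem_nhds (hfr.isOpen.mem_nhds hxU)]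
        with y hy hyf hye hyU
      rcases hpt y hyf with hh | hh
      · exact ⟨hyf, hh⟩
      · exact absurd (hh.1.mem (hfr.tmap_symm_mem₁ hye hyU)) hy
    have hS' : IsOpen S' := by
      rw [isOpen_iff_mem_nhds]
      rintro x ⟨hx, h1, h2⟩
      obtain ⟨U, Z₁, Z₂, hfr, hxU⟩ := hP.exists_frame x
      obtain ⟨U', Z₁', Z₂', hfr', hxU'⟩ := hP'.exists_frame (f x)
      have hxe := mem_chart_source C3 x
      have hxe' := mem_chart_source C3 (f x)
      have hn : tmap ℝ f x _ ∉ P'.l₁ (f x) := fun hn => hfr.tmap_symm_ne_zero₁ hxe hxU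
        (hdf.injective hx (by
          rw [map_zero]
          exact Submodule.disjoint_def.1 (hP'.disjoint (f x)) _ hn
            (h1.mem (hfr.tmap_symm_mem₁ hxe hxU))))
      filter_upwards [eventually_notMem_direction hfr.diffeo hfr'.diffeo hdf hfr.isOpen
        hfr'.isOpen hfr.hol₁ hfr'.hol₁ (L := P'.l₁) hfr'.mem₁ hx hxe hxU hxe' hxU'
        (ne_zero_of_det3_left (hfr'.indep _ hxU')) hn, f.open_source.mem_nhds hx,
        (chartAt C3 x).open_source.mem_nhds hxe,
        ((chartAt C3 x).continuousAt hxe).preimage_mem_nhds (hfr.isOpen.mem_nhds hxU)]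
        with y hy hyf hye hyU
      rcases hpt y hyf with hh | hh
      · exact absurd (hh.1.mem (hfr.tmap_symm_mem₁ hye hyU)) hy
      · exact ⟨hyf, hh⟩
    rcases hconn.subset_or_subset hS hS' hdisj (fun x hx => (hpt x hx).imp
      (fun hh => ⟨hx, hh⟩) fun hh => ⟨hx, hh⟩) with hsub | hsub
    · left
      rw [← isSplitCRIso_iff_isIso hP hP', isSplitCRIso_toCR_iff]
      exact ⟨h, fun x hx => (hsub hx).2.1, fun x hx => (hsub hx).2.2⟩
    · right
      rw [isAntiIso_iff]
      refine ⟨hdf, fun x hx a => ?_, fun x hx => (hsub hx).2.1, fun x hx => (hsub hx).2.2⟩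
      obtain ⟨U, Z₁, Z₂, hfr, hxU⟩ := hP.exists_frame x
      -- Composition with the conjugation of `ℂ³` reduces antiholomorphic maps to holomorphic ones.
      let κ : C3 →L[ℝ] C3 := ContinuousLinearMap.pi fun i =>
        (Complex.conjCLE : ℂ →L[ℝ] ℂ) ∘L ContinuousLinearMap.proj i
      have hκ : ∀ v i, κ v i = starRingEnd ℂ (v i) := fun v i => rfl
      have := hfr.tmap_I_smul hdf (κ := κ) (σ := -1) (by norm_num)
        (fun v => by ext i; simp [hκ]) (fun v w hvw => by
          ext i
          have := congrFun hvw i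
          rw [hκ, hκ] at this
          exact (starRingEnd ℂ).injective this) ?_ ?_ hx (mem_chart_source C3 x) hxU a
      · simpa using this
      · intro y hy a ha
        have h1 := hJ y hy a (Submodule.mem_sup_left ha)
        rw [twist_left (hP.disjoint y) ha,
          twist_right (hP'.disjoint (f y)) ((hsub hy).2.1.mem ha)] at h1
        rw [h1, neg_smul, one_smul]
      · intro y hy a ha
        have h1 := hJ y hy a (Submodule.mem_sup_right ha)
        rw [twist_right (hP.disjoint y) ha, map_neg,
          twist_left (hP'.disjoint (f y)) ((hsub hy).2.2.mem ha)] at h1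
        rw [neg_smul, one_smul, ← h1, neg_neg]
  · rintro (h | h)
    · exact (isSplitCRIso_toCR_iff.1 ((isSplitCRIso_iff_isIso hP hP' f).2 h)).1
    · obtain ⟨hf, ha, h₁, h₂⟩ := isAntiIso_iff.1 h
      rw [isCRIso_toCR_iff]
      refine ⟨hf, fun x hx => ?_, fun x hx a haD => ?_⟩
      · rw [sup_comm (P'.l₁ (f x))]
        exact (h₁ x hx).sup (h₂ x hx)
      · obtain ⟨b, hb, c, hc, rfl⟩ := Submodule.mem_sup.1 haD
        rw [twist_add (hP.disjoint x) hb hc, map_add, add_comm (tmap ℝ f x b),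
          twist_add (hP'.disjoint (f x)) ((h₂ x hx).mem hc) ((h₁ x hx).mem hb), map_sub,
          ha x hx, ha x hx]
        abel

end Threefold

/-! ### The 3-fold of an ODE -/

/-- The chart at a point has the identity as its differential there. -/
theorem tmap_chartAt {𝕜 : Type*} [RCLike 𝕜] [NormedSpace 𝕜 C3] {M : Type*} [TopologicalSpace M]
    [ChartedSpace C3 M] [IsManifold 𝓘(𝕜, C3) ∞ M] (x : M) (a : C3) :
    tmap 𝕜 (chartAt C3 x : OpenPartialHomeomorph M C3) x a = a := by
  have : IsManifold 𝓘(𝕜, C3) 1 M := .of_le (n := ∞) (by simp)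
  have h := mfderiv_chartAt_eq_tangentCoordChange (I := 𝓘(𝕜, C3)) (mem_chart_source C3 x)
  have h2 : tangentCoordChange 𝓘(𝕜, C3) x x x a = a :=
    tangentCoordChange_self (I := 𝓘(𝕜, C3)) (mem_extChartAt_source x)
  exact (DFunLike.congr_fun h a).trans h2

namespace ComplexODE

variable (o : ComplexODE)

/-- The coordinates `x`, `y`, `p` on the 3-fold of an ODE. -/
def coord (q : o.dom) : OpenPartialHomeomorph o.toThreefold.carrier C3 :=
  chartAt C3 (show o.toThreefold.carrier from q)

theorem coord_apply (q : o.dom) (y : o.dom) : o.coord q y = (y : C3) := rfl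

theorem coord_source (q : o.dom) : (o.coord q).source = univ := by
  ext y
  refine ⟨fun _ => mem_univ _, fun _ => ?_⟩
  exact mem_chart_source C3 (show o.toThreefold.carrier from y)

theorem coord_mem_source (q y : o.dom) : (show o.toThreefold.carrier from y) ∈ (o.coord q).source := by
  rw [coord_source]; trivial

theorem coord_target (q : o.dom) : (o.coord q).target = o.dom := by
  ext z
  constructor
  · intro hz
    have := (o.coord q).right_inv hz
    rw [← this]
    exact ((o.coord q).symm z : o.dom).2
  · intro hz
    exact (o.coord q).map_source (o.coord_mem_source q ⟨z, hz⟩)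

theorem isDiffeoOn_coord (q : o.dom) : IsDiffeoOn ℂ (o.coord q) :=
  isDiffeoOn_chart (M := o.toThreefold.carrier) q

theorem tmap_coord (q y : o.dom) (a : C3) :
    tmap ℂ (o.coord q) (show o.toThreefold.carrier from y) a = a :=
  tmap_chartAt (M := o.toThreefold.carrier) y a

theorem tmap_coord_symm (q y : o.dom) (a : C3) :
    tmap ℂ (o.coord q).symm (y : C3) a = a := by
  have := (o.isDiffeoOn_coord q).tmap_symm_tmap (o.coord_mem_source q y) a
  rwa [tmap_coord, coord_apply] at this

/-- The total derivative `∂_x + p ∂_y + B ∂_p`. -/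
def total (z : C3) : C3 := ![1, z 2, o.B z]

theorem contDiffOn_total : ContDiffOn ℂ ∞ o.total o.dom := by
  rw [contDiffOn_pi]
  intro i
  fin_cases i
  · exact contDiffOn_const
  · exact (contDiff_apply ℂ ℂ (2 : Fin 3)).contDiffOn
  · exact o.holomorphic

theorem mem_l₁_iff (q : o.dom) (a : C3) :
    a ∈ o.toThreefold.l₁ q ↔ ∃ c : ℂ, a = c • ![0, 0, 1] := by
  refine Submodule.mem_span_singleton.trans (exists_congr fun c => eq_comm)

theorem mem_l₂_iff (q : o.dom) (a : C3) :
    a ∈ o.toThreefold.l₂ q ↔ ∃ c : ℂ, a = c • o.total q := by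
  refine Submodule.mem_span_singleton.trans (exists_congr fun c => eq_comm)

/-- `[∂_p, ∂_x + p ∂_y + B ∂_p] = ∂_y + B_p ∂_p`, so the determinant of the frame is 1 for every
`B`. -/
theorem isFrame (q : o.dom) :
    o.toThreefold.IsFrame (o.coord q) o.dom (fun _ => ![0, 0, 1]) o.total where
  diffeo := o.isDiffeoOn_coord q
  isOpen := o.dom.isOpen
  subset := (o.coord_target q).ge
  hol₁ := contDiffOn_const
  hol₂ := o.contDiffOn_total
  mem₁ y _ _ a := by
    refine (o.mem_l₁_iff y a).trans (exists_congr fun c => ?_)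
    rw [show tmap ℂ (o.coord q) y a = a from o.tmap_coord q y a]
  mem₂ y _ _ a := by
    refine (o.mem_l₂_iff y a).trans (exists_congr fun c => ?_)
    rw [show tmap ℂ (o.coord q) y a = a from o.tmap_coord q y a]
    rfl
  indep z hz := by
    have hd : DifferentiableAt ℂ o.total z :=
      (o.contDiffOn_total.contDiffAt (o.dom.isOpen.mem_nhds hz)).differentiableAt (by simp)
    have hp := hasFDerivAt_pi'.1 hd.hasFDerivAt
    have h0 : fderiv ℂ o.total z ![0, 0, 1] 0 = 0 := by
      have := (hp 0).unique (hasFDerivAt_const (1 : ℂ) z)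
      exact DFunLike.congr_fun this ![0, 0, 1]
    have h1 : fderiv ℂ o.total z ![0, 0, 1] 1 = 1 := by
      have := (hp 1).unique (hasFDerivAt_apply (𝕜 := ℂ) (2 : Fin 3) z)
      exact DFunLike.congr_fun this ![0, 0, 1]
    simp [det3, VectorField.lieBracket, total, h0, h1]

theorem isPathGeometry : o.toThreefold.IsPathGeometry :=
  Threefold.isPathGeometry_of_frames fun q =>
    ⟨_, _, _, _, o.isFrame q, o.coord_mem_source q q, Subtype.prop (show o.dom from q)⟩

end ComplexODE

/-! ### Normal form of a non-involutive triple -/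

theorem isDiffeoOn_of_contDiffOn {𝕜 : Type*} [RCLike 𝕜] [NormedSpace 𝕜 C3]
    {φ : OpenPartialHomeomorph C3 C3} (h : ContDiffOn 𝕜 ∞ φ φ.source)
    (h' : ContDiffOn 𝕜 ∞ φ.symm φ.target) : IsDiffeoOn 𝕜 φ :=
  ⟨contMDiffOn_iff_contDiffOn.2 h, contMDiffOn_iff_contDiffOn.2 h'⟩

namespace Threefold

variable {P : Threefold.{u}}

theorem mapsOnto_of_line {T : C3 →L[ℝ] C3} {A B : Submodule ℂ C3} {S R : C3 →L[ℂ] C3} {z z' : C3}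
    (hA : ∀ a, a ∈ A ↔ ∃ c : ℂ, S a = c • z) (hB : ∀ b, b ∈ B ↔ ∃ c : ℂ, b = c • z')
    (hT : ∀ a, T a = R (S a)) (hS : Function.Surjective S) {k : ℂ} (hk : k ≠ 0)
    (hR : R z = k • z') : MapsOnto T A B := by
  intro b
  rw [hB]
  constructor
  · rintro ⟨c, rfl⟩
    obtain ⟨a, ha⟩ := hS ((c / k) • z)
    refine ⟨a, (hA a).2 ⟨_, ha⟩, ?_⟩
    rw [hT, ha, map_smul, hR, smul_smul, div_mul_cancel₀ _ hk]
  · rintro ⟨a, ha, rfl⟩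
    obtain ⟨c, hc⟩ := (hA a).1 ha
    exact ⟨c * k, by rw [hT, hc, map_smul, hR, smul_smul]⟩

/-- Coordinates which take the generators of `L₁` and `L₂` to multiples of those of an ODE define
a local isomorphism to the 3-fold of the ODE. -/
theorem IsFrame.exists_isIso {e : OpenPartialHomeomorph P.carrier C3} {U : Set C3}
    {Z₁ Z₂ : C3 → C3} (h : P.IsFrame e U Z₁ Z₂) {o : ComplexODE}
    {φ : OpenPartialHomeomorph C3 C3} (hφ : IsDiffeoOn ℂ φ) (hsrc : φ.source ⊆ U)
    (htgt : φ.target ⊆ o.dom)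
    (h₁ : ∀ z ∈ φ.source, ∃ k : ℂ, k ≠ 0 ∧ fderiv ℂ φ z (Z₁ z) = k • ![0, 0, 1])
    (h₂ : ∀ z ∈ φ.source, ∃ k : ℂ, k ≠ 0 ∧ fderiv ℂ φ z (Z₂ z) = k • o.total (φ z))
    {x : P.carrier} (hx : x ∈ e.source) (hxφ : e x ∈ φ.source) :
    ∃ f : OpenPartialHomeomorph P.carrier o.toThreefold.carrier, x ∈ f.source ∧
      f x = (⟨φ (e x), htgt (φ.map_source hxφ)⟩ : o.dom) ∧ IsIso f := by
  let q : o.dom := ⟨φ (e x), htgt (φ.map_source hxφ)⟩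
  have hc := o.isDiffeoOn_coord q
  have heφ := h.diffeo.trans hφ
  let f : OpenPartialHomeomorph P.carrier o.toThreefold.carrier :=
    (e.trans φ).trans (o.coord q).symm
  have hf : IsDiffeoOn ℂ f := heφ.trans hc.symm
  have hs : ∀ y ∈ f.source, y ∈ e.source ∧ e y ∈ φ.source ∧ φ (e y) ∈ (o.coord q).target ∧
      y ∈ (e.trans φ).source := by
    intro y hy
    have : (y ∈ e.source ∧ e y ∈ φ.source) ∧ φ (e y) ∈ (o.coord q).target := by
      simpa [f, OpenPartialHomeomorph.trans_source] using hy
    exact ⟨this.1.1, this.1.2, this.2, by rw [e.trans_source]; exact this.1⟩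
  have hfy : ∀ y ∈ f.source, ((show o.dom from f y) : C3) = φ (e y) := fun y hy =>
    (o.coord q).right_inv (hs y hy).2.2.1
  have ht : ∀ y ∈ f.source, ∀ a, tmap ℝ f y a = fderiv ℂ φ (e y) (tmap ℂ e y a) := by
    intro y hy a
    obtain ⟨hy1, hy2, hy3, hy4⟩ := hs y hy
    rw [hf.tmap_real hy]
    simp only [f]
    rw [heφ.tmap_comp hc.symm hy4 hy3, h.diffeo.tmap_comp hφ hy1 hy2, tmap_eq_fderiv]
    have := o.tmap_coord_symm q (show o.dom from f y)
      (fderiv ℂ φ (e y) (tmap ℂ e y a))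
    rwa [hfy y hy] at this
  have hxs : x ∈ f.source := by
    have h3 : φ (e x) ∈ (o.coord q).target := by
      rw [o.coord_target]; exact q.2
    simp only [f, OpenPartialHomeomorph.trans_source, OpenPartialHomeomorph.symm_source,
      mem_inter_iff, mem_preimage]
    exact ⟨⟨hx, hxφ⟩, h3⟩
  refine ⟨f, hxs, Subtype.ext (hfy x hxs), isIso_iff.2 ⟨hf, fun y hy => ?_, fun y hy => ?_⟩⟩
  · obtain ⟨k, hk, hk'⟩ := h₁ _ (hs y hy).2.1
    exact mapsOnto_of_line (h.mem₁ y (hs y hy).1 (hsrc (hs y hy).2.1)) (o.mem_l₁_iff _) (ht y hy)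
      (fun b => ⟨_, h.diffeo.tmap_tmap_symm' (hs y hy).1 b⟩) hk hk'
  · obtain ⟨k, hk, hk'⟩ := h₂ _ (hs y hy).2.1
    rw [← hfy y hy] at hk'
    exact mapsOnto_of_line (h.mem₂ y (hs y hy).1 (hsrc (hs y hy).2.1)) (o.mem_l₂_iff _) (ht y hy)
      (fun b => ⟨_, h.diffeo.tmap_tmap_symm' (hs y hy).1 b⟩) hk hk'

/-- The derivative of a function along a bracket, if it is invariant under the first field. -/
theorem fderiv_lieBracket_of_invariant {g : C3 → ℂ} {X Y : C3 → C3} {V : Set C3} (hV : IsOpen V)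
    (hg : ContDiffOn ℂ ∞ g V) (hX : ContDiffOn ℂ ∞ X V) (hY : ContDiffOn ℂ ∞ Y V)
    (h0 : ∀ z ∈ V, fderiv ℂ g z (X z) = 0) {z : C3} (hz : z ∈ V) :
    fderiv ℂ g z (VectorField.lieBracket ℂ X Y z) =
      fderiv ℂ (fun w => fderiv ℂ g w (Y w)) z (X z) := by
  have hga := hg.contDiffAt (hV.mem_nhds hz)
  have hX' := (hX.contDiffAt (hV.mem_nhds hz)).differentiableAt (by simp)
  have hY' := (hY.contDiffAt (hV.mem_nhds hz)).differentiableAt (by simp)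
  have hg' : DifferentiableAt ℂ (fderiv ℂ g) z :=
    (hga.fderiv_right (m := ∞) (by simp)).differentiableAt (by simp)
  have hsymm : IsSymmSndFDerivAt ℂ g z :=
    hga.isSymmSndFDerivAt (by simp; exact ENat.LEInfty.out)
  have hder : ∀ {W : C3 → C3}, DifferentiableAt ℂ W z → ∀ v,
      fderiv ℂ (fun w => fderiv ℂ g w (W w)) z v =
        fderiv ℂ (fderiv ℂ g) z v (W z) + fderiv ℂ g z (fderiv ℂ W z v) := by
    intro W hW v
    rw [fderiv_clm_apply hg' hW]
    simp [add_comm]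
  -- In `dg([X, Y]) = X(Y g) - Y(X g)` the last term vanishes because `X g = 0` near the point.
  have h1 : fderiv ℂ (fun w => fderiv ℂ g w (X w)) z (Y z) = 0 := by
    have : (fun w => fderiv ℂ g w (X w)) =ᶠ[𝓝 z] fun _ => 0 := by
      filter_upwards [hV.mem_nhds hz] with w hw using h0 w hw
    rw [this.fderiv_eq]
    simp
  rw [hder hX'] at h1
  rw [hder hY', VectorField.lieBracket, map_sub, hsymm.eq (X z) (Y z)]
  linear_combination -h1

/-- First integrals `ξ`, `η` of `L₁` serve as `x`, `y`, and the slope `p = Z₂ η / Z₂ ξ` of the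
projection of `L₂` as the third coordinate. Then `Z₁` is a multiple of `∂_p`, and `Z₂` is `Z₂ ξ`
times `∂_x + p ∂_y + B ∂_p` with `B = Z₂ p / Z₂ ξ`. -/
theorem exists_isIso_toThreefold (hP : P.IsPathGeometry) (n : P.carrier) :
    ∃ (o : ComplexODE) (f : OpenPartialHomeomorph P.carrier o.toThreefold.carrier),
      n ∈ f.source ∧ IsIso f := by
  obtain ⟨U, Z₁, Z₂, h, hnU⟩ := hP.exists_frame n
  set e : OpenPartialHomeomorph P.carrier C3 := chartAt C3 n with he
  have hne : n ∈ e.source := mem_chart_source C3 n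
  have hdet := h.indep _ hnU
  obtain ⟨V, g, hV, hnV, hVU, hg, hker⟩ := exists_first_integrals h.isOpen h.hol₁ hnU
    (ne_zero_of_det3_left hdet)
  -- `Z₂` is not tangent to `L₁`, so it does not annihilate both first integrals; the one it does
  -- not annihilate is taken as `x`.
  have hnz : fderiv ℂ g (e n) (Z₂ (e n)) ≠ 0 := by
    intro h0
    obtain ⟨r, hr⟩ := (hker _ hnV _).1 h0
    apply hdet
    rw [hr]
    simp [det3]
    ring
  have hgi := contDiffOn_pi.1 hg
  have hgd : ∀ z ∈ V, ∀ a i, fderiv ℂ g z a i = fderiv ℂ (fun w => g w i) z a := by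
    intro z hz a i
    have := ((hg.contDiffAt (hV.mem_nhds hz)).differentiableAt (by simp)).hasFDerivAt
    rw [((hasFDerivAt_pi'.1 this) i).fderiv]
    rfl
  obtain ⟨i, hi⟩ := Function.ne_iff.1 hnz
  obtain ⟨j, hij⟩ : ∃ j : Fin 2, ∀ k, k = i ∨ k = j := by
    fin_cases i
    · exact ⟨1, by decide⟩
    · exact ⟨0, by decide⟩
  let ξ : C3 → ℂ := fun w => g w i
  let η : C3 → ℂ := fun w => g w j
  have hker' : ∀ z ∈ V, ∀ a, fderiv ℂ ξ z a = 0 → fderiv ℂ η z a = 0 → ∃ r : ℂ, a = r • Z₁ z := by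
    intro z hz a h1 h2
    refine (hker z hz a).1 (funext fun k => ?_)
    rw [hgd z hz]
    rcases hij k with rfl | rfl
    · exact h1
    · exact h2
  have hZ₁ : ∀ z ∈ V, ∀ k, fderiv ℂ (fun w => g w k) z (Z₁ z) = 0 := by
    intro z hz k
    rw [← hgd z hz, (hker z hz (Z₁ z)).2 ⟨1, (one_smul _ _).symm⟩]
    rfl
  have h1V := h.hol₁.mono hVU
  have h2V := h.hol₂.mono hVU
  have hderiv : ∀ {g : C3 → ℂ} {V : Set C3}, IsOpen V → ContDiffOn ℂ ∞ g V → V ⊆ U →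
      ContDiffOn ℂ ∞ (fun z => fderiv ℂ g z (Z₂ z)) V := by
    intro g V hV hg hVU
    exact (hg.fderiv_of_isOpen (m := ∞) hV (by simp)).clm_apply (h.hol₂.mono hVU)
  let α : C3 → ℂ := fun z => fderiv ℂ ξ z (Z₂ z)
  let β : C3 → ℂ := fun z => fderiv ℂ η z (Z₂ z)
  have hα : ContDiffOn ℂ ∞ α V := hderiv hV (hgi i) hVU
  have hβ : ContDiffOn ℂ ∞ β V := hderiv hV (hgi j) hVU
  have hαn : α (e n) ≠ 0 := by
    have := hi
    rwa [hgd _ hnV] at this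
  let V' : Set C3 := V ∩ α ⁻¹' {0}ᶜ
  have hV' : IsOpen V' := hα.continuousOn.isOpen_inter_preimage hV isOpen_compl_singleton
  have hnV' : e n ∈ V' := ⟨hnV, hαn⟩
  let p : C3 → ℂ := fun z => β z / α z
  have hp : ContDiffOn ℂ ∞ p V' :=
    (hβ.mono inter_subset_left).div (hα.mono inter_subset_left) fun z hz => hz.2
  let Φ : C3 → C3 := fun z => ![ξ z, η z, p z]
  have hΦ : ContDiffOn ℂ ∞ Φ V' := by
    rw [contDiffOn_pi]
    intro k
    fin_cases k
    · exact (hgi i).mono inter_subset_left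
    · exact (hgi j).mono inter_subset_left
    · exact hp
  have hdΦ : ∀ z ∈ V', ∀ a, fderiv ℂ Φ z a = ![fderiv ℂ ξ z a, fderiv ℂ η z a, fderiv ℂ p z a] := by
    intro z hz a
    have := ((hΦ.contDiffAt (hV'.mem_nhds hz)).differentiableAt (by simp)).hasFDerivAt
    have h3 := hasFDerivAt_pi'.1 this
    ext k
    fin_cases k
    · exact DFunLike.congr_fun (h3 0).fderiv.symm a
    · exact DFunLike.congr_fun (h3 1).fderiv.symm a
    · exact DFunLike.congr_fun (h3 2).fderiv.symm a
  -- Suppose `Z₁ p = 0`. Then `T = [Z₁, Z₂]` satisfies `T η = p T ξ`, so `T - (T ξ / Z₂ ξ) Z₂`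
  -- annihilates both first integrals and is a multiple of `Z₁`. This contradicts non-involutivity.
  have hpZ : fderiv ℂ p (e n) (Z₁ (e n)) ≠ 0 := by
    intro h0
    have hα' := (hα.contDiffAt (hV.mem_nhds hnV)).differentiableAt (by simp)
    have hβ' := (hβ.contDiffAt (hV.mem_nhds hnV)).differentiableAt (by simp)
    have hp' := (hp.contDiffAt (hV'.mem_nhds hnV')).differentiableAt (by simp)
    have hξT := fderiv_lieBracket_of_invariant hV (hgi i) h1V h2V (fun z hz => hZ₁ z hz i) hnV
    have hηT := fderiv_lieBracket_of_invariant hV (hgi j) h1V h2V (fun z hz => hZ₁ z hz j) hnV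
    set T := VectorField.lieBracket ℂ Z₁ Z₂ (e n)
    have hmul : fderiv ℂ β (e n) (Z₁ (e n)) = p (e n) * fderiv ℂ α (e n) (Z₁ (e n)) := by
      have hev : β =ᶠ[𝓝 (e n)] fun z => p z * α z := by
        filter_upwards [hV'.mem_nhds hnV'] with z hz
        exact (div_mul_cancel₀ _ hz.2).symm
      rw [hev.fderiv_eq, fderiv_fun_mul hp' hα']
      simp [h0]
    obtain ⟨r, hr⟩ := hker' _ hnV (T - (fderiv ℂ ξ (e n) T / α (e n)) • Z₂ (e n))
      (by
        rw [map_sub, map_smul, smul_eq_mul]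
        exact sub_eq_zero.2 (div_mul_cancel₀ _ hαn).symm)
      (by
        rw [map_sub, map_smul, smul_eq_mul]
        have e1 : fderiv ℂ η (e n) T = p (e n) * fderiv ℂ ξ (e n) T := by
          rw [show fderiv ℂ η (e n) T = _ from hηT, show fderiv ℂ ξ (e n) T = _ from hξT]
          exact hmul
        rw [e1]
        simp only [p]
        ring)
    apply hdet
    rw [show T = r • Z₁ (e n) + (fderiv ℂ ξ (e n) T / α (e n)) • Z₂ (e n) by
      rw [← hr, sub_add_cancel]]
    exact det3_comb₃ _ _ _ _
  have hinj : Function.Injective (fderiv ℂ Φ (e n)) := by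
    rw [injective_iff_map_eq_zero]
    intro a ha
    rw [hdΦ _ hnV'] at ha
    obtain ⟨r, rfl⟩ := hker' _ hnV a (congrFun ha 0) (congrFun ha 1)
    have h2 : fderiv ℂ p (e n) (r • Z₁ (e n)) = 0 := congrFun ha 2
    rw [map_smul, smul_eq_mul] at h2
    rw [(mul_eq_zero.1 h2).resolve_right hpZ, zero_smul]
  obtain ⟨S, hS⟩ := exists_equiv_of_injective hinj
  obtain ⟨φ, hφΦ, hnφ, hφV', hφs, hφd⟩ := exists_openPartialHomeomorph_of_contDiffOn hV' hΦ hnV'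
    hS.symm
  have hφ : ContDiffOn ℂ ∞ φ φ.source := by rw [hφΦ]; exact hΦ.mono hφV'
  let b : C3 → ℂ := fun z => fderiv ℂ p z (Z₂ z) / α z
  have hb : ContDiffOn ℂ ∞ b V' := (hderiv hV' hp (inter_subset_left.trans hVU)).div
    (hα.mono inter_subset_left) fun z hz => hz.2
  let o : ComplexODE := ⟨⟨φ.target, φ.open_target⟩, fun w => b (φ.symm w),
    hb.comp hφs fun w hw => hφV' (φ.map_target hw)⟩
  obtain ⟨f, hf, -, hiso⟩ := h.exists_isIso (o := o) (isDiffeoOn_of_contDiffOn hφ hφs)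
    (hφV'.trans (inter_subset_left.trans hVU)) Subset.rfl
    (fun z hz => by
      -- On the whole source the multiple `Z₁ p` is nonzero because the differential of the chart is
      -- injective.
      refine ⟨fderiv ℂ p z (Z₁ z), fun h0 => ?_, ?_⟩
      · obtain ⟨T, hT⟩ := hφd z hz
        have h1 : T (Z₁ z) = 0 := by
          have := hdΦ z (hφV' hz) (Z₁ z)
          rw [hT.fderiv] at this
          refine Eq.trans this ?_
          rw [h0, hZ₁ z (hφV' hz).1 i, hZ₁ z (hφV' hz).1 j]
          ext k; fin_cases k <;> rfl
        exact ne_zero_of_det3_left (h.indep z (hVU (hφV' hz).1))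
          (T.injective (h1.trans (map_zero T).symm))
      · rw [hφΦ, hdΦ z (hφV' hz), hZ₁ z (hφV' hz).1 i, hZ₁ z (hφV' hz).1 j]
        ext k; fin_cases k <;> simp)
    (fun z hz => by
      have hαz : α z ≠ 0 := (hφV' hz).2
      refine ⟨α z, hαz, ?_⟩
      have hB : o.B (φ z) = b z := congrArg b (φ.left_inv hz)
      rw [ComplexODE.total, hB, hφΦ, hdΦ z (hφV' hz)]
      ext k
      fin_cases k
      · simp [α]
      · simp only [Φ, p, b]
        simp [mul_div_cancel₀ _ hαz, β]
      · simp only [Φ, p, b]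
        simp [mul_div_cancel₀ _ hαz])
    hne hnφ
  exact ⟨o, f, hf, hiso⟩

end Threefold

/-! ### General solutions -/

namespace ComplexODE

variable (o : ComplexODE)

/-- Straighten the total derivative, with the coordinate `x` as time and the points of the slice `x
= q₀` as parameters. The jet map of the second component of the flow box is the flow box itself, and
nondegeneracy and injectivity are inherited. -/
theorem exists_isGeneralSolution (q : o.dom) :
    ∃ (φ : C3 → ℂ) (Ω : Set C3), o.IsGeneralSolution φ Ω ∧ (q : C3) ∈ jet φ '' Ω := by
  obtain ⟨Ψ, ε, hε, hsrc, htgt, hΨ, hΨs, hsl, hT⟩ := exists_flow_box (k := 0) o.dom.isOpen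
    o.contDiffOn_total q.2 (by simp [total])
  have hd : ∀ c ∈ Ψ.source, ∀ i, HasFDerivAt (fun c => Ψ c i)
      (ContinuousLinearMap.proj i ∘L fderiv ℂ Ψ c) c := fun c hc i => by
    obtain ⟨T, hT, -⟩ := hT c hc
    rw [hT.fderiv]
    exact hasFDerivAt_pi'.1 hT i
  have hdT : ∀ c ∈ Ψ.source, fderiv ℂ Ψ c (Pi.single 0 1) = o.total (Ψ c) := fun c hc => by
    obtain ⟨T, hT, hT'⟩ := hT c hc
    rw [hT.fderiv]
    exact hT'
  -- Along the time line through `c` the first component has derivative 1, and on the slice, at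
  -- `c'`, it equals the first coordinate. The line stays in the polydisc, so the two agree at `c`.
  have h0 : ∀ c ∈ Ψ.source, Ψ c 0 = c 0 := by
    intro c hc
    let c' : C3 := Function.update c 0 ((q : C3) 0)
    let γ : ℂ → C3 := fun t => c' + t • Pi.single 0 1
    have hγ0 : ∀ t, γ t 0 = (q : C3) 0 + t := fun t => by simp [γ, c']
    have hγd : ∀ t, HasDerivAt γ (Pi.single 0 1) t := fun t => by
      have := ((hasDerivAt_id t).smul_const (Pi.single 0 1 : C3)).const_add c'
      rwa [one_smul] at this
    have hcq : ∀ i, dist (c i) ((q : C3) i) < ε := by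
      rw [hsrc, Metric.mem_ball, dist_pi_lt_iff hε] at hc
      exact hc
    have hγs : ∀ t ∈ Metric.ball (0 : ℂ) ε, γ t ∈ Ψ.source := by
      intro t ht
      rw [hsrc, Metric.mem_ball, dist_pi_lt_iff hε]
      intro i
      by_cases hi : i = 0
      · subst hi
        rw [hγ0, dist_eq_norm, add_sub_cancel_left]
        simpa using ht
      · simpa [γ, c', hi] using hcq i
    have hder : ∀ t ∈ Metric.ball (0 : ℂ) ε, HasDerivAt (fun t => Ψ (γ t) 0 - t) 0 t := by
      intro t ht
      have h1 := ((hd _ (hγs t ht) 0).comp_hasDerivAt t (hγd t)).sub (hasDerivAt_id t)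
      have h2 : (ContinuousLinearMap.proj (0 : Fin 3) ∘L fderiv ℂ Ψ (γ t)) (Pi.single 0 1)
          - (1 : ℂ) = 0 := by
        change fderiv ℂ Ψ (γ t) (Pi.single 0 1) 0 - 1 = 0
        rw [hdT _ (hγs t ht)]
        simp [total]
      rw [h2] at h1
      exact h1
    have hconst := Metric.isOpen_ball.is_const_of_deriv_eq_zero
      (convex_ball (0 : ℂ) ε).isPreconnected
      (fun t ht => (hder t ht).differentiableAt.differentiableWithinAt)
      (fun t ht => (hder t ht).deriv) (x := 0) (y := c 0 - (q : C3) 0)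
      (Metric.mem_ball_self hε) (by simpa [dist_eq_norm] using hcq 0)
    have e0 : γ 0 = c' := by simp [γ]
    have e1 : γ (c 0 - (q : C3) 0) = c := by
      ext i
      by_cases hi : i = 0
      · subst hi; rw [hγ0]; ring
      · simp [γ, c', hi]
    have e2 : Ψ c' = c' := by
      refine hsl _ ?_ (by simp [c'])
      rw [← e0]
      exact hγs 0 (Metric.mem_ball_self hε)
    rw [e0, e1, e2] at hconst
    have e3 : c' 0 = (q : C3) 0 := by simp [c']
    rw [e3] at hconst
    linear_combination -hconst
  have hpd : ∀ c ∈ Ψ.source, ∀ i, pd 0 (fun c => Ψ c i) c = o.total (Ψ c) i := by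
    intro c hc i
    rw [pd, (hd c hc i).fderiv, ← hdT c hc]
    rfl
  have hpd1 : ∀ c ∈ Ψ.source, pd 0 (fun c => Ψ c 1) c = Ψ c 2 := fun c hc => hpd c hc 1
  -- The components of the total derivative say that `∂_t` takes the second component to the third
  -- and the third to `B`.
  have hjet : ∀ c ∈ Ψ.source, jet (fun c => Ψ c 1) c = Ψ c := by
    intro c hc
    rw [jet, hpd1 c hc]
    ext i
    fin_cases i
    · exact (h0 c hc).symm
    · rfl
    · rfl
  have hq : (q : C3) ∈ Ψ.source := by rw [hsrc]; exact Metric.mem_ball_self hε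
  refine ⟨fun c => Ψ c 1, Ψ.source, ⟨Ψ.open_source, contDiffOn_pi.1 hΨ 1, fun c hc => ?_,
    fun c hc => ?_, ?_, fun c hc => ?_⟩, q, hq, ?_⟩
  · rw [hjet c hc]
    exact htgt (Ψ.map_source hc)
  · have hev : pd 0 (fun c => Ψ c 1) =ᶠ[𝓝 c] fun c => Ψ c 2 := by
      filter_upwards [Ψ.open_source.mem_nhds hc] with d hd using hpd1 d hd
    rw [hjet c hc, pd, hev.fderiv_eq]
    exact hpd c hc 2
  · intro c hc d hd hcd
    rw [hjet c hc, hjet d hd] at hcd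
    exact Ψ.injOn hc hd hcd
  · have hev : jet (fun c => Ψ c 1) =ᶠ[𝓝 c] Ψ := by
      filter_upwards [Ψ.open_source.mem_nhds hc] with d hd using hjet d hd
    obtain ⟨T, hT, -⟩ := hT c hc
    rw [hev.fderiv_eq, hT.fderiv]
    exact T.bijective
  · rw [hjet _ hq, hsl _ hq rfl]

end ComplexODE

/-! ### Solutions and point transformations -/

theorem fderiv_injective_of_contDiffOn {𝕜 E F : Type*} [RCLike 𝕜] [NormedAddCommGroup E]
    [NormedSpace 𝕜 E] [NormedAddCommGroup F] [NormedSpace 𝕜 F] {ψ : OpenPartialHomeomorph E F}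
    (h : ContDiffOn 𝕜 ∞ ψ ψ.source) (h' : ContDiffOn 𝕜 ∞ ψ.symm ψ.target) {x : E}
    (hx : x ∈ ψ.source) : Function.Injective (fderiv 𝕜 ψ x) := by
  have h1 := ((h.contDiffAt (ψ.open_source.mem_nhds hx)).differentiableAt (by simp)).hasFDerivAt
  have h2 := ((h'.contDiffAt (ψ.open_target.mem_nhds (ψ.map_source hx))).differentiableAt
    (by simp)).hasFDerivAt
  have h3 := (h2.comp x h1).congr_of_eventuallyEq (f₁ := id) (by
    filter_upwards [ψ.open_source.mem_nhds hx] with y hy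
    exact (ψ.left_inv hy).symm)
  have h4 := h3.unique (hasFDerivAt_id x)
  exact Function.LeftInverse.injective (g := fderiv 𝕜 ψ.symm (ψ x)) fun a =>
    DFunLike.congr_fun h4 a

namespace ComplexODE

variable {o o' : ComplexODE}

theorem IsSolutionOn.hasDerivAt {y : ℂ → ℂ} {S : Set ℂ} (h : o.IsSolutionOn y S) {t : ℂ}
    (ht : t ∈ S) : HasDerivAt (fun t => ![t, y t, deriv y t]) (o.total ![t, y t, deriv y t]) t := by
  rw [hasDerivAt_pi]
  have hn := h.isOpen.mem_nhds ht
  intro i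
  fin_cases i
  · exact hasDerivAt_id t
  · exact ((h.holomorphic t ht).differentiableAt hn).hasDerivAt
  · have := (((h.holomorphic.deriv h.isOpen) t ht).differentiableAt hn).hasDerivAt
    rw [h.eq t ht] at this
    exact this

/-- Freeze the two parameters of a general solution at the values belonging to `q`. -/
theorem exists_isSolutionOn (q : o.dom) : ∃ (y : ℂ → ℂ) (S : Set ℂ), o.IsSolutionOn y S ∧
    (q : C3) 0 ∈ S ∧ ![(q : C3) 0, y ((q : C3) 0), deriv y ((q : C3) 0)] = (q : C3) := by
  obtain ⟨φ, Ω, h, c, hc, hcq⟩ := o.exists_isGeneralSolution q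
  let γ : ℂ → C3 := fun t => ![t, c 1, c 2]
  have hγ : ∀ t, HasDerivAt γ (Pi.single 0 1) t := fun t => by
    rw [hasDerivAt_pi]
    intro i
    fin_cases i
    · exact hasDerivAt_id t
    · exact hasDerivAt_const t (c 1)
    · exact hasDerivAt_const t (c 2)
  have hS : IsOpen (γ ⁻¹' Ω) := h.isOpen.preimage
    (continuous_iff_continuousAt.2 fun t => (hγ t).continuousAt)
  have hpd : ContDiffOn ℂ ∞ (pd 0 φ) Ω :=
    (h.holomorphic.fderiv_of_isOpen (m := ∞) h.isOpen (by simp)).clm_apply contDiffOn_const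
  have hd : ∀ {g : C3 → ℂ}, ContDiffOn ℂ ∞ g Ω → ∀ t ∈ γ ⁻¹' Ω,
      HasDerivAt (fun t => g (γ t)) (pd 0 g (γ t)) t := fun hg t ht =>
    (((hg.contDiffAt (h.isOpen.mem_nhds ht)).differentiableAt (by simp)).hasFDerivAt).comp_hasDerivAt
      t (hγ t)
  have hd1 : ∀ t ∈ γ ⁻¹' Ω, deriv (fun t => φ (γ t)) t = pd 0 φ (γ t) := fun t ht =>
    (hd h.holomorphic t ht).deriv
  have hj : ∀ t ∈ γ ⁻¹' Ω, ![t, φ (γ t), deriv (fun t => φ (γ t)) t] = jet φ (γ t) := by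
    intro t ht
    rw [hd1 t ht]
    rfl
  have hc0 : (q : C3) 0 = c 0 := by rw [← hcq]; rfl
  have hγc : γ (c 0) = c := by ext i; fin_cases i <;> rfl
  refine ⟨fun t => φ (γ t), γ ⁻¹' Ω, ⟨hS, fun t ht =>
    (hd h.holomorphic t ht).differentiableAt.differentiableWithinAt, fun t ht => ?_,
    fun t ht => ?_⟩, ?_, ?_⟩
  · rw [hj t ht]
    exact h.mem _ ht
  · have hev : deriv (fun t => φ (γ t)) =ᶠ[𝓝 t] fun t => pd 0 φ (γ t) := by
      filter_upwards [hS.mem_nhds ht] with s hs using hd1 s hs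
    rw [hj t ht, hev.deriv_eq, (hd hpd t ht).deriv, h.eq _ ht]
  · rw [hc0, mem_preimage, hγc]
    exact hc
  · rw [hc0, hj _ (by rw [mem_preimage, hγc]; exact hc), hγc, hcq]

/-- The projection of the space of 1-jets to the plane. -/
def basePoint : C3 →L[ℂ] ℂ × ℂ :=
  (ContinuousLinearMap.proj (0 : Fin 3)).prod (ContinuousLinearMap.proj (1 : Fin 3))

theorem basePoint_apply (z : C3) : basePoint z = (z 0, z 1) := rfl

/-- The prolongation of a point transformation is an isomorphism of the 3-folds. -/
theorem IsPointTransformation.exists_isIso {q : o.dom} {q' : o'.dom}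
    {ψ : OpenPartialHomeomorph (ℂ × ℂ) (ℂ × ℂ)} (h : o.IsPointTransformation o' q q' ψ) :
    ∃ f : OpenPartialHomeomorph o.toThreefold.carrier o'.toThreefold.carrier,
      q ∈ f.source ∧ f q = q' ∧ Threefold.IsIso f := by
  have hψ : ∀ z ∈ basePoint ⁻¹' ψ.source, ContDiffAt ℂ ∞ ψ (basePoint z) := fun z hz =>
    h.holomorphic.contDiffAt (ψ.open_source.mem_nhds hz)
  have hψd : ∀ z ∈ basePoint ⁻¹' ψ.source,
      HasFDerivAt ψ (fderiv ℂ ψ (basePoint z)) (basePoint z) := fun z hz =>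
    ((hψ z hz).differentiableAt (by simp)).hasFDerivAt
  have hψi : ∀ z ∈ basePoint ⁻¹' ψ.source, Function.Injective (fderiv ℂ ψ (basePoint z)) :=
    fun z hz => fderiv_injective_of_contDiffOn h.holomorphic h.holomorphic_symm hz
  -- The image of the direction `(1, p)` under `dψ`; its slope `g` is the third component of the
  -- prolongation `Φ`.
  let D : C3 → ℂ × ℂ := fun z => fderiv ℂ ψ (basePoint z) (1, z 2)
  let V₀ : Set C3 := basePoint ⁻¹' ψ.source
  have hV₀ : IsOpen V₀ := ψ.open_source.preimage basePoint.continuous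
  have hD : ContDiffOn ℂ ∞ D V₀ :=
    ((h.holomorphic.fderiv_of_isOpen (m := ∞) ψ.open_source (by simp)).comp
      basePoint.contDiff.contDiffOn fun z hz => hz).clm_apply
      (contDiffOn_const.prodMk (contDiff_apply ℂ ℂ (2 : Fin 3)).contDiffOn)
  obtain ⟨W, hW, hsol⟩ := h.map_solutions
  obtain ⟨W', hW'W, hW', hqW'⟩ := mem_nhds_iff.1 hW
  let V₁ : Set C3 := V₀ ∩ (fun z => (D z).1) ⁻¹' {0}ᶜ
  have hV₁ : IsOpen V₁ := hD.fst.continuousOn.isOpen_inter_preimage hV₀ isOpen_compl_singleton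
  let g : C3 → ℂ := fun z => (D z).2 / (D z).1
  have hg : ContDiffOn ℂ ∞ g V₁ := (hD.snd.mono inter_subset_left).div
    (hD.fst.mono inter_subset_left) fun z hz => hz.2
  let Φ : C3 → C3 := fun z => ![(ψ (basePoint z)).1, (ψ (basePoint z)).2, g z]
  have hψ' : ContDiffOn ℂ ∞ (fun z => ψ (basePoint z)) V₀ :=
    h.holomorphic.comp basePoint.contDiff.contDiffOn fun z hz => hz
  have hΦ : ContDiffOn ℂ ∞ Φ V₁ := by
    rw [contDiffOn_pi]
    intro i
    fin_cases i
    · exact hψ'.fst.mono inter_subset_left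
    · exact hψ'.snd.mono inter_subset_left
    · exact hg
  have hΦd : ∀ z ∈ V₁, ∀ a, fderiv ℂ Φ z a = ![(fderiv ℂ ψ (basePoint z) (basePoint a)).1,
      (fderiv ℂ ψ (basePoint z) (basePoint a)).2, fderiv ℂ g z a] := by
    intro z hz a
    have h1 := hasFDerivAt_pi'.1
      ((hΦ.contDiffAt (hV₁.mem_nhds hz)).differentiableAt (by simp)).hasFDerivAt
    have h2 := (hψd z hz.1).comp z basePoint.hasFDerivAt
    have h3 : HasFDerivAt (fun z => (ψ (basePoint z)).1) _ z := hasFDerivAt_fst.comp z h2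
    have h4 : HasFDerivAt (fun z => (ψ (basePoint z)).2) _ z := hasFDerivAt_snd.comp z h2
    ext i
    fin_cases i
    · exact DFunLike.congr_fun ((h1 0).unique h3) a
    · exact DFunLike.congr_fun ((h1 1).unique h4) a
    · exact DFunLike.congr_fun (h1 2).fderiv.symm a
  let e₂ : C3 := ![0, 0, 1]
  have hbe : basePoint e₂ = 0 := rfl
  -- The `p`-derivative of the slope is the determinant of `D z` and `B = dψ(0, 1)` divided by the
  -- square of the first component of `D z`. If it vanished, `dψ` would annihilate a nonzero
  -- combination of `(0, 1)` and `(1, p)`.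
  have hge : ∀ z ∈ V₁, fderiv ℂ g z e₂ ≠ 0 := by
    intro z hz h0
    have hgz := ((hg.contDiffAt (hV₁.mem_nhds hz)).differentiableAt (by simp)).hasFDerivAt
    have hγ : HasDerivAt (fun t : ℂ => z + t • e₂) e₂ 0 := by
      have := ((hasDerivAt_id (0 : ℂ)).smul_const e₂).const_add z
      rwa [one_smul] at this
    have hγ0 : z + (0 : ℂ) • e₂ = z := by simp
    have hb : ∀ t : ℂ, basePoint (z + t • e₂) = basePoint z := fun t => by
      rw [map_add, map_smul, hbe, smul_zero, add_zero]
    let B := fderiv ℂ ψ (basePoint z) (0, 1)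
    have hDt : ∀ t : ℂ, D (z + t • e₂) = D z + t • B := fun t => by
      simp only [D, B]
      rw [hb, ← map_smul, ← map_add]
      simp [e₂]
    have h1 : HasDerivAt (fun t : ℂ => g (z + t • e₂)) (fderiv ℂ g z e₂) 0 := by
      rw [← hγ0] at hgz
      have := hgz.comp_hasDerivAt (0 : ℂ) hγ
      rwa [hγ0] at this
    have h2 : HasDerivAt (fun t : ℂ => ((D z).2 + t * B.2) / ((D z).1 + t * B.1))
        (((1 * B.2) * ((D z).1 + 0 * B.1) - ((D z).2 + 0 * B.2) * (1 * B.1)) /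
          ((D z).1 + 0 * B.1) ^ 2) 0 :=
      (((hasDerivAt_id (0 : ℂ)).mul_const B.2).const_add _).div
        (((hasDerivAt_id (0 : ℂ)).mul_const B.1).const_add _) (by simpa using hz.2)
    have h3 : (fun t : ℂ => g (z + t • e₂)) =
        fun t : ℂ => ((D z).2 + t * B.2) / ((D z).1 + t * B.1) := by
      ext t
      simp only [g, hDt]
      simp
    rw [h3] at h1
    have h4 := h1.unique h2
    rw [h0] at h4
    have hz2 : (D z).1 ≠ 0 := hz.2
    have h5 : B.2 * (D z).1 - (D z).2 * B.1 = 0 := by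
      have : (B.2 * (D z).1 - (D z).2 * B.1) / (D z).1 ^ 2 = 0 := by
        rw [h4]; ring_nf
      simpa [hz2] using this
    have h6 : fderiv ℂ ψ (basePoint z) ((D z).1 • (0, 1) - B.1 • (1, z 2)) = 0 := by
      rw [map_sub, map_smul, map_smul]
      change (D z).1 • B - B.1 • D z = 0
      ext
      · simp [mul_comm]
      · simp only [Prod.snd_sub, Prod.smul_snd, smul_eq_mul, Prod.snd_zero]
        linear_combination h5
    have h7 := hψi z hz.1 (h6.trans (map_zero _).symm)
    have h8 := congrArg Prod.fst h7
    have h9 := congrArg Prod.snd h7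
    simp at h8
    simp [h8] at h9
    exact hz2 h9
  obtain ⟨c, hc, hdir⟩ := h.map_direction
  have hDq : D q = c • ((1, (q' : C3) 2) : ℂ × ℂ) := hdir
  have hqV₁ : (q : C3) ∈ V₁ := by
    refine ⟨h.mem, ?_⟩
    simp [hDq, hc]
  have hΦq : Φ q = q' := by
    have h1 : ψ (basePoint q) = ((q' : C3) 0, (q' : C3) 1) := h.map_point
    ext i
    fin_cases i
    · simp [Φ, h1]
    · simp [Φ, h1]
    · simp [Φ, g, hDq, hc]
  let V : Set C3 := (V₁ ∩ Φ ⁻¹' o'.dom) ∩ (o.dom ∩ W')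
  have hV : IsOpen V := (hΦ.continuousOn.isOpen_inter_preimage hV₁ o'.dom.isOpen).inter
    (o.dom.isOpen.inter hW')
  have hqV : (q : C3) ∈ V :=
    ⟨⟨hqV₁, by rw [mem_preimage, hΦq]; exact q'.2⟩, q.2, hqW'⟩
  have hVV : V ⊆ V₁ := inter_subset_left.trans inter_subset_left
  have hΦi : Function.Injective (fderiv ℂ Φ q) := by
    rw [injective_iff_map_eq_zero]
    intro a ha
    rw [hΦd _ hqV₁] at ha
    have h1 : basePoint a = 0 := by
      apply hψi _ hqV₁.1
      rw [map_zero]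
      exact Prod.ext (congrFun ha 0) (congrFun ha 1)
    have h2 : a = a 2 • e₂ := by
      ext i
      fin_cases i
      · exact (congrArg Prod.fst h1).trans (mul_zero (a 2)).symm
      · exact (congrArg Prod.snd h1).trans (mul_zero (a 2)).symm
      · simp [e₂]
    have h3 : fderiv ℂ g q a = 0 := congrFun ha 2
    rw [h2, map_smul, smul_eq_mul] at h3
    rw [h2, (mul_eq_zero.1 h3).resolve_right (hge _ hqV₁), zero_smul]
  obtain ⟨T, hT⟩ := exists_equiv_of_injective hΦi
  obtain ⟨φ, hφΦ, hqφ, hφV, hφs, -⟩ := exists_openPartialHomeomorph_of_contDiffOn hV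
    (hΦ.mono hVV) hqV hT.symm
  have hφ : ContDiffOn ℂ ∞ φ φ.source := by rw [hφΦ]; exact hΦ.mono (hφV.trans hVV)
  have htgt : φ.target ⊆ o'.dom := by
    intro w hw
    have := (hφV (φ.map_target hw)).1.2
    rw [mem_preimage, ← hφΦ, φ.right_inv hw] at this
    exact this
  obtain ⟨f, hf, hfq, hiso⟩ := (o.isFrame q).exists_isIso (o := o')
    (isDiffeoOn_of_contDiffOn hφ hφs) (fun z hz => (hφV hz).2.1) htgt
    (fun z hz => by
      refine ⟨fderiv ℂ g z e₂, hge z (hVV (hφV hz)), ?_⟩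
      rw [hφΦ, hΦd z (hVV (hφV hz)), hbe, map_zero]
      ext i
      fin_cases i <;> simp [e₂])
    (fun z hz => by
      have hzV := hφV hz
      have hz1 : (D z).1 ≠ 0 := (hVV hzV).2
      refine ⟨(D z).1, hz1, ?_⟩
      -- The 1-jets of the solution through `z` have velocity the total derivative at `z`. Comparing
      -- them with the 1-jets of the image solution identifies the image of the total derivative
      -- under `dΦ`.
      obtain ⟨y, S, hy, hzS, hyz⟩ := exists_isSolutionOn (⟨z, hzV.2.1⟩ : o.dom)
      set j : ℂ → C3 := fun t => ![t, y t, deriv y t] with hj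
      have hyz' : j (z 0) = z := hyz
      have hjd : ∀ t ∈ S, HasDerivAt j (o.total (j t)) t := fun t ht => hy.hasDerivAt ht
      have hbj : ∀ t, basePoint (j t) = (t, y t) := fun t => rfl
      obtain ⟨v, S', hv, hev⟩ := hsol y S hy (z 0) hzS
        (by rw [← hbj, hyz']; exact (hVV hzV).1)
        (by change j (z 0) ∈ W; rw [hyz']; exact hW'W hzV.2.2)
      have hpos : ∀ᶠ t in 𝓝 (z 0), t ∈ S ∧ j t ∈ V₁ := by
        filter_upwards [hy.isOpen.mem_nhds hzS,
          (hjd _ hzS).continuousAt.preimage_mem_nhds (hV₁.mem_nhds (by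
            rw [hyz']; exact hVV hzV))] with t h1 h2 using ⟨h1, h2⟩
      have hψj : ∀ t, t ∈ S ∧ j t ∈ V₁ → HasDerivAt (fun t => ψ (t, y t)) (D (j t)) t := by
        rintro t ⟨h1, h2⟩
        have := (hψd (j t) h2.1).comp_hasDerivAt t
          (basePoint.hasFDerivAt.comp_hasDerivAt t (hjd t h1))
        exact this
      -- The slope of the image graph is the quotient of the components of the velocity of `ψ (t, y
      -- t)`, that is, the third component of `Φ`.
      have hvj : ∀ᶠ t in 𝓝 (z 0), ![(ψ (t, y t)).1, v (ψ (t, y t)).1, deriv v (ψ (t, y t)).1] =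
          Φ (j t) := by
        filter_upwards [hpos, hev.eventually_nhds] with t ht hevt
        have h1 := hψj t ht
        have hs : HasDerivAt (fun t => (ψ (t, y t)).1) _ t := hasFDerivAt_fst.comp_hasDerivAt t h1
        have hr : HasDerivAt (fun t => (ψ (t, y t)).2) _ t := hasFDerivAt_snd.comp_hasDerivAt t h1
        have hvS := ((hv.holomorphic _ hevt.self_of_nhds.1).differentiableAt
          (hv.isOpen.mem_nhds hevt.self_of_nhds.1)).hasDerivAt
        have h2 := (hvS.comp t hs).congr_of_eventuallyEq (f₁ := fun t => (ψ (t, y t)).2) (by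
          filter_upwards [hevt] with s hs using hs.2)
        have h3 : (D (j t)).2 = deriv v (ψ (t, y t)).1 * (D (j t)).1 := hr.unique h2
        ext i
        fin_cases i
        · rfl
        · exact hevt.self_of_nhds.2.symm
        · change deriv v (ψ (t, y t)).1 = (D (j t)).2 / (D (j t)).1
          rw [h3, mul_div_cancel_right₀ _ ht.2.2]
      have h1 := hψj (z 0) hpos.self_of_nhds
      have hs : HasDerivAt (fun t => (ψ (t, y t)).1) _ (z 0) :=
        hasFDerivAt_fst.comp_hasDerivAt (z 0) h1
      have hvd := (hv.hasDerivAt hev.self_of_nhds.1).scomp (z 0) hs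
      have hΦz := ((hΦ.contDiffAt (hV₁.mem_nhds (hVV hzV))).differentiableAt
        (by simp)).hasFDerivAt
      rw [← hyz'] at hΦz
      have h2 := hΦz.comp_hasDerivAt (z 0) (hjd _ hzS)
      have h3 := (h2.congr_of_eventuallyEq hvj).unique hvd
      have h4 : ![(ψ (z 0, y (z 0))).1, v (ψ (z 0, y (z 0))).1, deriv v (ψ (z 0, y (z 0))).1] =
          Φ (j (z 0)) := hvj.self_of_nhds
      rw [h4, hyz'] at h3
      rw [hφΦ]
      exact h3)
    (o.coord_mem_source q q) hqφ
  refine ⟨f, hf, hfq.trans (Subtype.ext ?_), hiso⟩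
  change φ (q : C3) = q'
  rw [hφΦ, hΦq]

end ComplexODE

/-! ### Descent of isomorphisms of triples to the plane -/

namespace ComplexODE

variable {o o' : ComplexODE}

/-- A local isomorphism of the 3-folds of two ODE, in the coordinates `x`, `y`, `p`. -/
theorem exists_of_isIso {q : o.dom} {q' : o'.dom}
    {f : OpenPartialHomeomorph o.toThreefold.carrier o'.toThreefold.carrier}
    (hq : q ∈ f.source) (hfq : f q = q')
    (hf : Threefold.IsIso f) :
    ∃ G : OpenPartialHomeomorph C3 C3, (q : C3) ∈ G.source ∧ G q = q' ∧ IsDiffeoOn ℂ G ∧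
      G.source ⊆ o.dom ∧ (∀ z ∈ G.source, G z ∈ o'.dom) ∧
      (∀ z ∈ G.source, ∃ k : ℂ, fderiv ℂ G z ![0, 0, 1] = k • ![0, 0, 1]) ∧
      ∀ z ∈ G.source, ∃ m : ℂ, fderiv ℂ G z (o.total z) = m • o'.total (G z) := by
  obtain ⟨hd, h₁, h₂⟩ := Threefold.isIso_iff.1 hf
  have hc := o.isDiffeoOn_coord q
  have hc' := o'.isDiffeoOn_coord q'
  have hfc := hd.trans hc'
  let G : OpenPartialHomeomorph C3 C3 := (o.coord q).symm.trans (f.trans (o'.coord q'))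
  have hG : IsDiffeoOn ℂ G := hc.symm.trans hfc
  have hs : ∀ z ∈ G.source, z ∈ o.dom ∧ (o.coord q).symm z ∈ f.source := by
    intro z hz
    have : z ∈ (o.coord q).target ∧ (o.coord q).symm z ∈ f.source ∧
        f ((o.coord q).symm z) ∈ (o'.coord q').source := by
      simpa [G, OpenPartialHomeomorph.trans_source] using hz
    exact ⟨by rw [o.coord_target] at this; exact this.1, this.2.1⟩
  have hsymm : ∀ z (hz : z ∈ o.dom), (o.coord q).symm z =
      (show o.toThreefold.carrier from (⟨z, hz⟩ : o.dom)) := fun z hz =>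
    (o.coord q).left_inv (o.coord_mem_source q ⟨z, hz⟩)
  have hGz : ∀ z (hz : z ∈ o.dom), G z = ((show o'.dom from f (show o.toThreefold.carrier from
      (⟨z, hz⟩ : o.dom))) : C3) := fun z hz => by
    rw [← hsymm z hz]
    rfl
  have hfd : ∀ z (hz : z ∈ o.dom), z ∈ G.source → ∀ a, fderiv ℂ G z a =
      tmap ℝ f (show o.toThreefold.carrier from (⟨z, hz⟩ : o.dom)) a := by
    intro z hz hzG a
    rw [← tmap_eq_fderiv]
    have h1 : z ∈ (o.coord q).symm.source := by
      rw [(o.coord q).symm_source, o.coord_target]; exact hz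
    have h3 : f ((o.coord q).symm z) ∈ (o'.coord q').source := by
      rw [o'.coord_source]; trivial
    have h2 : (o.coord q).symm z ∈ (f.trans (o'.coord q')).source := by
      rw [f.trans_source]
      exact ⟨(hs z hzG).2, h3⟩
    simp only [G]
    rw [hc.symm.tmap_comp hfc h1 h2, hd.tmap_comp hc' (hs z hzG).2 h3,
      o'.tmap_coord q' (show o'.dom from f ((o.coord q).symm z))]
    have := o.tmap_coord_symm q ⟨z, hz⟩ a
    rw [show tmap ℂ (o.coord q).symm z a = a from this, hsymm z hz]
    exact (hd.tmap_real (by rw [← hsymm z hz]; exact (hs z hzG).2) a).symm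
  have hqG : (q : C3) ∈ G.source := by
    simp only [G, OpenPartialHomeomorph.trans_source, OpenPartialHomeomorph.symm_source,
      mem_inter_iff, mem_preimage]
    rw [hsymm q q.2, o.coord_target, o'.coord_source]
    exact ⟨q.2, hq, trivial⟩
  refine ⟨G, hqG, ?_, hG, fun z hz => (hs z hz).1, fun z hz => ?_, fun z hz => ?_, fun z hz => ?_⟩
  · rw [hGz q q.2]
    exact congrArg (fun w : o'.dom => (w : C3)) hfq
  · rw [hGz z (hs z hz).1]
    exact Subtype.prop (show o'.dom from _)
  · have hzd := (hs z hz).1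
    have hzf := (hs z hz).2
    rw [hsymm z hzd] at hzf
    rw [hfd z hzd hz]
    exact (o'.mem_l₁_iff _ _).1 ((h₁ _ hzf).mem ((o.mem_l₁_iff _ _).2 ⟨1, (one_smul _ _).symm⟩))
  · have hzd := (hs z hz).1
    have hzf := (hs z hz).2
    rw [hsymm z hzd] at hzf
    rw [hfd z hzd hz, hGz z hzd]
    exact (o'.mem_l₂_iff _ _).1 ((h₂ _ hzf).mem ((o.mem_l₂_iff _ _).2 ⟨1, (one_smul _ _).symm⟩))

/-- An isomorphism preserves the `p`-lines, so on a polydisc its first two components depend only on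
`(x, y)` and define the point transformation. It takes the 1-jets of a solution to an integral curve
of the other total derivative up to parametrization; parametrized by `x` this is the 1-jet curve of
a solution. -/
theorem exists_isPointTransformation {q : o.dom} {q' : o'.dom}
    {f : OpenPartialHomeomorph o.toThreefold.carrier o'.toThreefold.carrier}
    (hq : q ∈ f.source) (hfq : f q = q')
    (hf : Threefold.IsIso f) : ∃ ψ, o.IsPointTransformation o' q q' ψ := by
  obtain ⟨G, hqG, hGq, hG, hGo, hGo', hk, hm⟩ := exists_of_isIso hq hfq hf
  have hGc : ContDiffOn ℂ ∞ G G.source := contDiffOn_of_isDiffeoOn hG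
  have hGi : ∀ z ∈ G.source, Function.Injective (fderiv ℂ G z) := fun z hz =>
    fderiv_injective_of_contDiffOn hGc (contDiffOn_of_isDiffeoOn hG.symm) hz
  have hGd : ∀ z ∈ G.source, HasFDerivAt G (fderiv ℂ G z) z := fun z hz =>
    ((hGc.contDiffAt (G.open_source.mem_nhds hz)).differentiableAt (by simp)).hasFDerivAt
  have hm0 : ∀ z ∈ G.source, ∃ m : ℂ, m ≠ 0 ∧ fderiv ℂ G z (o.total z) = m • o'.total (G z) := by
    intro z hz
    obtain ⟨m, hm⟩ := hm z hz
    refine ⟨m, fun h0 => ?_, hm⟩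
    rw [h0, zero_smul] at hm
    have := hGi z hz (hm.trans (map_zero _).symm)
    simpa [total] using congrFun this 0
  obtain ⟨ε, hε, hball⟩ := Metric.isOpen_iff.1 G.open_source _ hqG
  let e₂ : C3 := ![0, 0, 1]
  have hbe : basePoint e₂ = 0 := rfl
  -- The section of the 1-jets over the plane with constant slope that of `q`.
  let ι : ℂ × ℂ → C3 := fun w => ![w.1, w.2, (q : C3) 2]
  let L : ℂ × ℂ →L[ℂ] C3 := ContinuousLinearMap.pi
    ![ContinuousLinearMap.fst ℂ ℂ ℂ, ContinuousLinearMap.snd ℂ ℂ ℂ, 0]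
  have hι : ∀ w, HasFDerivAt ι L w := by
    intro w
    rw [hasFDerivAt_pi']
    intro i
    fin_cases i
    · exact hasFDerivAt_fst
    · exact hasFDerivAt_snd
    · exact hasFDerivAt_const ((q : C3) 2) w
  have hιc : ContDiff ℂ ∞ ι := by
    rw [contDiff_pi]
    intro i
    fin_cases i
    · exact contDiff_fst
    · exact contDiff_snd
    · exact contDiff_const
  have hball_iff : ∀ z : C3, z ∈ Metric.ball (q : C3) ε ↔ ∀ i, dist (z i) ((q : C3) i) < ε :=
    fun z => by rw [Metric.mem_ball, dist_pi_lt_iff hε]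
  have hιb : ∀ z ∈ Metric.ball (q : C3) ε, ι (basePoint z) ∈ Metric.ball (q : C3) ε := by
    intro z hz
    rw [hball_iff] at hz ⊢
    intro i
    fin_cases i
    · exact hz 0
    · exact hz 1
    · simpa [ι] using hε
  have hbG : ∀ z ∈ G.source, basePoint (fderiv ℂ G z e₂) = 0 := by
    intro z hz
    obtain ⟨k, hk⟩ := hk z hz
    rw [show fderiv ℂ G z e₂ = _ from hk, map_smul, show basePoint ![0, 0, 1] = 0 from rfl,
      smul_zero]
  -- Integrate along the `p`-line, which meets the polydisc in a disc; the base point of `G` has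
  -- derivative zero there.
  have hindep : ∀ z ∈ Metric.ball (q : C3) ε, basePoint (G (ι (basePoint z))) =
      basePoint (G z) := by
    intro z hz
    let γ : ℂ → C3 := fun t => ι (basePoint z) + t • e₂
    have hγd : ∀ t, HasDerivAt γ e₂ t := fun t => by
      have := ((hasDerivAt_id t).smul_const e₂).const_add (ι (basePoint z))
      rwa [one_smul] at this
    have hzq := (hball_iff z).1 hz
    have hγs : ∀ t ∈ Metric.ball (0 : ℂ) ε, γ t ∈ Metric.ball (q : C3) ε := by
      intro t ht
      rw [hball_iff]
      intro i
      fin_cases i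
      · simpa [γ, ι, e₂, basePoint_apply] using hzq 0
      · simpa [γ, ι, e₂, basePoint_apply] using hzq 1
      · simpa [γ, ι, e₂, dist_eq_norm] using ht
    have hder : ∀ t ∈ Metric.ball (0 : ℂ) ε, HasDerivAt (fun t => basePoint (G (γ t))) 0 t := by
      intro t ht
      have hz' := hball (hγs t ht)
      have := basePoint.hasFDerivAt.comp_hasDerivAt t ((hGd _ hz').comp_hasDerivAt t (hγd t))
      rwa [hbG _ hz'] at this
    have hconst := Metric.isOpen_ball.is_const_of_deriv_eq_zero
      (convex_ball (0 : ℂ) ε).isPreconnected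
      (fun t ht => (hder t ht).differentiableAt.differentiableWithinAt)
      (fun t ht => (hder t ht).deriv) (x := 0) (y := z 2 - (q : C3) 2)
      (Metric.mem_ball_self hε) (by simpa [dist_eq_norm] using hzq 2)
    have e0 : γ 0 = ι (basePoint z) := by simp [γ]
    have e1 : γ (z 2 - (q : C3) 2) = z := by
      ext i
      fin_cases i <;> simp [γ, ι, e₂, basePoint_apply]
    rwa [e0, e1] at hconst
  let B : Set (ℂ × ℂ) := ι ⁻¹' Metric.ball (q : C3) ε
  have hB : IsOpen B := Metric.isOpen_ball.preimage hιc.continuous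
  let ψ₀ : ℂ × ℂ → ℂ × ℂ := fun w => basePoint (G (ι w))
  have hψ₀ : ContDiffOn ℂ ∞ ψ₀ B := basePoint.contDiff.comp_contDiffOn
    (hGc.comp hιc.contDiffOn fun w hw => hball hw)
  have hψ₀d : ∀ w ∈ B, ∀ v, fderiv ℂ ψ₀ w v = basePoint (fderiv ℂ G (ι w) (L v)) := fun w hw v => by
    have := basePoint.hasFDerivAt.comp w ((hGd _ (hball hw)).comp w (hι w))
    rw [show fderiv ℂ ψ₀ w = _ from this.fderiv]
    rfl
  have hιq : ι (basePoint q) = q := by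
    ext i; fin_cases i <;> rfl
  have hqb : (q : C3) ∈ Metric.ball (q : C3) ε := Metric.mem_ball_self hε
  have hqB : basePoint q ∈ B := by
    rw [mem_preimage, hιq]
    exact hqb
  -- If `v` is in the kernel, `dG (L v)` is vertical and so is the image of a vertical vector.
  -- Injectivity of `dG` makes `L v` vertical, which forces `v = 0`.
  have hinj : Function.Injective (fderiv ℂ ψ₀ (basePoint q)) := by
    rw [injective_iff_map_eq_zero]
    intro v hv
    rw [hψ₀d _ hqB, hιq] at hv
    obtain ⟨k, hk⟩ := hk q hqG
    have hk0 : k ≠ 0 := by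
      rintro rfl
      rw [zero_smul] at hk
      simpa using congrFun (hGi q hqG (hk.trans (map_zero _).symm)) 2
    have h1 : fderiv ℂ G q (L v) = fderiv ℂ G q ((fderiv ℂ G q (L v) 2 / k) • e₂) := by
      rw [map_smul, show fderiv ℂ G q e₂ = _ from hk, smul_smul, div_mul_cancel₀ _ hk0]
      ext i
      fin_cases i
      · exact (congrArg Prod.fst hv).trans (mul_zero _).symm
      · exact (congrArg Prod.snd hv).trans (mul_zero _).symm
      · simp
    have h2 := hGi q hqG h1
    exact Prod.ext ((congrFun h2 0).trans (mul_zero _)) ((congrFun h2 1).trans (mul_zero _))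
  obtain ⟨T, hT⟩ := exists_equiv_of_injective hinj
  obtain ⟨ψ, hψ, hqψ, hψB, hψs, -⟩ := exists_openPartialHomeomorph_of_contDiffOn hB hψ₀ hqB
    hT.symm
  have hψG : ∀ z ∈ Metric.ball (q : C3) ε, ψ (z 0, z 1) = basePoint (G z) := fun z hz => by
    rw [hψ]
    exact hindep z hz
  refine ⟨ψ, by rw [hψ]; exact hψ₀.mono hψB, hψs, hqψ, ?_, ?_, Metric.ball (q : C3) ε,
    Metric.ball_mem_nhds _ hε, ?_⟩
  · rw [hψG q hqb, hGq]
    rfl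
  · obtain ⟨m, hm0, hm⟩ := hm0 q hqG
    refine ⟨m, hm0, ?_⟩
    have h1 : L (1, (q : C3) 2) = o.total q - o.B q • e₂ := by
      ext i
      fin_cases i <;> simp [L, total, e₂]
    have h2 := hψ₀d _ hqB (1, (q : C3) 2)
    rw [hιq, h1, map_sub, map_sub, map_smul, map_smul, hbG q hqG, smul_zero, sub_zero, hm,
      hGq] at h2
    rw [hψ]
    exact h2
  · intro y S hy x hx hxψ hxb
    set j : ℂ → C3 := fun t => ![t, y t, deriv y t] with hj
    have hjd : ∀ t ∈ S, HasDerivAt j (o.total (j t)) t := fun t ht => hy.hasDerivAt ht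
    have hjc : ContinuousOn j S := fun t ht => (hjd t ht).continuousAt.continuousWithinAt
    let S₁ : Set ℂ := S ∩ j ⁻¹' Metric.ball (q : C3) ε
    have hS₁ : IsOpen S₁ := hjc.isOpen_inter_preimage hy.isOpen Metric.isOpen_ball
    have hxS₁ : x ∈ S₁ := ⟨hx, hxb⟩
    let k : ℂ → C3 := fun t => G (j t)
    have hkd : ∀ t ∈ S₁, ∃ m : ℂ, m ≠ 0 ∧ HasDerivAt k (m • o'.total (k t)) t := by
      intro t ht
      obtain ⟨m, hm0, hm⟩ := hm0 _ (hball ht.2)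
      have := (hGd _ (hball ht.2)).comp_hasDerivAt t (hjd t ht.1)
      rw [hm] at this
      exact ⟨m, hm0, this⟩
    have hs : ContDiffOn ℂ ∞ (fun t => k t 0) S₁ := by
      refine DifferentiableOn.contDiffOn (fun t ht => ?_) hS₁
      obtain ⟨m, -, hm⟩ := hkd t ht
      exact ((hasDerivAt_pi.1 hm) 0).differentiableAt.differentiableWithinAt
    obtain ⟨m₀, hm₀, hkx⟩ := hkd x hxS₁
    -- The new `x`-coordinate along the curve has derivative `m₀ ≠ 0`, since the total derivative
    -- has first component 1; `σ` is this local change of parameter.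
    obtain ⟨σ, hσ, hxσ, hσS, -, -⟩ := exists_openPartialHomeomorph_of_contDiffOn hS₁ hs hxS₁
      (f' := ContinuousLinearEquiv.unitsEquivAut ℂ (Units.mk0 m₀ hm₀)) (by
        ext
        have := ((hasDerivAt_pi.1 hkx) 0).hasFDerivAt.fderiv
        rw [this]
        simp [total])
    -- The inverse parameter has derivative `m⁻¹`, which cancels the factor `m` of the velocity.
    have hτ : ∀ s ∈ σ.target, ∃ m : ℂ, m ≠ 0 ∧ HasDerivAt σ.symm m⁻¹ s ∧
        HasDerivAt (fun s => k (σ.symm s)) (o'.total (k (σ.symm s))) s := by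
      intro s hs
      have hmS := hσS (σ.map_target hs)
      obtain ⟨m, hm0, hm⟩ := hkd _ hmS
      have h0 : HasDerivAt σ m (σ.symm s) := by
        rw [hσ]
        simpa [total] using (hasDerivAt_pi.1 hm) 0
      have h1 := σ.hasDerivAt_symm hs hm0 h0
      refine ⟨m, hm0, h1, ?_⟩
      have := hm.scomp s h1
      rwa [smul_smul, inv_mul_cancel₀ hm0, one_smul] at this
    have hτ0 : ∀ s ∈ σ.target, k (σ.symm s) 0 = s := fun s hs => by
      have := σ.right_inv hs
      rwa [hσ] at this
    have hd1 : ∀ s ∈ σ.target, HasDerivAt (fun s => k (σ.symm s) 1) (k (σ.symm s) 2) s :=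
      fun s hs => by
        obtain ⟨m, -, -, h⟩ := hτ s hs
        exact (hasDerivAt_pi.1 h) 1
    have hd2 : ∀ s ∈ σ.target, HasDerivAt (fun s => k (σ.symm s) 2) (o'.B (k (σ.symm s))) s :=
      fun s hs => by
        obtain ⟨m, -, -, h⟩ := hτ s hs
        exact (hasDerivAt_pi.1 h) 2
    have hjet : ∀ s ∈ σ.target, ![s, k (σ.symm s) 1, deriv (fun s => k (σ.symm s) 1) s] =
        k (σ.symm s) := by
      intro s hs
      rw [(hd1 s hs).deriv]
      ext i
      fin_cases i
      · exact (hτ0 s hs).symm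
      · rfl
      · rfl
    refine ⟨fun s => k (σ.symm s) 1, σ.target, ⟨σ.open_target, fun s hs =>
      (hd1 s hs).differentiableAt.differentiableWithinAt, fun s hs => ?_, fun s hs => ?_⟩, ?_⟩
    · rw [hjet s hs]
      exact hGo' _ (hball (hσS (σ.map_target hs)).2)
    · have hev : deriv (fun s => k (σ.symm s) 1) =ᶠ[𝓝 s] fun s => k (σ.symm s) 2 := by
        filter_upwards [σ.open_target.mem_nhds hs] with r hr using (hd1 r hr).deriv
      rw [hjet s hs, hev.deriv_eq, (hd2 s hs).deriv]
    · filter_upwards [σ.open_source.mem_nhds hxσ] with t ht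
      have h1 : ψ (t, y t) = basePoint (k t) := hψG (j t) (hσS ht).2
      have h2 : (basePoint (k t)).1 = σ t := by rw [hσ]; rfl
      rw [h1, h2]
      refine ⟨σ.map_source ht, ?_⟩
      rw [σ.left_inv ht]
      rfl

theorem exists_isPointTransformation_iff (q : o.dom) (q' : o'.dom) :
    (∃ ψ, o.IsPointTransformation o' q q' ψ) ↔
      ∃ f : OpenPartialHomeomorph o.toThreefold.carrier o'.toThreefold.carrier,
        q ∈ f.source ∧ f q = q' ∧ Threefold.IsIso f :=
  ⟨fun ⟨_, h⟩ => h.exists_isIso, fun ⟨_, h₁, h₂, h₃⟩ => exists_isPointTransformation h₁ h₂ h₃⟩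

end ComplexODE

/-! ### The CR-structure of a non-involutive triple in coordinates -/

theorem ContDiffOn.det3 {E : Type*} [NormedAddCommGroup E] [NormedSpace ℝ E] {A B C : E → C3}
    {U : Set E} (hA : ContDiffOn ℝ ∞ A U) (hB : ContDiffOn ℝ ∞ B U) (hC : ContDiffOn ℝ ∞ C U) :
    ContDiffOn ℝ ∞ (fun z => _root_.det3 (A z) (B z) (C z)) U := by
  have a := contDiffOn_pi.1 hA
  have b := contDiffOn_pi.1 hB
  have c := contDiffOn_pi.1 hC
  exact (((a 0).mul (((b 1).mul (c 2)).sub ((b 2).mul (c 1)))).sub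
    ((a 1).mul (((b 0).mul (c 2)).sub ((b 2).mul (c 0))))).add
    ((a 2).mul (((b 0).mul (c 1)).sub ((b 1).mul (c 0))))

theorem SmoothFld.of_eventuallyEq {𝕜 : Type*} [RCLike 𝕜] [NormedSpace 𝕜 C3] {M : Type*}
    [TopologicalSpace M] [ChartedSpace C3 M] [IsManifold 𝓘(𝕜, C3) ∞ M] {X : M → C3} {V : Set M}
    (h : ∀ x ∈ V, ∃ (O : Set M) (Y : M → C3), IsOpen O ∧ x ∈ O ∧ SmoothFld 𝕜 Y O ∧
      X =ᶠ[𝓝 x] Y) : SmoothFld 𝕜 X V := by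
  intro x hx
  obtain ⟨O, Y, hO, hxO, hY, hXY⟩ := h x hx
  refine ((hY.contMDiffAt (hO.mem_nhds hxO)).congr_of_eventuallyEq ?_).contMDiffWithinAt
  filter_upwards [hXY] with y hy
  exact congrArg (fun v : C3 => (⟨y, v⟩ : TangentBundle 𝓘(𝕜, C3) M)) hy

theorem isSmoothDistribution_of_frames {M : Type u} [TopologicalSpace M] [ChartedSpace C3 M]
    [IsManifold 𝓘(ℝ, C3) ∞ M] {r : ℕ} {D : (x : M) → Submodule ℝ (TangentSpace 𝓘(ℝ, C3) x)}
    (h : ∀ x, ∃ (e : OpenPartialHomeomorph M C3) (U : Set C3) (W : Fin r → C3 → C3),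
      IsDiffeoOn ℝ e ∧ IsOpen U ∧ x ∈ e.source ∧ e x ∈ U ∧ (∀ i, ContDiffOn ℝ ∞ (W i) U) ∧
      (∀ z ∈ U, LinearIndependent ℝ fun i => W i z) ∧
      ∀ y ∈ e.source, e y ∈ U → ∀ a : C3, (show TangentSpace 𝓘(ℝ, C3) y from a) ∈ D y ↔
        ∃ c : Fin r → ℝ, ∑ i, c i • W i (e y) = tmap ℝ e y a) : IsSmoothDistribution r D := by
  intro x
  obtain ⟨e, U, W, he, hU, hx, hxU, hW, hli, hD⟩ := h x
  refine ⟨e.source ∩ e ⁻¹' U, e.isOpen_inter_preimage hU, ⟨hx, hxU⟩, fun i => push ℝ e.symm (W i),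
    fun i => he.symm.push_smooth hU (smoothFld_iff_contDiffOn.2 (hW i)), fun y hy => ?_⟩
  have h1 : ∀ i, tmap ℝ e y (push ℝ e.symm (W i) y) = W i (e y) := fun i =>
    he.tmap_tmap_symm' hy.1 _
  have hli' : LinearIndependent ℝ fun i => push ℝ e.symm (W i) y := by
    refine LinearIndependent.of_comp (tmap ℝ e y).toLinearMap ?_
    have : (tmap ℝ e y).toLinearMap ∘ (fun i => push ℝ e.symm (W i) y) = fun i => W i (e y) :=
      funext h1
    rw [this]
    exact hli _ hy.2
  have hsp : ∀ a : C3, a ∈ Submodule.span ℝ (range fun i => push ℝ e.symm (W i) y) ↔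
      ∃ c : Fin r → ℝ, ∑ i, c i • W i (e y) = tmap ℝ e y a := by
    intro a
    rw [Submodule.mem_span_range_iff_exists_fun]
    refine exists_congr fun c => ?_
    rw [← (he.injective hy.1).eq_iff, map_sum]
    simp only [map_smul, h1]
  refine ⟨hli', ?_⟩
  ext a
  exact (hD y hy.1 hy.2 a).trans (hsp a).symm

namespace Threefold

instance isManifold_real (P : Threefold.{u}) : IsManifold 𝓘(ℝ, C3) ∞ P.carrier :=
  isManifold_real_of_complex P.carrier

variable {P : Threefold.{u}}

namespace IsFrame

variable {e : OpenPartialHomeomorph P.carrier C3} {U : Set C3} {Z₁ Z₂ : C3 → C3}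

theorem mem_l₁_iff (h : P.IsFrame e U Z₁ Z₂) {y : P.carrier} (hy : y ∈ e.source) (hyU : e y ∈ U)
    (a : C3) : a ∈ P.l₁ y ↔ ∃ r : ℂ, tmap ℝ e y a = r • Z₁ (e y) := by
  rw [h.diffeo.tmap_real hy]
  exact h.mem₁ y hy hyU a

theorem mem_l₂_iff (h : P.IsFrame e U Z₁ Z₂) {y : P.carrier} (hy : y ∈ e.source) (hyU : e y ∈ U)
    (a : C3) : a ∈ P.l₂ y ↔ ∃ r : ℂ, tmap ℝ e y a = r • Z₂ (e y) := by
  rw [h.diffeo.tmap_real hy]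
  exact h.mem₂ y hy hyU a

theorem mem_sup_iff (h : P.IsFrame e U Z₁ Z₂) {y : P.carrier} (hy : y ∈ e.source) (hyU : e y ∈ U)
    (a : C3) : a ∈ P.l₁ y ⊔ P.l₂ y ↔
      ∃ r s : ℂ, tmap ℝ e y a = r • Z₁ (e y) + s • Z₂ (e y) := by
  rw [h.diffeo.tmap_real hy]
  exact h.mem_sup hy hyU a

theorem mem_sup_iff_det3 (h : P.IsFrame e U Z₁ Z₂) {y : P.carrier} (hy : y ∈ e.source)
    (hyU : e y ∈ U) (a : C3) : a ∈ P.l₁ y ⊔ P.l₂ y ↔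
      det3 (Z₁ (e y)) (Z₂ (e y)) (tmap ℝ e y a) = 0 := by
  rw [h.mem_sup_iff hy hyU, det3_eq_zero_iff (h.indep _ hyU)]

theorem disjoint (h : P.IsFrame e U Z₁ Z₂) {y : P.carrier} (hy : y ∈ e.source)
    (hyU : e y ∈ U) : Disjoint (P.l₁ y) (P.l₂ y) := by
  rw [Submodule.disjoint_def]
  intro a h₁ h₂
  obtain ⟨r, hr⟩ := (h.mem_l₁_iff hy hyU a).1 h₁
  obtain ⟨s, hs⟩ := (h.mem_l₂_iff hy hyU a).1 h₂
  have h1 : r • Z₁ (e y) + (0 : ℂ) • Z₂ (e y) = (0 : ℂ) • Z₁ (e y) + s • Z₂ (e y) := by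
    rw [zero_smul, zero_smul, add_zero, zero_add, ← hr, ← hs]
  apply h.diffeo.restrictScalars.injective hy
  rw [hr, (det3_comb_unique (h.indep _ hyU) h1).1, zero_smul, map_zero]

theorem tmap_twist (h : P.IsFrame e U Z₁ Z₂) {y : P.carrier} (hy : y ∈ e.source)
    (hyU : e y ∈ U) {a : C3} {r s : ℂ} (ha : tmap ℝ e y a = r • Z₁ (e y) + s • Z₂ (e y)) :
    tmap ℝ e y (twist (P.l₁ y) (P.l₂ y) a) =
      (Complex.I * r) • Z₁ (e y) + (-(Complex.I * s)) • Z₂ (e y) := by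
  have hm := (h.mem_sup_iff hy hyU a).2 ⟨r, s, ha⟩
  obtain ⟨b, hb, c, hc, rfl⟩ := Submodule.mem_sup.1 hm
  obtain ⟨r', hr'⟩ := (h.mem_l₁_iff hy hyU b).1 hb
  obtain ⟨s', hs'⟩ := (h.mem_l₂_iff hy hyU c).1 hc
  rw [map_add, hr', hs'] at ha
  obtain ⟨rfl, rfl⟩ := det3_comb_unique (h.indep _ hyU) ha
  rw [twist_add (h.disjoint hy hyU) hb hc, map_sub, h.diffeo.tmap_real_smul hy,
    h.diffeo.tmap_real_smul hy, hr', hs', smul_smul, smul_smul, neg_smul, sub_eq_add_neg]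

theorem twist_mem (h : P.IsFrame e U Z₁ Z₂) {y : P.carrier} (hy : y ∈ e.source)
    (hyU : e y ∈ U) {a : C3} (ha : a ∈ P.l₁ y ⊔ P.l₂ y) :
    twist (P.l₁ y) (P.l₂ y) a ∈ P.l₁ y ⊔ P.l₂ y := by
  obtain ⟨r, s, hrs⟩ := (h.mem_sup_iff hy hyU a).1 ha
  exact (h.mem_sup_iff hy hyU _).2 ⟨_, _, h.tmap_twist hy hyU hrs⟩

theorem contDiffOn_lieBracket (h : P.IsFrame e U Z₁ Z₂) :
    ContDiffOn ℝ ∞ (VectorField.lieBracket ℂ Z₁ Z₂) U := by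
  have h1 : ContDiffOn ℂ ∞ (fun z => fderiv ℂ Z₂ z (Z₁ z) - fderiv ℂ Z₁ z (Z₂ z)) U :=
    ((h.hol₂.fderiv_of_isOpen (m := ∞) h.isOpen (by simp)).clm_apply h.hol₁).sub
      ((h.hol₁.fderiv_of_isOpen (m := ∞) h.isOpen (by simp)).clm_apply h.hol₂)
  exact h1.restrict_scalars ℝ

end IsFrame

/-- The domain, in coordinates, of the push-forward of a vector field on `V`. -/
theorem isOpen_push_domain (e : OpenPartialHomeomorph P.carrier C3) {U : Set C3} (hU : IsOpen U)
    {V : Set P.carrier} (hV : IsOpen V) : IsOpen (U ∩ (e.target ∩ e.symm ⁻¹' V)) :=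
  hU.inter (e.isOpen_inter_preimage_symm hV)

theorem IsFrame.push_domain_mem {e : OpenPartialHomeomorph P.carrier C3} {U : Set C3}
    {V : Set P.carrier} {x : P.carrier} (hx : x ∈ e.source) (hxU : e x ∈ U) (hxV : x ∈ V) :
    e x ∈ U ∩ (e.target ∩ e.symm ⁻¹' V) :=
  ⟨hxU, e.map_source hx, by rw [mem_preimage, e.left_inv hx]; exact hxV⟩

/-- The Levi form in coordinates. -/
theorem IsFrame.det3_bra {e : OpenPartialHomeomorph P.carrier C3} {U : Set C3} {Z₁ Z₂ : C3 → C3}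
    (h : P.IsFrame e U Z₁ Z₂) {V : Set P.carrier} (hV : IsOpen V) {X Y : P.carrier → C3}
    (hX : SmoothFld ℝ X V) (hY : SmoothFld ℝ Y V) (hXD : ∀ y ∈ V, X y ∈ P.l₁ y ⊔ P.l₂ y)
    (hYD : ∀ y ∈ V, Y y ∈ P.l₁ y ⊔ P.l₂ y) {x : P.carrier} (hx : x ∈ e.source) (hxU : e x ∈ U)
    (hxV : x ∈ V) {a₁ a₂ b₁ b₂ : ℂ} (ha : tmap ℝ e x (X x) = a₁ • Z₁ (e x) + a₂ • Z₂ (e x))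
    (hb : tmap ℝ e x (Y x) = b₁ • Z₁ (e x) + b₂ • Z₂ (e x)) :
    det3 (Z₁ (e x)) (Z₂ (e x)) (tmap ℝ e x (bra ℝ X Y x)) = (a₁ * b₂ - a₂ * b₁) *
      det3 (Z₁ (e x)) (Z₂ (e x)) (VectorField.lieBracket ℂ Z₁ Z₂ (e x)) := by
  have he := h.diffeo.restrictScalars
  have hz₁ := h.differentiableAt₁ hxU
  have hz₂ := h.differentiableAt₂ hxU
  have hO := isOpen_push_domain e h.isOpen hV
  have hxO := IsFrame.push_domain_mem hx hxU hxV
  have hd : ∀ {X : P.carrier → C3}, SmoothFld ℝ X V → DifferentiableAt ℝ (push ℝ e X) (e x) :=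
    fun hX => (((smoothFld_iff_contDiffOn.1 (he.push_smooth hV hX)).mono
      inter_subset_right).contDiffAt (hO.mem_nhds hxO)).differentiableAt (by simp)
  have hdet : ∀ {X : P.carrier → C3}, (∀ y ∈ V, X y ∈ P.l₁ y ⊔ P.l₂ y) →
      ∀ᶠ z in 𝓝 (e x), det3 (Z₁ z) (Z₂ z) (push ℝ e X z) = 0 := by
    intro X hXD
    filter_upwards [hO.mem_nhds hxO] with z hz
    have hy := e.map_target hz.2.1
    have hr := e.right_inv hz.2.1
    have := (h.mem_sup_iff_det3 hy (by rw [hr]; exact hz.1) _).1 (hXD _ hz.2.2)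
    rwa [hr] at this
  rw [he.tmap_bra hV hX hY hx hxV, bra_eq_lieBracket, ← lieBracket_real_eq_complex hz₁ hz₂]
  exact det3_bracket (hz₁.restrictScalars ℝ) (hz₂.restrictScalars ℝ) (hd hX) (hd hY)
    (dbar_eq_zero_of_differentiableAt hz₁ _) (dbar_eq_zero_of_differentiableAt hz₁ _)
    (dbar_eq_zero_of_differentiableAt hz₂ _) (dbar_eq_zero_of_differentiableAt hz₂ _)
    (hdet hXD) (hdet hYD) (by rw [push_apply e X hx, ha]) (by rw [push_apply e Y hx, hb])

theorem IsFrame.det3_of_leviValue {e : OpenPartialHomeomorph P.carrier C3} {U : Set C3}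
    {Z₁ Z₂ : C3 → C3} (h : P.IsFrame e U Z₁ Z₂) {x : P.carrier} (hx : x ∈ e.source)
    (hxU : e x ∈ U) {u v w : C3} (hw : LeviValue P.toCR.D x u v w) {a₁ a₂ b₁ b₂ : ℂ}
    (ha : tmap ℝ e x u = a₁ • Z₁ (e x) + a₂ • Z₂ (e x))
    (hb : tmap ℝ e x v = b₁ • Z₁ (e x) + b₂ • Z₂ (e x)) :
    det3 (Z₁ (e x)) (Z₂ (e x)) (tmap ℝ e x w) = (a₁ * b₂ - a₂ * b₁) *
      det3 (Z₁ (e x)) (Z₂ (e x)) (VectorField.lieBracket ℂ Z₁ Z₂ (e x)) := by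
  obtain ⟨V, X, Y, hV, hxV, hX, hY, rfl, rfl, rfl⟩ := hw
  exact h.det3_bra hV hX.1 hY.1 hX.2 hY.2 hx hxU hxV ha hb

/-- Combinations of `Z₁`, `Z₂` with constant coefficients extend any two vectors of `D`. This keeps
the conditions quantified over all Levi values from being vacuous. -/
theorem IsFrame.exists_leviValue {e : OpenPartialHomeomorph P.carrier C3} {U : Set C3}
    {Z₁ Z₂ : C3 → C3} (h : P.IsFrame e U Z₁ Z₂) {x : P.carrier} (hx : x ∈ e.source)
    (hxU : e x ∈ U) {u v : C3} (hu : u ∈ P.l₁ x ⊔ P.l₂ x) (hv : v ∈ P.l₁ x ⊔ P.l₂ x) :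
    ∃ w : C3, LeviValue P.toCR.D x u v w := by
  have he := h.diffeo.restrictScalars
  have key : ∀ u ∈ P.l₁ x ⊔ P.l₂ x, ∃ X : P.carrier → C3, SmoothFld ℝ X (e.source ∩ e ⁻¹' U) ∧
      (∀ y ∈ e.source ∩ e ⁻¹' U, X y ∈ P.l₁ y ⊔ P.l₂ y) ∧ X x = u := by
    intro u hu
    obtain ⟨r, s, hrs⟩ := (h.mem_sup_iff hx hxU u).1 hu
    have hW : ContDiffOn ℝ ∞ (fun z => r • Z₁ z + s • Z₂ z) U :=
      ((h.hol₁.const_smul r).add (h.hol₂.const_smul s)).restrict_scalars ℝ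
    refine ⟨push ℝ e.symm (fun z => r • Z₁ z + s • Z₂ z),
      he.symm.push_smooth h.isOpen (smoothFld_iff_contDiffOn.2 hW), fun y hy => ?_, ?_⟩
    · exact (h.mem_sup_iff hy.1 hy.2 _).2 ⟨r, s, he.tmap_tmap_symm' hy.1 _⟩
    · apply he.injective hx
      rw [hrs]
      exact he.tmap_tmap_symm' hx _
  obtain ⟨X, hX, hXD, rfl⟩ := key u hu
  obtain ⟨Y, hY, hYD, rfl⟩ := key v hv
  exact ⟨_, e.source ∩ e ⁻¹' U, X, Y, e.isOpen_inter_preimage h.isOpen, ⟨hx, hxU⟩, ⟨hX, hXD⟩,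
    ⟨hY, hYD⟩, rfl, rfl, rfl⟩

theorem twist_map_add {A B : Submodule ℂ C3} (hd : Disjoint A B) {a b : C3} (ha : a ∈ A ⊔ B)
    (hb : b ∈ A ⊔ B) : twist A B (a + b) = twist A B a + twist A B b := by
  obtain ⟨a₁, ha₁, a₂, ha₂, rfl⟩ := Submodule.mem_sup.1 ha
  obtain ⟨b₁, hb₁, b₂, hb₂, rfl⟩ := Submodule.mem_sup.1 hb
  rw [twist_add hd ha₁ ha₂, twist_add hd hb₁ hb₂, add_add_add_comm,
    twist_add hd (A.add_mem ha₁ hb₁) (B.add_mem ha₂ hb₂), smul_add, smul_add]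
  abel

theorem twist_map_smul {A B : Submodule ℂ C3} (hd : Disjoint A B) (r : ℝ) {a : C3}
    (ha : a ∈ A ⊔ B) : twist A B (r • a) = r • twist A B a := by
  obtain ⟨a₁, ha₁, a₂, ha₂, rfl⟩ := Submodule.mem_sup.1 ha
  rw [twist_add hd ha₁ ha₂, smul_add, ← Complex.coe_smul, ← Complex.coe_smul,
    twist_add hd (A.smul_mem _ ha₁) (B.smul_mem _ ha₂), ← Complex.coe_smul,
    smul_sub, smul_comm Complex.I, smul_comm Complex.I]

theorem twist_twist {A B : Submodule ℂ C3} (hd : Disjoint A B) {a : C3} (ha : a ∈ A ⊔ B) :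
    twist A B (twist A B a) = -a := by
  obtain ⟨a₁, ha₁, a₂, ha₂, rfl⟩ := Submodule.mem_sup.1 ha
  rw [twist_add hd ha₁ ha₂, sub_eq_add_neg, ← smul_neg,
    twist_add hd (A.smul_mem _ ha₁) (B.smul_mem _ (B.neg_mem ha₂))]
  simp only [smul_smul, Complex.I_mul_I, neg_smul, one_smul, smul_neg, neg_neg]
  abel

theorem isAlmostCR_toCR (hP : P.IsPathGeometry) : P.toCR.IsAlmostCR where
  dist := by
    refine isSmoothDistribution_of_frames (M := P.carrier) fun x => ?_
    obtain ⟨U, Z₁, Z₂, h, hxU⟩ := hP.exists_frame x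
    have h₁ := h.hol₁.restrict_scalars ℝ
    have h₂ := h.hol₂.restrict_scalars ℝ
    -- The real frame `Z₁`, `i Z₁`, `Z₂`, `i Z₂` is handled with complex coefficients, where
    -- independence is that of `Z₁`, `Z₂` over `ℂ`.
    have hsum : ∀ (z : C3) (c : Fin 4 → ℝ),
        ∑ i, c i • (![Z₁, fun z => Complex.I • Z₁ z, Z₂, fun z => Complex.I • Z₂ z] :
          Fin 4 → C3 → C3) i z =
        ((c 0 : ℂ) + c 1 * Complex.I) • Z₁ z + ((c 2 : ℂ) + c 3 * Complex.I) • Z₂ z := by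
      intro z c
      rw [Fin.sum_univ_four]
      simp only [Matrix.cons_val, add_smul, mul_smul, Complex.coe_smul]
      abel
    refine ⟨_, U, ![Z₁, fun z => Complex.I • Z₁ z, Z₂, fun z => Complex.I • Z₂ z],
      h.diffeo.restrictScalars, h.isOpen, mem_chart_source C3 x, hxU, fun i => ?_, fun z hz => ?_,
      fun y hy hyU a => ?_⟩
    · fin_cases i
      · exact h₁
      · exact h₁.const_smul Complex.I
      · exact h₂
      · exact h₂.const_smul Complex.I
    · rw [Fintype.linearIndependent_iff]
      intro c hc
      rw [hsum] at hc
      have h0 := det3_comb_unique (h.indep z hz) (r' := 0) (s' := 0)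
        (hc.trans (by rw [zero_smul, zero_smul, add_zero]))
      have e1 := Complex.ext_iff.1 h0.1
      have e2 := Complex.ext_iff.1 h0.2
      simp at e1 e2
      intro i
      fin_cases i
      exacts [e1.1, e1.2, e2.1, e2.2]
    · refine (h.mem_sup_iff hy hyU a).trans ?_
      simp only [hsum]
      constructor
      · rintro ⟨r, s, hrs⟩
        exact ⟨![r.re, r.im, s.re, s.im], by simp [hrs]⟩
      · rintro ⟨c, hc⟩
        exact ⟨_, _, hc.symm⟩
  J_mem x a ha := by
    obtain ⟨U, Z₁, Z₂, h, hxU⟩ := hP.exists_frame x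
    exact h.twist_mem (mem_chart_source C3 x) hxU ha
  J_add x _ ha _ hb := twist_map_add (hP.disjoint x) ha hb
  J_smul x r _ ha := twist_map_smul (hP.disjoint x) r ha
  J_sq x _ ha := twist_twist (hP.disjoint x) ha
  J_smooth V X hV hX := by
    refine SmoothFld.of_eventuallyEq (M := P.carrier) fun x hx => ?_
    obtain ⟨U, Z₁, Z₂, h, hxU⟩ := hP.exists_frame x
    set e : OpenPartialHomeomorph P.carrier C3 := chartAt C3 x with he'
    have he := h.diffeo.restrictScalars
    have hxe : x ∈ e.source := mem_chart_source C3 x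
    have hO := isOpen_push_domain e h.isOpen hV
    have hXs : SmoothFld ℝ X V := hX.1
    have hA := (smoothFld_iff_contDiffOn.1 (he.push_smooth hV hXs)).mono
      (inter_subset_right (s := U))
    have h₁ := (h.hol₁.restrict_scalars ℝ).mono
      (inter_subset_left (t := e.target ∩ e.symm ⁻¹' V))
    have h₂ := (h.hol₂.restrict_scalars ℝ).mono
      (inter_subset_left (t := e.target ∩ e.symm ⁻¹' V))
    have hT := h.contDiffOn_lieBracket.mono (inter_subset_left (t := e.target ∩ e.symm ⁻¹' V))
    let T := VectorField.lieBracket ℂ Z₁ Z₂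
    let A := push ℝ e X
    have hdet : ContDiffOn ℝ ∞ (fun z => (det3 (Z₁ z) (Z₂ z) (T z))⁻¹)
        (U ∩ (e.target ∩ e.symm ⁻¹' V)) := (h₁.det3 h₂ hT).inv fun z hz => h.indep z hz.1
    -- Cramer's rule gives the coefficients of `A` as smooth quotients of determinants, so `J A` is
    -- smooth.
    have hW : ContDiffOn ℝ ∞ (fun z => (Complex.I * (det3 (A z) (Z₂ z) (T z) *
        (det3 (Z₁ z) (Z₂ z) (T z))⁻¹)) • Z₁ z + (-(Complex.I * (det3 (Z₁ z) (A z) (T z) *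
        (det3 (Z₁ z) (Z₂ z) (T z))⁻¹))) • Z₂ z) (U ∩ (e.target ∩ e.symm ⁻¹' V)) :=
      ((contDiffOn_const.mul ((hA.det3 h₂ hT).mul hdet)).smul h₁).add
        (((contDiffOn_const.mul ((h₁.det3 hA hT).mul hdet)).neg).smul h₂)
    refine ⟨_, _, e.isOpen_inter_preimage hO,
      ⟨hxe, IsFrame.push_domain_mem hxe hxU hx⟩,
      he.symm.push_smooth hO (smoothFld_iff_contDiffOn.2 hW), ?_⟩
    filter_upwards [(e.isOpen_inter_preimage hO).mem_nhds
      ⟨hxe, IsFrame.push_domain_mem hxe hxU hx⟩] with y hy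
    have hyV : y ∈ V := by
      have : e.symm (e y) ∈ V := hy.2.2.2
      rwa [e.left_inv hy.1] at this
    obtain ⟨r, s, hrs⟩ := (h.mem_sup_iff hy.1 hy.2.1 (X y)).1 (hX.2 y hyV)
    apply he.injective hy.1
    refine (h.tmap_twist hy.1 hy.2.1 hrs).trans (Eq.trans ?_ (he.tmap_tmap_symm' hy.1 _).symm)
    have hAy : A (e y) = r • Z₁ (e y) + s • Z₂ (e y) := (push_apply e X hy.1).trans hrs
    have hi := h.indep _ hy.2.1
    have e1 : det3 (A (e y)) (Z₂ (e y)) (T (e y)) * (det3 (Z₁ (e y)) (Z₂ (e y)) (T (e y)))⁻¹ =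
        r := by
      rw [hAy, show det3 (r • Z₁ (e y) + s • Z₂ (e y)) (Z₂ (e y)) (T (e y)) =
        r * det3 (Z₁ (e y)) (Z₂ (e y)) (T (e y)) by simp [det3]; ring, mul_assoc,
        mul_inv_cancel₀ hi, mul_one]
    have e2 : det3 (Z₁ (e y)) (A (e y)) (T (e y)) * (det3 (Z₁ (e y)) (Z₂ (e y)) (T (e y)))⁻¹ =
        s := by
      rw [hAy, show det3 (Z₁ (e y)) (r • Z₁ (e y) + s • Z₂ (e y)) (T (e y)) =
        s * det3 (Z₁ (e y)) (Z₂ (e y)) (T (e y)) by simp [det3]; ring, mul_assoc,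
        mul_inv_cancel₀ hi, mul_one]
    change _ = (Complex.I * (det3 (A (e y)) (Z₂ (e y)) (T (e y)) *
      (det3 (Z₁ (e y)) (Z₂ (e y)) (T (e y)))⁻¹)) • Z₁ (e y) +
      (-(Complex.I * (det3 (Z₁ (e y)) (A (e y)) (T (e y)) *
      (det3 (Z₁ (e y)) (Z₂ (e y)) (T (e y)))⁻¹))) • Z₂ (e y)
    rw [e1, e2]

end Threefold

/-! ### Ellipticity and null spaces of the Levi form -/

namespace Threefold

variable {P : Threefold.{u}}

theorem isSmoothDistribution_line {L : P.carrier → Submodule ℂ C3}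
    (h : ∀ x, ∃ (e : OpenPartialHomeomorph P.carrier C3) (U : Set C3) (Z : C3 → C3),
      IsDiffeoOn ℂ e ∧ IsOpen U ∧ x ∈ e.source ∧ e x ∈ U ∧ ContDiffOn ℂ ∞ Z U ∧
      (∀ z ∈ U, Z z ≠ 0) ∧
      ∀ y ∈ e.source, e y ∈ U → ∀ a, a ∈ L y ↔ ∃ r : ℂ, tmap ℝ e y a = r • Z (e y)) :
    IsSmoothDistribution (M := P.carrier) 2 fun x => underlyingReal (L x) := by
  refine isSmoothDistribution_of_frames fun x => ?_
  obtain ⟨e, U, Z, he, hU, hx, hxU, hZ, hZ0, hL⟩ := h x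
  have hsum : ∀ (z : C3) (c : Fin 2 → ℝ),
      ∑ i, c i • (![Z, fun z => Complex.I • Z z] : Fin 2 → C3 → C3) i z =
      ((c 0 : ℂ) + c 1 * Complex.I) • Z z := by
    intro z c
    rw [Fin.sum_univ_two]
    simp only [Matrix.cons_val, add_smul, mul_smul, Complex.coe_smul]
  refine ⟨e, U, ![Z, fun z => Complex.I • Z z], he.restrictScalars, hU, hx, hxU, fun i => ?_,
    fun z hz => ?_, fun y hy hyU a => ?_⟩
  · have := hZ.restrict_scalars ℝ
    fin_cases i
    · exact this
    · exact this.const_smul Complex.I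
  · rw [Fintype.linearIndependent_iff]
    intro c hc
    rw [hsum] at hc
    have e1 := Complex.ext_iff.1 ((smul_eq_zero.1 hc).resolve_right (hZ0 z hz))
    simp at e1
    intro i
    fin_cases i
    exacts [e1.1, e1.2]
  · refine (hL y hy hyU a).trans ?_
    simp only [hsum]
    constructor
    · rintro ⟨r, hr⟩
      exact ⟨![r.re, r.im], by simp [hr]⟩
    · rintro ⟨c, hc⟩
      exact ⟨_, hc.symm⟩

namespace IsFrame

variable {e : OpenPartialHomeomorph P.carrier C3} {U : Set C3} {Z₁ Z₂ : C3 → C3}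

theorem exists_mem_sup (h : P.IsFrame e U Z₁ Z₂) {x : P.carrier} (hx : x ∈ e.source)
    (hxU : e x ∈ U) (r s : ℂ) : ∃ b ∈ P.l₁ x ⊔ P.l₂ x,
      tmap ℝ e x b = r • Z₁ (e x) + s • Z₂ (e x) := by
  have he := h.diffeo.restrictScalars.tmap_tmap_symm' hx (r • Z₁ (e x) + s • Z₂ (e x))
  exact ⟨_, (h.mem_sup_iff hx hxU _).2 ⟨r, s, he⟩, he⟩

/-- For `a ≠ 0` the map `b ↦ a₁ b₂ - a₂ b₁` is onto `ℂ`. So the Levi values of `a` fill the tangent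
space modulo `D`, and a covector killing them and `D` is zero. -/
theorem eq_zero_of_levi_eq_zero (h : P.IsFrame e U Z₁ Z₂) {x : P.carrier} (hx : x ∈ e.source)
    (hxU : e x ∈ U) {ℓ : C3 →ₗ[ℝ] ℝ} (hℓ : ℓ ≠ 0) (hD : ∀ a ∈ P.l₁ x ⊔ P.l₂ x, ℓ a = 0) {a : C3}
    (ha : a ∈ P.l₁ x ⊔ P.l₂ x)
    (h0 : ∀ b ∈ P.l₁ x ⊔ P.l₂ x, ∀ w : C3, LeviValue P.toCR.D x a b w → ℓ w = 0) : a = 0 := by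
  obtain ⟨a₁, a₂, haa⟩ := (h.mem_sup_iff hx hxU a).1 ha
  have hi := h.indep _ hxU
  by_contra ha0
  have hne : a₁ ≠ 0 ∨ a₂ ≠ 0 := by
    by_contra! hcon
    apply ha0
    apply h.diffeo.restrictScalars.injective hx
    rw [haa, hcon.1, hcon.2, zero_smul, zero_smul, add_zero, map_zero]
  apply hℓ
  refine LinearMap.ext fun w₀ => ?_
  obtain ⟨b₁, b₂, hb⟩ : ∃ b₁ b₂ : ℂ, a₁ * b₂ - a₂ * b₁ =
      det3 (Z₁ (e x)) (Z₂ (e x)) (tmap ℝ e x w₀) /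
        det3 (Z₁ (e x)) (Z₂ (e x)) (VectorField.lieBracket ℂ Z₁ Z₂ (e x)) := by
    rcases hne with hne | hne
    · exact ⟨0, _ / a₁, by rw [mul_zero, sub_zero, mul_div_cancel₀ _ hne]⟩
    · exact ⟨-(_ / a₂), 0, by rw [mul_zero, zero_sub, mul_neg, neg_neg, mul_div_cancel₀ _ hne]⟩
  obtain ⟨b, hbD, hbb⟩ := h.exists_mem_sup hx hxU b₁ b₂
  obtain ⟨w, hw⟩ := h.exists_leviValue hx hxU ha hbD
  have hd := h.det3_of_leviValue hx hxU hw haa hbb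
  rw [hb, div_mul_cancel₀ _ hi] at hd
  have hm : w₀ - w ∈ P.l₁ x ⊔ P.l₂ x := by
    rw [h.mem_sup_iff_det3 hx hxU, map_sub]
    have e1 : ∀ a b c d : C3, det3 a b (c - d) = det3 a b c - det3 a b d := by
      intro a b c d; simp [det3]; ring
    rw [e1, hd, sub_self]
  have := hD _ hm
  rw [map_sub, h0 b hbD w hw, sub_zero] at this
  exact this

/-- The linear form with kernel `D`, with values in `ℂ`, which gives the Levi form. -/
def leviForm (e : OpenPartialHomeomorph P.carrier C3) (Z₁ Z₂ : C3 → C3) (x : P.carrier) :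
    C3 →ₗ[ℝ] ℂ where
  toFun w := det3 (Z₁ (e x)) (Z₂ (e x)) (tmap ℝ e x w)
  map_add' v w := by rw [map_add]; simp [det3]; ring
  map_smul' r w := by rw [map_smul]; simp [det3]; ring

theorem leviForm_apply (x : P.carrier) (w : C3) :
    leviForm e Z₁ Z₂ x w = det3 (Z₁ (e x)) (Z₂ (e x)) (tmap ℝ e x w) := rfl

/-- `J a` has coefficients `i a₁`, `-i a₂`. So `𝓛(a, b) - i 𝓛(J a, b)` is `2 a₁ b₂` times a nonzero
number, which vanishes for all `b` exactly when `a₁ = 0`. -/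
theorem mem_l₂_iff_null (h : P.IsFrame e U Z₁ Z₂) {x : P.carrier} (hx : x ∈ e.source)
    (hxU : e x ∈ U) (a : C3) : a ∈ P.l₂ x ↔ a ∈ P.l₁ x ⊔ P.l₂ x ∧ ∀ b ∈ P.l₁ x ⊔ P.l₂ x,
      ∀ w w' : C3, LeviValue P.toCR.D x a b w →
        LeviValue P.toCR.D x (twist (P.l₁ x) (P.l₂ x) a) b w' →
        leviForm e Z₁ Z₂ x w - Complex.I * leviForm e Z₁ Z₂ x w' = 0 := by
  have hi := h.indep _ hxU
  have key : ∀ {a₁ a₂ b₁ b₂ : ℂ} {a b w w' : C3},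
      tmap ℝ e x a = a₁ • Z₁ (e x) + a₂ • Z₂ (e x) →
      tmap ℝ e x b = b₁ • Z₁ (e x) + b₂ • Z₂ (e x) → LeviValue P.toCR.D x a b w →
      LeviValue P.toCR.D x (twist (P.l₁ x) (P.l₂ x) a) b w' →
      leviForm e Z₁ Z₂ x w - Complex.I * leviForm e Z₁ Z₂ x w' =
        2 * a₁ * b₂ * det3 (Z₁ (e x)) (Z₂ (e x)) (VectorField.lieBracket ℂ Z₁ Z₂ (e x)) := by
    intro a₁ a₂ b₁ b₂ a b w w' ha hb hw hw'
    rw [leviForm_apply, leviForm_apply, h.det3_of_leviValue hx hxU hw ha hb,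
      h.det3_of_leviValue hx hxU hw' (h.tmap_twist hx hxU ha) hb]
    linear_combination (-a₁ * b₂ - a₂ * b₁) *
      det3 (Z₁ (e x)) (Z₂ (e x)) (VectorField.lieBracket ℂ Z₁ Z₂ (e x)) * Complex.I_mul_I
  constructor
  · intro ha
    refine ⟨Submodule.mem_sup_right ha, fun b hb w w' hw hw' => ?_⟩
    obtain ⟨s, hs⟩ := (h.mem_l₂_iff hx hxU a).1 ha
    obtain ⟨b₁, b₂, hb⟩ := (h.mem_sup_iff hx hxU b).1 hb
    rw [key (a₁ := 0) (a₂ := s) (by rw [hs, zero_smul, zero_add]) hb hw hw']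
    ring
  · rintro ⟨ha, hall⟩
    obtain ⟨a₁, a₂, haa⟩ := (h.mem_sup_iff hx hxU a).1 ha
    obtain ⟨b, hb, hbb⟩ := h.exists_mem_sup hx hxU 0 1
    obtain ⟨w, hw⟩ := h.exists_leviValue hx hxU ha hb
    obtain ⟨w', hw'⟩ := h.exists_leviValue hx hxU (h.twist_mem hx hxU ha) hb
    have := hall b hb w w' hw hw'
    rw [key haa hbb hw hw'] at this
    have ha₁ : a₁ = 0 := by simpa [hi] using this
    exact (h.mem_l₂_iff hx hxU a).2 ⟨a₂, by rw [haa, ha₁, zero_smul, zero_add]⟩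

/-- For the conjugate form the expression is the conjugate of `𝓛(a, b) + i 𝓛(J a, b)`, in which only
the term `-2 a₂ b₁` survives. -/
theorem mem_l₁_iff_null (h : P.IsFrame e U Z₁ Z₂) {x : P.carrier} (hx : x ∈ e.source)
    (hxU : e x ∈ U) (a : C3) : a ∈ P.l₁ x ↔ a ∈ P.l₁ x ⊔ P.l₂ x ∧ ∀ b ∈ P.l₁ x ⊔ P.l₂ x,
      ∀ w w' : C3, LeviValue P.toCR.D x a b w →
        LeviValue P.toCR.D x (twist (P.l₁ x) (P.l₂ x) a) b w' →
        starRingEnd ℂ (leviForm e Z₁ Z₂ x w) -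
          Complex.I * starRingEnd ℂ (leviForm e Z₁ Z₂ x w') = 0 := by
  have hi := h.indep _ hxU
  have key : ∀ {a₁ a₂ b₁ b₂ : ℂ} {a b w w' : C3},
      tmap ℝ e x a = a₁ • Z₁ (e x) + a₂ • Z₂ (e x) →
      tmap ℝ e x b = b₁ • Z₁ (e x) + b₂ • Z₂ (e x) → LeviValue P.toCR.D x a b w →
      LeviValue P.toCR.D x (twist (P.l₁ x) (P.l₂ x) a) b w' →
      starRingEnd ℂ (leviForm e Z₁ Z₂ x w) -
          Complex.I * starRingEnd ℂ (leviForm e Z₁ Z₂ x w') = starRingEnd ℂ (-(2 * a₂ * b₁ *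
        det3 (Z₁ (e x)) (Z₂ (e x)) (VectorField.lieBracket ℂ Z₁ Z₂ (e x)))) := by
    intro a₁ a₂ b₁ b₂ a b w w' ha hb hw hw'
    have e1 : Complex.I = -starRingEnd ℂ Complex.I := by rw [Complex.conj_I, neg_neg]
    rw [e1, neg_mul, sub_neg_eq_add, ← map_mul, ← map_add]
    congr 1
    rw [leviForm_apply, leviForm_apply, h.det3_of_leviValue hx hxU hw ha hb,
      h.det3_of_leviValue hx hxU hw' (h.tmap_twist hx hxU ha) hb]
    linear_combination (a₁ * b₂ + a₂ * b₁) *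
      det3 (Z₁ (e x)) (Z₂ (e x)) (VectorField.lieBracket ℂ Z₁ Z₂ (e x)) * Complex.I_mul_I
  constructor
  · intro ha
    refine ⟨Submodule.mem_sup_left ha, fun b hb w w' hw hw' => ?_⟩
    obtain ⟨r, hr⟩ := (h.mem_l₁_iff hx hxU a).1 ha
    obtain ⟨b₁, b₂, hb⟩ := (h.mem_sup_iff hx hxU b).1 hb
    rw [key (a₁ := r) (a₂ := 0) (by rw [hr, zero_smul, add_zero]) hb hw hw']
    simp
  · rintro ⟨ha, hall⟩
    obtain ⟨a₁, a₂, haa⟩ := (h.mem_sup_iff hx hxU a).1 ha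
    obtain ⟨b, hb, hbb⟩ := h.exists_mem_sup hx hxU 1 0
    obtain ⟨w, hw⟩ := h.exists_leviValue hx hxU ha hb
    obtain ⟨w', hw'⟩ := h.exists_leviValue hx hxU (h.twist_mem hx hxU ha) hb
    have := hall b hb w w' hw hw'
    rw [key haa hbb hw hw', map_eq_zero] at this
    have ha₂ : a₂ = 0 := by simpa [hi] using this
    exact (h.mem_l₁_iff hx hxU a).2 ⟨a₁, by rw [haa, ha₂, zero_smul, add_zero]⟩

/-- The conjugate of `leviForm` is taken because its null space is `L₁`; conjugating again gives
`L₂`, in the order `D⁺`, `D⁻`. -/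
theorem exists_null (h : P.IsFrame e U Z₁ Z₂) {x : P.carrier} (hx : x ∈ e.source)
    (hxU : e x ∈ U) : ∃ ℓ : C3 →ₗ[ℝ] ℂ, ℓ ≠ 0 ∧ (∀ a ∈ P.l₁ x ⊔ P.l₂ x, ℓ a = 0) ∧
      (∀ a, a ∈ P.l₁ x ↔ P.toCR.IsNullVector x ℓ a) ∧
      ∀ a, a ∈ P.l₂ x ↔ P.toCR.IsNullVector x (Complex.conjAe.toLinearMap ∘ₗ ℓ : C3 →ₗ[ℝ] ℂ) a := by
  refine ⟨Complex.conjAe.toLinearMap ∘ₗ leviForm e Z₁ Z₂ x, fun h0 => ?_, fun a ha => ?_,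
    h.mem_l₁_iff_null hx hxU, fun a => (h.mem_l₂_iff_null hx hxU a).trans ?_⟩
  · have := LinearMap.congr_fun h0
      (tmap ℝ e.symm (e x) (VectorField.lieBracket ℂ Z₁ Z₂ (e x)))
    apply h.indep _ hxU
    have h1 : starRingEnd ℂ (leviForm e Z₁ Z₂ x
      (tmap ℝ e.symm (e x) (VectorField.lieBracket ℂ Z₁ Z₂ (e x)))) = 0 := this
    rwa [map_eq_zero, leviForm_apply, h.diffeo.restrictScalars.tmap_tmap_symm' hx] at h1
  · change starRingEnd ℂ (leviForm e Z₁ Z₂ x a) = 0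
    rw [leviForm_apply, (h.mem_sup_iff_det3 hx hxU a).1 ha, map_zero]
  · have : Complex.conjAe.toLinearMap ∘ₗ (Complex.conjAe.toLinearMap ∘ₗ leviForm e Z₁ Z₂ x) =
        leviForm e Z₁ Z₂ x := by
      ext w
      exact Complex.conj_conj _
    constructor
    · rintro ⟨ha, hh⟩
      refine ⟨ha, fun b hb w w' hw hw' => ?_⟩
      have e1 : ∀ w : C3, (Complex.conjAe.toLinearMap ∘ₗ (Complex.conjAe.toLinearMap ∘ₗ
        leviForm e Z₁ Z₂ x)) w = leviForm e Z₁ Z₂ x w := LinearMap.congr_fun ‹_›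
      have := hh b hb w w' hw hw'
      rw [← e1 w, ← e1 w'] at this
      exact this
    · rintro ⟨ha, hh⟩
      refine ⟨ha, fun b hb w w' hw hw' => ?_⟩
      have := hh b hb w w' hw hw'
      have e1 : ∀ w : C3, (Complex.conjAe.toLinearMap ∘ₗ (Complex.conjAe.toLinearMap ∘ₗ
        leviForm e Z₁ Z₂ x)) w = leviForm e Z₁ Z₂ x w := LinearMap.congr_fun ‹_›
      rw [← e1 w, ← e1 w']
      exact this

/-- The coefficient `a₁ b₂ - a₂ b₁` is a determinant, and `J` acts by the diagonal matrix with
entries `i`, `-i` of determinant 1. -/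
theorem sub_mem_of_leviValue (h : P.IsFrame e U Z₁ Z₂) {x : P.carrier} (hx : x ∈ e.source)
    (hxU : e x ∈ U) {a b w w' : C3} (ha : a ∈ P.l₁ x ⊔ P.l₂ x) (hb : b ∈ P.l₁ x ⊔ P.l₂ x)
    (hw : LeviValue P.toCR.D x a b w) (hw' : LeviValue P.toCR.D x (twist (P.l₁ x) (P.l₂ x) a)
      (twist (P.l₁ x) (P.l₂ x) b) w') : w' - w ∈ P.l₁ x ⊔ P.l₂ x := by
  obtain ⟨a₁, a₂, ha⟩ := (h.mem_sup_iff hx hxU a).1 ha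
  obtain ⟨b₁, b₂, hb⟩ := (h.mem_sup_iff hx hxU b).1 hb
  rw [h.mem_sup_iff_det3 hx hxU, ← leviForm_apply, map_sub, leviForm_apply, leviForm_apply,
    h.det3_of_leviValue hx hxU hw ha hb,
    h.det3_of_leviValue hx hxU hw' (h.tmap_twist hx hxU ha) (h.tmap_twist hx hxU hb)]
  linear_combination (a₂ * b₁ - a₁ * b₂) *
    det3 (Z₁ (e x)) (Z₂ (e x)) (VectorField.lieBracket ℂ Z₁ Z₂ (e x)) * Complex.I_mul_I

end IsFrame

theorem isElliptic_toCR (hP : P.IsPathGeometry) : P.toCR.IsElliptic where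
  toIsAlmostCR := isAlmostCR_toCR hP
  partiallyIntegrable x a ha b hb w w' hw hw' := by
    obtain ⟨U, Z₁, Z₂, h, hxU⟩ := hP.exists_frame x
    exact h.sub_mem_of_leviValue (mem_chart_source C3 x) hxU ha hb hw hw'
  elliptic x ℓ hℓ hD a ha h0 := by
    obtain ⟨U, Z₁, Z₂, h, hxU⟩ := hP.exists_frame x
    exact h.eq_zero_of_levi_eq_zero (mem_chart_source C3 x) hxU hℓ hD ha h0
  rank_Dp := isSmoothDistribution_line (L := P.l₁) fun x => by
    obtain ⟨U, Z₁, Z₂, h, hxU⟩ := hP.exists_frame x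
    exact ⟨_, U, Z₁, h.diffeo, h.isOpen, mem_chart_source C3 x, hxU, h.hol₁,
      fun z hz => ne_zero_of_det3_left (h.indep z hz), fun y hy hyU a => h.mem_l₁_iff hy hyU a⟩
  rank_Dm := isSmoothDistribution_line (L := P.l₂) fun x => by
    obtain ⟨U, Z₁, Z₂, h, hxU⟩ := hP.exists_frame x
    exact ⟨_, U, Z₂, h.diffeo, h.isOpen, mem_chart_source C3 x, hxU, h.hol₂,
      fun z hz => ne_zero_of_det3_mid (h.indep z hz), fun y hy hyU a => h.mem_l₂_iff hy hyU a⟩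
  splitting x := by
    refine ⟨Submodule.disjoint_def.2 fun a h₁ h₂ =>
      Submodule.disjoint_def.1 (hP.disjoint x) a h₁ h₂, ?_⟩
    ext a
    exact (Submodule.mem_sup (p := underlyingReal (P.l₁ x)) (p' := underlyingReal (P.l₂ x))).trans
      (Submodule.mem_sup (p := P.l₁ x) (p' := P.l₂ x)).symm
  null x := by
    obtain ⟨U, Z₁, Z₂, h, hxU⟩ := hP.exists_frame x
    exact h.exists_null (mem_chart_source C3 x) hxU

end Threefold

/-! ### Local embeddings -/

theorem isEmbedding_restrict_source {X Y : Type*} [TopologicalSpace X] [TopologicalSpace Y]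
    (φ : OpenPartialHomeomorph X Y) : IsEmbedding fun x : φ.source => φ x :=
  IsEmbedding.subtypeVal.comp φ.toHomeomorphSourceTarget.isEmbedding

/-- An immersion of `ℂ³` is locally an embedding. -/
theorem exists_leftInverse_of_immersion {W : Type*} [NormedAddCommGroup W] [NormedSpace ℝ W]
    [FiniteDimensional ℝ W] {H : C3 → W} {O : Set C3} (hO : IsOpen O) (hH : ContDiffOn ℝ ∞ H O)
    {z : C3} (hz : z ∈ O) (hi : Function.Injective (fderiv ℝ H z)) :
    ∃ (φ : OpenPartialHomeomorph C3 C3) (S : W →L[ℝ] C3), z ∈ φ.source ∧ φ.source ⊆ O ∧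
      ∀ w, φ w = S (H w) := by
  -- Compose with a linear left inverse of the differential: the composition has identity
  -- differential at `z`, and its local inverse shows that `H` is an embedding near `z`.
  obtain ⟨S₀, hS₀⟩ := LinearMap.exists_leftInverse_of_injective (fderiv ℝ H z).toLinearMap
    (LinearMap.ker_eq_bot.2 hi)
  let S : W →L[ℝ] C3 := S₀.toContinuousLinearMap
  have hd := S.hasFDerivAt.comp z
    ((hH.contDiffAt (hO.mem_nhds hz)).differentiableAt (by simp)).hasFDerivAt
  obtain ⟨φ, hφ, hzφ, hφO, -, -⟩ := exists_openPartialHomeomorph_of_contDiffOn hO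
    (S.contDiff.comp_contDiffOn hH) hz (f' := ContinuousLinearEquiv.refl ℝ C3) (by
      refine hd.fderiv.trans ?_
      ext v : 1
      exact LinearMap.congr_fun hS₀ v)
  exact ⟨φ, S, hzφ, hφO, fun w => by rw [hφ]; rfl⟩

namespace Threefold

variable {P : Threefold.{u}}

/-- The map to `ℂ⁴` with the components of `h₂` and the conjugates of those of `h₁`. -/
def embed (h₁ h₂ : C3 → Fin 2 → ℂ) (z : C3) : Fin 4 → ℂ :=
  ![h₂ z 0, h₂ z 1, starRingEnd ℂ (h₁ z 0), starRingEnd ℂ (h₁ z 1)]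

theorem contDiffOn_embed {h₁ h₂ : C3 → Fin 2 → ℂ} {O : Set C3} (hh₁ : ContDiffOn ℂ ∞ h₁ O)
    (hh₂ : ContDiffOn ℂ ∞ h₂ O) : ContDiffOn ℝ ∞ (embed h₁ h₂) O := by
  have k₁ := contDiffOn_pi.1 (hh₁.restrict_scalars ℝ)
  have k₂ := contDiffOn_pi.1 (hh₂.restrict_scalars ℝ)
  rw [contDiffOn_pi]
  intro i
  fin_cases i
  · exact k₂ 0
  · exact k₂ 1
  · exact (Complex.conjCLE : ℂ →L[ℝ] ℂ).contDiff.comp_contDiffOn (k₁ 0)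
  · exact (Complex.conjCLE : ℂ →L[ℝ] ℂ).contDiff.comp_contDiffOn (k₁ 1)

theorem fderiv_embed {h₁ h₂ : C3 → Fin 2 → ℂ} {z : C3} (hh₁ : DifferentiableAt ℂ h₁ z)
    (hh₂ : DifferentiableAt ℂ h₂ z) (a : C3) : fderiv ℝ (embed h₁ h₂) z a =
      ![fderiv ℂ h₂ z a 0, fderiv ℂ h₂ z a 1, starRingEnd ℂ (fderiv ℂ h₁ z a 0),
        starRingEnd ℂ (fderiv ℂ h₁ z a 1)] := by
  have k₁ := hasFDerivAt_pi'.1 (hh₁.hasFDerivAt.restrictScalars ℝ)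
  have k₂ := hasFDerivAt_pi'.1 (hh₂.hasFDerivAt.restrictScalars ℝ)
  have hc : ∀ {g : C3 → ℂ} {g'}, HasFDerivAt g g' z →
      HasFDerivAt (fun z => starRingEnd ℂ (g z)) ((Complex.conjCLE : ℂ →L[ℝ] ℂ) ∘L g') z :=
    fun hg => (Complex.conjCLE : ℂ →L[ℝ] ℂ).hasFDerivAt.comp z hg
  let p : Fin 2 → (Fin 2 → ℂ) →L[ℝ] ℂ := fun i => ContinuousLinearMap.proj i
  let D₁ : C3 →L[ℝ] (Fin 2 → ℂ) := (fderiv ℂ h₁ z).restrictScalars ℝ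
  let D₂ : C3 →L[ℝ] (Fin 2 → ℂ) := (fderiv ℂ h₂ z).restrictScalars ℝ
  let D : C3 →L[ℝ] (Fin 4 → ℂ) := ContinuousLinearMap.pi ![p 0 ∘L D₂, p 1 ∘L D₂,
    (Complex.conjCLE : ℂ →L[ℝ] ℂ) ∘L p 0 ∘L D₁, (Complex.conjCLE : ℂ →L[ℝ] ℂ) ∘L p 1 ∘L D₁]
  have hD : HasFDerivAt (embed h₁ h₂) D z := by
    rw [hasFDerivAt_pi']
    intro i
    fin_cases i
    · exact k₂ 0
    · exact k₂ 1
    · exact hc (k₁ 0)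
    · exact hc (k₁ 1)
  rw [hD.fderiv]
  ext i
  fin_cases i <;> rfl

theorem ext_of_fin_two {v w : Fin 2 → ℂ} (h0 : v 0 = w 0) (h1 : v 1 = w 1) : v = w := by
  ext i
  fin_cases i
  exacts [h0, h1]

/-- First integrals of the two direction fields, with kernels `L₁` and `L₂`. -/
structure IsFirstIntegral (O : Set C3) (Z₁ Z₂ : C3 → C3) (h₁ h₂ : C3 → Fin 2 → ℂ) : Prop where
  isOpen : IsOpen O
  hol₁ : ContDiffOn ℂ ∞ h₁ O
  hol₂ : ContDiffOn ℂ ∞ h₂ O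
  ker₁ : ∀ z ∈ O, ∀ a, fderiv ℂ h₁ z a = 0 ↔ ∃ r : ℂ, a = r • Z₁ z
  ker₂ : ∀ z ∈ O, ∀ a, fderiv ℂ h₂ z a = 0 ↔ ∃ r : ℂ, a = r • Z₂ z

namespace IsFrame

variable {e : OpenPartialHomeomorph P.carrier C3} {U O : Set C3} {Z₁ Z₂ : C3 → C3}
  {h₁ h₂ : C3 → Fin 2 → ℂ}

theorem fderiv_embed_apply (hI : IsFirstIntegral O Z₁ Z₂ h₁ h₂) {z : C3} (hz : z ∈ O) (a : C3) :
    fderiv ℝ (embed h₁ h₂) z a =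
      ![fderiv ℂ h₂ z a 0, fderiv ℂ h₂ z a 1, starRingEnd ℂ (fderiv ℂ h₁ z a 0),
        starRingEnd ℂ (fderiv ℂ h₁ z a 1)] :=
  fderiv_embed ((hI.hol₁.contDiffAt (hI.isOpen.mem_nhds hz)).differentiableAt (by simp))
    ((hI.hol₂.contDiffAt (hI.isOpen.mem_nhds hz)).differentiableAt (by simp)) a

/-- The kernel is the intersection of the kernels of the two families of first integrals, `L₁ ∩ L₂ =
0`. -/
theorem fderiv_embed_injective (h : P.IsFrame e U Z₁ Z₂) (hI : IsFirstIntegral O Z₁ Z₂ h₁ h₂)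
    {z : C3} (hz : z ∈ O) (hzU : z ∈ U) : Function.Injective (fderiv ℝ (embed h₁ h₂) z) := by
  rw [injective_iff_map_eq_zero]
  intro a ha
  rw [fderiv_embed_apply hI hz] at ha
  obtain ⟨s, hs⟩ := (hI.ker₂ z hz a).1 (ext_of_fin_two (congrFun ha 0) (congrFun ha 1))
  obtain ⟨r, hr⟩ := (hI.ker₁ z hz a).1 (ext_of_fin_two
    ((map_eq_zero _).1 (congrFun ha 2)) ((map_eq_zero _).1 (congrFun ha 3)))
  have h1 : r • Z₁ z + (0 : ℂ) • Z₂ z = (0 : ℂ) • Z₁ z + s • Z₂ z := by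
    rw [zero_smul, zero_smul, add_zero, zero_add, ← hr, ← hs]
  rw [hr, (det3_comb_unique (h.indep _ hzU) h1).1, zero_smul]

/-- In coordinates: `dH` takes `J` to multiplication by `i`. -/
theorem fderiv_embed_twist (hI : IsFirstIntegral O Z₁ Z₂ h₁ h₂) {z : C3} (hz : z ∈ O) (r s : ℂ) :
    fderiv ℝ (embed h₁ h₂) z ((Complex.I * r) • Z₁ z + (-(Complex.I * s)) • Z₂ z) =
      Complex.I • fderiv ℝ (embed h₁ h₂) z (r • Z₁ z + s • Z₂ z) := by
  have k₁ := (hI.ker₁ z hz (Z₁ z)).2 ⟨1, (one_smul _ _).symm⟩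
  have k₂ := (hI.ker₂ z hz (Z₂ z)).2 ⟨1, (one_smul _ _).symm⟩
  rw [fderiv_embed_apply hI hz, fderiv_embed_apply hI hz]
  ext i
  fin_cases i <;> simp [k₁, k₂, mul_assoc]

/-- In coordinates: the maximal complex subspace of the image of `dH` is the image of `D`. -/
theorem exists_of_fderiv_embed_eq (hI : IsFirstIntegral O Z₁ Z₂ h₁ h₂) {z : C3} (hz : z ∈ O)
    {a b : C3} (hab : fderiv ℝ (embed h₁ h₂) z b = Complex.I • fderiv ℝ (embed h₁ h₂) z a) :
    ∃ r s : ℂ, a = r • Z₁ z + s • Z₂ z := by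
  rw [fderiv_embed_apply hI hz, fderiv_embed_apply hI hz] at hab
  -- The holomorphic components put `b - i a` in `L₂`, the conjugated ones put `b + i a` in `L₁`.
  -- The difference of these vectors is `2 i a`.
  obtain ⟨s, hs⟩ := (hI.ker₂ z hz (b - Complex.I • a)).1 (by
    rw [map_sub, map_smul]
    exact ext_of_fin_two (sub_eq_zero.2 (congrFun hab 0)) (sub_eq_zero.2 (congrFun hab 1)))
  have hconj : ∀ {p q : ℂ}, starRingEnd ℂ p = Complex.I * starRingEnd ℂ q →
      p + Complex.I * q = 0 := by
    intro p q h
    have := congrArg (starRingEnd ℂ) h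
    simp at this
    rw [this]
    ring
  obtain ⟨r, hr⟩ := (hI.ker₁ z hz (b + Complex.I • a)).1 (by
    rw [map_add, map_smul]
    exact ext_of_fin_two (hconj (congrFun hab 2)) (hconj (congrFun hab 3)))
  refine ⟨-Complex.I / 2 * r, Complex.I / 2 * s, ?_⟩
  rw [mul_smul, mul_smul, ← hr, ← hs]
  ext i
  simp only [Pi.add_apply, Pi.sub_apply, Pi.smul_apply, smul_eq_mul]
  linear_combination (a i) * Complex.I_mul_I

/-- The topological part remains a hypothesis: near a point it comes from the immersion, for a
general solution from the global inverse of its jet map. -/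
theorem isCREmbeddingOn (h : P.IsFrame e U Z₁ Z₂) (hI : IsFirstIntegral O Z₁ Z₂ h₁ h₂)
    {F : P.carrier → Fin 4 → ℂ} {V : Set P.carrier} (hV : IsOpen V) (hVe : V ⊆ e.source)
    (hVU : ∀ y ∈ V, e y ∈ U ∩ O) (hF : ∀ y ∈ V, F y = embed h₁ h₂ (e y))
    (hemb : IsEmbedding fun x : V => F x) : P.toCR.IsCREmbeddingOn F V := by
  have hH := contDiffOn_embed hI.hol₁ hI.hol₂
  have he := h.diffeo.restrictScalars
  have hsm : ∀ y ∈ V, ContMDiffAt 𝓘(ℝ, C3) 𝓘(ℝ, Fin 4 → ℂ) ∞ F y := by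
    intro y hy
    refine ContMDiffAt.congr_of_eventuallyEq (f := embed h₁ h₂ ∘ e) ?_ ?_
    · exact ContMDiffAt.comp y
        ((hH.contDiffAt (hI.isOpen.mem_nhds (hVU y hy).2)).contMDiffAt)
        (he.smooth.contMDiffAt (e.open_source.mem_nhds (hVe hy)))
    · filter_upwards [hV.mem_nhds hy] with w hw using hF w hw
  have hd : ∀ y ∈ V, ∀ a : C3, realDiff (M := P.carrier) F y a =
      fderiv ℝ (embed h₁ h₂) (e y) (tmap ℝ e y a) := by
    intro y hy a
    have h1 : F =ᶠ[𝓝 y] embed h₁ h₂ ∘ e := by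
      filter_upwards [hV.mem_nhds hy] with w hw using hF w hw
    have h2 : MDifferentiableAt 𝓘(ℝ, C3) 𝓘(ℝ, Fin 4 → ℂ) (embed h₁ h₂) (e y) :=
      ((hH.contDiffAt (hI.isOpen.mem_nhds (hVU y hy).2)).differentiableAt
        (by simp)).mdifferentiableAt
    have h3 := mfderiv_comp (I' := 𝓘(ℝ, C3)) y h2
      (he.mdifferentiable.mdifferentiableAt (hVe hy))
    rw [mfderiv_eq_fderiv] at h3
    have h4 : mfderiv 𝓘(ℝ, C3) 𝓘(ℝ, Fin 4 → ℂ) F y = _ := h1.mfderiv_eq.trans h3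
    exact DFunLike.congr_fun h4 a
  have hJ : ∀ y ∈ V, ∀ a ∈ P.l₁ y ⊔ P.l₂ y, realDiff (M := P.carrier) F y
      (twist (P.l₁ y) (P.l₂ y) a : C3) = Complex.I • realDiff (M := P.carrier) F y a := by
    intro y hy a ha
    obtain ⟨r, s, hrs⟩ := (h.mem_sup_iff (hVe hy) (hVU y hy).1 a).1 ha
    refine (hd y hy _).trans (Eq.trans ?_ (congrArg (Complex.I • ·) (hd y hy a)).symm)
    rw [h.tmap_twist (hVe hy) (hVU y hy).1 hrs, hrs]
    exact fderiv_embed_twist hI (hVU y hy).2 r s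
  refine ⟨hV, fun y hy => (hsm y hy).contMDiffWithinAt, hemb, fun y hy a b hab => ?_,
    fun y hy a => ⟨fun ha => ⟨_, hJ y hy a ha⟩, ?_⟩, hJ⟩
  · apply he.injective (hVe hy)
    apply h.fderiv_embed_injective hI (hVU y hy).2 (hVU y hy).1
    exact (hd y hy a).symm.trans (hab.trans (hd y hy b))
  · rintro ⟨b, hb⟩
    have h1 := (hd y hy b).symm.trans (hb.trans (congrArg (Complex.I • ·) (hd y hy a)))
    exact (h.mem_sup_iff (hVe hy) (hVU y hy).1 a).2 (exists_of_fderiv_embed_eq hI (hVU y hy).2 h1)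

end IsFrame

theorem exists_isCREmbeddingOn (hP : P.IsPathGeometry) (x : P.carrier) :
    ∃ (F : P.carrier → Fin 4 → ℂ) (V : Set P.carrier), x ∈ V ∧ P.toCR.IsCREmbeddingOn F V := by
  obtain ⟨U, Z₁, Z₂, h, hxU⟩ := hP.exists_frame x
  set e : OpenPartialHomeomorph P.carrier C3 := chartAt C3 x with he'
  have hxe : x ∈ e.source := mem_chart_source C3 x
  obtain ⟨V₁, h₁, hV₁, hx₁, hVU₁, hh₁, hk₁⟩ := exists_first_integrals h.isOpen h.hol₁ hxU
    (ne_zero_of_det3_left (h.indep _ hxU))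
  obtain ⟨V₂, h₂, hV₂, hx₂, hVU₂, hh₂, hk₂⟩ := exists_first_integrals h.isOpen h.hol₂ hxU
    (ne_zero_of_det3_mid (h.indep _ hxU))
  have hI : IsFirstIntegral (V₁ ∩ V₂) Z₁ Z₂ h₁ h₂ := ⟨hV₁.inter hV₂, hh₁.mono inter_subset_left,
    hh₂.mono inter_subset_right, fun z hz => hk₁ z hz.1, fun z hz => hk₂ z hz.2⟩
  obtain ⟨φ, S, hxφ, hφO, hφ⟩ := exists_leftInverse_of_immersion hI.isOpen
    (contDiffOn_embed hI.hol₁ hI.hol₂) ⟨hx₁, hx₂⟩ (h.fderiv_embed_injective hI ⟨hx₁, hx₂⟩ hxU)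
  have hsrc : ∀ y ∈ (e.trans φ).source, y ∈ e.source ∧ e y ∈ φ.source := fun y hy => by
    rw [e.trans_source] at hy
    exact hy
  refine ⟨fun y => embed h₁ h₂ (e y), (e.trans φ).source, by
    rw [e.trans_source]; exact ⟨hxe, hxφ⟩, h.isCREmbeddingOn hI (e.trans φ).open_source
    (fun y hy => (hsrc y hy).1) (fun y hy => ⟨hVU₁ (hφO (hsrc y hy).2).1, hφO (hsrc y hy).2⟩)
    (fun _ _ => rfl) ?_⟩
  refine IsEmbedding.of_comp ?_ S.continuous ?_
  · have h1 : ContinuousOn (fun y => embed h₁ h₂ (e y)) (e.trans φ).source :=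
      (contDiffOn_embed hI.hol₁ hI.hol₂).continuousOn.comp
        (e.continuousOn.mono fun y hy => (hsrc y hy).1) fun y hy => hφO (hsrc y hy).2
    exact h1.domRestrict
  · have : (S ∘ fun y : (e.trans φ).source => embed h₁ h₂ (e y)) =
        fun y : (e.trans φ).source => (e.trans φ) y := funext fun y => (hφ _).symm
    rw [this]
    exact isEmbedding_restrict_source _

end Threefold

/-! ### The canonical almost complex structure -/

/-- With `J A = i A` and `J B = -i B` this says that the bracket of `A - iJA` and `B + iJB` is of
type `(1,0)` for the standard structure. It holds for all real differentiable fields, since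
differentiation commutes with the constant factor `i`. -/
theorem lieBracket_twist {A B : C3 → C3} {z : C3} (hA : DifferentiableAt ℝ A z)
    (hB : DifferentiableAt ℝ B z) :
    Complex.I • (VectorField.lieBracket ℝ A B z + VectorField.lieBracket ℝ
      (fun y => Complex.I • A y) (fun y => -(Complex.I • B y)) z) =
    -(VectorField.lieBracket ℝ A (fun y => -(Complex.I • B y)) z -
      VectorField.lieBracket ℝ (fun y => Complex.I • A y) B z) := by
  have hIA : fderiv ℝ (fun y => Complex.I • A y) z = Complex.I • fderiv ℝ A z :=
    fderiv_fun_const_smul hA _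
  have hIB : fderiv ℝ (fun y => -(Complex.I • B y)) z = -(Complex.I • fderiv ℝ B z) := by
    rw [fderiv_fun_neg, fderiv_fun_const_smul hB]
  simp only [VectorField.lieBracket, hIA, hIB]
  simp only [_root_.neg_apply, _root_.smul_apply, map_neg, smul_add, smul_sub,
    smul_neg, smul_smul, Complex.I_mul_I]
  simp only [neg_smul, one_smul]
  abel

namespace Threefold

variable {P : Threefold.{u}}

theorem bra_mem_of_line {e : OpenPartialHomeomorph P.carrier C3} {U : Set C3} {Z : C3 → C3}
    {L : P.carrier → Submodule ℂ C3} (hd : IsDiffeoOn ℂ e) (hU : IsOpen U)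
    (hZ : ContDiffOn ℂ ∞ Z U) (hZ0 : ∀ z ∈ U, Z z ≠ 0)
    (hL : ∀ y ∈ e.source, e y ∈ U → ∀ a, a ∈ L y ↔ ∃ r : ℂ, tmap ℝ e y a = r • Z (e y))
    {V : Set P.carrier} (hV : IsOpen V) {X Y : P.carrier → C3} (hX : SmoothFld ℝ X V)
    (hY : SmoothFld ℝ Y V) (hXL : ∀ y ∈ V, X y ∈ L y) (hYL : ∀ y ∈ V, Y y ∈ L y) {x : P.carrier}
    (hx : x ∈ e.source) (hxU : e x ∈ U) (hxV : x ∈ V) : bra ℝ X Y x ∈ L x := by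
  have he := hd.restrictScalars
  have hz := (hZ.contDiffAt (hU.mem_nhds hxU)).differentiableAt (by simp)
  have hO := isOpen_push_domain e hU hV
  have hxO := IsFrame.push_domain_mem hx hxU hxV
  have hdX : ∀ {X : P.carrier → C3}, SmoothFld ℝ X V → DifferentiableAt ℝ (push ℝ e X) (e x) :=
    fun hX => (((smoothFld_iff_contDiffOn.1 (he.push_smooth hV hX)).mono
      inter_subset_right).contDiffAt (hO.mem_nhds hxO)).differentiableAt (by simp)
  have hline : ∀ {X : P.carrier → C3}, (∀ y ∈ V, X y ∈ L y) →
      ∀ᶠ z in 𝓝 (e x), ∃ r : ℂ, push ℝ e X z = r • Z z := by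
    intro X hXL
    filter_upwards [hO.mem_nhds hxO] with z hz
    have hy := e.map_target hz.2.1
    have hr := e.right_inv hz.2.1
    have := (hL _ hy (by rw [hr]; exact hz.1) _).1 (hXL _ hz.2.2)
    rwa [hr] at this
  rw [hL x hx hxU, he.tmap_bra hV hX hY hx hxV, bra_eq_lieBracket, ← det3_line_iff (hZ0 _ hxU)]
  exact det3_bracket_line (hz.restrictScalars ℝ) (hdX hX) (hdX hY)
    (dbar_eq_zero_of_differentiableAt hz _) (hline hXL) (hline hYL)

theorem isInvolutive_l₁ (hP : P.IsPathGeometry) : IsInvolutive P.toCR.Dp := by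
  intro V X Y hV hX hY x hx
  obtain ⟨U, Z₁, Z₂, h, hxU⟩ := hP.exists_frame x
  exact bra_mem_of_line (L := P.l₁) h.diffeo h.isOpen h.hol₁
    (fun z hz => ne_zero_of_det3_left (h.indep z hz)) (fun y hy hyU a => h.mem_l₁_iff hy hyU a)
    hV hX.1 hY.1 hX.2 hY.2 (mem_chart_source C3 x) hxU hx

theorem isInvolutive_l₂ (hP : P.IsPathGeometry) : IsInvolutive P.toCR.Dm := by
  intro V X Y hV hX hY x hx
  obtain ⟨U, Z₁, Z₂, h, hxU⟩ := hP.exists_frame x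
  exact bra_mem_of_line (L := P.l₂) h.diffeo h.isOpen h.hol₂
    (fun z hz => ne_zero_of_det3_mid (h.indep z hz)) (fun y hy hyU a => h.mem_l₂_iff hy hyU a)
    hV hX.1 hY.1 hX.2 hY.2 (mem_chart_source C3 x) hxU hx

theorem smul_bra_twist (hP : P.IsPathGeometry) {V : Set P.carrier} (hV : IsOpen V)
    {X Y : P.carrier → C3} (hX : SmoothFld ℝ X V) (hY : SmoothFld ℝ Y V)
    (hXL : ∀ y ∈ V, X y ∈ P.l₁ y) (hYL : ∀ y ∈ V, Y y ∈ P.l₂ y) {x : P.carrier} (hxV : x ∈ V) :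
    Complex.I • (bra ℝ X Y x + bra ℝ (fun y => twist (P.l₁ y) (P.l₂ y) (X y))
        (fun y => twist (P.l₁ y) (P.l₂ y) (Y y)) x) =
      -(bra ℝ X (fun y => twist (P.l₁ y) (P.l₂ y) (Y y)) x -
        bra ℝ (fun y => twist (P.l₁ y) (P.l₂ y) (X y)) Y x) := by
  let e : OpenPartialHomeomorph P.carrier C3 := chartAt C3 x
  have hd : IsDiffeoOn ℂ e := isDiffeoOn_chart x
  have he := hd.restrictScalars
  have hx : x ∈ e.source := mem_chart_source C3 x
  have hJX : SmoothFld ℝ (fun y => twist (P.l₁ y) (P.l₂ y) (X y)) V :=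
    (isAlmostCR_toCR hP).J_smooth V X hV ⟨hX, fun y hy => (le_sup_left : P.l₁ y ≤ P.l₁ y ⊔ P.l₂ y) (hXL y hy)⟩
  have hJY : SmoothFld ℝ (fun y => twist (P.l₁ y) (P.l₂ y) (Y y)) V :=
    (isAlmostCR_toCR hP).J_smooth V Y hV ⟨hY, fun y hy => (le_sup_right : P.l₂ y ≤ P.l₁ y ⊔ P.l₂ y) (hYL y hy)⟩
  have hO : IsOpen (e.target ∩ e.symm ⁻¹' V) := e.isOpen_inter_preimage_symm hV
  have hxO : e x ∈ e.target ∩ e.symm ⁻¹' V :=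
    ⟨e.map_source hx, by rw [mem_preimage, e.left_inv hx]; exact hxV⟩
  have hdX : ∀ {X : P.carrier → C3}, SmoothFld ℝ X V → DifferentiableAt ℝ (push ℝ e X) (e x) :=
    fun hX => ((smoothFld_iff_contDiffOn.1 (he.push_smooth hV hX)).contDiffAt
      (hO.mem_nhds hxO)).differentiableAt (by simp)
  have pX : push ℝ e (fun y => twist (P.l₁ y) (P.l₂ y) (X y)) =ᶠ[𝓝 (e x)]
      fun z => Complex.I • push ℝ e X z := by
    filter_upwards [hO.mem_nhds hxO] with z hz
    rw [push, push, ← hd.tmap_real_smul (e.map_target hz.1),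
      twist_left (hP.disjoint _) (hXL _ hz.2)]
  have pY : push ℝ e (fun y => twist (P.l₁ y) (P.l₂ y) (Y y)) =ᶠ[𝓝 (e x)]
      fun z => -(Complex.I • push ℝ e Y z) := by
    filter_upwards [hO.mem_nhds hxO] with z hz
    rw [push, push, ← hd.tmap_real_smul (e.map_target hz.1),
      twist_right (hP.disjoint _) (hYL _ hz.2), map_neg]
  have eX : push ℝ e X =ᶠ[𝓝 (e x)] push ℝ e X := .rfl
  have eY : push ℝ e Y =ᶠ[𝓝 (e x)] push ℝ e Y := .rfl
  apply he.injective hx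
  rw [hd.tmap_real_smul hx, map_add, map_neg, map_sub, he.tmap_bra hV hX hY hx hxV,
    he.tmap_bra hV hJX hJY hx hxV, he.tmap_bra hV hX hJY hx hxV, he.tmap_bra hV hJX hY hx hxV,
    bra_congr pX pY, bra_congr eX pY, bra_congr pX eY]
  simp only [bra_eq_lieBracket]
  exact lieBracket_twist (hdX hX) (hdX hY)

/-- Multiplication by `i`. -/
def mulI : C3 →ₗ[ℝ] C3 where
  toFun a := Complex.I • a
  map_add' := smul_add _
  map_smul' _ _ := smul_comm _ _ _

theorem mulI_mulI (a : C3) : mulI (mulI a) = -a := by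
  change Complex.I • Complex.I • a = -a
  rw [smul_smul, Complex.I_mul_I, neg_smul, one_smul]

/-- The complex structure of the 3-fold itself is canonical: it agrees with `J` on `L₁` and with
`-J` on `L₂`, and it is standard in the holomorphic charts. -/
theorem exists_isCanonicalACS (hP : P.IsPathGeometry) :
    ∃ I, P.toCR.IsCanonicalACS I ∧ IsIntegrableACS I := by
  refine ⟨fun _ => mulI, ⟨fun _ => mulI_mulI, fun x a ha => ?_, fun x a ha => ?_,
    fun V X Y hV hX hY x hx => smul_bra_twist hP hV hX.1 hY.1 hX.2 hY.2 hx⟩, fun x => ?_⟩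
  · exact (twist_left (hP.disjoint x) ha).symm
  · exact (neg_eq_iff_eq_neg.2 (twist_right (hP.disjoint x) ha)).symm
  · exact ⟨chartAt C3 x, IsManifold.chart_mem_maximalAtlas x, mem_chart_source C3 x,
      fun y hy a => (isDiffeoOn_chart (M := P.carrier) x).tmap_real_smul hy Complex.I a⟩

theorem isTorsionFreeElliptic_toCR (hP : P.IsPathGeometry) : P.toCR.IsTorsionFreeElliptic where
  toIsElliptic := isElliptic_toCR hP
  embeddable x := ⟨4, exists_isCREmbeddingOn hP x⟩
  involutive_Dp := isInvolutive_l₁ hP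
  involutive_Dm := isInvolutive_l₂ hP
  integrable := exists_isCanonicalACS hP

end Threefold

/-! ### The embedding defined by a general solution -/

namespace ComplexODE

variable {o : ComplexODE} {φ : C3 → ℂ} {Ω : Set C3}

theorem IsGeneralSolution.contDiffOn_jet (h : o.IsGeneralSolution φ Ω) :
    ContDiffOn ℂ ∞ (jet φ) Ω := by
  rw [contDiffOn_pi]
  intro i
  fin_cases i
  · exact (contDiff_apply ℂ ℂ (0 : Fin 3)).contDiffOn
  · exact h.holomorphic
  · exact (h.holomorphic.fderiv_of_isOpen (m := ∞) h.isOpen (by simp)).clm_apply contDiffOn_const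

theorem IsGeneralSolution.fderiv_jet (h : o.IsGeneralSolution φ Ω) {c : C3} (hc : c ∈ Ω) :
    fderiv ℂ (jet φ) c (Pi.single 0 1) = o.total (jet φ c) := by
  have hd := hasFDerivAt_pi'.1 ((h.contDiffOn_jet.contDiffAt
    (h.isOpen.mem_nhds hc)).differentiableAt (by simp)).hasFDerivAt
  ext i
  fin_cases i
  · have := DFunLike.congr_fun ((hd 0).unique (hasFDerivAt_apply (𝕜 := ℂ) (0 : Fin 3) c))
      (Pi.single 0 1)
    refine this.trans ?_
    change (Pi.single 0 1 : C3) 0 = 1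
    simp
  · exact DFunLike.congr_fun (hd 1).fderiv.symm (Pi.single 0 1)
  · exact (DFunLike.congr_fun (hd 2).fderiv.symm (Pi.single 0 1)).trans (h.eq c hc)

/-- The 1-jets of a general solution are holomorphic coordinates. -/
theorem IsGeneralSolution.exists_openPartialHomeomorph (h : o.IsGeneralSolution φ Ω) :
    ∃ J : OpenPartialHomeomorph C3 C3, (J : C3 → C3) = jet φ ∧ J.source = Ω ∧
      J.target = jet φ '' Ω ∧ ContDiffOn ℂ ∞ J.symm J.target := by
  have hloc : ∀ c ∈ Ω, ∃ ψ : OpenPartialHomeomorph C3 C3, (ψ : C3 → C3) = jet φ ∧ c ∈ ψ.source ∧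
      ψ.source ⊆ Ω ∧ ContDiffOn ℂ ∞ ψ.symm ψ.target := by
    intro c hc
    obtain ⟨T, hT⟩ := exists_equiv_of_injective (h.nondegenerate c hc).1
    obtain ⟨ψ, h1, h2, h3, h4, -⟩ := exists_openPartialHomeomorph_of_contDiffOn h.isOpen
      h.contDiffOn_jet hc hT.symm
    exact ⟨ψ, h1, h2, h3, h4⟩
  -- By injectivity there is one inverse on the whole image; it agrees with each local inverse,
  -- hence is holomorphic.
  let inv := Function.invFunOn (jet φ) Ω
  have hinv : ∀ c ∈ Ω, inv (jet φ c) = c := fun c hc => h.injOn.leftInvOn_invFunOn hc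
  have hsub : ∀ ψ : OpenPartialHomeomorph C3 C3, (ψ : C3 → C3) = jet φ → ψ.source ⊆ Ω →
      ψ.target ⊆ jet φ '' Ω ∧ ∀ z ∈ ψ.target, inv z = ψ.symm z := by
    intro ψ hψ hψs
    have h1 : ∀ z ∈ ψ.target, jet φ (ψ.symm z) = z := fun z hz => by
      rw [← hψ]; exact ψ.right_inv hz
    exact ⟨fun z hz => ⟨_, hψs (ψ.map_target hz), h1 z hz⟩, fun z hz => by
      conv_lhs => rw [← h1 z hz]
      exact hinv _ (hψs (ψ.map_target hz))⟩
  have hopen : IsOpen (jet φ '' Ω) := by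
    rw [isOpen_iff_mem_nhds]
    rintro _ ⟨c, hc, rfl⟩
    obtain ⟨ψ, h1, h2, h3, -⟩ := hloc c hc
    refine Filter.mem_of_superset (ψ.open_target.mem_nhds ?_) (hsub ψ h1 h3).1
    rw [← h1]
    exact ψ.map_source h2
  have hsm : ContDiffOn ℂ ∞ inv (jet φ '' Ω) := by
    rintro _ ⟨c, hc, rfl⟩
    obtain ⟨ψ, h1, h2, h3, h4⟩ := hloc c hc
    have hm : jet φ c ∈ ψ.target := by rw [← h1]; exact ψ.map_source h2
    refine ((h4.contDiffAt (ψ.open_target.mem_nhds hm)).congr_of_eventuallyEq ?_).contDiffWithinAt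
    filter_upwards [ψ.open_target.mem_nhds hm] with z hz using (hsub ψ h1 h3).2 z hz
  exact ⟨{
    toFun := jet φ
    invFun := inv
    source := Ω
    target := jet φ '' Ω
    map_source' := fun c hc => ⟨c, hc, rfl⟩
    map_target' := fun z hz => Function.invFunOn_mem hz
    left_inv' := hinv
    right_inv' := fun z hz => Function.invFunOn_eq hz
    open_source := h.isOpen
    open_target := hopen
    continuousOn_toFun := h.contDiffOn_jet.continuousOn
    continuousOn_invFun := hsm.continuousOn }, rfl, rfl, rfl, hsm⟩

/-- The parameters of a general solution and the projection to the plane are first integrals. -/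
theorem IsGeneralSolution.isFirstIntegral (h : o.IsGeneralSolution φ Ω)
    {J : OpenPartialHomeomorph C3 C3} (hJ : (J : C3 → C3) = jet φ) (hJs : J.source = Ω)
    (hJi : ContDiffOn ℂ ∞ J.symm J.target) :
    Threefold.IsFirstIntegral J.target (fun _ => ![0, 0, 1]) o.total (fun z => ![z 0, z 1])
      (fun z => ![J.symm z 1, J.symm z 2]) where
  isOpen := J.open_target
  hol₁ := by
    rw [contDiffOn_pi]
    intro i
    fin_cases i
    · exact (contDiff_apply ℂ ℂ (0 : Fin 3)).contDiffOn
    · exact (contDiff_apply ℂ ℂ (1 : Fin 3)).contDiffOn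
  hol₂ := by
    have := contDiffOn_pi.1 hJi
    rw [contDiffOn_pi]
    intro i
    fin_cases i
    · exact this 1
    · exact this 2
  ker₁ z _ a := by
    have hd : HasFDerivAt (fun z : C3 => (![z 0, z 1] : Fin 2 → ℂ))
        (ContinuousLinearMap.pi ![ContinuousLinearMap.proj (0 : Fin 3),
          ContinuousLinearMap.proj (1 : Fin 3)] : C3 →L[ℂ] (Fin 2 → ℂ)) z := by
      rw [hasFDerivAt_pi']
      intro i
      fin_cases i
      · exact hasFDerivAt_apply (𝕜 := ℂ) (0 : Fin 3) z
      · exact hasFDerivAt_apply (𝕜 := ℂ) (1 : Fin 3) z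
    rw [hd.fderiv]
    constructor
    · intro h0
      refine ⟨a 2, ?_⟩
      ext i
      fin_cases i
      · exact (congrFun h0 0).trans (mul_zero _).symm
      · exact (congrFun h0 1).trans (mul_zero _).symm
      · simp
    · rintro ⟨r, rfl⟩
      ext i
      fin_cases i
      · exact mul_zero r
      · exact mul_zero r
  ker₂ z hz a := by
    have hJc : ContDiffOn ℂ ∞ J J.source := by rw [hJ, hJs]; exact h.contDiffOn_jet
    have hc := J.map_target hz
    have hd1 := ((hJi.contDiffAt (J.open_target.mem_nhds hz)).differentiableAt
      (by simp)).hasFDerivAt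
    have hd2 := ((hJc.contDiffAt (J.open_source.mem_nhds hc)).differentiableAt
      (by simp)).hasFDerivAt
    have hid : ∀ a, fderiv ℂ J (J.symm z) (fderiv ℂ J.symm z a) = a := by
      have h3 := (hd2.comp z hd1).congr_of_eventuallyEq (f₁ := id) (by
        filter_upwards [J.open_target.mem_nhds hz] with y hy
        exact (J.right_inv hy).symm)
      exact fun a => DFunLike.congr_fun (h3.unique (hasFDerivAt_id z)) a
    have htot : fderiv ℂ J (J.symm z) (Pi.single 0 1) = o.total z := by
      have h4 : jet φ (J.symm z) = z := by rw [← hJ]; exact J.right_inv hz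
      rw [hJ, h.fderiv_jet (hJs ▸ hc), h4]
    have hi := fderiv_injective_of_contDiffOn hJi (by rwa [J.symm_symm]) (x := z) hz
    have hi2 := fderiv_injective_of_contDiffOn hJc hJi hc
    have hp := hasFDerivAt_pi'.1 hd1
    have hd : HasFDerivAt (fun z => (![J.symm z 1, J.symm z 2] : Fin 2 → ℂ))
        (ContinuousLinearMap.pi ![ContinuousLinearMap.proj (1 : Fin 3) ∘L fderiv ℂ J.symm z,
          ContinuousLinearMap.proj (2 : Fin 3) ∘L fderiv ℂ J.symm z] : C3 →L[ℂ] (Fin 2 → ℂ))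
        z := by
      rw [hasFDerivAt_pi']
      intro i
      fin_cases i
      · exact hp 1
      · exact hp 2
    rw [hd.fderiv]
    constructor
    -- If the parameters have zero derivative along `a`, then `a` corresponds to a multiple of
    -- `∂_t`, whose image is the total derivative.
    · intro h0
      refine ⟨fderiv ℂ J.symm z a 0, ?_⟩
      rw [← htot, ← map_smul]
      conv_lhs => rw [← hid a]
      congr 1
      ext i
      fin_cases i
      · simp
      · exact (congrFun h0 0).trans (by simp)
      · exact (congrFun h0 1).trans (by simp)
    · rintro ⟨r, rfl⟩
      have h5 : fderiv ℂ J.symm z (r • o.total z) = r • Pi.single 0 1 := by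
        apply hi2
        rw [hid, map_smul, htot]
      ext i
      fin_cases i
      · exact (congrFun h5 1).trans (by simp)
      · exact (congrFun h5 2).trans (by simp)

/-- First integrals of `∂_p` are `x`, `y`; those of the total derivative are the parameters `c₁`,
`c₂`. Three coordinates of the image recover `(t, c₁, c₂)` and the fourth is then the conjugate of
`φ`. -/
theorem IsGeneralSolution.exists_isCREmbeddingOn (h : o.IsGeneralSolution φ Ω) :
    ∃ F : o.toThreefold.toCR.carrier → (Fin 4 → ℂ),
      o.toThreefold.toCR.IsCREmbeddingOn F {q : o.dom | (q : C3) ∈ jet φ '' Ω} ∧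
      (∀ (q : o.dom) (c : C3), c ∈ Ω → (q : C3) = jet φ c →
        F q = ![c 1, c 2, starRingEnd ℂ (c 0), starRingEnd ℂ (φ c)]) ∧
      F '' {q : o.dom | (q : C3) ∈ jet φ '' Ω} =
        {ζ : Fin 4 → ℂ | ![starRingEnd ℂ (ζ 2), ζ 0, ζ 1] ∈ Ω ∧
          starRingEnd ℂ (ζ 3) = φ ![starRingEnd ℂ (ζ 2), ζ 0, ζ 1]} := by
  obtain ⟨J, hJ, hJs, hJt, hJi⟩ := h.exists_openPartialHomeomorph
  have hI := h.isFirstIntegral hJ hJs hJi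
  let H := Threefold.embed (fun z => ![z 0, z 1]) (fun z => ![J.symm z 1, J.symm z 2])
  let F : o.dom → (Fin 4 → ℂ) := fun q => H q
  let V : Set o.dom := {q : o.dom | (q : C3) ∈ jet φ '' Ω}
  have hF : ∀ (q : o.dom) (c : C3), c ∈ Ω → (q : C3) = jet φ c →
      F q = ![c 1, c 2, starRingEnd ℂ (c 0), starRingEnd ℂ (φ c)] := by
    intro q c hc hq
    have h1 : J.symm (q : C3) = c := by
      rw [hq, ← hJ]
      exact J.left_inv (hJs ▸ hc)
    change H (q : C3) = _
    simp only [H, Threefold.embed, h1]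
    rw [hq]
    rfl
  have hVJ : ∀ q : V, ((q : o.dom) : C3) ∈ J.symm.source := fun q => by
    rw [J.symm_source, hJt]
    exact q.2
  have hVo : IsOpen V := by
    have := J.open_target
    rw [hJt] at this
    exact this.preimage continuous_subtype_val
  have hemb : IsEmbedding fun q : V => F q := by
    -- This continuous map recovers `(t, c₁, c₂)`; its composition with `F` is the inverse of the
    -- jet map, an embedding.
    let g : (Fin 4 → ℂ) → C3 := fun ζ => ![starRingEnd ℂ (ζ 2), ζ 0, ζ 1]
    have hg : Continuous g := by
      refine continuous_pi fun i => ?_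
      fin_cases i
      · exact Complex.continuous_conj.comp (continuous_apply 2)
      · exact continuous_apply 0
      · exact continuous_apply 1
    refine IsEmbedding.of_comp (g := g) ?_ hg ?_
    · have h1 : ContinuousOn H J.target :=
        (Threefold.contDiffOn_embed hI.hol₁ hI.hol₂).continuousOn
      exact h1.comp_continuous (continuous_subtype_val.comp continuous_subtype_val) hVJ
    · have h1 : (g ∘ fun q : V => F q) = (fun y : J.symm.source => J.symm y) ∘
          J.symm.source.codRestrict (fun q : V => ((q : o.dom) : C3)) hVJ := by
        ext q : 1
        obtain ⟨c, hc, hq⟩ := q.2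
        have h2 : J.symm ((q : o.dom) : C3) = c := by
          rw [← hq, ← hJ]
          exact J.left_inv (hJs ▸ hc)
        simp only [Function.comp_apply, codRestrict, h2]
        rw [hF q c hc hq.symm]
        ext i
        fin_cases i <;> simp [g]
      rw [h1]
      exact (isEmbedding_restrict_source J.symm).comp
        ((IsEmbedding.subtypeVal.comp IsEmbedding.subtypeVal).codRestrict _ _)
  refine ⟨F, ?_, hF, ?_⟩
  · rcases isEmpty_or_nonempty o.dom with hemp | ⟨⟨q⟩⟩
    · exact ⟨hVo, fun x _ => (hemp.false x).elim, hemb, fun x => (hemp.false x).elim,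
        fun x => (hemp.false x).elim, fun x => (hemp.false x).elim⟩
    · exact (o.isFrame q).isCREmbeddingOn hI hVo (fun y _ => o.coord_mem_source q y)
        (fun y hy => ⟨Subtype.prop (show o.dom from y), hVJ ⟨y, hy⟩⟩) (fun _ _ => rfl) hemb
  · ext ζ
    constructor
    · rintro ⟨q, ⟨c, hc, hq⟩, rfl⟩
      have h1 : F q = _ := hF q c hc hq.symm
      have h2 : (![starRingEnd ℂ (F q 2), F q 0, F q 1] : C3) = c := by
        rw [h1]
        ext i
        fin_cases i <;> simp
      refine ⟨?_, ?_⟩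
      · exact h2.symm ▸ hc
      · refine Eq.trans ?_ (congrArg φ h2).symm
        rw [h1]
        simp
    · rintro ⟨hc, hζ⟩
      set c : C3 := ![starRingEnd ℂ (ζ 2), ζ 0, ζ 1]
      refine ⟨(⟨jet φ c, h.mem c hc⟩ : o.dom), ⟨c, hc, rfl⟩, ?_⟩
      refine (hF ⟨jet φ c, h.mem c hc⟩ c hc rfl).trans ?_
      rw [← hζ]
      ext i
      fin_cases i <;> simp [c]

end ComplexODE

/-! ### Normalized generators of complex line fields in coordinates -/

/-- A constant component has zero derivative. With `eq_zero_of_eq_smul`, this turns "proportional to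
`X`" into "zero" for the `(0,1)`-derivatives of a normalized generator `X`. -/
theorem dbar_apply_eq_zero {X : C3 → C3} {z : C3} (hX : DifferentiableAt ℝ X z) {k : Fin 3} {c : ℂ}
    (hk : ∀ᶠ y in 𝓝 z, X y k = c) (a : C3) : dbar X z a k = 0 := by
  have h1 : HasFDerivAt (fun y => X y k) (0 : C3 →L[ℝ] ℂ) z :=
    (hasFDerivAt_const c z).congr_of_eventuallyEq hk
  have h2 := (hasFDerivAt_pi'.1 hX.hasFDerivAt k).unique h1
  have h3 : ∀ v, fderiv ℝ X z v k = 0 := fun v => DFunLike.congr_fun h2 v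
  simp [dbar, h3]

theorem eq_zero_of_eq_smul {v w : C3} {r : ℂ} {k : Fin 3} (h : v = r • w) (hw : w k = 1)
    (hv : v k = 0) : v = 0 := by
  have h1 := congrFun h k
  rw [hv, Pi.smul_apply, hw, smul_eq_mul, mul_one] at h1
  rw [h, ← h1, zero_smul]

/-- A normalized generator of an involutive complex line field is annihilated by its own
conjugate. -/
theorem dbar_self_eq_zero {X : C3 → C3} {z : C3} (hX : DifferentiableAt ℝ X z) {k : Fin 3}
    (hk : ∀ᶠ y in 𝓝 z, X y k = 1) {r : ℂ}
    (h : VectorField.lieBracket ℝ X (fun y => Complex.I • X y) z = r • X z) :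
    dbar X z (X z) = 0 := by
  have h1 : fderiv ℝ (fun y => Complex.I • X y) z = Complex.I • fderiv ℝ X z :=
    fderiv_fun_const_smul hX _
  have h2 : VectorField.lieBracket ℝ X (fun y => Complex.I • X y) z =
      Complex.I • dbar X z (X z) := by
    simp only [VectorField.lieBracket, h1, dbar, _root_.smul_apply, smul_add, smul_smul,
      Complex.I_mul_I, neg_one_smul]
    abel
  rw [h2] at h
  have h3 : dbar X z (X z) = (-(Complex.I * r)) • X z := by
    have := congrArg (fun v => -(Complex.I • v)) h
    simp only [smul_smul, Complex.I_mul_I, neg_one_smul, neg_neg] at this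
    rw [this, neg_smul]
  exact eq_zero_of_eq_smul h3 hk.self_of_nhds (dbar_apply_eq_zero hX hk _)

theorem fderiv_lieBracket {W : Type*} [NormedAddCommGroup W] [NormedSpace ℝ W] {G : C3 → W}
    {A B : C3 → C3} {z : C3} (hG : ContDiffAt ℝ 2 G z) (hA : DifferentiableAt ℝ A z)
    (hB : DifferentiableAt ℝ B z) : fderiv ℝ G z (VectorField.lieBracket ℝ A B z) =
      fderiv ℝ (fun y => fderiv ℝ G y (B y)) z (A z) -
        fderiv ℝ (fun y => fderiv ℝ G y (A y)) z (B z) := by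
  have hG' : DifferentiableAt ℝ (fderiv ℝ G) z :=
    (hG.fderiv_right (m := 1) (by norm_num)).differentiableAt (by norm_num)
  have hsymm : IsSymmSndFDerivAt ℝ G z := hG.isSymmSndFDerivAt (by simp)
  rw [(hG'.hasFDerivAt.clm_apply hA.hasFDerivAt).fderiv,
    (hG'.hasFDerivAt.clm_apply hB.hasFDerivAt).fderiv]
  simp only [VectorField.lieBracket, map_sub, _root_.add_apply, ContinuousLinearMap.comp_apply,
    ContinuousLinearMap.flip_apply]
  rw [hsymm (A z) (B z)]
  abel

/-- The hypotheses say that the complex fields `X + i X'` and `Y + i Y'` annihilate `G`. Hence so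
does their bracket, and the identity is this fact separated into real fields. -/
theorem fderiv_bracket_complex {W : Type*} [NormedAddCommGroup W] [NormedSpace ℂ W] {G : C3 → W}
    {X Y X' Y' : C3 → C3} {z : C3} (hG : ContDiffAt ℝ 2 G z) (hX : DifferentiableAt ℝ X z)
    (hY : DifferentiableAt ℝ Y z) (hX' : DifferentiableAt ℝ X' z) (hY' : DifferentiableAt ℝ Y' z)
    (hGX : ∀ᶠ y in 𝓝 z, fderiv ℝ G y (X' y) = Complex.I • fderiv ℝ G y (X y))
    (hGY : ∀ᶠ y in 𝓝 z, fderiv ℝ G y (Y' y) = Complex.I • fderiv ℝ G y (Y y)) :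
    fderiv ℝ G z (VectorField.lieBracket ℝ X Y' z + VectorField.lieBracket ℝ X' Y z) =
      Complex.I • fderiv ℝ G z
        (VectorField.lieBracket ℝ X Y z - VectorField.lieBracket ℝ X' Y' z) := by
  have hG' : DifferentiableAt ℝ (fderiv ℝ G) z :=
    (hG.fderiv_right (m := 1) (by norm_num)).differentiableAt (by norm_num)
  have key : ∀ {A A' : C3 → C3}, DifferentiableAt ℝ A z →
      (∀ᶠ y in 𝓝 z, fderiv ℝ G y (A' y) = Complex.I • fderiv ℝ G y (A y)) → ∀ v,
      fderiv ℝ (fun y => fderiv ℝ G y (A' y)) z v =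
        Complex.I • fderiv ℝ (fun y => fderiv ℝ G y (A y)) z v := by
    intro A A' hA h v
    rw [Filter.EventuallyEq.fderiv_eq h, fderiv_fun_const_smul (hG'.clm_apply hA) Complex.I,
      _root_.smul_apply]
  rw [map_add, map_sub, fderiv_lieBracket hG hX hY, fderiv_lieBracket hG hX' hY',
    fderiv_lieBracket hG hX hY', fderiv_lieBracket hG hX' hY, key hX hGX, key hX hGX, key hY hGY,
    key hY hGY]
  simp only [smul_sub, smul_smul, Complex.I_mul_I, neg_one_smul]
  abel

/-- Let `u`, `v` be the left sides of `hu`, `hv`. Then `i v - u = 2 dbar X (Y) = -2 r X` and `i v +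
u = 2 dbar Y (X) = 2 s Y`, and the normalized components force both to vanish. -/
theorem dbar_eq_zero_of_bracket {X Y : C3 → C3} {z : C3} (hX : DifferentiableAt ℝ X z)
    (hY : DifferentiableAt ℝ Y z) {k m : Fin 3} (hk : ∀ᶠ y in 𝓝 z, X y k = 1)
    (hm : ∀ᶠ y in 𝓝 z, Y y m = 1) {r s : ℂ}
    (hu : VectorField.lieBracket ℝ X Y z - VectorField.lieBracket ℝ (fun y => Complex.I • X y)
      (fun y => -(Complex.I • Y y)) z = r • X z + s • Y z)
    (hv : VectorField.lieBracket ℝ X (fun y => -(Complex.I • Y y)) z +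
      VectorField.lieBracket ℝ (fun y => Complex.I • X y) Y z =
        (Complex.I * r) • X z + (-(Complex.I * s)) • Y z) :
    dbar X z (Y z) = 0 ∧ dbar Y z (X z) = 0 := by
  have h1 : fderiv ℝ (fun y => Complex.I • X y) z = Complex.I • fderiv ℝ X z :=
    fderiv_fun_const_smul hX _
  have h2 : fderiv ℝ (fun y => -(Complex.I • Y y)) z = -(Complex.I • fderiv ℝ Y z) := by
    rw [fderiv_fun_neg, fderiv_fun_const_smul hY]
  have hv' := congrArg (fun v => Complex.I • v) hv
  simp only [VectorField.lieBracket, h1, h2, _root_.smul_apply, _root_.neg_apply, smul_add,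
    smul_sub, smul_neg, map_neg, smul_smul, ← mul_assoc, Complex.I_mul_I, neg_mul, one_mul,
    one_smul, neg_smul, neg_neg] at hu hv'
  constructor
  · refine eq_zero_of_eq_smul (r := -r) ?_ hk.self_of_nhds (dbar_apply_eq_zero hX hk _)
    have h3 := congrArg₂ (· - ·) hv' hu
    have h4 : (2 : ℂ) • dbar X z (Y z) = (2 : ℂ) • ((-r) • X z) := by
      simp only [dbar, two_smul, neg_smul]
      refine Eq.trans ?_ (h3.trans ?_) <;> abel
    exact smul_right_injective C3 (two_ne_zero (α := ℂ)) h4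
  · refine eq_zero_of_eq_smul (r := s) ?_ hm.self_of_nhds (dbar_apply_eq_zero hY hm _)
    have h3 := congrArg₂ (· + ·) hv' hu
    have h4 : (2 : ℂ) • dbar Y z (X z) = (2 : ℂ) • (s • Y z) := by
      simp only [dbar, two_smul]
      refine Eq.trans ?_ (h3.trans ?_) <;> abel
    exact smul_right_injective C3 (two_ne_zero (α := ℂ)) h4

/-- A distribution of complex lines has a generator with a constant component. -/
theorem exists_complex_generator {M : Type u} [TopologicalSpace M] [ChartedSpace C3 M]
    [IsManifold 𝓘(ℝ, C3) ∞ M] {L : M → Submodule ℝ C3} (hL : IsSmoothDistribution (M := M) 2 L)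
    {e : OpenPartialHomeomorph M C3} (he : IsDiffeoOn ℝ e)
    (hI : ∀ y ∈ e.source, ∀ a ∈ L y, ∃ b ∈ L y, tmap ℝ e y b = Complex.I • tmap ℝ e y a)
    {x : M} (hx : x ∈ e.source) :
    ∃ (k : Fin 3) (U : Set C3) (X : C3 → C3), IsOpen U ∧ e x ∈ U ∧ U ⊆ e.target ∧
      ContDiffOn ℝ ∞ X U ∧ (∀ z ∈ U, X z k = 1) ∧
      ∀ y ∈ e.source, e y ∈ U → ∀ a, a ∈ L y ↔ ∃ r : ℂ, tmap ℝ e y a = r • X (e y) := by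
  obtain ⟨V, hV, hxV, W, hW, hWL⟩ := hL x
  let w : Fin 2 → M → C3 := W
  have hw0 : ∀ y ∈ V, w 0 y ≠ 0 := fun y hy => (hWL y hy).1.ne_zero 0
  have hmem : ∀ y ∈ V, ∀ a, a ∈ L y ↔ ∃ α β : ℝ, α • w 0 y + β • w 1 y = a := by
    intro y hy a
    have h1 : a ∈ L y ↔ a ∈ Submodule.span ℝ (range fun i => w i y) := by
      have : L y = Submodule.span ℝ (range fun i => w i y) := (hWL y hy).2
      rw [this]
    rw [h1, Submodule.mem_span_range_iff_exists_fun]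
    constructor
    · rintro ⟨c, hc⟩
      exact ⟨c 0, c 1, by rw [← hc, Fin.sum_univ_two]⟩
    · rintro ⟨α, β, h⟩
      exact ⟨![α, β], by rw [Fin.sum_univ_two, ← h]; rfl⟩
  have hpx : push ℝ e (w 0) (e x) ≠ 0 := by
    rw [push_apply e _ hx]
    intro h0
    exact hw0 x hxV (he.injective hx (h0.trans (map_zero _).symm))
  obtain ⟨k, hk⟩ := Function.ne_iff.1 hpx
  have hsm : ContDiffOn ℝ ∞ (push ℝ e (w 0)) (e.target ∩ e.symm ⁻¹' V) :=
    smoothFld_iff_contDiffOn.1 (he.push_smooth hV (hW 0))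
  have hsmk := contDiffOn_pi.1 hsm k
  have hO : IsOpen (e.target ∩ e.symm ⁻¹' V) := e.isOpen_inter_preimage_symm hV
  refine ⟨k, (e.target ∩ e.symm ⁻¹' V) ∩ (fun z => push ℝ e (w 0) z k) ⁻¹' {0}ᶜ,
    fun z => (push ℝ e (w 0) z k)⁻¹ • push ℝ e (w 0) z,
    hsmk.continuousOn.isOpen_inter_preimage hO isOpen_compl_singleton,
    ⟨⟨e.map_source hx, by rw [mem_preimage, e.left_inv hx]; exact hxV⟩, hk⟩,
    fun z hz => hz.1.1,
    ((hsmk.mono inter_subset_left).inv fun z hz => hz.2).smul (hsm.mono inter_subset_left),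
    fun z hz => inv_mul_cancel₀ hz.2, fun y hy hyU a => ?_⟩
  have hyV : y ∈ V := by
    have : e.symm (e y) ∈ V := hyU.1.2
    rwa [e.left_inv hy] at this
  have hc : push ℝ e (w 0) (e y) k ≠ 0 := hyU.2
  rw [push_apply e _ hy] at hc
  simp only [push_apply e _ hy]
  have h0L : w 0 y ∈ L y := (hmem y hyV _).2 ⟨1, 0, by rw [one_smul, zero_smul, add_zero]⟩
  obtain ⟨b, hbL, hb⟩ := hI y hy _ h0L
  obtain ⟨α, β, hαβ⟩ := (hmem y hyV b).1 hbL
  rw [← hαβ, map_add, map_smul, map_smul] at hb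
  -- If `β = 0`, the real number `α` would equal `i`. Hence `w 1` is a complex multiple of `w 0`,
  -- and the distribution is the complex line through `w 0`.
  have hβ : (β : ℂ) ≠ 0 := by
    intro hβ
    rw [Complex.ofReal_eq_zero.1 hβ, zero_smul, add_zero] at hb
    have h1 := congrFun hb k
    rw [Pi.smul_apply, Pi.smul_apply, Complex.real_smul, smul_eq_mul] at h1
    have h2 := mul_right_cancel₀ hc h1
    have h3 := congrArg Complex.im h2
    simp at h3
  constructor
  · intro ha
    obtain ⟨α', β', rfl⟩ := (hmem y hyV a).1 ha
    refine ⟨(α' + β' * ((Complex.I - α) / β)) * tmap ℝ e y (w 0 y) k, ?_⟩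
    have h1 : tmap ℝ e y (w 1 y) = ((Complex.I - α) / β) • tmap ℝ e y (w 0 y) := by
      apply smul_right_injective C3 hβ
      change (β : ℂ) • _ = (β : ℂ) • _
      rw [smul_smul, mul_div_cancel₀ _ hβ, sub_smul, ← hb, Complex.coe_smul, Complex.coe_smul,
        add_sub_cancel_left]
    rw [smul_smul, mul_assoc, mul_inv_cancel₀ hc, mul_one, map_add, map_smul, map_smul, h1,
      add_smul, mul_smul, Complex.coe_smul, Complex.coe_smul]
  · rintro ⟨r, hr⟩
    rw [smul_smul] at hr
    generalize r * (tmap ℝ e y (w 0 y) k)⁻¹ = s at hr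
    have : a = s.re • w 0 y + s.im • b := by
      apply he.injective hy
      rw [hr, map_add, map_smul, map_smul, ← hαβ, map_add, map_smul, map_smul, hb]
      conv_lhs => rw [← Complex.re_add_im s]
      rw [add_smul, mul_smul, Complex.coe_smul, Complex.coe_smul]
    rw [this]
    exact (L y).add_mem ((L y).smul_mem _ h0L) ((L y).smul_mem _ hbL)

/-! ### Torsion-free elliptic CR-manifolds in complex coordinates -/

namespace CRManifold

variable {C : CRManifold.{u}}

/-- The distribution `D`, with values in the model space. -/
def d (C : CRManifold.{u}) (x : C.carrier) : Submodule ℝ C3 := C.D x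

/-- The distribution `D⁺`, with values in the model space. -/
def dp (C : CRManifold.{u}) (x : C.carrier) : Submodule ℝ C3 := C.Dp x

/-- The distribution `D⁻`, with values in the model space. -/
def dm (C : CRManifold.{u}) (x : C.carrier) : Submodule ℝ C3 := C.Dm x

/-- The structure map `J`, with values in the model space. -/
def j (C : CRManifold.{u}) (x : C.carrier) (a : C3) : C3 := C.J x a

theorem smoothFld_neg {X : C.carrier → C3} {V : Set C.carrier} (hX : SmoothFld ℝ X V) :
    SmoothFld ℝ (fun y => -X y) V :=
  ContMDiffOn.neg_section (V := fun x : C.carrier => TangentSpace 𝓘(ℝ, C3) x) hX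

theorem bra_neg_left {X Y : C.carrier → C3} {V : Set C.carrier} (hV : IsOpen V)
    (hX : SmoothFld ℝ X V) {x : C.carrier} (hx : x ∈ V) :
    bra ℝ (fun y => -X y) Y x = -bra ℝ X Y x := by
  have h1 : IsManifold 𝓘(ℝ, C3) (minSmoothness ℝ 2) C.carrier := by
    rw [minSmoothness_of_isRCLikeNormedField]
    exact .of_le (n := ∞) ENat.LEInfty.out
  have h2 : (fun y => -X y) = (-1 : ℝ) • X := by
    funext y
    simp
  rw [h2]
  have := VectorField.mlieBracket_const_smul_left (I := 𝓘(ℝ, C3)) (c := (-1 : ℝ)) (W := Y)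
    ((hX.contMDiffAt (hV.mem_nhds hx)).mdifferentiableAt (by simp))
  exact Eq.trans this (neg_one_smul ℝ (bra ℝ X Y x))

theorem leviValue_neg_left {x : C.carrier} {u v w : C3} (h : LeviValue C.D x u v w) :
    LeviValue C.D x (-u : C3) v (-w : C3) := by
  obtain ⟨V, X, Y, hV, hxV, hX, hY, rfl, rfl, rfl⟩ := h
  exact ⟨V, fun y => (-X y : C3), Y, hV, hxV,
    ⟨smoothFld_neg hX.1, fun y hy => (C.d y).neg_mem (hX.2 y hy)⟩, hY, rfl, rfl,
    bra_neg_left hV hX.1 hxV⟩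

/-- `Ja - iJ(Ja) = i (a - iJa)`, so the null condition is multiplied by `i`. It gives the
`J`-invariance of `D⁺` and `D⁻`. -/
theorem IsAlmostCR.isNullVector_j (h : C.IsAlmostCR) {x : C.carrier} {ℓ : C3 →ₗ[ℝ] ℂ} {a : C3}
    (ha : C.IsNullVector x ℓ a) : C.IsNullVector x ℓ (C.j x a) := by
  refine ⟨h.J_mem x a ha.1, fun b hb w w' hw hw' => ?_⟩
  have hJ : C.J x (C.j x a) = (-a : C3) := h.J_sq x a ha.1
  rw [hJ] at hw'
  have h1 := leviValue_neg_left hw'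
  have h2 : (- -a : C3) = a := neg_neg a
  rw [h2] at h1
  have h3 : ℓ (-w' : C3) - Complex.I * ℓ w = 0 := ha.2 b hb _ _ h1 hw
  have h4 : ℓ (-w' : C3) = -ℓ w' := map_neg ℓ w'
  generalize ℓ (-w' : C3) = p at h3 h4
  subst h4
  linear_combination Complex.I * h3 + ℓ w * Complex.I_mul_I

theorem IsElliptic.j_mem_dp (h : C.IsElliptic) {x : C.carrier} {a : C3} (ha : a ∈ C.dp x) :
    C.j x a ∈ C.dp x := by
  obtain ⟨ℓ, -, -, hp, -⟩ := h.null x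
  exact (hp _).2 (h.isNullVector_j ((hp _).1 ha))

theorem IsElliptic.j_mem_dm (h : C.IsElliptic) {x : C.carrier} {a : C3} (ha : a ∈ C.dm x) :
    C.j x a ∈ C.dm x := by
  obtain ⟨ℓ, -, -, -, hm⟩ := h.null x
  exact (hm _).2 (h.isNullVector_j ((hm _).1 ha))

theorem IsElliptic.mem_d_iff (h : C.IsElliptic) {x : C.carrier} {a : C3} :
    a ∈ C.d x ↔ ∃ b ∈ C.dp x, ∃ c ∈ C.dm x, b + c = a := by
  have : C.dp x ⊔ C.dm x = C.d x := (h.splitting x).2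
  rw [← this]
  exact Submodule.mem_sup

theorem IsElliptic.disjoint (h : C.IsElliptic) (x : C.carrier) : Disjoint (C.dp x) (C.dm x) :=
  (h.splitting x).1

/-- Coordinates in which `J` is multiplication by `i` on `D⁺` and by `-i` on `D⁻`. -/
structure IsAdapted (C : CRManifold.{u}) (e : OpenPartialHomeomorph C.carrier C3) : Prop where
  diffeo : IsDiffeoOn ℝ e
  tmap_dp : ∀ y ∈ e.source, ∀ a ∈ C.dp y, tmap ℝ e y (C.j y a) = Complex.I • tmap ℝ e y a
  tmap_dm : ∀ y ∈ e.source, ∀ a ∈ C.dm y, tmap ℝ e y (C.j y a) = -(Complex.I • tmap ℝ e y a)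

/-- Over the open set `U` in the adapted coordinates `e`, the line fields `D⁺` and `D⁻` are
generated by `X` and `Y`, which have a component equal to one. -/
structure IsNormalFrame (C : CRManifold.{u}) (e : OpenPartialHomeomorph C.carrier C3) (U : Set C3)
    (X Y : C3 → C3) (k m : Fin 3) : Prop where
  adapted : C.IsAdapted e
  isOpen : IsOpen U
  subset : U ⊆ e.target
  smooth_p : ContDiffOn ℝ ∞ X U
  smooth_m : ContDiffOn ℝ ∞ Y U
  norm_p : ∀ z ∈ U, X z k = 1
  norm_m : ∀ z ∈ U, Y z m = 1
  mem_dp : ∀ y ∈ e.source, e y ∈ U → ∀ a, a ∈ C.dp y ↔ ∃ r : ℂ, tmap ℝ e y a = r • X (e y)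
  mem_dm : ∀ y ∈ e.source, e y ∈ U → ∀ a, a ∈ C.dm y ↔ ∃ r : ℂ, tmap ℝ e y a = r • Y (e y)

theorem IsElliptic.exists_isNormalFrame (h : C.IsElliptic)
    {e : OpenPartialHomeomorph C.carrier C3} (he : C.IsAdapted e) {x : C.carrier}
    (hx : x ∈ e.source) :
    ∃ (U : Set C3) (X Y : C3 → C3) (k m : Fin 3), C.IsNormalFrame e U X Y k m ∧ e x ∈ U := by
  obtain ⟨k, U, X, hU, hxU, hUe, hX, hXk, hXm⟩ := exists_complex_generator (L := C.dp) h.rank_Dp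
    he.diffeo (fun y hy a ha => ⟨_, h.j_mem_dp ha, he.tmap_dp y hy a ha⟩) hx
  obtain ⟨m, U', Y, hU', hxU', hUe', hY, hYk, hYm⟩ := exists_complex_generator (L := C.dm)
    h.rank_Dm he.diffeo (fun y hy a ha => ⟨_, (C.dm y).neg_mem (h.j_mem_dm ha), by
      rw [map_neg, he.tmap_dm y hy a ha, neg_neg]⟩) hx
  exact ⟨U ∩ U', X, Y, k, m, ⟨he, hU.inter hU', inter_subset_left.trans hUe,
    hX.mono inter_subset_left, hY.mono inter_subset_right, fun z hz => hXk z hz.1,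
    fun z hz => hYk z hz.2, fun y hy hyU => hXm y hy hyU.1, fun y hy hyU => hYm y hy hyU.2⟩,
    hxU, hxU'⟩

/-- The real differential in coordinates. -/
theorem IsCREmbeddingOn.realDiff_eq {N : ℕ} {F : C.carrier → Fin N → ℂ} {V : Set C.carrier}
    (hF : C.IsCREmbeddingOn F V) {e : OpenPartialHomeomorph C.carrier C3} (he : IsDiffeoOn ℝ e)
    {y : C.carrier} (hy : y ∈ e.source) (hyV : y ∈ V) (a : C3) :
    (realDiff F y a : Fin N → ℂ) = fderiv ℝ (F ∘ e.symm) (e y) (tmap ℝ e y a) := by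
  have h1 : MDifferentiableAt 𝓘(ℝ, C3) 𝓘(ℝ, Fin N → ℂ) F (e.symm (e y)) := by
    rw [e.left_inv hy]
    exact (hF.smooth.contMDiffAt (hF.isOpen.mem_nhds hyV)).mdifferentiableAt (by simp)
  have h2 := mfderiv_comp (I' := 𝓘(ℝ, C3)) (e y) h1
    (he.symm.mdifferentiable.mdifferentiableAt (e.map_source hy))
  rw [mfderiv_eq_fderiv] at h2
  have h3 := DFunLike.congr_fun h2 (tmap ℝ e y a)
  refine Eq.trans ?_ h3.symm
  change realDiff F y a = realDiff F (e.symm (e y)) (tmap ℝ e.symm (e y) (tmap ℝ e y a))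
  rw [he.tmap_symm_tmap hy, e.left_inv hy]

theorem IsCREmbeddingOn.contDiffAt {N : ℕ} {F : C.carrier → Fin N → ℂ} {V : Set C.carrier}
    (hF : C.IsCREmbeddingOn F V) {e : OpenPartialHomeomorph C.carrier C3} (he : IsDiffeoOn ℝ e)
    {y : C.carrier} (hy : y ∈ e.source) (hyV : y ∈ V) : ContDiffAt ℝ ∞ (F ∘ e.symm) (e y) := by
  rw [← contMDiffAt_iff_contDiffAt]
  refine ContMDiffAt.comp (I' := 𝓘(ℝ, C3)) (e y) ?_
    (he.smooth_symm.contMDiffAt (e.open_target.mem_nhds (e.map_source hy)))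
  rw [e.left_inv hy]
  exact hF.smooth.contMDiffAt (hF.isOpen.mem_nhds hyV)

end CRManifold

/-! ### The coordinates of a torsion-free elliptic CR-manifold -/

section Lift

variable {M : Type*} [TopologicalSpace M] [ChartedSpace C3 M] [IsManifold 𝓘(ℝ, C3) ∞ M]
  {e : OpenPartialHomeomorph M C3}

omit [IsManifold 𝓘(ℝ, C3) ∞ M] in
theorem IsDiffeoOn.tmap_lift (he : IsDiffeoOn ℝ e) (W : C3 → C3) {y : M} (hy : y ∈ e.source) :
    tmap ℝ e y (push ℝ e.symm W y) = W (e y) :=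
  he.tmap_tmap_symm' hy _

theorem IsDiffeoOn.lift_smooth (he : IsDiffeoOn ℝ e) {W : C3 → C3} {U : Set C3} (hU : IsOpen U)
    (hW : ContDiffOn ℝ ∞ W U) : SmoothFld ℝ (push ℝ e.symm W) (e.source ∩ e ⁻¹' U) :=
  he.symm.push_smooth hU (smoothFld_iff_contDiffOn.2 hW)

theorem IsDiffeoOn.tmap_bra_lift (he : IsDiffeoOn ℝ e) {A B : C3 → C3} {U : Set C3} (hU : IsOpen U)
    (hA : ContDiffOn ℝ ∞ A U) (hB : ContDiffOn ℝ ∞ B U) {y : M} (hy : y ∈ e.source)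
    (hyU : e y ∈ U) : tmap ℝ e y (bra ℝ (push ℝ e.symm A) (push ℝ e.symm B) y) =
      VectorField.lieBracket ℝ A B (e y) := by
  rw [he.tmap_bra (e.isOpen_inter_preimage hU) (he.lift_smooth hU hA) (he.lift_smooth hU hB) hy
    ⟨hy, hyU⟩, ← bra_eq_lieBracket]
  have key : ∀ W : C3 → C3, push ℝ e (push ℝ e.symm W) =ᶠ[𝓝 (e y)] W := by
    intro W
    filter_upwards [e.open_target.mem_nhds (e.map_source hy)] with z hz
    exact he.symm.push_symm_push W hz
  exact bra_congr (key A) (key B)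

end Lift

/-! ### Cauchy-Riemann equations for normalized generators of `D⁺` and `D⁻` -/

namespace CRManifold

variable {C : CRManifold.{u}}

namespace IsNormalFrame

variable {e : OpenPartialHomeomorph C.carrier C3} {U : Set C3} {X Y : C3 → C3} {k m : Fin 3}

theorem differentiableAt_p (h : C.IsNormalFrame e U X Y k m) {z : C3} (hz : z ∈ U) :
    DifferentiableAt ℝ X z :=
  (h.smooth_p.contDiffAt (h.isOpen.mem_nhds hz)).differentiableAt (by simp)

theorem differentiableAt_m (h : C.IsNormalFrame e U X Y k m) {z : C3} (hz : z ∈ U) :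
    DifferentiableAt ℝ Y z :=
  (h.smooth_m.contDiffAt (h.isOpen.mem_nhds hz)).differentiableAt (by simp)

theorem eventually_p (h : C.IsNormalFrame e U X Y k m) {z : C3} (hz : z ∈ U) :
    ∀ᶠ y in 𝓝 z, X y k = 1 := by
  filter_upwards [h.isOpen.mem_nhds hz] with y hy using h.norm_p y hy

theorem eventually_m (h : C.IsNormalFrame e U X Y k m) {z : C3} (hz : z ∈ U) :
    ∀ᶠ y in 𝓝 z, Y y m = 1 := by
  filter_upwards [h.isOpen.mem_nhds hz] with y hy using h.norm_m y hy

theorem lift_mem_dp (h : C.IsNormalFrame e U X Y k m) (r : ℂ) {y : C.carrier}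
    (hy : y ∈ e.source ∩ e ⁻¹' U) : push ℝ e.symm (fun z => r • X z) y ∈ C.dp y :=
  (h.mem_dp y hy.1 hy.2 _).2 ⟨r, h.adapted.diffeo.tmap_lift _ hy.1⟩

theorem lift_mem_dm (h : C.IsNormalFrame e U X Y k m) (r : ℂ) {y : C.carrier}
    (hy : y ∈ e.source ∩ e ⁻¹' U) : push ℝ e.symm (fun z => r • Y z) y ∈ C.dm y :=
  (h.mem_dm y hy.1 hy.2 _).2 ⟨r, h.adapted.diffeo.tmap_lift _ hy.1⟩

theorem mem_d_iff (h : C.IsNormalFrame e U X Y k m) (hC : C.IsElliptic) {y : C.carrier}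
    (hy : y ∈ e.source) (hyU : e y ∈ U) (a : C3) :
    a ∈ C.d y ↔ ∃ r s : ℂ, tmap ℝ e y a = r • X (e y) + s • Y (e y) := by
  have he := h.adapted.diffeo
  rw [hC.mem_d_iff]
  constructor
  · rintro ⟨b, hb, c, hc, rfl⟩
    obtain ⟨r, hr⟩ := (h.mem_dp y hy hyU b).1 hb
    obtain ⟨s, hs⟩ := (h.mem_dm y hy hyU c).1 hc
    exact ⟨r, s, by rw [map_add, hr, hs]⟩
  · rintro ⟨r, s, hrs⟩
    refine ⟨_, h.lift_mem_dp r ⟨hy, hyU⟩, _, h.lift_mem_dm s ⟨hy, hyU⟩, he.injective hy ?_⟩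
    rw [map_add, hrs, he.tmap_lift _ hy, he.tmap_lift _ hy]

theorem tmap_j (h : C.IsNormalFrame e U X Y k m) (hC : C.IsElliptic) {y : C.carrier}
    (hy : y ∈ e.source) (hyU : e y ∈ U) {a : C3} {r s : ℂ}
    (ha : tmap ℝ e y a = r • X (e y) + s • Y (e y)) :
    tmap ℝ e y (C.j y a) = (Complex.I * r) • X (e y) + (-(Complex.I * s)) • Y (e y) := by
  have he := h.adapted.diffeo
  have hb := h.lift_mem_dp r ⟨hy, hyU⟩
  have hc := h.lift_mem_dm s ⟨hy, hyU⟩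
  have hbt := he.tmap_lift (fun z => r • X z) hy
  have hct := he.tmap_lift (fun z => s • Y z) hy
  generalize push ℝ e.symm (fun z => r • X z) y = b at hb hbt
  generalize push ℝ e.symm (fun z => s • Y z) y = c at hc hct
  have hab : a = b + c := he.injective hy (by rw [map_add, ha, hbt, hct])
  have hb' : b ∈ C.d y := hC.mem_d_iff.2 ⟨b, hb, 0, (C.dm y).zero_mem, add_zero b⟩
  have hc' : c ∈ C.d y := hC.mem_d_iff.2 ⟨0, (C.dp y).zero_mem, c, hc, zero_add c⟩
  have hj : C.j y (b + c) = C.j y b + C.j y c := hC.J_add y b hb' c hc'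
  rw [hab, hj, map_add, h.adapted.tmap_dp y hy b hb, h.adapted.tmap_dm y hy c hc, hbt, hct,
    smul_smul, smul_smul, neg_smul]

/-- Both `X` and `i X` are sections of `D⁺`, so involutivity makes their bracket a complex multiple
of `X`; normalization does the rest. -/
theorem dbar_p_self (h : C.IsNormalFrame e U X Y k m) (hC : IsInvolutive C.Dp) {y : C.carrier}
    (hy : y ∈ e.source) (hyU : e y ∈ U) : dbar X (e y) (X (e y)) = 0 := by
  have he := h.adapted.diffeo
  have h1 : ContDiffOn ℝ ∞ (fun z => (1 : ℂ) • X z) U := h.smooth_p.const_smul (1 : ℂ)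
  have h2 : ContDiffOn ℝ ∞ (fun z => Complex.I • X z) U := h.smooth_p.const_smul Complex.I
  have h3 : bra ℝ (push ℝ e.symm fun z => (1 : ℂ) • X z)
      (push ℝ e.symm fun z => Complex.I • X z) y ∈ C.dp y :=
    hC (e.source ∩ e ⁻¹' U) _ _ (e.isOpen_inter_preimage h.isOpen)
      ⟨he.lift_smooth h.isOpen h1, fun y hy => h.lift_mem_dp 1 hy⟩
      ⟨he.lift_smooth h.isOpen h2, fun y hy => h.lift_mem_dp Complex.I hy⟩ y ⟨hy, hyU⟩
  rw [h.mem_dp y hy hyU, he.tmap_bra_lift h.isOpen h1 h2 hy hyU] at h3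
  simp only [one_smul] at h3
  obtain ⟨r, hr⟩ := h3
  exact dbar_self_eq_zero (h.differentiableAt_p hyU) (h.eventually_p hyU) hr

theorem dbar_m_self (h : C.IsNormalFrame e U X Y k m) (hC : IsInvolutive C.Dm) {y : C.carrier}
    (hy : y ∈ e.source) (hyU : e y ∈ U) : dbar Y (e y) (Y (e y)) = 0 := by
  have he := h.adapted.diffeo
  have h1 : ContDiffOn ℝ ∞ (fun z => (1 : ℂ) • Y z) U := h.smooth_m.const_smul (1 : ℂ)
  have h2 : ContDiffOn ℝ ∞ (fun z => Complex.I • Y z) U := h.smooth_m.const_smul Complex.I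
  have h3 : bra ℝ (push ℝ e.symm fun z => (1 : ℂ) • Y z)
      (push ℝ e.symm fun z => Complex.I • Y z) y ∈ C.dm y :=
    hC (e.source ∩ e ⁻¹' U) _ _ (e.isOpen_inter_preimage h.isOpen)
      ⟨he.lift_smooth h.isOpen h1, fun y hy => h.lift_mem_dm 1 hy⟩
      ⟨he.lift_smooth h.isOpen h2, fun y hy => h.lift_mem_dm Complex.I hy⟩ y ⟨hy, hyU⟩
  rw [h.mem_dm y hy hyU, he.tmap_bra_lift h.isOpen h1 h2 hy hyU] at h3
  simp only [one_smul] at h3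
  obtain ⟨r, hr⟩ := h3
  exact dbar_self_eq_zero (h.differentiableAt_m hyU) (h.eventually_m hyU) hr

/-- The embedding is annihilated by `X + iJX` and `Y + iJY`, hence by their bracket `u + i v`, which
means `dF v = i dF u`. As the image of `D` is the maximal complex subspace, `u` lies in `D` and `v =
J u`. This is the hypothesis of `dbar_eq_zero_of_bracket`. -/
theorem dbar_cross (h : C.IsNormalFrame e U X Y k m) (hC : C.IsElliptic) {N : ℕ}
    {F : C.carrier → Fin N → ℂ} {V : Set C.carrier} (hF : C.IsCREmbeddingOn F V) {x : C.carrier}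
    (hx : x ∈ e.source) (hxU : e x ∈ U) (hxV : x ∈ V) :
    dbar X (e x) (Y (e x)) = 0 ∧ dbar Y (e x) (X (e x)) = 0 := by
  have he := h.adapted.diffeo
  have hX := h.differentiableAt_p hxU
  have hY := h.differentiableAt_m hxU
  have hX' : DifferentiableAt ℝ (fun z => Complex.I • X z) (e x) := hX.const_smul Complex.I
  have hY' : DifferentiableAt ℝ (fun z => -(Complex.I • Y z)) (e x) := (hY.const_smul Complex.I).neg
  have hJ : ∀ y ∈ e.source, e y ∈ U → y ∈ V → ∀ r s : ℂ, fderiv ℝ (F ∘ e.symm) (e y)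
      ((Complex.I * r) • X (e y) + (-(Complex.I * s)) • Y (e y)) =
        Complex.I • fderiv ℝ (F ∘ e.symm) (e y) (r • X (e y) + s • Y (e y)) := by
    intro y hy hyU hyV r s
    have h1 := he.tmap_lift (fun z => r • X z + s • Y z) hy
    generalize push ℝ e.symm (fun z => r • X z + s • Y z) y = a at h1
    have h2 := (h.mem_d_iff hC hy hyU a).2 ⟨r, s, h1⟩
    have h3 := hF.map_J y hyV a h2
    have h4 := (hF.realDiff_eq he hy hyV (C.j y a)).symm.trans
      (h3.trans (congrArg (Complex.I • ·) (hF.realDiff_eq he hy hyV a)))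
    rwa [h1, h.tmap_j hC hy hyU h1] at h4
  have hev : ∀ᶠ z in 𝓝 (e x), z ∈ e.target ∧ e.symm z ∈ V ∧ z ∈ U := by
    refine ((e.isOpen_inter_preimage_symm hF.isOpen).mem_nhds
      ⟨e.map_source hx, by rw [mem_preimage, e.left_inv hx]; exact hxV⟩ |> fun hO => ?_)
    filter_upwards [hO, h.isOpen.mem_nhds hxU] with z hz hzU using ⟨hz.1, hz.2, hzU⟩
  have hG := (hF.contDiffAt he hx hxV).of_le (m := 2) ENat.LEInfty.out
  have hbr := fderiv_bracket_complex hG hX hY hX' hY' (by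
      filter_upwards [hev] with z hz
      have := hJ _ (e.map_target hz.1) (by rw [e.right_inv hz.1]; exact hz.2.2) hz.2.1 1 0
      simpa [e.right_inv hz.1] using this) (by
      filter_upwards [hev] with z hz
      have := hJ _ (e.map_target hz.1) (by rw [e.right_inv hz.1]; exact hz.2.2) hz.2.1 0 1
      simpa [e.right_inv hz.1] using this)
  obtain ⟨w, hw⟩ : ∃ w, tmap ℝ e x w = VectorField.lieBracket ℝ X Y (e x) -
      VectorField.lieBracket ℝ (fun z => Complex.I • X z) (fun z => -(Complex.I • Y z)) (e x) :=
    ⟨_, he.tmap_tmap_symm' hx _⟩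
  obtain ⟨w', hw'⟩ : ∃ w', tmap ℝ e x w' =
      VectorField.lieBracket ℝ X (fun z => -(Complex.I • Y z)) (e x) +
      VectorField.lieBracket ℝ (fun z => Complex.I • X z) Y (e x) :=
    ⟨_, he.tmap_tmap_symm' hx _⟩
  rw [← hw, ← hw'] at hbr
  have h1 := (hF.realDiff_eq he hx hxV w').trans
    (hbr.trans (congrArg (Complex.I • ·) (hF.realDiff_eq he hx hxV w).symm))
  have hwD : w ∈ C.d x := (hF.maximal x hxV w).2 ⟨w', h1⟩
  have h2 : w' = C.j x w := hF.immersion x hxV (h1.trans (hF.map_J x hxV w hwD).symm)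
  obtain ⟨r, s, hrs⟩ := (h.mem_d_iff hC hx hxU w).1 hwD
  have h3 := h.tmap_j hC hx hxU hrs
  rw [← h2, hw'] at h3
  rw [hw] at hrs
  exact dbar_eq_zero_of_bracket hX hY (h.eventually_p hxU) (h.eventually_m hxU) hrs h3

end IsNormalFrame

end CRManifold

/-! ### Ellipticity and holomorphy of the normalized generators -/

namespace CRManifold

variable {C : CRManifold.{u}}

namespace IsNormalFrame

variable {e : OpenPartialHomeomorph C.carrier C3} {U : Set C3} {X Y : C3 → C3} {k m : Fin 3}

/-- Otherwise `Y` would be a complex multiple of `X`, and `D⁺` and `D⁻` would intersect. -/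
theorem exists_det3_ne_zero (h : C.IsNormalFrame e U X Y k m) (hC : C.IsElliptic) {y : C.carrier}
    (hy : y ∈ e.source) (hyU : e y ∈ U) : ∃ c, det3 (X (e y)) (Y (e y)) c ≠ 0 := by
  by_contra! h0
  have hX : X (e y) ≠ 0 := fun h1 => by simpa [h1] using h.norm_p _ hyU
  obtain ⟨r, hr⟩ := (det3_line_iff hX _).1 h0
  have he := h.adapted.diffeo
  have h1 := h.lift_mem_dm 1 ⟨hy, hyU⟩
  have h2 := he.tmap_lift (fun z => (1 : ℂ) • Y z) hy
  generalize push ℝ e.symm (fun z => (1 : ℂ) • Y z) y = a at h1 h2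
  rw [one_smul] at h2
  have h3 : a ∈ C.dp y := (h.mem_dp y hy hyU a).2 ⟨r, h2.trans hr⟩
  rw [Submodule.disjoint_def.1 (hC.disjoint y) a h3 h1, map_zero] at h2
  simpa [← h2] using h.norm_m _ hyU

theorem mem_d_iff_det3 (h : C.IsNormalFrame e U X Y k m) (hC : C.IsElliptic) {y : C.carrier}
    (hy : y ∈ e.source) (hyU : e y ∈ U) (a : C3) :
    a ∈ C.d y ↔ det3 (X (e y)) (Y (e y)) (tmap ℝ e y a) = 0 := by
  obtain ⟨c, hc⟩ := h.exists_det3_ne_zero hC hy hyU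
  rw [h.mem_d_iff hC hy hyU, det3_eq_zero_iff hc]

theorem det3_of_leviValue (h : C.IsNormalFrame e U X Y k m) (hC : C.IsElliptic) {x : C.carrier}
    (hx : x ∈ e.source) (hxU : e x ∈ U) (hXX : dbar X (e x) (X (e x)) = 0)
    (hXY : dbar X (e x) (Y (e x)) = 0) (hYX : dbar Y (e x) (X (e x)) = 0)
    (hYY : dbar Y (e x) (Y (e x)) = 0) {u v w : C3} (hw : LeviValue C.D x u v w)
    (h0 : det3 (X (e x)) (Y (e x)) (VectorField.lieBracket ℝ X Y (e x)) = 0) :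
    det3 (X (e x)) (Y (e x)) (tmap ℝ e x w) = 0 := by
  obtain ⟨V, A, B, hV, hxV, hA, hB, -, -, rfl⟩ := hw
  have he := h.adapted.diffeo
  have hO : IsOpen (U ∩ (e.target ∩ e.symm ⁻¹' V)) :=
    h.isOpen.inter (e.isOpen_inter_preimage_symm hV)
  have hxO : e x ∈ U ∩ (e.target ∩ e.symm ⁻¹' V) :=
    ⟨hxU, e.map_source hx, by rw [mem_preimage, e.left_inv hx]; exact hxV⟩
  have hd : ∀ {A : C.carrier → C3}, SmoothFld ℝ A V → DifferentiableAt ℝ (push ℝ e A) (e x) :=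
    fun hA => (((smoothFld_iff_contDiffOn.1 (he.push_smooth hV hA)).mono
      inter_subset_right).contDiffAt (hO.mem_nhds hxO)).differentiableAt (by simp)
  have hdet : ∀ {A : C.carrier → C3}, (∀ y ∈ V, A y ∈ C.d y) →
      ∀ᶠ z in 𝓝 (e x), det3 (X z) (Y z) (push ℝ e A z) = 0 := by
    intro A hAD
    filter_upwards [hO.mem_nhds hxO] with z hz
    have hy := e.map_target hz.2.1
    have hr := e.right_inv hz.2.1
    have := (h.mem_d_iff_det3 hC hy (by rw [hr]; exact hz.1) _).1 (hAD _ hz.2.2)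
    rwa [hr] at this
  have hcomb : ∀ {A : C.carrier → C3}, (∀ y ∈ V, A y ∈ C.d y) →
      ∃ r s : ℂ, push ℝ e A (e x) = r • X (e x) + s • Y (e x) := by
    intro A hAD
    rw [push_apply e A hx]
    exact (h.mem_d_iff hC hx hxU _).1 (hAD x hxV)
  have hAD : ∀ y ∈ V, (A y : C3) ∈ C.d y := hA.2
  have hBD : ∀ y ∈ V, (B y : C3) ∈ C.d y := hB.2
  obtain ⟨a₁, a₂, ha⟩ := hcomb hAD
  obtain ⟨b₁, b₂, hb⟩ := hcomb hBD
  have hbr := det3_bracket (h.differentiableAt_p hxU) (h.differentiableAt_m hxU) (hd hA.1)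
    (hd hB.1) hXX hXY hYX hYY (hdet hAD) (hdet hBD) ha hb
  rw [h0, mul_zero, ← bra_eq_lieBracket, ← he.tmap_bra hV hA.1 hB.1 hx hxV] at hbr
  exact hbr

/-- Otherwise every Levi value lies in `D`, and the real covector `Re det3 X Y` contradicts
ellipticity with the nonzero vector given by `X`. -/
theorem det3_lieBracket_ne_zero (h : C.IsNormalFrame e U X Y k m) (hC : C.IsElliptic)
    {x : C.carrier} (hx : x ∈ e.source) (hxU : e x ∈ U) (hXX : dbar X (e x) (X (e x)) = 0)
    (hXY : dbar X (e x) (Y (e x)) = 0) (hYX : dbar Y (e x) (X (e x)) = 0)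
    (hYY : dbar Y (e x) (Y (e x)) = 0) :
    det3 (X (e x)) (Y (e x)) (VectorField.lieBracket ℝ X Y (e x)) ≠ 0 := by
  intro h0
  have he := h.adapted.diffeo
  obtain ⟨c, hc⟩ := h.exists_det3_ne_zero hC hx hxU
  let ℓ : C3 →ₗ[ℝ] ℝ :=
    { toFun := fun w => (det3 (X (e x)) (Y (e x)) (tmap ℝ e x w)).re
      map_add' := fun a b => by
        rw [map_add, ← Complex.add_re]
        congr 1
        simp only [det3, Pi.add_apply]
        ring
      map_smul' := fun r a => by
        rw [map_smul, RingHom.id_apply, smul_eq_mul, ← Complex.re_ofReal_mul]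
        congr 1
        simp only [det3, Pi.smul_apply, Complex.real_smul]
        ring }
  have hℓ : ∀ w, ℓ w = (det3 (X (e x)) (Y (e x)) (tmap ℝ e x w)).re := fun _ => rfl
  have hne : ℓ ≠ 0 := by
    intro hz
    have h1 := LinearMap.congr_fun hz
      (push ℝ e.symm (fun _ => (det3 (X (e x)) (Y (e x)) c)⁻¹ • c) x)
    rw [hℓ, he.tmap_lift _ hx] at h1
    have h2 : det3 (X (e x)) (Y (e x)) ((det3 (X (e x)) (Y (e x)) c)⁻¹ • c) = 1 := by
      have : det3 (X (e x)) (Y (e x)) ((det3 (X (e x)) (Y (e x)) c)⁻¹ • c) =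
          (det3 (X (e x)) (Y (e x)) c)⁻¹ * det3 (X (e x)) (Y (e x)) c := by
        simp only [det3, Pi.smul_apply, smul_eq_mul]
        ring
      rw [this, inv_mul_cancel₀ hc]
    rw [h2] at h1
    simp at h1
  have hlift := h.lift_mem_dp 1 ⟨hx, hxU⟩
  have htm := he.tmap_lift (fun z => (1 : ℂ) • X z) hx
  generalize push ℝ e.symm (fun z => (1 : ℂ) • X z) x = a at hlift htm
  have haD : a ∈ C.d x := hC.mem_d_iff.2 ⟨a, hlift, 0, (C.dm x).zero_mem, add_zero a⟩
  have ha0 : a = (0 : C3) := hC.elliptic x ℓ hne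
    (fun b hb => by
      have h1 := (h.mem_d_iff_det3 hC hx hxU b).1 hb
      exact (hℓ b).trans (by rw [h1, Complex.zero_re])) a haD
    (fun b _ w hw => by
      have h1 := h.det3_of_leviValue hC hx hxU hXX hXY hYX hYY hw h0
      exact (hℓ w).trans (by rw [h1, Complex.zero_re]))
  rw [ha0, map_zero, one_smul] at htm
  simpa [← htm] using h.norm_p _ hxU

theorem dbar_eq_zero (h : C.IsNormalFrame e U X Y k m) (hC : C.IsTorsionFreeElliptic) {z : C3}
    (hz : z ∈ U) : dbar X z (X z) = 0 ∧ dbar X z (Y z) = 0 ∧ dbar Y z (X z) = 0 ∧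
      dbar Y z (Y z) = 0 := by
  have hx := e.map_target (h.subset hz)
  have hr := e.right_inv (h.subset hz)
  have hxU : e (e.symm z) ∈ U := by rwa [hr]
  obtain ⟨N, F, V, hxV, hF⟩ := hC.embeddable (e.symm z)
  have h1 := h.dbar_p_self hC.involutive_Dp hx hxU
  have h2 := h.dbar_m_self hC.involutive_Dm hx hxU
  have h3 := h.dbar_cross hC.toIsElliptic hF hx hxU hxV
  rw [hr] at h1 h2 h3
  exact ⟨h1, h3.1, h3.2, h2⟩

theorem det3_lieBracket (h : C.IsNormalFrame e U X Y k m) (hC : C.IsTorsionFreeElliptic) {z : C3}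
    (hz : z ∈ U) : det3 (X z) (Y z) (VectorField.lieBracket ℝ X Y z) ≠ 0 := by
  have hx := e.map_target (h.subset hz)
  have hr := e.right_inv (h.subset hz)
  obtain ⟨h1, h2, h3, h4⟩ := h.dbar_eq_zero hC hz
  have h5 := h.det3_lieBracket_ne_zero hC.toIsElliptic hx (by rwa [hr])
  rw [hr] at h5
  exact h5 h1 h2 h3 h4

/-- The `(0,1)`-derivatives vanish along `X` and `Y`, hence along `[X, Y] - [iX, iY]`. The component
of the latter transversal to `D` is twice that of `[X, Y]`, because `[iX, iY]` contributes the
factor `i²`; so the three directions form a frame. -/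
theorem holomorphic (h : C.IsNormalFrame e U X Y k m) (hC : C.IsTorsionFreeElliptic) :
    ContDiffOn ℂ ∞ X U ∧ ContDiffOn ℂ ∞ Y U := by
  have hT : ∀ z ∈ U, det3 (X z) (Y z) (VectorField.lieBracket ℝ X Y z -
      VectorField.lieBracket ℝ (fun y => Complex.I • X y) (fun y => Complex.I • Y y) z) ≠ 0 := by
    intro z hz
    obtain ⟨h1, h2, h3, h4⟩ := h.dbar_eq_zero hC hz
    have hX := h.differentiableAt_p hz
    have hY := h.differentiableAt_m hz
    have h5 := det3_bracket hX hY (hX.const_smul Complex.I) (hY.const_smul Complex.I) h1 h2 h3 h4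
      (Filter.Eventually.of_forall fun y => by simp [det3]; ring)
      (Filter.Eventually.of_forall fun y => by simp [det3]; ring)
      (a₁ := Complex.I) (a₂ := 0) (b₁ := 0) (b₂ := Complex.I) (by simp) (by simp)
    rw [mul_zero, sub_zero, Complex.I_mul_I] at h5
    have h6 : ∀ a b v w : C3, det3 a b (v - w) = det3 a b v - det3 a b w := fun a b v w => by
      simp only [det3, Pi.sub_apply]
      ring
    rw [h6]
    refine fun h7 => h.det3_lieBracket hC hz ?_
    refine (mul_eq_zero.1 (?_ : (2 : ℂ) * _ = 0)).resolve_left two_ne_zero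
    refine Eq.trans ?_ h7
    rw [show det3 (X z) (Y z) (VectorField.lieBracket ℝ (fun y => Complex.I • X y)
      (fun y => Complex.I • Y y) z) = _ from h5]
    ring
  have key : ∀ f : C3 → C3, ContDiffOn ℝ ∞ f U → (∀ z ∈ U, dbar f z (X z) = 0) →
      (∀ z ∈ U, dbar f z (Y z) = 0) → ContDiffOn ℂ ∞ f U := by
    intro f hf hfX hfY
    refine contDiffOn_complex_of_real h.isOpen hf fun z hz a => ?_
    rw [← dbar_eq_zero_iff]
    refine dbar_eq_zero_of_frame (hfX z hz) (hfY z hz) ?_ (hT z hz) a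
    refine dbar_bracket ((hf.contDiffAt (h.isOpen.mem_nhds hz)).of_le ENat.LEInfty.out)
      (h.differentiableAt_p hz) (h.differentiableAt_m hz) ?_ ?_
    · filter_upwards [h.isOpen.mem_nhds hz] with y hy using hfX y hy
    · filter_upwards [h.isOpen.mem_nhds hz] with y hy using hfY y hy
  exact ⟨key X h.smooth_p (fun z hz => (h.dbar_eq_zero hC hz).1)
      (fun z hz => (h.dbar_eq_zero hC hz).2.1),
    key Y h.smooth_m (fun z hz => (h.dbar_eq_zero hC hz).2.2.1)
      (fun z hz => (h.dbar_eq_zero hC hz).2.2.2)⟩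

theorem det3_lieBracket_complex (h : C.IsNormalFrame e U X Y k m) (hC : C.IsTorsionFreeElliptic)
    {z : C3} (hz : z ∈ U) : det3 (X z) (Y z) (VectorField.lieBracket ℂ X Y z) ≠ 0 := by
  obtain ⟨hX, hY⟩ := h.holomorphic hC
  rw [← lieBracket_real_eq_complex
    ((hX.contDiffAt (h.isOpen.mem_nhds hz)).differentiableAt (by simp))
    ((hY.contDiffAt (h.isOpen.mem_nhds hz)).differentiableAt (by simp))]
  exact h.det3_lieBracket hC hz

end IsNormalFrame

end CRManifold

/-! ### The complex 3-fold of a torsion-free elliptic CR-manifold -/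

/-- A family of charts, one around each point, in which the almost complex structure `I` is
multiplication by `i`. -/
structure IsComplexAtlas {M : Type*} [TopologicalSpace M] [ChartedSpace C3 M] (I : M → C3 → C3)
    (ψ : M → OpenPartialHomeomorph M C3) : Prop where
  mem : ∀ x, x ∈ (ψ x).source
  diffeo : ∀ x, IsDiffeoOn ℝ (ψ x)
  tmap_I : ∀ x, ∀ y ∈ (ψ x).source, ∀ a, tmap ℝ (ψ x) y (I y a) = Complex.I • tmap ℝ (ψ x) y a

/-- The complex manifold structure given by a family of charts. -/
abbrev chartedSpaceOfCharts {M : Type*} [TopologicalSpace M] (ψ : M → OpenPartialHomeomorph M C3)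
    (h : ∀ x, x ∈ (ψ x).source) : ChartedSpace C3 M where
  atlas := range ψ
  chartAt := ψ
  mem_chart_source := h
  chart_mem_atlas := mem_range_self

/-- The differential of a transition map passes from `i` to `I` and back to `i`, so it is complex
linear and the map is holomorphic. -/
theorem IsComplexAtlas.isManifold {M : Type*} [TopologicalSpace M] [ChartedSpace C3 M]
    {I : M → C3 → C3} {ψ : M → OpenPartialHomeomorph M C3} (h : IsComplexAtlas I ψ) :
    @IsManifold ℂ _ C3 _ _ C3 _ 𝓘(ℂ, C3) ∞ M _ (chartedSpaceOfCharts ψ h.mem) := by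
  refine @isManifold_of_contDiffOn ℂ _ C3 _ _ C3 _ 𝓘(ℂ, C3) ∞ M _
    (chartedSpaceOfCharts ψ h.mem) ?_
  rintro _ _ ⟨x, rfl⟩ ⟨y, rfl⟩
  have hxy := (h.diffeo x).symm.trans (h.diffeo y)
  have key : ContDiffOn ℂ ∞ ((ψ x).symm.trans (ψ y)) ((ψ x).symm.trans (ψ y)).source := by
    refine contDiffOn_complex_of_real ((ψ x).symm.trans (ψ y)).open_source
      (contDiffOn_of_isDiffeoOn hxy) fun z hz a => ?_
    have hz' : z ∈ (ψ x).target ∧ (ψ x).symm z ∈ (ψ y).source := by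
      have h1 := hz
      rw [OpenPartialHomeomorph.trans_source] at h1
      exact h1
    have hs := (ψ x).map_target hz'.1
    have hI : tmap ℝ (ψ x).symm z (Complex.I • a) =
        I ((ψ x).symm z) (tmap ℝ (ψ x).symm z a) := by
      apply (h.diffeo x).injective hs
      rw [h.tmap_I x _ hs, (h.diffeo x).tmap_tmap_symm hz'.1, (h.diffeo x).tmap_tmap_symm hz'.1]
    rw [← tmap_eq_fderiv, (h.diffeo x).symm.tmap_comp (h.diffeo y) hz'.1 hz'.2, hI,
      h.tmap_I y _ hz'.2, (h.diffeo x).symm.tmap_comp (h.diffeo y) hz'.1 hz'.2]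
  exact key.mono fun z hz => hz.1

namespace CRManifold

variable {C : CRManifold.{u}} {I : C.carrier → C3 → C3}
  {ψ : C.carrier → OpenPartialHomeomorph C.carrier C3}

/-- The complex 3-fold with direction fields `D⁺` and `D⁻` in the complex charts `ψ`. -/
def threefold (h : IsComplexAtlas I ψ) : Threefold.{u} :=
  @Threefold.mk C.carrier C.top (chartedSpaceOfCharts ψ h.mem) h.isManifold
    (fun x => (Submodule.span ℂ (tmap ℝ (ψ x) x '' C.dp x) : Submodule ℂ C3))
    (fun x => (Submodule.span ℂ (tmap ℝ (ψ x) x '' C.dm x) : Submodule ℂ C3))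

/-- The identity map, from a CR-manifold to its complex 3-fold. -/
def toThreefold (h : IsComplexAtlas I ψ) :
    OpenPartialHomeomorph C.carrier (threefold h).carrier :=
  OpenPartialHomeomorph.refl C.carrier

/-- The chart `ψ x`, as a chart of the complex 3-fold. -/
def threefoldChart (h : IsComplexAtlas I ψ) (x : C.carrier) :
    OpenPartialHomeomorph (threefold h).carrier C3 := ψ x

theorem isDiffeoOn_threefoldChart (h : IsComplexAtlas I ψ) (x : C.carrier) :
    IsDiffeoOn ℂ (threefoldChart h x) :=
  isDiffeoOn_chart (M := (threefold h).carrier) x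

theorem tmap_threefoldChart (h : IsComplexAtlas I ψ) (x : C.carrier) (a : C3) :
    tmap ℝ (threefoldChart h x) (show (threefold h).carrier from x) a = a :=
  tmap_chartAt (𝕜 := ℝ) (M := (threefold h).carrier) x a

/-- Locally the identity is `ψ x`, read in the original atlas, followed by its inverse, read in the
new one. -/
theorem isDiffeoOn_toThreefold (h : IsComplexAtlas I ψ) : IsDiffeoOn ℝ (toThreefold h) := by
  have key : ∀ x : C.carrier, IsDiffeoOn ℝ ((ψ x).trans (threefoldChart h x).symm) := fun x =>
    (h.diffeo x).trans (isDiffeoOn_threefoldChart h x).restrictScalars.symm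
  have hsrc : ∀ x : C.carrier, x ∈ ((ψ x).trans (threefoldChart h x).symm).source := fun x => by
    rw [OpenPartialHomeomorph.trans_source]
    exact ⟨h.mem x, (ψ x).map_source (h.mem x)⟩
  have htgt : ∀ x : C.carrier, (show (threefold h).carrier from x) ∈
      ((ψ x).trans (threefoldChart h x).symm).target := fun x => by
    rw [OpenPartialHomeomorph.trans_target]
    exact ⟨h.mem x, (ψ x).map_source (h.mem x)⟩
  constructor
  · intro x _
    refine ContMDiffAt.contMDiffWithinAt ?_
    refine ((key x).smooth.contMDiffAt
      ((OpenPartialHomeomorph.open_source _).mem_nhds (hsrc x))).congr_of_eventuallyEq ?_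
    filter_upwards [(ψ x).open_source.mem_nhds (h.mem x)] with y hy
    exact ((ψ x).left_inv hy).symm
  · intro x _
    refine ContMDiffAt.contMDiffWithinAt ?_
    refine ((key x).smooth_symm.contMDiffAt
      ((OpenPartialHomeomorph.open_target _).mem_nhds (htgt x))).congr_of_eventuallyEq ?_
    filter_upwards [(threefoldChart h x).open_source.mem_nhds (h.mem x)] with y hy
    exact ((ψ x).left_inv hy).symm

theorem tmap_chart_eq (h : IsComplexAtlas I ψ) (x : C.carrier) {y : C.carrier}
    (hy : y ∈ (ψ x).source) (a : C3) : tmap ℝ (ψ x) y a =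
      tmap ℝ (threefoldChart h x) (toThreefold h y) (tmap ℝ (toThreefold h) y a) := by
  have h1 := (isDiffeoOn_toThreefold h).tmap_comp
    (isDiffeoOn_threefoldChart h x).restrictScalars (x := y) (mem_univ _) hy a
  rw [← h1]
  rfl

/-- The differential of the identity map is not the identity of `ℂ³`, because the two atlases
identify the tangent space with `ℂ³` by different charts. This explains the differentials of `ψ x`
in `threefold`. -/
theorem tmap_toThreefold (h : IsComplexAtlas I ψ) (x : C.carrier) (a : C3) :
    tmap ℝ (toThreefold h) x a = tmap ℝ (ψ x) x a := by
  rw [tmap_chart_eq h x (h.mem x)]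
  exact (tmap_threefoldChart h x _).symm

theorem isAdapted_of_isCanonicalACS {I : (x : C.carrier) → TangentSpace 𝓘(ℝ, C3) x →ₗ[ℝ]
    TangentSpace 𝓘(ℝ, C3) x} (hI : C.IsCanonicalACS I)
    (h : IsComplexAtlas (M := C.carrier) (fun x a => I x a) ψ) (x : C.carrier) :
    C.IsAdapted (ψ x) := by
  refine ⟨h.diffeo x, fun y hy a ha => ?_, fun y hy a ha => ?_⟩
  · have h1 : I y a = C.j y a := hI.on_Dp y a ha
    rw [← h1]
    exact h.tmap_I x y hy a
  · have h1 : I y a = -C.j y a := hI.on_Dm y a ha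
    have h2 := h.tmap_I x y hy a
    simp only [h1] at h2
    rw [map_neg] at h2
    rw [← h2, neg_neg]

theorem exists_isComplexAtlas {I : (x : C.carrier) → TangentSpace 𝓘(ℝ, C3) x →ₗ[ℝ]
    TangentSpace 𝓘(ℝ, C3) x} (hI : IsIntegrableACS I) :
    ∃ ψ, IsComplexAtlas (M := C.carrier) (fun x a => I x a) ψ := by
  choose ψ h1 h2 h3 using hI
  exact ⟨ψ, h2, fun x => isDiffeoOn_of_mem_maximalAtlas (h1 x), h3⟩

/-- A real-linear isomorphism which takes a real subspace to a complex line maps it onto the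
complex span of its image. -/
theorem mem_span_image_iff {T : C3 →L[ℝ] C3} {L : Submodule ℝ C3} {w : C3}
    (hL : ∀ a, a ∈ L ↔ ∃ r : ℂ, T a = r • w) (hT : Function.Surjective T) (b : C3) :
    b ∈ Submodule.span ℂ (T '' L) ↔ ∃ a ∈ L, T a = b := by
  constructor
  · intro hb
    have h1 : Submodule.span ℂ (T '' L) ≤ Submodule.span ℂ {w} := by
      rw [Submodule.span_le]
      rintro _ ⟨a, ha, rfl⟩
      obtain ⟨r, hr⟩ := (hL a).1 ha
      exact Submodule.mem_span_singleton.2 ⟨r, hr.symm⟩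
    obtain ⟨r, hr⟩ := Submodule.mem_span_singleton.1 (h1 hb)
    obtain ⟨a, rfl⟩ := hT b
    exact ⟨a, (hL a).2 ⟨r, hr.symm⟩, rfl⟩
  · rintro ⟨a, ha, rfl⟩
    exact Submodule.subset_span ⟨a, ha, rfl⟩

theorem tmap_toThreefold_surjective (h : IsComplexAtlas I ψ) (x : C.carrier) :
    Function.Surjective (tmap ℝ (toThreefold h) x) := fun b =>
  ⟨_, (isDiffeoOn_toThreefold h).tmap_tmap_symm' (mem_univ _) b⟩

section Adapted

variable (h : IsComplexAtlas I ψ) (hC : C.IsTorsionFreeElliptic)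
  (hψ : ∀ x, C.IsAdapted (ψ x))

include hC hψ

theorem mem_l₁_threefold (x : C.carrier) (b : C3) : b ∈ (threefold h).l₁ x ↔
    ∃ a ∈ C.dp x, tmap ℝ (toThreefold h) x a = b := by
  obtain ⟨U, X, Y, k, m, hf, hxU⟩ := hC.toIsElliptic.exists_isNormalFrame (hψ x) (h.mem x)
  have h1 : tmap ℝ (toThreefold h) x = tmap ℝ (ψ x) x :=
    ContinuousLinearMap.ext (tmap_toThreefold h x)
  have h2 := tmap_toThreefold_surjective h x
  rw [h1] at h2 ⊢
  exact mem_span_image_iff (hf.mem_dp x (h.mem x) hxU) h2 b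

theorem mem_l₂_threefold (x : C.carrier) (b : C3) : b ∈ (threefold h).l₂ x ↔
    ∃ a ∈ C.dm x, tmap ℝ (toThreefold h) x a = b := by
  obtain ⟨U, X, Y, k, m, hf, hxU⟩ := hC.toIsElliptic.exists_isNormalFrame (hψ x) (h.mem x)
  have h1 : tmap ℝ (toThreefold h) x = tmap ℝ (ψ x) x :=
    ContinuousLinearMap.ext (tmap_toThreefold h x)
  have h2 := tmap_toThreefold_surjective h x
  rw [h1] at h2 ⊢
  exact mem_span_image_iff (hf.mem_dm x (h.mem x) hxU) h2 b

/-- In the chart `ψ x` the normalized generators of `D⁺` and `D⁻` are holomorphic and form a frame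
with their bracket. -/
theorem isPathGeometry_threefold : (threefold h).IsPathGeometry := by
  refine Threefold.isPathGeometry_of_frames fun x => ?_
  obtain ⟨U, X, Y, k, m, hf, hxU⟩ := hC.toIsElliptic.exists_isNormalFrame (hψ x) (h.mem x)
  obtain ⟨hX, hY⟩ := hf.holomorphic hC
  have hdif := isDiffeoOn_threefoldChart h x
  have key : ∀ y ∈ (ψ x).source, ∀ (L : Submodule ℝ C3) (w : C3),
      (∀ a, a ∈ L ↔ ∃ r : ℂ, tmap ℝ (ψ x) y a = r • w) → ∀ b : C3,
      (∃ a ∈ L, tmap ℝ (toThreefold h) y a = b) ↔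
        ∃ r : ℂ, tmap ℂ (threefoldChart h x) (toThreefold h y) b = r • w := by
    intro y hy L w hL b
    have hreal := hdif.tmap_real (x := toThreefold h y) hy
    constructor
    · rintro ⟨a, ha, rfl⟩
      rw [← hreal, ← tmap_chart_eq h x hy]
      exact (hL a).1 ha
    · intro hr
      obtain ⟨a, rfl⟩ := tmap_toThreefold_surjective h y b
      rw [← hreal, ← tmap_chart_eq h x hy] at hr
      exact ⟨a, (hL a).2 hr, rfl⟩
  exact ⟨threefoldChart h x, U, X, Y, ⟨hdif, hf.isOpen, hf.subset, hX, hY,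
    fun y hy hyU b => (mem_l₁_threefold h hC hψ y b).trans
      (key y hy _ _ (hf.mem_dp y hy hyU) b),
    fun y hy hyU b => (mem_l₂_threefold h hC hψ y b).trans
      (key y hy _ _ (hf.mem_dm y hy hyU) b),
    fun z hz => hf.det3_lieBracket_complex hC hz⟩, h.mem x, hxU⟩

theorem mem_sup_threefold (x : C.carrier) (b : C3) :
    b ∈ (threefold h).l₁ x ⊔ (threefold h).l₂ x ↔
      ∃ a ∈ C.d x, tmap ℝ (toThreefold h) x a = b := by
  rw [Submodule.mem_sup]
  constructor
  · rintro ⟨b₁, hb₁, b₂, hb₂, rfl⟩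
    obtain ⟨a₁, ha₁, rfl⟩ := (mem_l₁_threefold h hC hψ x b₁).1 hb₁
    obtain ⟨a₂, ha₂, rfl⟩ := (mem_l₂_threefold h hC hψ x b₂).1 hb₂
    exact ⟨a₁ + a₂, hC.toIsElliptic.mem_d_iff.2 ⟨a₁, ha₁, a₂, ha₂, rfl⟩, map_add _ _ _⟩
  · rintro ⟨a, ha, rfl⟩
    obtain ⟨a₁, ha₁, a₂, ha₂, rfl⟩ := hC.toIsElliptic.mem_d_iff.1 ha
    exact ⟨_, (mem_l₁_threefold h hC hψ x _).2 ⟨a₁, ha₁, rfl⟩, _,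
      (mem_l₂_threefold h hC hψ x _).2 ⟨a₂, ha₂, rfl⟩, (map_add _ _ _).symm⟩

theorem tmap_toThreefold_j {x : C.carrier} {a : C3} (ha : a ∈ C.d x) :
    tmap ℝ (toThreefold h) x (C.j x a) = Threefold.twist ((threefold h).l₁ x)
      ((threefold h).l₂ x) (tmap ℝ (toThreefold h) x a) := by
  obtain ⟨a₁, ha₁, a₂, ha₂, rfl⟩ := hC.toIsElliptic.mem_d_iff.1 ha
  have ha₁' : a₁ ∈ C.d x :=
    hC.toIsElliptic.mem_d_iff.2 ⟨a₁, ha₁, 0, (C.dm x).zero_mem, add_zero _⟩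
  have ha₂' : a₂ ∈ C.d x :=
    hC.toIsElliptic.mem_d_iff.2 ⟨0, (C.dp x).zero_mem, a₂, ha₂, zero_add _⟩
  have hj : C.j x (a₁ + a₂) = C.j x a₁ + C.j x a₂ := hC.J_add x a₁ ha₁' a₂ ha₂'
  rw [hj, map_add, map_add, Threefold.twist_add
    ((isPathGeometry_threefold h hC hψ).disjoint x)
    ((mem_l₁_threefold h hC hψ x _).2 ⟨a₁, ha₁, rfl⟩)
    ((mem_l₂_threefold h hC hψ x _).2 ⟨a₂, ha₂, rfl⟩), tmap_toThreefold, tmap_toThreefold,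
    tmap_toThreefold, tmap_toThreefold, (hψ x).tmap_dp x (h.mem x) a₁ ha₁,
    (hψ x).tmap_dm x (h.mem x) a₂ ha₂, sub_eq_add_neg]

theorem isSplitCRIso_toThreefold :
    IsSplitCRIso (C := C) (C' := (threefold h).toCR) (toThreefold h) := by
  have hd := isDiffeoOn_toThreefold h
  refine ⟨⟨hd.smooth, hd.smooth_symm, fun x _ => ?_, fun x _ a ha =>
    tmap_toThreefold_j h hC hψ ha⟩, fun x _ => ?_, fun x _ => ?_⟩
  · exact Submodule.ext fun b => (mem_sup_threefold h hC hψ x b).symm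
  · exact Submodule.ext fun b => (mem_l₁_threefold h hC hψ x b).symm
  · exact Submodule.ext fun b => (mem_l₂_threefold h hC hψ x b).symm

end Adapted

/-- Every torsion-free elliptic CR-manifold is the CR-manifold of a complex 3-fold with two
direction fields. -/
theorem IsTorsionFreeElliptic.exists_isSplitCRIso (hC : C.IsTorsionFreeElliptic) :
    ∃ P : Threefold.{u}, P.IsPathGeometry ∧
      ∃ f : OpenPartialHomeomorph C.carrier P.toCR.carrier,
        f.source = Set.univ ∧ f.target = Set.univ ∧ IsSplitCRIso f := by
  obtain ⟨I, hI, hint⟩ := hC.integrable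
  obtain ⟨ψ, h⟩ := exists_isComplexAtlas hint
  have hψ := isAdapted_of_isCanonicalACS hI h
  exact ⟨threefold h, isPathGeometry_threefold h hC hψ, toThreefold h, rfl, rfl,
    isSplitCRIso_toThreefold h hC hψ⟩

end CRManifold

end

/-! ### The correspondence -/

theorem proposition1 :
    -- a complex 3-fold with two direction fields defines a torsion-free CR-manifold
    (∀ P : Threefold.{u}, P.IsPathGeometry → P.toCR.IsTorsionFreeElliptic) ∧
    -- every torsion-free elliptic CR-manifold arises in this way
    (∀ C : CRManifold.{u}, C.IsTorsionFreeElliptic →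
      ∃ P : Threefold.{u}, P.IsPathGeometry ∧
        ∃ f : OpenPartialHomeomorph C.carrier P.toCR.carrier,
          f.source = Set.univ ∧ f.target = Set.univ ∧ CRManifold.IsSplitCRIso f) ∧
    -- the isomorphisms (local or global) are the same on both sides
    (∀ (P : Threefold.{u}) (P' : Threefold.{v}), P.IsPathGeometry → P'.IsPathGeometry →
      ∀ f : OpenPartialHomeomorph P.carrier P'.carrier,
        (CRManifold.IsSplitCRIso (C := P.toCR) (C' := P'.toCR) f ↔ Threefold.IsIso f)) ∧
    -- CR-isomorphisms without regard to the order of the splitting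
    (∀ (P : Threefold.{u}) (P' : Threefold.{v}), P.IsPathGeometry → P'.IsPathGeometry →
      ∀ f : OpenPartialHomeomorph P.carrier P'.carrier, IsPreconnected f.source →
        (CRManifold.IsCRIso (C := P.toCR) (C' := P'.toCR) f ↔
          Threefold.IsIso f ∨ Threefold.IsAntiIso f)) ∧
    -- an ODE defines a complex 3-fold with two direction fields
    (∀ o : ComplexODE, o.toThreefold.IsPathGeometry) ∧
    -- near each point every complex 3-fold with two direction fields arises in this way
    (∀ P : Threefold.{u}, P.IsPathGeometry → ∀ n : P.carrier,
      ∃ (o : ComplexODE) (f : OpenPartialHomeomorph P.carrier o.toThreefold.carrier),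
        n ∈ f.source ∧ Threefold.IsIso f) ∧
    -- point equivalence of ODE is local isomorphism of the 3-folds
    (∀ (o o' : ComplexODE) (q : o.dom) (q' : o'.dom),
      (∃ ψ, o.IsPointTransformation o' q q' ψ) ↔
        ∃ f : OpenPartialHomeomorph o.toThreefold.carrier o'.toThreefold.carrier,
          q ∈ f.source ∧ f q = q' ∧ Threefold.IsIso f) ∧
    -- the embedding: general solutions exist near each 1-jet, and each of them embeds the
    -- CR-manifold of the ODE in `ℂ⁴` (coordinates `z₁, w₁, z₂, w₂`) by `w̄₂ = φ(z̄₂, z₁, w₁)`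
    (∀ (o : ComplexODE) (q : o.dom), ∃ (φ : C3 → ℂ) (Ω : Set C3),
      o.IsGeneralSolution φ Ω ∧ (q : C3) ∈ ComplexODE.jet φ '' Ω) ∧
    (∀ (o : ComplexODE) (φ : C3 → ℂ) (Ω : Set C3), o.IsGeneralSolution φ Ω →
      ∃ F : o.toThreefold.toCR.carrier → (Fin 4 → ℂ),
        o.toThreefold.toCR.IsCREmbeddingOn F
          {q : o.dom | (q : C3) ∈ ComplexODE.jet φ '' Ω} ∧
        (∀ (q : o.dom) (c : C3), c ∈ Ω → (q : C3) = ComplexODE.jet φ c →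
          F q = ![c 1, c 2, starRingEnd ℂ (c 0), starRingEnd ℂ (φ c)]) ∧
        F '' {q : o.dom | (q : C3) ∈ ComplexODE.jet φ '' Ω} =
          {ζ : Fin 4 → ℂ | ![starRingEnd ℂ (ζ 2), ζ 0, ζ 1] ∈ Ω ∧
            starRingEnd ℂ (ζ 3) = φ ![starRingEnd ℂ (ζ 2), ζ 0, ζ 1]}) :=
  ⟨fun _ => Threefold.isTorsionFreeElliptic_toCR,
    fun _ => CRManifold.IsTorsionFreeElliptic.exists_isSplitCRIso,
    fun _ _ => Threefold.isSplitCRIso_iff_isIso,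
    fun _ _ => Threefold.isCRIso_iff_isIso_or_isAntiIso,
    ComplexODE.isPathGeometry, fun _ => Threefold.exists_isIso_toThreefold,
    fun _ _ => ComplexODE.exists_isPointTransformation_iff,
    ComplexODE.exists_isGeneralSolution,
    fun _ _ _ => ComplexODE.IsGeneralSolution.exists_isCREmbeddingOn⟩
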